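/- Let $N\ge 1$ be an integer and $0<T\le\infty$. Let $H^0$ be a self-adjoint operator on $L^2(\mathbb{R}^3)$ and let $v:\mathbb{R}^3\to\mathbb{R}$ be measurable with $v(-x)=v(x)$. Assume that $$H^N=\sum_{j=1}^N H^0_j+\sum_{1\le i<j\le N}v(x_i-x_j)$$ (sum of operators, $H^0_j$ denoting $H^0$ acting on the $j$-th particle) is self-adjoint on $L^2(\mathbb{R}^{3N})$. Here $\sum_jH^0_j$ is the closure of its restriction to the linear span of the products $f_1\otimes\dots\otimes f_N$ with all $f_j$ in the domain of $H^0$, and the domain of $H^N$ consists of all $\psi$ in the domain of $\sum_j H_j^0$ with $v(x_i-x_j)\psi\in L^2$ for all $i<j$. Let $\psi^t\in L^2(\mathbb{R}^{3N})$, $t\in[0,T)$, be the solution $\psi^t=e^{-iH^Nt}\psi^0$ of $i\partial_t\psi^t=H^N\psi^t$ with normalized antisymmetric initial condition $\psi^0$. Let $\varphi_1^t,\dots,\varphi_N^t\in L^2(\mathbb{R}^3)$, continuous in $t\in[0,T)$, solve the fermionic Hartree equations $$i\partial_t\varphi^t_j=\big(H^0+v\star\rho^t\big)\varphi^t_j,\qquad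 \rho^t=\sum_{i=1}^N|\varphi_i^t|^2,\qquad j=1,\dots,N,$$ (weakly, tested against the domain of $H^0$) with orthonormal initial conditions $\varphi_1^0,\dots,\varphi_N^0$. Assume that there are a measurable set $\Omega\subset\mathbb{R}^3$, numbers $0<\gamma\le 1$, $\delta_2<\gamma$, $\delta_3\ge 0$, $\delta_4\ge 0$ and positive functions $D_0,\dots,D_4$ on $[0,T)$ such that for all $t\in[0,T)$ $$\sup_{y\in\mathbb{R}^3}\big(|v|\star\rho^t\big)(y)\le D_0(t),\qquad \sup_{y\in\mathbb{R}^3}\big(v^2\star\rho^t\big)(y)\le D_1(t)N^{-\gamma},\qquad \int_{\mathbb{R}^3}\big(v^2\star\rho^t\big)(y)\,\rho^t(y)\,dy\le D_2(t)N^{\delta_2},$$ $$\sup_{y\in\mathbb{R}^3}\int_{\Omega+y}v(y-x)^2\rho^t(x)\,dx\le D_3(t)N^{-1-\delta_3},\qquad \sup_{y\in\mathbb{R}^3\setminus\Omega}|v(y)|\le D_4(t)N^{-\frac12-\frac{\gamma}{2}-\delta_4}.$$ Put $$C(t)=12\max\Big\{4\sqrt{D_3(t)}\,N^{-\delta_3/2},\;4\sqrt2\,D_4(t)N^{-\delta_4},\;\sqrt{12}\,D_0(t),\;\sqrt{12}\,\tfrac{D_2(t)}{D_0(t)},\;8\sqrt{D_1(t)}\Big\},$$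 assume that $C$ is integrable on $[0,t]$ for every $t\in[0,T)$, and put $\delta=\min\{\gamma-\delta_2,\ \gamma+\tfrac{\delta_3}{2},\ \gamma+\delta_4\}$. For orthonormal $\varphi_1,\dots,\varphi_N$ let $p_m=\sum_{j=1}^N|\varphi_j\rangle\langle\varphi_j|_m$ (acting on the $m$-th variable), $q_m=1-p_m$, let $P_{N,k}$ be the sum over all $S\subset\{1,\dots,N\}$ with $|S|=k$ of $\prod_{m\in S}q_m\prod_{m\notin S}p_m$, and let $$\alpha_{m^{(\gamma)}}(t)=\sum_{k=0}^N m^{(\gamma)}(k)\,\langle\psi^t,P_{N,k}\psi^t\rangle,\qquad m^{(\gamma)}(k)=\begin{cases}k/N^{\gamma},&k\le N^\gamma,\\ 1,&\text{otherwise,}\end{cases}$$ where $P_{N,k}$ is formed with $\varphi_1^t,\dots,\varphi_N^t$. Then $\delta>0$, and for all $t\in[0,T)$ one has $C(t)>0$ and $$\alpha_{m^{(\gamma)}}(t)\le e^{\int_0^tC(s)\,ds}\,\alpha_{m^{(\gamma)}}(0)+\Big(e^{\int_0^tC(s)\,ds}-1\Big)N^{-\delta}.$$ In particular, if data as above are given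 for every $N$ with $\gamma,\delta_2,\delta_3,\delta_4$ and $D_0,\dots,D_4$ independent of $N$, the bound holds for every $N$ with these $N$-independent quantities. -/

import Mathlib

open MeasureTheory Set
open scoped ComplexConjugate InnerProductSpace

noncomputable section

/-- Physical space `ℝ³`. -/
abbrev R3 : Type := EuclideanSpace ℝ (Fin 3)

/-- The one-particle Hilbert space `L²(ℝ³)`. -/
abbrev OneBody : Type := Lp ℂ 2 (volume : Measure R3)

/-- The `N`-particle Hilbert space `L²(ℝ^{3N})`, realised on `N`-tuples `(x₁, …, x_N)` of points of
`ℝ³` with the product Lebesgue measure. -/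
abbrev ManyBody (N : ℕ) : Type := Lp ℂ 2 (volume : Measure (Fin N → R3))

/-- The time interval `[0, T)`, where `T` is a positive real number or `∞`. -/
def timeInterval (T : EReal) : Set ℝ := {t | 0 ≤ t ∧ (t : EReal) < T}

/-- Antisymmetry: `ψ(x_{σ 1}, …, x_{σ N}) = sgn(σ) ψ(x₁, …, x_N)` for every permutation `σ`. -/
def IsAntisymmetricWave {N : ℕ} (ψ : ManyBody N) : Prop :=
  ∀ σ : Equiv.Perm (Fin N),
    (fun x : Fin N → R3 => ψ (fun j => x (σ j)))
      =ᵐ[volume] fun x => (((Equiv.Perm.sign σ : ℤˣ) : ℤ) : ℂ) * ψ x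

/-! ### Projectors and the counting functional -/

section Counting

variable {N : ℕ}

/-- `(p_m ψ)(x₁, …, x_N) = ∑_j φ_j(x_m) ∫ φ_j(y)^* ψ(x₁, …, x_{m-1}, y, x_{m+1}, …, x_N) dy`. -/
def projP (φ : Fin N → OneBody) (m : Fin N) (ψ : (Fin N → R3) → ℂ) : (Fin N → R3) → ℂ :=
  fun x => ∑ j, φ j (x m) * ∫ y : R3, conj (φ j y) * ψ (Function.update x m y)

/-- `q_m = 1 - p_m`. -/
def projQ (φ : Fin N → OneBody) (m : Fin N) (ψ : (Fin N → R3) → ℂ) : (Fin N → R3) → ℂ :=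
  fun x => ψ x - projP φ m ψ x

open Classical in
/-- The product over `m = 1, …, N` of `q_m` (for `m ∈ S`) and `p_m` (for `m ∉ S`), applied to `ψ`. -/
def projProd (φ : Fin N → OneBody) (S : Finset (Fin N)) (ψ : (Fin N → R3) → ℂ) :
    (Fin N → R3) → ℂ :=
  (List.finRange N).foldr (fun m g => if m ∈ S then projQ φ m g else projP φ m g) ψ

/-- `P_{N,k} ψ`: the sum of the products above over all choices of `k` indices carrying a `q`. -/
def projPNk (φ : Fin N → OneBody) (k : ℕ) (ψ : (Fin N → R3) → ℂ) : (Fin N → R3) → ℂ :=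
  fun x => ∑ S ∈ Finset.powersetCard k (Finset.univ : Finset (Fin N)), projProd φ S ψ x

/-- The counting functional `α_f(ψ, φ₁, …, φ_N) = ∑_{k=0}^N f(k) ⟨ψ, P_{N,k} ψ⟩`. -/
def countingFunctional (f : ℕ → ℝ) (ψ : ManyBody N) (φ : Fin N → OneBody) : ℝ :=
  ∑ k ∈ Finset.range (N + 1),
    f k * (∫ x : Fin N → R3, conj (ψ x) * projPNk φ k (fun z => ψ z) x).re

/-- The weight `m^{(γ)}(k) = k / N^γ` for `k ≤ N^γ`, and `1` otherwise. -/
def weightM (N : ℕ) (γ : ℝ) (k : ℕ) : ℝ :=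
  if (k : ℝ) ≤ (N : ℝ) ^ γ then (k : ℝ) / (N : ℝ) ^ γ else 1

end Counting

/-! ### The many-body Schrödinger equation -/

/-- The graph of the free Hamiltonian `∑_j H_j^0`, where `H_j^0` is `H^0` acting on the `j`-th
particle: the closure of the operator that is defined on the linear span of the products
`f₁(x₁) ⋯ f_N(x_N)` with all `f_j` in the domain of `H^0` and that sends such a product to
`∑_j f₁(x₁) ⋯ (H^0 f_j)(x_j) ⋯ f_N(x_N)`. -/
def freeGraph (N : ℕ) (H0 : OneBody →ₗ.[ℂ] OneBody) : Submodule ℂ (ManyBody N × ManyBody N) :=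
  (Submodule.span ℂ {w : ManyBody N × ManyBody N | ∃ f : Fin N → H0.domain,
    (w.1 =ᵐ[volume] fun x => ∏ j, (f j : OneBody) (x j)) ∧
    (w.2 =ᵐ[volume] fun x =>
      ∑ j, (H0 (f j)) (x j) * ∏ i ∈ Finset.univ.erase j, (f i : OneBody) (x i))}).topologicalClosure

/-- `H^N = ∑_j H_j^0 + ∑_{i<j} v(x_i - x_j)` as a sum of operators: the domain consists of the `ψ` in
the domain of the free Hamiltonian such that all `v(x_i - x_j) ψ` lie in `L²`. -/
def IsManyBodyHamiltonian {N : ℕ} (H0 : OneBody →ₗ.[ℂ] OneBody) (v : R3 → ℝ)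
    (H : ManyBody N →ₗ.[ℂ] ManyBody N) : Prop :=
  ∀ ψ η : ManyBody N, (ψ, η) ∈ H.graph ↔
    ∃ κ : ManyBody N, (ψ, κ) ∈ freeGraph N H0 ∧
      (∀ i j : Fin N, i < j →
        MemLp (fun x : Fin N → R3 => (v (x i - x j) : ℂ) * ψ x) 2 volume) ∧
      η =ᵐ[volume] fun x : Fin N → R3 =>
        κ x + ∑ i : Fin N, ∑ j ∈ Finset.Ioi i, (v (x i - x j) : ℂ) * ψ x

/-- Solutions `ψ ∈ C([0,T); L²)` of `i ∂_t ψ^t = H ψ^t`, the equation being tested against the domain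
of `H`: `∂_t ⟨χ, ψ^t⟩ = -i ⟨H χ, ψ^t⟩`. For self-adjoint `H` these are exactly the functions
`ψ^t = e^{-iHt} ψ^0` with `ψ^0 ∈ L²`. -/
structure IsSchrodingerSolution {N : ℕ} (H : ManyBody N →ₗ.[ℂ] ManyBody N) (T : EReal)
    (ψ : ℝ → ManyBody N) : Prop where
  continuousOn : ContinuousOn ψ (timeInterval T)
  hasDeriv : ∀ t ∈ timeInterval T, ∀ χ : H.domain,
    HasDerivWithinAt (fun s => ⟪(χ : ManyBody N), ψ s⟫_ℂ)
      (-Complex.I * ⟪H χ, ψ t⟫_ℂ) (timeInterval T) t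

/-! ### The fermionic Hartree equations -/

/-- The density `ρ = ∑_i |φ_i|²`. -/
def density {N : ℕ} (φ : Fin N → OneBody) (x : R3) : ℝ := ∑ i, ‖φ i x‖ ^ 2

/-- The mean field `(v ⋆ ρ)(x) = ∫ v(x - y) ρ(y) dy`. -/
def meanField {N : ℕ} (v : R3 → ℝ) (φ : Fin N → OneBody) (x : R3) : ℝ :=
  ∫ y : R3, v (x - y) * density φ y

/-- Solutions `φ_j ∈ C([0,T); L²)` of `i ∂_t φ_j^t = (H^0 + v ⋆ ρ^t) φ_j^t`, where
`ρ^t = ∑_i |φ_i^t|²`, the equation being tested against the domain of `H^0`: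
`∂_t ⟨χ, φ_j^t⟩ = -i (⟨H^0 χ, φ_j^t⟩ + ⟨χ, (v ⋆ ρ^t) φ_j^t⟩)`. -/
structure IsHartreeSolution {N : ℕ} (H0 : OneBody →ₗ.[ℂ] OneBody) (v : R3 → ℝ) (T : EReal)
    (φ : ℝ → Fin N → OneBody) : Prop where
  continuousOn : ∀ j, ContinuousOn (fun t => φ t j) (timeInterval T)
  hasDeriv : ∀ t ∈ timeInterval T, ∀ j, ∃ η : OneBody,
    (η =ᵐ[volume] fun x => (meanField v (φ t) x : ℂ) * φ t j x) ∧
    ∀ χ : H0.domain,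
      HasDerivWithinAt (fun s => ⟪(χ : OneBody), φ s j⟫_ℂ)
        (-Complex.I * (⟪H0 χ, φ t j⟫_ℂ + ⟪(χ : OneBody), η⟫_ℂ)) (timeInterval T) t

/-! ### Assumptions on the density, and the constant in the estimate -/

/-- The bounds on the interaction `v` and the density `ρ` at a fixed time. The integrands are
nonnegative and the integrals are taken in `[0, ∞]`, so the bounds contain the finiteness. -/
structure MeanFieldBounds (N : ℕ) (v : R3 → ℝ) (ρ : R3 → ℝ) (Ω : Set R3)
    (γ δ₂ δ₃ δ₄ D₀ D₁ D₂ D₃ D₄ : ℝ) : Prop where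
  sup_abs : ⨆ y : R3, ∫⁻ x : R3, ENNReal.ofReal (|v (y - x)| * ρ x) ≤ ENNReal.ofReal D₀
  sup_sq : ⨆ y : R3, ∫⁻ x : R3, ENNReal.ofReal (v (y - x) ^ 2 * ρ x)
    ≤ ENNReal.ofReal (D₁ * (N : ℝ) ^ (-γ))
  integral_sq : ∫⁻ y : R3, (∫⁻ x : R3, ENNReal.ofReal (v (y - x) ^ 2 * ρ x)) * ENNReal.ofReal (ρ y)
    ≤ ENNReal.ofReal (D₂ * (N : ℝ) ^ δ₂)
  sup_near : ⨆ y : R3, ∫⁻ x in (fun z => z + y) '' Ω, ENNReal.ofReal (v (y - x) ^ 2 * ρ x)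
    ≤ ENNReal.ofReal (D₃ * (N : ℝ) ^ (-1 - δ₃))
  sup_far : ∀ y : R3, y ∉ Ω → |v y| ≤ D₄ * (N : ℝ) ^ (-(1 / 2 : ℝ) - γ / 2 - δ₄)

/-- `12 max{4 √D₃ N^{-δ₃/2}, 4 √2 D₄ N^{-δ₄}, √12 D₀, √12 D₂/D₀, 8 √D₁}`. -/
def rateC (N : ℕ) (δ₃ δ₄ D₀ D₁ D₂ D₃ D₄ : ℝ) : ℝ :=
  12 * max (4 * √D₃ * (N : ℝ) ^ (-(δ₃ / 2)))
    (max (4 * √2 * D₄ * (N : ℝ) ^ (-δ₄))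
      (max (√12 * D₀) (max (√12 * (D₂ / D₀)) (8 * √D₁))))

end

/-! Let p_m be the projection onto the span of the orbitals in the variable m, q_m = 1 - p_m and n =
∑ q_m. The counting functional is the expectation of m(n), where m is the weight `weightM`
(`countingFunctional_eq`). When it is differentiated in time, the free Hamiltonian drops out,
because wave function and orbitals are moved by the same one-particle operator. What remains is the
commutator of m(n) with the fluctuation W = ∑_{i<j} v(x_i - x_j) - ∑_i (v ⋆ ρ)(x_i). The core of the
proof bounds its expectation by C (α + N^{-δ}), and Grönwall's inequality for α + N^{-δ} finishes.

Only those parts of W that change n contribute. Inserting p + q = 1 on both sides of each pair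
interaction leaves a part B₁ that lowers n by one, a part B₂ that lowers n by two, and their
adjoints (`CommIdem.commutator_sum`). For B lowering n by c, the commutator of B with f(n) is
(f(n+c) - f(n))^{1/2} B (f(n) - f(n-c))^{1/2} (`CommIdem.lowering_commutator`). The increments of
the weight are at most c N^{-γ} and vanish beyond N^γ, so that both square roots turn the factors n
and n² from the estimates into multiples of α.

Fermi statistics enters through the exclusion principle: on antisymmetric functions ∑_m |f⟩⟨f|_m ≤
‖f‖², and the difference, the hole operator, is ‖f‖² times a projection
(`AntisymmOn.rankOne_rankOne_same`, `AntisymmOn.holeOp_holeOp`). It gives ∑_m ∫ κ(x_m) |p_m χ|² ≤ ∫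
(∫ κ ρ) |χ|² (`AntisymmOn.sum_lintegral_orbProj_le`), which trades sums over particles for
convolutions with ρ. Three kinds of terms are then treated by weighted Cauchy-Schwarz inequalities.
(1) One particle changes, the other one is in q: v² ⋆ ρ suffices (`PairBounds.norm_sum_pq_qq_le`).
(2) Both particles change: the square of the excited state has a diagonal part, bounded by ∫ (v² ⋆
ρ) ρ, and an off-diagonal part in which two factors q are exchanged between the two sides, bounded
by (|v| ⋆ ρ)² (`PairBounds.sum_norm_sum_excited_sq_le`). (3) One particle changes, the other one is
in p, minus the mean field: with f_y = ∑_j φ_j(y)^* φ_j both are integrals over y of v(x_i - y),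
against |f_y⟩⟨f_y|_j and against ‖f_y‖². Their difference is a hole operator, whose expectation
integrates to the number of excitations, up to an exchange term (`PairBounds.norm_sum_pp_qp_le`).

The analytic difficulties are that the equations hold only weakly, that the wave function and the
orbitals need not lie in the operator domains, that v is unbounded and that C is merely integrable.
Averages over [t, t+h] of a weak solution lie in the domain of the self-adjoint generator and are
differentiable (`IsWeakSolution.forwardAverage_mem_graph`). This yields the conservation laws
(`IsWeakSolution.inner_eq`) and the integrated evolution of the weight; the averaging is removed
first from the orbitals (`inner_hatOp_sub_eq_integral`) and last from the wave function
(`MeanFieldEvolution.expect_le`). The commutator bound is proved for truncated v and passes to the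
limit on vectors Ψ for which all v(x_i - x_j)Ψ are in L² (`DensityBounds.norm_commutator_le`). -/

noncomputable section

/-! ### Exchanging one coordinate with an additional variable -/

section SwapCoord

variable {N : ℕ}

/-- Exchange the additional variable `z.1` with the coordinate `m` of `z.2`. -/
def swapCoord (m : Fin N) (z : R3 × (Fin N → R3)) : R3 × (Fin N → R3) :=
  (z.2 m, Function.update z.2 m z.1)

theorem measurable_update_coord (m : Fin N) :
    Measurable fun z : R3 × (Fin N → R3) => Function.update z.2 m z.1 := by
  refine measurable_pi_lambda _ fun i => ?_
  by_cases h : i = m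
  · subst h; simpa using measurable_fst
  · simp only [Function.update_of_ne h]
    exact (measurable_pi_apply i).comp measurable_snd

theorem measurable_swapCoord (m : Fin N) : Measurable (swapCoord m) :=
  ((measurable_pi_apply m).comp measurable_snd).prodMk (measurable_update_coord m)

theorem measurePreserving_leftComm {α β γ : Type*} [MeasureSpace α] [MeasureSpace β]
    [MeasureSpace γ] [SFinite (volume : Measure α)] [SFinite (volume : Measure β)]
    [SFinite (volume : Measure γ)] :
    MeasurePreserving (fun z : α × β × γ => (z.2.1, (z.1, z.2.2))) volume volume := by
  have h1 : MeasurePreserving (MeasurableEquiv.prodAssoc : (α × β) × γ ≃ᵐ α × β × γ)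
    volume volume := measurePreserving_prodAssoc volume volume volume
  have h1' : MeasurePreserving (MeasurableEquiv.prodAssoc : (β × α) × γ ≃ᵐ β × α × γ)
    volume volume := measurePreserving_prodAssoc volume volume volume
  have h2 : MeasurePreserving (Prod.swap : α × β → β × α) volume volume :=
    Measure.measurePreserving_swap
  have h3 : MeasurePreserving (Prod.map (Prod.swap : α × β → β × α) (id : γ → γ))
      volume volume := h2.prod (MeasurePreserving.id _)
  exact (h1'.comp h3).comp (MeasurePreserving.symm _ h1)

/-- After splitting off the coordinate m from the tuple, the map only exchanges the first two of
three factors. -/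
theorem measurePreserving_swapCoord (m : Fin N) :
    MeasurePreserving (swapCoord m) volume volume := by
  obtain ⟨n, rfl⟩ : ∃ n, N = n + 1 := ⟨N - 1, by have := m.pos; omega⟩
  have he := volume_preserving_piFinSuccAbove (fun _ : Fin (n + 1) => R3) m
  have h1 : MeasurePreserving (Prod.map (id : R3 → R3)
      (MeasurableEquiv.piFinSuccAbove (fun _ : Fin (n + 1) => R3) m)) volume volume :=
    (MeasurePreserving.id _).prod he
  have h2 : MeasurePreserving (Prod.map (id : R3 → R3)
      (MeasurableEquiv.piFinSuccAbove (fun _ : Fin (n + 1) => R3) m).symm) volume volume :=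
    (MeasurePreserving.id _).prod (MeasurePreserving.symm _ he)
  have h := h2.comp ((measurePreserving_leftComm (α := R3) (β := R3)
    (γ := Fin n → R3)).comp h1)
  convert h using 1
  funext z
  refine Prod.ext rfl (funext fun i => ?_)
  refine Fin.succAboveCases m ?_ (fun k => ?_) i
  · simp [swapCoord, MeasurableEquiv.piFinSuccAbove, Fin.insertNthEquiv]
  · simp [swapCoord, MeasurableEquiv.piFinSuccAbove, Fin.insertNthEquiv]

/-- The left side is the integral of F composed with the exchange of the additional variable and the
coordinate m. This is the device by which a coordinate x_m and a free variable y trade places in all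
later estimates. -/
theorem lintegral_update_comm (m : Fin N) {F : R3 → (Fin N → R3) → ENNReal}
    (hF : Measurable (Function.uncurry F)) :
    ∫⁻ x, ∫⁻ y, F (x m) (Function.update x m y) = ∫⁻ y, ∫⁻ x, F y x := by
  have h := (measurePreserving_swapCoord m).lintegral_comp hF
  have h1 : ∫⁻ z : R3 × (Fin N → R3), Function.uncurry F (swapCoord m z)
      = ∫⁻ x, ∫⁻ y, F (x m) (Function.update x m y) := by
    rw [Measure.volume_eq_prod, lintegral_prod_symm']
    · rfl
    · exact hF.comp (measurable_swapCoord m)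
  rw [← h1, h, Measure.volume_eq_prod, lintegral_prod]
  · rfl
  · exact hF.aemeasurable

/-- The slice obtained by varying one coordinate is a null set, so this needs the measure-preserving
exchange and Fubini. It makes contractions independent of the chosen representative. -/
theorem ae_update_of_ae (m : Fin N) {P : (Fin N → R3) → Prop} (hP : ∀ᵐ x, P x) :
    ∀ᵐ x : Fin N → R3, ∀ᵐ y : R3, P (Function.update x m y) := by
  have h1 : ∀ᵐ z : R3 × (Fin N → R3), P z.2 := by
    rw [Measure.volume_eq_prod]
    exact Measure.quasiMeasurePreserving_snd.ae hP
  have h2 : ∀ᵐ z : R3 × (Fin N → R3), P (swapCoord m z).2 :=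
    (measurePreserving_swapCoord m).quasiMeasurePreserving.ae h1
  have h3 : ∀ᵐ z : (Fin N → R3) × R3, P (Function.update z.1 m z.2) := by
    have : MeasurePreserving (Prod.swap : (Fin N → R3) × R3 → R3 × (Fin N → R3))
      volume volume := Measure.measurePreserving_swap
    exact this.quasiMeasurePreserving.ae h2
  rw [Measure.volume_eq_prod] at h3
  exact Measure.ae_ae_of_ae_prod h3

end SwapCoord

/-! ### Square norms as lower Lebesgue integrals. -/

theorem sq_lintegral_mul_le {α : Type*} [MeasurableSpace α] {μ : Measure α} {f g : α → ENNReal}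
    (hf : AEMeasurable f μ) (hg : AEMeasurable g μ) :
    (∫⁻ a, f a * g a ∂μ) ^ 2 ≤ (∫⁻ a, f a ^ 2 ∂μ) * ∫⁻ a, g a ^ 2 ∂μ := by
  have h := ENNReal.lintegral_mul_le_Lp_mul_Lq μ Real.HolderConjugate.two_two hf hg
  have h2 := pow_le_pow_left₀ (by positivity) h 2
  refine h2.trans (le_of_eq ?_)
  rw [mul_pow, ← ENNReal.rpow_natCast, ← ENNReal.rpow_natCast, ← ENNReal.rpow_mul,
    ← ENNReal.rpow_mul]
  norm_num

theorem Lp_enorm_sq {α : Type*} [MeasurableSpace α] {μ : Measure α} (f : Lp ℂ 2 μ) :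
    ‖f‖ₑ ^ 2 = ∫⁻ x, ‖f x‖ₑ ^ 2 ∂μ := by
  rw [Lp.enorm_def, eLpNorm_eq_lintegral_rpow_enorm_toReal (by norm_num) (by norm_num)]
  rw [← ENNReal.rpow_natCast, ← ENNReal.rpow_mul]
  norm_num

theorem memLp_two_iff_lintegral {α : Type*} [MeasurableSpace α] {μ : Measure α} {f : α → ℂ}
    (hf : AEStronglyMeasurable f μ) : MemLp f 2 μ ↔ ∫⁻ x, ‖f x‖ₑ ^ 2 ∂μ < ⊤ := by
  rw [MemLp, and_iff_right hf, eLpNorm_lt_top_iff_lintegral_rpow_enorm_lt_top (by norm_num)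
    (by norm_num)]
  norm_num

/-! ### Rank-one operators acting on one coordinate. -/

section RankOne

variable {N : ℕ}

/-- Contraction of the coordinate `m` of `ψ` with the one-particle function `g`. -/
def contract (g : OneBody) (m : Fin N) (ψ : (Fin N → R3) → ℂ) (x : Fin N → R3) : ℂ :=
  ∫ y : R3, conj (g y) * ψ (Function.update x m y)

theorem contract_congr (g : OneBody) (m : Fin N) {ψ ψ' : (Fin N → R3) → ℂ}
    (h : ψ =ᵐ[volume] ψ') : contract g m ψ =ᵐ[volume] contract g m ψ' := by
  filter_upwards [ae_update_of_ae m h] with x hx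
  refine integral_congr_ae ?_
  filter_upwards [hx] with y hy
  rw [hy]

theorem measurable_update_snd (m : Fin N) :
    Measurable fun z : (Fin N → R3) × R3 => Function.update z.1 m z.2 :=
  (measurable_update_coord m).comp measurable_swap

theorem stronglyMeasurable_contract (g : OneBody) (m : Fin N) {ψ : (Fin N → R3) → ℂ}
    (h : StronglyMeasurable ψ) : StronglyMeasurable (contract g m ψ) := by
  have hg : StronglyMeasurable fun z : (Fin N → R3) × R3 => conj (g z.2) :=
    (Lp.stronglyMeasurable g).comp_measurable measurable_snd |>.star
  exact StronglyMeasurable.integral_prod_right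
    (f := fun x y => conj (g y) * ψ (Function.update x m y))
    (hg.mul (h.comp_measurable (measurable_update_snd m)))

theorem enorm_contract_sq_le (g : OneBody) (m : Fin N) {ψ : (Fin N → R3) → ℂ}
    (h : StronglyMeasurable ψ) (x : Fin N → R3) :
    ‖contract g m ψ x‖ₑ ^ 2 ≤ ‖g‖ₑ ^ 2 * ∫⁻ y, ‖ψ (Function.update x m y)‖ₑ ^ 2 := by
  have h1 : ‖contract g m ψ x‖ₑ ≤ ∫⁻ y, ‖g y‖ₑ * ‖ψ (Function.update x m y)‖ₑ := by
    refine (enorm_integral_le_lintegral_enorm _).trans (le_of_eq ?_)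
    refine lintegral_congr fun y => ?_
    rw [enorm_mul]
    congr 1
    rw [← ofReal_norm, ← ofReal_norm, RCLike.norm_conj]
  refine (pow_le_pow_left₀ (by positivity) h1 2).trans ?_
  rw [Lp_enorm_sq]
  refine sq_lintegral_mul_le ?_ ?_
  · exact (Lp.stronglyMeasurable g).measurable.enorm.aemeasurable
  · exact (h.measurable.comp (measurable_update x)).enorm.aemeasurable

theorem lintegral_rankOne_le (f g : OneBody) (m : Fin N) {ψ : (Fin N → R3) → ℂ}
    (h : StronglyMeasurable ψ) :
    ∫⁻ x, ‖f (x m) * contract g m ψ x‖ₑ ^ 2 ≤ ‖f‖ₑ ^ 2 * ‖g‖ₑ ^ 2 * ∫⁻ x, ‖ψ x‖ₑ ^ 2 := by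
  have hf : Measurable fun y => ‖f y‖ₑ ^ 2 := (Lp.stronglyMeasurable f).measurable.enorm.pow_const _
  have hψ : Measurable fun x => ‖ψ x‖ₑ ^ 2 := h.measurable.enorm.pow_const _
  have h1 : Measurable fun z : R3 × (Fin N → R3) => ‖f z.1‖ₑ ^ 2 * ‖ψ z.2‖ₑ ^ 2 :=
    (hf.comp measurable_fst).mul (hψ.comp measurable_snd)
  calc ∫⁻ x, ‖f (x m) * contract g m ψ x‖ₑ ^ 2
      ≤ ∫⁻ x, ∫⁻ y, ‖g‖ₑ ^ 2 * (‖f (x m)‖ₑ ^ 2 * ‖ψ (Function.update x m y)‖ₑ ^ 2) := by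
        refine lintegral_mono fun x => ?_
        have h2 : Measurable fun y => ‖ψ (Function.update x m y)‖ₑ ^ 2 :=
          hψ.comp (measurable_update x)
        rw [enorm_mul, mul_pow, lintegral_const_mul _ (h2.const_mul _), lintegral_const_mul _ h2]
        calc _ ≤ ‖f (x m)‖ₑ ^ 2 * (‖g‖ₑ ^ 2 * ∫⁻ y, ‖ψ (Function.update x m y)‖ₑ ^ 2) := by
              gcongr
              exact enorm_contract_sq_le g m h x
          _ = _ := by ring
    _ = ∫⁻ y, ∫⁻ x, ‖g‖ₑ ^ 2 * (‖f y‖ₑ ^ 2 * ‖ψ x‖ₑ ^ 2) :=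
        lintegral_update_comm m (F := fun y x => ‖g‖ₑ ^ 2 * (‖f y‖ₑ ^ 2 * ‖ψ x‖ₑ ^ 2))
          (h1.const_mul _)
    _ = ‖f‖ₑ ^ 2 * ‖g‖ₑ ^ 2 * ∫⁻ x, ‖ψ x‖ₑ ^ 2 := by
        simp_rw [← mul_assoc, lintegral_const_mul _ hψ]
        rw [lintegral_mul_const _ (hf.const_mul _), lintegral_const_mul _ hf, Lp_enorm_sq f]
        ring

theorem memLp_rankOne (f g : OneBody) (m : Fin N) {ψ : (Fin N → R3) → ℂ}
    (h : MemLp ψ 2 volume) :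
    MemLp (fun x => f (x m) * contract g m ψ x) 2 volume := by
  obtain ⟨ψ', hm, he⟩ := h.1
  have hf : StronglyMeasurable fun x : Fin N → R3 => f (x m) :=
    (Lp.stronglyMeasurable f).comp_measurable (measurable_pi_apply m)
  have h' : MemLp (fun x => f (x m) * contract g m ψ' x) 2 volume := by
    have hs : AEStronglyMeasurable (fun x => f (x m) * contract g m ψ' x) volume :=
      (hf.mul (stronglyMeasurable_contract g m hm)).aestronglyMeasurable
    rw [memLp_two_iff_lintegral hs]
    refine (lintegral_rankOne_le f g m hm).trans_lt ?_
    refine ENNReal.mul_lt_top (ENNReal.mul_lt_top ?_ ?_) ?_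
    · exact ENNReal.pow_lt_top enorm_lt_top
    · exact ENNReal.pow_lt_top enorm_lt_top
    · rw [← memLp_two_iff_lintegral hm.aestronglyMeasurable]
      exact (memLp_congr_ae he).1 h
  refine (memLp_congr_ae ?_).2 h'
  filter_upwards [contract_congr g m he] with x hx
  rw [hx]

/-- Needed so that the integrals defining contractions converge for almost every x and are therefore
additive. -/
theorem ae_memLp_update (m : Fin N) {ψ : (Fin N → R3) → ℂ} (h : MemLp ψ 2 volume) :
    ∀ᵐ x : Fin N → R3, MemLp (fun y => ψ (Function.update x m y)) 2 volume := by
  obtain ⟨ψ', hm, he⟩ := h.1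
  have h' := (memLp_congr_ae he).1 h
  rw [memLp_two_iff_lintegral hm.aestronglyMeasurable] at h'
  have hψ : Measurable fun x => ‖ψ' x‖ₑ ^ 2 := hm.measurable.enorm.pow_const _
  -- The slices ignore x_m, so the integral of their square norms over all x diverges in general. A
  -- positive integrable weight in x_m makes it finite, and positivity allows its removal
  -- afterwards.
  obtain ⟨w, hw0, hwm, hw⟩ := exists_pos_lintegral_lt_of_sigmaFinite (volume : Measure R3)
    (ε := 1) one_ne_zero
  have h1 : ∫⁻ x : Fin N → R3, ∫⁻ y, (w (x m) : ENNReal) * ‖ψ' (Function.update x m y)‖ₑ ^ 2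
      ≠ ⊤ := by
    have hFm : Measurable fun z : R3 × (Fin N → R3) => (w z.1 : ENNReal) * ‖ψ' z.2‖ₑ ^ 2 :=
      (hwm.coe_nnreal_ennreal.comp measurable_fst).mul (hψ.comp measurable_snd)
    rw [lintegral_update_comm m (F := fun y x => (w y : ENNReal) * ‖ψ' x‖ₑ ^ 2) hFm]
    simp_rw [lintegral_const_mul _ hψ]
    rw [lintegral_mul_const _ hwm.coe_nnreal_ennreal]
    exact (ENNReal.mul_lt_top (hw.trans ENNReal.one_lt_top) h').ne
  have h2 := ae_lt_top' ?_ h1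
  · filter_upwards [h2, ae_update_of_ae m he] with x hx hx'
    have hms : StronglyMeasurable fun y => ψ' (Function.update x m y) :=
      hm.comp_measurable (measurable_update x)
    refine (memLp_congr_ae (g := fun y => ψ' (Function.update x m y)) hx').2 ?_
    rw [memLp_two_iff_lintegral hms.aestronglyMeasurable]
    have hψx : Measurable fun y => ‖ψ' (Function.update x m y)‖ₑ ^ 2 :=
      hψ.comp (measurable_update x)
    rw [lintegral_const_mul _ hψx] at hx
    by_contra hc
    rw [not_lt, top_le_iff] at hc
    rw [hc, ENNReal.mul_top] at hx
    · exact lt_irrefl _ hx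
    · exact_mod_cast (hw0 _).ne'
  · refine Measurable.aemeasurable ?_
    have hFm : Measurable fun z : (Fin N → R3) × R3 => (w (z.1 m) : ENNReal) *
        ‖ψ' (Function.update z.1 m z.2)‖ₑ ^ 2 :=
      (hwm.coe_nnreal_ennreal.comp ((measurable_pi_apply m).comp measurable_fst)).mul
        (hψ.comp (measurable_update_snd m))
    exact hFm.lintegral_prod_right'

theorem ae_integrable_contract (g : OneBody) (m : Fin N) {ψ : (Fin N → R3) → ℂ}
    (h : MemLp ψ 2 volume) :
    ∀ᵐ x : Fin N → R3, Integrable (fun y => conj (g y) * ψ (Function.update x m y)) := by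
  filter_upwards [ae_memLp_update m h] with x hx
  exact (Lp.memLp g).star.integrable_mul hx

theorem contract_add (g : OneBody) (m : Fin N) {ψ χ : (Fin N → R3) → ℂ}
    (hψ : MemLp ψ 2 volume) (hχ : MemLp χ 2 volume) :
    contract g m (ψ + χ) =ᵐ[volume] contract g m ψ + contract g m χ := by
  filter_upwards [ae_integrable_contract g m hψ, ae_integrable_contract g m hχ] with x h1 h2
  simp only [contract, Pi.add_apply, mul_add]
  exact integral_add h1 h2

theorem contract_smul (g : OneBody) (m : Fin N) (c : ℂ) (ψ : (Fin N → R3) → ℂ) :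
    contract g m (c • ψ) = c • contract g m ψ := by
  funext x
  simp only [contract, Pi.smul_apply, smul_eq_mul, ← integral_const_mul]
  refine integral_congr_ae (Filter.Eventually.of_forall fun y => ?_)
  ring

theorem contract_add_left (g g' : OneBody) (m : Fin N) {ψ : (Fin N → R3) → ℂ}
    (hψ : MemLp ψ 2 volume) :
    contract (g + g') m ψ =ᵐ[volume] contract g m ψ + contract g' m ψ := by
  filter_upwards [ae_integrable_contract g m hψ, ae_integrable_contract g' m hψ] with x h1 h2
  simp only [contract, Pi.add_apply]
  rw [← integral_add h1 h2]
  refine integral_congr_ae ?_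
  filter_upwards [Lp.coeFn_add g g'] with y hy
  rw [hy, Pi.add_apply, map_add, add_mul]

theorem contract_smul_left (g : OneBody) (m : Fin N) (c : ℂ) (ψ : (Fin N → R3) → ℂ) :
    contract (c • g) m ψ = conj c • contract g m ψ := by
  funext x
  simp only [contract, Pi.smul_apply, smul_eq_mul, ← integral_const_mul]
  refine integral_congr_ae ?_
  filter_upwards [Lp.coeFn_smul c g] with y hy
  rw [hy, Pi.smul_apply, smul_eq_mul, map_mul]
  ring

/-- The operator `|f⟩⟨g|` acting on the coordinate `m`. -/
def rankOne (m : Fin N) (f g : OneBody) : ManyBody N →L[ℂ] ManyBody N :=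
  LinearMap.mkContinuous
    { toFun := fun ψ => (memLp_rankOne f g m (Lp.memLp ψ)).toLp _
      map_add' := fun ψ χ => by
        rw [← MemLp.toLp_add, MemLp.toLp_eq_toLp_iff]
        filter_upwards [contract_congr g m (Lp.coeFn_add ψ χ),
          contract_add g m (Lp.memLp ψ) (Lp.memLp χ)] with x h1 h2
        rw [h1, h2, Pi.add_apply, Pi.add_apply, mul_add]
      map_smul' := fun c ψ => by
        rw [RingHom.id_apply, ← MemLp.toLp_const_smul, MemLp.toLp_eq_toLp_iff]
        filter_upwards [contract_congr g m (Lp.coeFn_smul c ψ)] with x h1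
        rw [h1, contract_smul, Pi.smul_apply, Pi.smul_apply, smul_eq_mul, smul_eq_mul]
        ring }
    (‖f‖ * ‖g‖) fun ψ => by
      set E := (memLp_rankOne f g m (Lp.memLp ψ)).toLp _
      have h1 : ‖E‖ₑ ^ 2 ≤ (‖f‖ₑ * ‖g‖ₑ * ‖ψ‖ₑ) ^ 2 := by
        rw [Lp_enorm_sq, mul_pow, mul_pow, Lp_enorm_sq ψ]
        refine le_trans (le_of_eq (lintegral_congr_ae ?_))
          (lintegral_rankOne_le f g m (Lp.stronglyMeasurable ψ))
        filter_upwards [(memLp_rankOne f g m (Lp.memLp ψ)).coeFn_toLp] with x hx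
        rw [hx]
      have h2 : ‖E‖ₑ ≤ ‖f‖ₑ * ‖g‖ₑ * ‖ψ‖ₑ :=
        (ENNReal.pow_le_pow_left_iff two_ne_zero).1 h1
      have h3 := ENNReal.toReal_mono (by finiteness) h2
      simp only [ENNReal.toReal_mul, toReal_enorm] at h3
      exact h3

theorem coeFn_rankOne (m : Fin N) (f g : OneBody) (ψ : ManyBody N) :
    rankOne m f g ψ =ᵐ[volume] fun x => f (x m) * contract g m ψ x :=
  (memLp_rankOne f g m (Lp.memLp ψ)).coeFn_toLp

theorem norm_rankOne_le (m : Fin N) (f g : OneBody) : ‖rankOne m f g‖ ≤ ‖f‖ * ‖g‖ :=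
  LinearMap.mkContinuous_norm_le _ (by positivity) _

theorem ae_comp_eval {P : R3 → Prop} (hP : ∀ᵐ y, P y) (m : Fin N) :
    ∀ᵐ x : Fin N → R3, P (x m) :=
  (Measure.quasiMeasurePreserving_eval (μ := fun _ : Fin N => (volume : Measure R3)) m).ae hP

theorem rankOne_add_left (m : Fin N) (f f' g : OneBody) :
    rankOne m (f + f') g = rankOne m f g + rankOne m f' g := by
  ext1 ψ
  refine Lp.ext ?_
  filter_upwards [coeFn_rankOne m (f + f') g ψ, coeFn_rankOne m f g ψ, coeFn_rankOne m f' g ψ,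
    Lp.coeFn_add (rankOne m f g ψ) (rankOne m f' g ψ), ae_comp_eval (Lp.coeFn_add f f') m]
    with x h1 h2 h3 h4 h5
  rw [_root_.add_apply, h4, Pi.add_apply, h1, h2, h3, h5, Pi.add_apply, add_mul]

theorem rankOne_smul_left (m : Fin N) (c : ℂ) (f g : OneBody) :
    rankOne m (c • f) g = c • rankOne m f g := by
  ext1 ψ
  refine Lp.ext ?_
  filter_upwards [coeFn_rankOne m (c • f) g ψ, coeFn_rankOne m f g ψ,
    Lp.coeFn_smul c (rankOne m f g ψ), ae_comp_eval (Lp.coeFn_smul c f) m]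
    with x h1 h2 h4 h5
  rw [_root_.smul_apply, h4, Pi.smul_apply, h1, h2, h5, Pi.smul_apply, smul_eq_mul,
    smul_eq_mul, mul_assoc]

theorem rankOne_add_right (m : Fin N) (f g g' : OneBody) :
    rankOne m f (g + g') = rankOne m f g + rankOne m f g' := by
  ext1 ψ
  refine Lp.ext ?_
  filter_upwards [coeFn_rankOne m f (g + g') ψ, coeFn_rankOne m f g ψ, coeFn_rankOne m f g' ψ,
    Lp.coeFn_add (rankOne m f g ψ) (rankOne m f g' ψ), contract_add_left g g' m (Lp.memLp ψ)]
    with x h1 h2 h3 h4 h5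
  rw [_root_.add_apply, h4, Pi.add_apply, h1, h2, h3, h5, Pi.add_apply, mul_add]

theorem rankOne_smul_right (m : Fin N) (c : ℂ) (f g : OneBody) :
    rankOne m f (c • g) = conj c • rankOne m f g := by
  ext1 ψ
  refine Lp.ext ?_
  filter_upwards [coeFn_rankOne m f (c • g) ψ, coeFn_rankOne m f g ψ,
    Lp.coeFn_smul (conj c) (rankOne m f g ψ)] with x h1 h2 h4
  rw [_root_.smul_apply, h4, Pi.smul_apply, h1, h2, contract_smul_left,
    Pi.smul_apply, smul_eq_mul, smul_eq_mul]
  ring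

end RankOne

/-! ### Product functions and their totality. -/

section Tensor

variable {N : ℕ}

theorem memLp_tensor (f : Fin N → OneBody) :
    MemLp (fun x : Fin N → R3 => ∏ j, f j (x j)) 2 volume := by
  have hm : StronglyMeasurable fun x : Fin N → R3 => ∏ j, f j (x j) :=
    Finset.stronglyMeasurable_fun_prod _ fun j _ =>
      (Lp.stronglyMeasurable (f j)).comp_measurable (measurable_pi_apply j)
  rw [memLp_two_iff_integrable_sq_norm hm.aestronglyMeasurable]
  simp_rw [norm_prod, ← Finset.prod_pow]
  refine Integrable.fintype_prod (f := fun j y => ‖f j y‖ ^ 2) fun j => ?_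
  exact (memLp_two_iff_integrable_sq_norm (Lp.aestronglyMeasurable (f j))).1 (Lp.memLp (f j))

/-- The product `f₁(x₁) ⋯ f_N(x_N)`. -/
def tensor (f : Fin N → OneBody) : ManyBody N := (memLp_tensor f).toLp _

theorem coeFn_tensor (f : Fin N → OneBody) :
    tensor f =ᵐ[volume] fun x => ∏ j, f j (x j) := (memLp_tensor f).coeFn_toLp

theorem L2_inner_eq {α : Type*} [MeasurableSpace α] {μ : Measure α} (f g : Lp ℂ 2 μ) :
    ⟪f, g⟫_ℂ = ∫ x, conj (f x) * g x ∂μ := by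
  rw [L2.inner_def]
  refine integral_congr_ae (Filter.Eventually.of_forall fun x => ?_)
  simp [mul_comm]

theorem inner_tensor (f g : Fin N → OneBody) :
    ⟪tensor f, tensor g⟫_ℂ = ∏ j, ⟪f j, g j⟫_ℂ := by
  simp_rw [L2_inner_eq]
  rw [← integral_fintype_prod_volume_eq_prod (f := fun j (y : R3) => conj (f j y) * g j y)]
  refine integral_congr_ae ?_
  filter_upwards [coeFn_tensor f, coeFn_tensor g] with x h1 h2
  rw [h1, h2, map_prod, Finset.prod_mul_distrib]

/-- The indicator function of a box of finite measure is itself a product of one-particle functions.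
-/
theorem integral_box_eq_zero {ψ : ManyBody N} (h : ∀ f, ⟪tensor f, ψ⟫_ℂ = 0)
    (s : Fin N → Set R3) (hs : ∀ j, MeasurableSet (s j)) (hs' : ∀ j, volume (s j) ≠ ⊤) :
    ∫ x in Set.pi univ s, ψ x = 0 := by
  have h1 := h fun j => indicatorConstLp 2 (hs j) (hs' j) (1 : ℂ)
  rw [L2_inner_eq] at h1
  rw [← integral_indicator (MeasurableSet.univ_pi hs), ← h1]
  refine integral_congr_ae ?_
  have h2 : ∀ᵐ x : Fin N → R3, ∀ j,
      indicatorConstLp 2 (hs j) (hs' j) (1 : ℂ) (x j) = (s j).indicator (fun _ => 1) (x j) :=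
    ae_all_iff.2 fun j => ae_comp_eval indicatorConstLp_coeFn j
  filter_upwards [coeFn_tensor fun j => indicatorConstLp 2 (hs j) (hs' j) (1 : ℂ), h2]
    with x h3 h4
  rw [h3]
  simp_rw [h4]
  by_cases hx : x ∈ Set.pi univ s
  · rw [indicator_of_mem hx, Finset.prod_eq_one, map_one, one_mul]
    intro j _
    rw [indicator_of_mem (hx j (mem_univ j))]
  · rw [indicator_of_notMem hx]
    simp only [mem_pi, mem_univ, true_implies, not_forall] at hx
    obtain ⟨j, hj⟩ := hx
    rw [Finset.prod_eq_zero (Finset.mem_univ j), map_zero, zero_mul]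
    rw [indicator_of_notMem hj]

/-- The sets A for which the integral of ψ over A ∩ B n vanishes contain the boxes and form a
λ-system, so they include all measurable sets. The bounded sets B n guarantee that ψ, which is only
square integrable, is integrable there; they exhaust the space. -/
theorem eq_zero_of_inner_tensor {ψ : ManyBody N} (h : ∀ f, ⟪tensor f, ψ⟫_ℂ = 0) : ψ = 0 := by
  set B : ℕ → Set (Fin N → R3) := fun n => Set.pi univ fun _ => Metric.ball (0 : R3) n with hB
  have hBm : ∀ n, MeasurableSet (B n) := fun n => MeasurableSet.univ_pi fun _ => measurableSet_ball
  have hBf : ∀ n, volume (B n) < ⊤ := fun n => by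
    rw [hB, volume_pi_pi]
    exact ENNReal.prod_lt_top fun i _ => measure_ball_lt_top
  have hint : ∀ n, IntegrableOn ψ (B n) := fun n => by
    have : IsFiniteMeasure (volume.restrict (B n)) := ⟨by simpa using hBf n⟩
    exact ((Lp.memLp ψ).restrict (B n)).integrable (by norm_num)
  have hzero : ∀ n, ∀ A, MeasurableSet A → ∫ x in A ∩ B n, ψ x = 0 := by
    intro n A hA
    induction A, hA using MeasurableSpace.induction_on_inter
      (generateFrom_pi (α := fun _ : Fin N => R3)).symm isPiSystem_pi with
    | empty => simp
    | basic A hA =>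
      obtain ⟨s, hs, rfl⟩ := hA
      rw [hB, ← Set.pi_inter_distrib]
      refine integral_box_eq_zero h _ (fun j => MeasurableSet.inter (show MeasurableSet (s j) from hs j (mem_univ j)) measurableSet_ball)
        fun j => ?_
      exact ((measure_mono inter_subset_right).trans_lt measure_ball_lt_top).ne
    | compl A hA ih =>
      have h0 : ∫ x in B n, ψ x = 0 := integral_box_eq_zero h _ (fun j => measurableSet_ball)
        fun j => measure_ball_lt_top.ne
      have h1 := integral_inter_add_sdiff (μ := volume) (f := ψ) (s := B n) hA (hint n)
      rw [inter_comm] at ih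
      rw [ih, zero_add, h0] at h1
      rw [inter_comm, ← sdiff_eq]
      exact h1
    | iUnion A hd hA ih =>
      rw [iUnion_inter]
      rw [integral_iUnion (fun i => (hA i).inter (hBm n))]
      · simp [ih]
      · exact fun i j hij => (hd hij).mono inter_subset_left inter_subset_left
      · exact (hint n).mono_set (iUnion_subset fun i => inter_subset_right)
  have hae : ∀ n, ∀ᵐ x ∂(volume.restrict (B n)), ψ x = 0 := fun n => by
    refine Integrable.ae_eq_zero_of_forall_setIntegral_eq_zero (hint n) fun A hA _ => ?_
    rw [Measure.restrict_restrict hA]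
    exact hzero n A hA
  have huniv : ⋃ n, B n = univ := by
    refine eq_univ_of_forall fun x => ?_
    obtain ⟨n, hn⟩ := exists_nat_gt (∑ j, ‖x j‖)
    refine mem_iUnion.2 ⟨n, fun j _ => ?_⟩
    rw [mem_ball_zero_iff]
    exact (Finset.single_le_sum (f := fun j => ‖x j‖) (fun i _ => norm_nonneg _)
      (Finset.mem_univ j)).trans_lt hn
  rw [Lp.eq_zero_iff_ae_eq_zero]
  have := ae_restrict_iUnion_iff B (fun x => ψ x = 0) (μ := volume) |>.2 hae
  rwa [huniv, Measure.restrict_univ] at this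

/-- By totality of the products. Operator identities are thereby reduced to algebra with
one-particle inner products. -/
theorem tensor_ext {E : Type*} [NormedAddCommGroup E] [NormedSpace ℂ E]
    {A B : ManyBody N →L[ℂ] E} (h : ∀ f, A (tensor f) = B (tensor f)) : A = B := by
  have hd : Dense (Submodule.span ℂ (range (tensor (N := N))) : Set (ManyBody N)) := by
    rw [Submodule.dense_iff_topologicalClosure_eq_top, Submodule.topologicalClosure_eq_top_iff,
      Submodule.eq_bot_iff]
    intro ψ hψ
    refine eq_zero_of_inner_tensor fun f => ?_
    exact Submodule.mem_orthogonal _ ψ |>.1 hψ _ (Submodule.subset_span ⟨f, rfl⟩)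
  refine ContinuousLinearMap.ext_on hd ?_
  rintro _ ⟨f, rfl⟩
  exact h f

theorem inner_tensor_ext {A B : ManyBody N →L[ℂ] ManyBody N}
    (h : ∀ f g, ⟪tensor f, A (tensor g)⟫_ℂ = ⟪tensor f, B (tensor g)⟫_ℂ) : A = B := by
  refine tensor_ext fun g => ?_
  rw [← sub_eq_zero]
  refine eq_zero_of_inner_tensor fun f => ?_
  rw [inner_sub_right, h, sub_self]

theorem rankOne_tensor (m : Fin N) (f g : OneBody) (h : Fin N → OneBody) :
    rankOne m f g (tensor h) = ⟪g, h m⟫_ℂ • tensor (Function.update h m f) := by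
  refine Lp.ext ?_
  filter_upwards [coeFn_rankOne m f g (tensor h), contract_congr g m (coeFn_tensor h),
    coeFn_tensor (Function.update h m f), Lp.coeFn_smul ⟪g, h m⟫_ℂ (tensor (Function.update h m f))]
    with x h1 h2 h3 h4
  rw [h1, h2, h4, Pi.smul_apply, h3, smul_eq_mul, L2_inner_eq, contract,
    ← Finset.mul_prod_erase _ _ (Finset.mem_univ m), Function.update_self]
  rw [← integral_mul_const, ← integral_const_mul]
  refine integral_congr_ae (Filter.Eventually.of_forall fun y => ?_)
  dsimp only
  rw [← Finset.mul_prod_erase _ _ (Finset.mem_univ m), Function.update_self,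
    Finset.prod_congr rfl (g := fun j => Function.update h m f j (x j))]
  · ring
  · intro j hj
    rw [Function.update_of_ne (Finset.ne_of_mem_erase hj),
      Function.update_of_ne (Finset.ne_of_mem_erase hj)]

theorem rankOne_mul_rankOne (m : Fin N) (f g f' g' : OneBody) :
    rankOne m f g * rankOne m f' g' = ⟪g, f'⟫_ℂ • rankOne m f g' := by
  refine tensor_ext fun h => ?_
  rw [mul_apply_eq_comp, rankOne_tensor, map_smul, rankOne_tensor, Function.update_self,
    Function.update_idem, _root_.smul_apply, rankOne_tensor, smul_comm]

theorem rankOne_commute {m l : Fin N} (hml : m ≠ l) (f g f' g' : OneBody) :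
    Commute (rankOne m f g) (rankOne l f' g') := by
  refine tensor_ext fun h => ?_
  simp only [mul_apply_eq_comp, rankOne_tensor, map_smul,
    Function.update_of_ne hml, Function.update_of_ne hml.symm]
  rw [Function.update_comm hml, smul_comm]

theorem adjoint_rankOne (m : Fin N) (f g : OneBody) :
    ContinuousLinearMap.adjoint (rankOne m f g) = rankOne m g f := by
  refine inner_tensor_ext fun h h' => ?_
  have e1 : ∏ j ∈ Finset.univ.erase m, ⟪Function.update h m f j, h' j⟫_ℂ
      = ∏ j ∈ Finset.univ.erase m, ⟪h j, h' j⟫_ℂ := Finset.prod_congr rfl fun j hj => by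
    rw [Function.update_of_ne (Finset.ne_of_mem_erase hj)]
  have e2 : ∏ j ∈ Finset.univ.erase m, ⟪h j, Function.update h' m g j⟫_ℂ
      = ∏ j ∈ Finset.univ.erase m, ⟪h j, h' j⟫_ℂ := Finset.prod_congr rfl fun j hj => by
    rw [Function.update_of_ne (Finset.ne_of_mem_erase hj)]
  rw [ContinuousLinearMap.adjoint_inner_right, rankOne_tensor, rankOne_tensor, inner_smul_left,
    inner_smul_right, inner_tensor, inner_tensor, ← Finset.mul_prod_erase _ _ (Finset.mem_univ m),
    ← Finset.mul_prod_erase Finset.univ (fun j => ⟪h j, Function.update h' m g j⟫_ℂ)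
      (Finset.mem_univ m), e1, e2]
  simp only [Function.update_self, inner_conj_symm]
  ring

/-! ### Permutations of the particles -/

theorem measurePreserving_permute (σ : Equiv.Perm (Fin N)) :
    MeasurePreserving (fun (x : Fin N → R3) j => x (σ j)) volume volume := by
  have h := volume_measurePreserving_piCongrLeft (fun _ : Fin N => R3) σ.symm
  convert h using 1
  funext x j
  have := MeasurableEquiv.piCongrLeft_apply_apply (β := fun _ : Fin N => R3) σ.symm x (σ j)
  simpa using this.symm

/-- The action of a permutation of the particles. -/
def permute (σ : Equiv.Perm (Fin N)) : ManyBody N →L[ℂ] ManyBody N :=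
  (Lp.compMeasurePreservingₗᵢ ℂ _ (measurePreserving_permute σ)).toContinuousLinearMap

theorem coeFn_permute (σ : Equiv.Perm (Fin N)) (ψ : ManyBody N) :
    permute σ ψ =ᵐ[volume] fun x => ψ fun j => x (σ j) :=
  Lp.coeFn_compMeasurePreserving ψ (measurePreserving_permute σ)

theorem permute_tensor (σ : Equiv.Perm (Fin N)) (f : Fin N → OneBody) :
    permute σ (tensor f) = tensor fun j => f (σ.symm j) := by
  refine Lp.ext ?_
  filter_upwards [coeFn_permute σ (tensor f), coeFn_tensor fun j => f (σ.symm j),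
    (measurePreserving_permute σ).quasiMeasurePreserving.ae (coeFn_tensor f)] with x h1 h2 h3
  rw [h1, h2, h3]
  simpa using Equiv.prod_comp σ fun j => f (σ.symm j) (x j)

theorem adjoint_permute (σ : Equiv.Perm (Fin N)) :
    ContinuousLinearMap.adjoint (permute σ) = permute σ.symm := by
  refine inner_tensor_ext fun f g => ?_
  rw [ContinuousLinearMap.adjoint_inner_right, permute_tensor, permute_tensor, inner_tensor,
    inner_tensor, ← Equiv.prod_comp σ]
  simp

theorem permute_mul_rankOne (σ : Equiv.Perm (Fin N)) (m : Fin N) (f g : OneBody) :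
    permute σ * rankOne m f g = rankOne (σ m) f g * permute σ := by
  refine tensor_ext fun h => ?_
  simp only [mul_apply_eq_comp, permute_tensor, rankOne_tensor, map_smul,
    Equiv.symm_apply_apply]
  congr 2
  funext j
  by_cases hj : j = σ m
  · subst hj; simp
  · rw [Function.update_of_ne hj, Function.update_of_ne]
    intro h'
    exact hj (by rw [← h', Equiv.apply_symm_apply])

end Tensor

/-! ### Bounded multiplication operators on L². -/

section MulOp

variable {α : Type*} [MeasurableSpace α] {μ : Measure α}

/-- Measurable bounded functions. -/
def BddMeas (h : α → ℂ) : Prop := Measurable h ∧ ∃ C : ℝ, ∀ x, ‖h x‖ ≤ C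

theorem BddMeas.memLp_mul {h : α → ℂ} (hh : BddMeas h) {f : α → ℂ} (hf : MemLp f 2 μ) :
    MemLp (fun x => h x * f x) 2 μ := by
  obtain ⟨C, hC⟩ := hh.2
  refine MemLp.of_le_mul hf (c := C) (hh.1.aestronglyMeasurable.mul hf.1)
    (Filter.Eventually.of_forall fun x => ?_)
  rw [norm_mul]
  exact mul_le_mul_of_nonneg_right (hC x) (norm_nonneg _)

open Classical in
/-- Multiplication by the bounded measurable function `h` (and `0` for other functions). -/
def mulOp (μ : Measure α) (h : α → ℂ) : Lp ℂ 2 μ →L[ℂ] Lp ℂ 2 μ :=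
  if hh : BddMeas h then
    LinearMap.mkContinuousOfExistsBound
      { toFun := fun f => (hh.memLp_mul (Lp.memLp f)).toLp _
        map_add' := fun f g => by
          rw [← MemLp.toLp_add, MemLp.toLp_eq_toLp_iff]
          filter_upwards [Lp.coeFn_add f g] with x h1
          rw [h1, Pi.add_apply, Pi.add_apply, mul_add]
        map_smul' := fun c f => by
          rw [RingHom.id_apply, ← MemLp.toLp_const_smul, MemLp.toLp_eq_toLp_iff]
          filter_upwards [Lp.coeFn_smul c f] with x h1
          rw [h1, Pi.smul_apply, Pi.smul_apply, smul_eq_mul, smul_eq_mul]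
          ring }
      (by
        obtain ⟨C, hC⟩ := hh.2
        refine ⟨C, fun f => ?_⟩
        refine Lp.norm_le_mul_norm_of_ae_le_mul ?_
        filter_upwards [(hh.memLp_mul (Lp.memLp f)).coeFn_toLp] with x hx
        simp only [LinearMap.coe_mk, AddHom.coe_mk]
        rw [hx, norm_mul]
        exact mul_le_mul_of_nonneg_right (hC x) (norm_nonneg _))
  else 0

theorem coeFn_mulOp {h : α → ℂ} (hh : BddMeas h) (f : Lp ℂ 2 μ) :
    mulOp μ h f =ᵐ[μ] fun x => h x * f x := by
  rw [mulOp, dif_pos hh]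
  exact (hh.memLp_mul (Lp.memLp f)).coeFn_toLp

theorem norm_mulOp_apply_le {h : α → ℂ} (hm : Measurable h) {C : ℝ} (hC : ∀ x, ‖h x‖ ≤ C)
    (f : Lp ℂ 2 μ) : ‖mulOp μ h f‖ ≤ C * ‖f‖ := by
  refine Lp.norm_le_mul_norm_of_ae_le_mul ?_
  filter_upwards [coeFn_mulOp (μ := μ) ⟨hm, C, hC⟩ f] with x hx
  rw [hx, norm_mul]
  exact mul_le_mul_of_nonneg_right (hC x) (norm_nonneg _)

theorem BddMeas.star {h : α → ℂ} (hh : BddMeas h) : BddMeas fun x => conj (h x) :=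
  ⟨Complex.continuous_conj.measurable.comp hh.1, hh.2.imp fun C hC x => by
    rw [RCLike.norm_conj]; exact hC x⟩

theorem BddMeas.mul {h k : α → ℂ} (hh : BddMeas h) (hk : BddMeas k) :
    BddMeas fun x => h x * k x := by
  obtain ⟨C, hC⟩ := hh.2
  obtain ⟨D, hD⟩ := hk.2
  refine ⟨hh.1.mul hk.1, C * D, fun x => ?_⟩
  rw [norm_mul]
  exact mul_le_mul (hC x) (hD x) (norm_nonneg _) ((norm_nonneg _).trans (hC x))

theorem BddMeas.comp {β : Type*} [MeasurableSpace β] {h : α → ℂ} (hh : BddMeas h) {g : β → α}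
    (hg : Measurable g) : BddMeas fun x => h (g x) :=
  ⟨hh.1.comp hg, hh.2.imp fun _ hC x => hC (g x)⟩

theorem mulOp_mul {h k : α → ℂ} (hh : BddMeas h) (hk : BddMeas k) :
    mulOp μ h * mulOp μ k = mulOp μ fun x => h x * k x := by
  ext1 f
  refine Lp.ext ?_
  rw [mul_apply_eq_comp]
  filter_upwards [coeFn_mulOp hh (mulOp μ k f), coeFn_mulOp hk f, coeFn_mulOp (hh.mul hk) f]
    with x h1 h2 h3
  rw [h1, h2, h3, mul_assoc]

theorem adjoint_mulOp {h : α → ℂ} (hh : BddMeas h) :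
    ContinuousLinearMap.adjoint (mulOp μ h) = mulOp μ fun x => conj (h x) := by
  symm
  rw [ContinuousLinearMap.eq_adjoint_iff]
  intro f g
  simp_rw [L2_inner_eq]
  refine integral_congr_ae ?_
  filter_upwards [coeFn_mulOp hh g, coeFn_mulOp hh.star f] with x h1 h2
  rw [h1, h2, map_mul, Complex.conj_conj]
  ring

theorem adjoint_mulOp_real {h : α → ℝ} (hh : BddMeas fun x => (h x : ℂ)) :
    ContinuousLinearMap.adjoint (mulOp μ fun x => (h x : ℂ)) = mulOp μ fun x => (h x : ℂ) := by
  rw [adjoint_mulOp hh]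
  simp

theorem enorm_mulOp_sq {h : α → ℂ} (hh : BddMeas h) (f : Lp ℂ 2 μ) :
    ‖mulOp μ h f‖ₑ ^ 2 = ∫⁻ x, ‖h x‖ₑ ^ 2 * ‖f x‖ₑ ^ 2 ∂μ := by
  rw [Lp_enorm_sq]
  refine lintegral_congr_ae ?_
  filter_upwards [coeFn_mulOp hh f] with x h1
  rw [h1, enorm_mul, mul_pow]

end MulOp

/-! ### Multiplication operators against rank-one operators and permutations. -/

section ManyBodyMulOp

variable {N : ℕ}

theorem mulOp_commute_rankOne {h : (Fin N → R3) → ℂ} (hh : BddMeas h) (m : Fin N)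
    (hm : ∀ x y, h (Function.update x m y) = h x) (f g : OneBody) :
    Commute (mulOp volume h) (rankOne m f g) := by
  rw [commute_iff_eq]
  ext1 ψ
  refine Lp.ext ?_
  rw [mul_apply_eq_comp, mul_apply_eq_comp]
  filter_upwards [coeFn_mulOp hh (rankOne m f g ψ), coeFn_rankOne m f g ψ,
    coeFn_rankOne m f g (mulOp volume h ψ), contract_congr g m (coeFn_mulOp hh ψ)] with x h1 h2 h3 h4
  rw [h1, h2, h3, h4, contract, contract, ← mul_assoc, mul_comm (h x), mul_assoc,
    ← integral_const_mul]
  congr 2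
  funext y
  rw [hm]
  ring

theorem permute_mul_mulOp {h : (Fin N → R3) → ℂ} (hh : BddMeas h) (σ : Equiv.Perm (Fin N)) :
    permute σ * mulOp volume h = mulOp volume (fun x => h fun j => x (σ j)) * permute σ := by
  ext1 ψ
  refine Lp.ext ?_
  rw [mul_apply_eq_comp, mul_apply_eq_comp]
  filter_upwards [coeFn_permute σ (mulOp volume h ψ), coeFn_permute σ ψ,
    (measurePreserving_permute σ).quasiMeasurePreserving.ae (coeFn_mulOp hh ψ),
    coeFn_mulOp (hh.comp (measurePreserving_permute σ).measurable) (permute σ ψ)] with x h1 h2 h3 h4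
  rw [h1, h3, h4, h2]

end ManyBodyMulOp

/-! ### Antisymmetry in some of the variables -/

section Antisymm

variable {N : ℕ}

/-- Antisymmetry under exchange of two of the variables in `S`. -/
def AntisymmOn (S : Finset (Fin N)) (χ : ManyBody N) : Prop :=
  ∀ i ∈ S, ∀ j ∈ S, i ≠ j → permute (Equiv.swap i j) χ = -χ

theorem AntisymmOn.mono {S S' : Finset (Fin N)} {χ : ManyBody N} (h : AntisymmOn S χ)
    (hS : S' ⊆ S) : AntisymmOn S' χ :=
  fun i hi j hj hij => h i (hS hi) j (hS hj) hij

theorem AntisymmOn.apply {S : Finset (Fin N)} {χ : ManyBody N} (h : AntisymmOn S χ)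
    {A : ManyBody N →L[ℂ] ManyBody N}
    (hA : ∀ i ∈ S, ∀ j ∈ S, i ≠ j → Commute (permute (Equiv.swap i j)) A) :
    AntisymmOn S (A χ) := by
  intro i hi j hj hij
  rw [← mul_apply_eq_comp, (hA i hi j hj hij).eq, mul_apply_eq_comp, h i hi j hj hij, map_neg]

theorem AntisymmOn.mulOp_apply {S : Finset (Fin N)} {χ : ManyBody N} (hχ : AntisymmOn S χ)
    {h : (Fin N → R3) → ℂ} (hh : BddMeas h)
    (hS : ∀ m ∈ S, ∀ x y, h (Function.update x m y) = h x) :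
    AntisymmOn S (mulOp volume h χ) := by
  refine hχ.apply fun i hi j hj hij => ?_
  rw [commute_iff_eq, permute_mul_mulOp hh]
  congr 2
  funext x
  -- A transposition amounts to two coordinate updates, both in S, and h is insensitive to these.
  have : (fun k => x (Equiv.swap i j k))
      = Function.update (Function.update x i (x j)) j (x i) := by
    funext k
    by_cases hkj : k = j
    · subst hkj; simp
    · by_cases hki : k = i
      · subst hki; simp [Function.update_of_ne hkj]
      · simp [Function.update_of_ne hkj, Function.update_of_ne hki,
          Equiv.swap_apply_of_ne_of_ne hki hkj]
  rw [this, hS j hj, hS i hi]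

theorem rankOne_zero_right (m : Fin N) (f : OneBody) : rankOne m f 0 = 0 := by
  simpa using rankOne_smul_right m (0 : ℂ) f (0 : OneBody)

/-- The Pauli principle. The operator A = |f⟩⟨f|_i |f⟩⟨f|_j absorbs the transposition of i and j
from the left and commutes with it, while the transposition acts on χ as -1; hence A χ = -A χ = 0.
Since ⟨f, f⟩ ≠ 0, the operators with general left vectors factor through A. -/
theorem AntisymmOn.rankOne_rankOne_same {S : Finset (Fin N)} {χ : ManyBody N}
    (h : AntisymmOn S χ) {i j : Fin N} (hi : i ∈ S) (hj : j ∈ S) (hij : i ≠ j)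
    (u u' f : OneBody) : rankOne i u f (rankOne j u' f χ) = 0 := by
  by_cases hf : f = 0
  · rw [hf, rankOne_zero_right, _root_.zero_apply]
  set A := rankOne i f f * rankOne j f f with hA
  have hc : (⟪f, f⟫_ℂ) ≠ 0 := inner_self_ne_zero.2 hf
  have h1 : permute (Equiv.swap i j) * A = A := by
    refine tensor_ext fun k => ?_
    simp only [hA, mul_apply_eq_comp, rankOne_tensor, map_smul, permute_tensor]
    congr 3
    funext l
    by_cases hli : l = i
    · subst hli; simp [Function.update_apply]
    · by_cases hlj : l = j
      · subst hlj; simp [Function.update_apply]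
      · simp [Equiv.swap_apply_of_ne_of_ne hli hlj, Function.update_of_ne hli,
          Function.update_of_ne hlj]
  have h2 : permute (Equiv.swap i j) * A = A * permute (Equiv.swap i j) := by
    rw [hA, ← mul_assoc, permute_mul_rankOne, mul_assoc, permute_mul_rankOne, ← mul_assoc,
      Equiv.swap_apply_left, Equiv.swap_apply_right, (rankOne_commute hij.symm _ _ _ _).eq]
  have h3 : A χ = 0 := by
    have : A χ = -A χ := by
      conv_lhs => rw [← h1, h2, mul_apply_eq_comp, h i hi j hj hij, map_neg]
    rw [← add_eq_zero_iff_eq_neg, ← two_smul ℂ, smul_eq_zero] at this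
    exact this.resolve_left two_ne_zero
  have h4 : rankOne i u f * rankOne j u' f * A
      = (⟪f, f⟫_ℂ * ⟪f, f⟫_ℂ) • (rankOne i u f * rankOne j u' f) := by
    rw [hA, mul_assoc, ← mul_assoc (rankOne j u' f), (rankOne_commute hij.symm _ _ _ _).eq,
      mul_assoc, rankOne_mul_rankOne, ← mul_assoc, rankOne_mul_rankOne, smul_mul_assoc,
      mul_smul_comm, smul_smul]
  have h5 := congrArg (fun B : ManyBody N →L[ℂ] ManyBody N => B χ) h4
  simp only [mul_apply_eq_comp, _root_.smul_apply] at h5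
  rw [h3, map_zero, map_zero, eq_comm, smul_eq_zero] at h5
  exact h5.resolve_left (mul_ne_zero hc hc)

/-- `‖f‖² - ∑_{m ∈ S} |f⟩⟨f|_m`. -/
def holeOp (S : Finset (Fin N)) (f : OneBody) : ManyBody N →L[ℂ] ManyBody N :=
  ((‖f‖ : ℂ) ^ 2) • 1 - ∑ m ∈ S, rankOne m f f

theorem holeOp_apply (S : Finset (Fin N)) (f : OneBody) (χ : ManyBody N) :
    holeOp S f χ = ((‖f‖ : ℂ) ^ 2) • χ - ∑ m ∈ S, rankOne m f f χ := by
  simp [holeOp, sub_apply, _root_.smul_apply, _root_.sum_apply]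

/-- By exclusion only the term with the same index survives in the sum, and it cancels the term
‖f‖². If f is already empty, no particle can be removed from it. -/
theorem AntisymmOn.rankOne_holeOp {S : Finset (Fin N)} {χ : ManyBody N} (h : AntisymmOn S χ)
    {m : Fin N} (hm : m ∈ S) (u f : OneBody) : rankOne m u f (holeOp S f χ) = 0 := by
  rw [holeOp_apply, map_sub, map_smul, map_sum, Finset.sum_eq_single_of_mem m hm
    fun l hl hlm => h.rankOne_rankOne_same hm hl hlm.symm u f f, ← mul_apply_eq_comp,
    rankOne_mul_rankOne, _root_.smul_apply, inner_self_eq_norm_sq_to_K]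
  exact sub_self _

/-- On functions that are antisymmetric in S, the operator is thus ‖f‖² times the projection onto
states in which no particle of S occupies f. -/
theorem AntisymmOn.holeOp_holeOp {S : Finset (Fin N)} {χ : ManyBody N} (h : AntisymmOn S χ)
    (f : OneBody) : holeOp S f (holeOp S f χ) = ((‖f‖ : ℂ) ^ 2) • holeOp S f χ := by
  rw [holeOp_apply, Finset.sum_eq_zero fun m hm => h.rankOne_holeOp hm f f, sub_zero]

theorem adjoint_holeOp (S : Finset (Fin N)) (f : OneBody) :
    ContinuousLinearMap.adjoint (holeOp S f) = holeOp S f := by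
  rw [holeOp, map_sub, map_sum]
  congr 1
  · rw [← ContinuousLinearMap.star_eq_adjoint, star_smul, star_one]
    simp
  · exact Finset.sum_congr rfl fun m _ => adjoint_rankOne m f f

theorem AntisymmOn.norm_holeOp_sq {S : Finset (Fin N)} {χ : ManyBody N} (h : AntisymmOn S χ)
    (f : OneBody) : ‖holeOp S f χ‖ ^ 2 = ‖f‖ ^ 2 * (⟪χ, holeOp S f χ⟫_ℂ).re := by
  rw [← inner_self_eq_norm_sq (𝕜 := ℂ)]
  conv_lhs => rw [← adjoint_holeOp, ContinuousLinearMap.adjoint_inner_left, adjoint_holeOp,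
    h.holeOp_holeOp, inner_smul_right]
  rw [← Complex.ofReal_pow]
  exact Complex.re_ofReal_mul _ _

/-- The expectation times ‖f‖² is a squared norm. -/
theorem AntisymmOn.inner_holeOp_nonneg {S : Finset (Fin N)} {χ : ManyBody N} (h : AntisymmOn S χ)
    (f : OneBody) : 0 ≤ (⟪χ, holeOp S f χ⟫_ℂ).re := by
  by_cases hf : f = 0
  · simp [hf, holeOp_apply, rankOne_zero_right]
  · have h1 := h.norm_holeOp_sq f
    have h2 : 0 < ‖f‖ ^ 2 := by positivity
    nlinarith [sq_nonneg ‖holeOp S f χ‖]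

theorem norm_rankOne_apply_sq (m : Fin N) (u f : OneBody) (χ : ManyBody N) :
    ‖rankOne m u f χ‖ ^ 2 = ‖u‖ ^ 2 * (⟪χ, rankOne m f f χ⟫_ℂ).re := by
  rw [← inner_self_eq_norm_sq (𝕜 := ℂ)]
  conv_lhs => rw [← ContinuousLinearMap.adjoint_inner_right, adjoint_rankOne, ← mul_apply_eq_comp,
    rankOne_mul_rankOne, _root_.smul_apply, inner_smul_right, inner_self_eq_norm_sq_to_K]
  exact_mod_cast Complex.re_ofReal_mul _ _

/-- At most one particle occupies f: this is positivity of the hole operator. No factor of the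
number of particles appears on the right, which is the gain over the bosonic bound. -/
theorem AntisymmOn.sum_norm_rankOne_sq_le {S : Finset (Fin N)} {χ : ManyBody N}
    (h : AntisymmOn S χ) (u f : OneBody) :
    ∑ m ∈ S, ‖rankOne m u f χ‖ ^ 2 ≤ ‖u‖ ^ 2 * ‖f‖ ^ 2 * ‖χ‖ ^ 2 := by
  have h1 := h.inner_holeOp_nonneg f
  rw [holeOp_apply, inner_sub_right, inner_sum, inner_smul_right, Complex.sub_re, Complex.re_sum,
    inner_self_eq_norm_sq_to_K] at h1
  have h2 : (((‖f‖ : ℂ) ^ 2) * ((‖χ‖ : ℂ) ^ 2)).re = ‖f‖ ^ 2 * ‖χ‖ ^ 2 := by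
    exact_mod_cast Complex.ofReal_re _
  simp_rw [norm_rankOne_apply_sq, ← Finset.mul_sum, mul_assoc]
  refine mul_le_mul_of_nonneg_left ?_ (by positivity)
  have h3 := h1
  simp only [Complex.coe_algebraMap] at h3
  rw [h2] at h3
  linarith

end Antisymm

/-! ### Weighted forms of the exclusion principle. -/

section Fermi

variable {N : ℕ}

theorem AntisymmOn.sum_enorm_rankOne_sq_le {S : Finset (Fin N)} {χ : ManyBody N}
    (h : AntisymmOn S χ) (u f : OneBody) :
    ∑ m ∈ S, ‖rankOne m u f χ‖ₑ ^ 2 ≤ ‖u‖ₑ ^ 2 * ‖f‖ₑ ^ 2 * ‖χ‖ₑ ^ 2 := by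
  have h1 := ENNReal.ofReal_le_ofReal (h.sum_norm_rankOne_sq_le u f)
  rw [ENNReal.ofReal_sum_of_nonneg fun _ _ => by positivity, ENNReal.ofReal_mul (by positivity),
    ENNReal.ofReal_mul (by positivity)] at h1
  simpa [ENNReal.ofReal_pow] using h1

/-- The fermionic operator bound with a weight that does not depend on the variables in `S`. -/
theorem AntisymmOn.sum_lintegral_rankOne_le {S : Finset (Fin N)} {χ : ManyBody N}
    (hχ : AntisymmOn S χ) {κ : (Fin N → R3) → ENNReal} (hκ : Measurable κ)
    (hS : ∀ m ∈ S, ∀ x y, κ (Function.update x m y) = κ x) (u f : OneBody) :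
    ∑ m ∈ S, ∫⁻ x, κ x * ‖rankOne m u f χ x‖ₑ ^ 2
      ≤ ‖u‖ₑ ^ 2 * ‖f‖ₑ ^ 2 * ∫⁻ x, κ x * ‖χ x‖ₑ ^ 2 := by
  have hbd : ∀ n : ℕ, ∑ m ∈ S, ∫⁻ x, min (κ x) n * ‖rankOne m u f χ x‖ₑ ^ 2
      ≤ ‖u‖ₑ ^ 2 * ‖f‖ₑ ^ 2 * ∫⁻ x, κ x * ‖χ x‖ₑ ^ 2 := by
    intro n
    -- The root of the truncated weight is a bounded multiplication operator that commutes with the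
    -- rank-one operators in S and keeps the antisymmetry in S. The bound without weight applies to
    -- the function multiplied by it; the truncation is removed by monotone convergence.
    set h : (Fin N → R3) → ℂ := fun x => ((√(min (κ x) n).toReal : ℝ) : ℂ) with hdef
    have hmin : ∀ x, min (κ x) n ≠ ⊤ := fun x =>
      ((min_le_right _ _).trans_lt (ENNReal.natCast_lt_top n)).ne
    have hh : BddMeas h := by
      refine ⟨Complex.measurable_ofReal.comp ((hκ.min measurable_const).ennreal_toReal.sqrt),
        √n, fun x => ?_⟩
      rw [hdef, Complex.norm_real, Real.norm_of_nonneg (Real.sqrt_nonneg _)]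
      refine Real.sqrt_le_sqrt ?_
      exact (ENNReal.toReal_mono (by simp) (min_le_right _ _)).trans (by simp)
    have hsq : ∀ x, ‖h x‖ₑ ^ 2 = min (κ x) n := fun x => by
      rw [hdef, ← ofReal_norm, ← ENNReal.ofReal_pow (norm_nonneg _), Complex.norm_real,
        Real.norm_eq_abs, sq_abs, Real.sq_sqrt ENNReal.toReal_nonneg, ENNReal.ofReal_toReal (hmin x)]
    have hhS : ∀ m ∈ S, ∀ x y, h (Function.update x m y) = h x := fun m hm x y => by
      simp only [hdef, hS m hm x y]
    calc ∑ m ∈ S, ∫⁻ x, min (κ x) n * ‖rankOne m u f χ x‖ₑ ^ 2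
        = ∑ m ∈ S, ‖rankOne m u f (mulOp volume h χ)‖ₑ ^ 2 := by
          refine Finset.sum_congr rfl fun m hm => ?_
          rw [← mul_apply_eq_comp, ← (mulOp_commute_rankOne hh m (hhS m hm) u f).eq,
            mul_apply_eq_comp, enorm_mulOp_sq hh]
          simp_rw [hsq]
      _ ≤ ‖u‖ₑ ^ 2 * ‖f‖ₑ ^ 2 * ‖mulOp volume h χ‖ₑ ^ 2 :=
          (hχ.mulOp_apply hh hhS).sum_enorm_rankOne_sq_le u f
      _ ≤ _ := by
          rw [enorm_mulOp_sq hh]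
          simp_rw [hsq]
          gcongr
          exact min_le_left _ _
  have hlim : ∀ m, ∫⁻ x, κ x * ‖rankOne m u f χ x‖ₑ ^ 2
      = ⨆ n : ℕ, ∫⁻ x, min (κ x) n * ‖rankOne m u f χ x‖ₑ ^ 2 := by
    intro m
    rw [← lintegral_iSup]
    · refine lintegral_congr fun x => ?_
      rw [← ENNReal.iSup_mul]
      congr 1
      refine le_antisymm ?_ (iSup_le fun n => min_le_left _ _)
      by_cases hx : κ x = ⊤
      · simp [hx, ENNReal.iSup_natCast]
      · obtain ⟨n, hn⟩ := ENNReal.exists_nat_gt hx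
        exact le_iSup_of_le n (le_min le_rfl hn.le)
    · exact fun n => (hκ.min measurable_const).mul
        ((Lp.stronglyMeasurable _).measurable.enorm.pow_const _)
    · intro n k hnk x
      dsimp only
      gcongr
  simp_rw [hlim]
  rw [ENNReal.finsetSum_iSup_of_monotone]
  · exact iSup_le hbd
  · intro m n k hnk
    dsimp only
    gcongr

theorem contract_update (g : OneBody) (m : Fin N) (ψ : (Fin N → R3) → ℂ) (x : Fin N → R3) (y : R3) :
    contract g m ψ (Function.update x m y) = contract g m ψ x := by
  simp [contract]

theorem contract_zero (m : Fin N) (ψ : (Fin N → R3) → ℂ) : contract 0 m ψ = 0 := by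
  simpa using contract_smul_left (0 : OneBody) m 0 ψ

theorem contract_sum_left {ι : Type*} (s : Finset ι) (g : ι → OneBody) (m : Fin N)
    {ψ : (Fin N → R3) → ℂ} (hψ : MemLp ψ 2 volume) :
    contract (∑ j ∈ s, g j) m ψ =ᵐ[volume] fun x => ∑ j ∈ s, contract (g j) m ψ x := by
  classical
  induction s using Finset.induction_on with
  | empty => simp [contract_zero]; rfl
  | insert a s ha ih =>
    rw [Finset.sum_insert ha]
    filter_upwards [ih, contract_add_left (g a) (∑ j ∈ s, g j) m hψ] with x h1 h2
    rw [h2, Pi.add_apply, h1, Finset.sum_insert ha]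

/-- The vector `∑_j c_j(y)^* φ_j`. -/
def orbitalCombination (φ : Fin N → OneBody) (c : Fin N → R3 → ℂ) (y : R3) : OneBody :=
  ∑ j, conj (c j y) • φ j

theorem coeFn_rankOne_orbitalCombination (φ : Fin N → OneBody) (c : Fin N → R3 → ℂ) (m : Fin N)
    (u : OneBody) (ψ : ManyBody N) (y : R3) :
    rankOne m u (orbitalCombination φ c y) ψ =ᵐ[volume]
      fun x => u (x m) * ∑ j, c j y * contract (φ j) m ψ x := by
  filter_upwards [coeFn_rankOne m u (orbitalCombination φ c y) ψ,
    contract_sum_left Finset.univ (fun j => conj (c j y) • φ j) m (Lp.memLp ψ)] with x h1 h2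
  rw [h1, orbitalCombination, h2]
  simp [contract_smul_left]

/-- Integrals of `|∑_j c_j(x_m) ⟨φ_j|_m ψ|²` in terms of rank one operators. -/
theorem lintegral_sum_contract (φ : Fin N → OneBody) {c : Fin N → R3 → ℂ}
    (hc : ∀ j, Measurable (c j)) (m : Fin N) {u : OneBody} (hu : ‖u‖ = 1) (ψ : ManyBody N)
    {κ : R3 → (Fin N → R3) → ENNReal} (hκ : Measurable (Function.uncurry κ))
    (hm : ∀ y x z, κ y (Function.update x m z) = κ y x) :
    ∫⁻ x, κ (x m) x * ‖∑ j, c j (x m) * contract (φ j) m ψ x‖ₑ ^ 2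
      = ∫⁻ y, ∫⁻ x, κ y x * ‖rankOne m u (orbitalCombination φ c y) ψ x‖ₑ ^ 2 := by
  have hct : ∀ j, Measurable (contract (φ j) m ψ) := fun j =>
    (stronglyMeasurable_contract (φ j) m (Lp.stronglyMeasurable ψ)).measurable
  have hum : Measurable fun y => ‖u y‖ₑ ^ 2 := (Lp.stronglyMeasurable u).measurable.enorm.pow_const _
  set F : R3 → (Fin N → R3) → ENNReal := fun y x =>
    κ y x * ‖∑ j, c j y * contract (φ j) m ψ x‖ₑ ^ 2 with hF
  have hFm : Measurable (Function.uncurry F) := by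
    refine hκ.mul (Measurable.pow_const (Measurable.enorm ?_) _)
    exact Finset.measurable_fun_sum _ fun j _ =>
      ((hc j).comp measurable_fst).mul ((hct j).comp measurable_snd)
  have hFu : ∀ y x z, F y (Function.update x m z) = F y x := fun y x z => by
    simp only [hF, hm, contract_update]
  have h1 : ∀ y, ∫⁻ x, κ y x * ‖rankOne m u (orbitalCombination φ c y) ψ x‖ₑ ^ 2
      = ∫⁻ x, ‖u (x m)‖ₑ ^ 2 * F y x := fun y => by
    refine lintegral_congr_ae ?_
    filter_upwards [coeFn_rankOne_orbitalCombination φ c m u ψ y] with x hx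
    rw [hx, enorm_mul, mul_pow, hF]
    ring
  simp_rw [h1]
  have hum2 : Measurable fun z : (Fin N → R3) × R3 => ‖u (z.1 m)‖ₑ ^ 2 :=
    hum.comp ((measurable_pi_apply m).comp measurable_fst)
  have hFd : Measurable fun z : R3 × (Fin N → R3) => F (z.2 m) z.2 := by
    have hp : Measurable fun z : R3 × (Fin N → R3) => (z.2 m, z.2) :=
      ((measurable_pi_apply m).comp measurable_snd).prodMk measurable_snd
    exact hFm.comp hp
  have hG : Measurable fun z : R3 × (Fin N → R3) => ‖u z.1‖ₑ ^ 2 * F (z.2 m) z.2 :=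
    (hum.comp measurable_fst).mul hFd
  rw [lintegral_lintegral_swap]
  -- The contraction no longer depends on x_m, which appears only in |u(x_m)|². Exchanging x_m with
  -- y puts the orbital coefficients back at x_m and leaves ∫ |u|² = 1.
  · have h2 := lintegral_update_comm m (F := fun y x => ‖u y‖ₑ ^ 2 * F (x m) x) hG
    simp only [Function.update_self, hFu] at h2
    rw [h2]
    have h3 : Measurable fun x : Fin N → R3 => F (x m) x := by
      have hp : Measurable fun x : Fin N → R3 => (x m, x) :=
        (measurable_pi_apply m).prodMk measurable_id
      exact hFm.comp hp
    simp_rw [lintegral_const_mul _ h3]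
    rw [lintegral_mul_const _ hum, ← Lp_enorm_sq, ← ofReal_norm, hu]
    simp [hF]
  · have : Measurable fun z : R3 × (Fin N → R3) => ‖u (z.2 m)‖ₑ ^ 2 * F z.1 z.2 :=
      (hum2.comp measurable_swap).mul hFm
    exact this.aemeasurable

theorem enorm_sq_orbitalCombination {φ : Fin N → OneBody} (hφ : Orthonormal ℂ φ)
    (c : Fin N → R3 → ℂ) (y : R3) :
    ‖orbitalCombination φ c y‖ₑ ^ 2 = ∑ j, ‖c j y‖ₑ ^ 2 := by
  have h : ‖orbitalCombination φ c y‖ ^ 2 = ∑ j, ‖c j y‖ ^ 2 := by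
    rw [← inner_self_eq_norm_sq (𝕜 := ℂ), orbitalCombination, hφ.inner_sum]
    rw [map_sum]
    refine Finset.sum_congr rfl fun j _ => ?_
    rw [Complex.conj_conj, Complex.mul_conj, Complex.normSq_eq_norm_sq]
    exact Complex.ofReal_re _
  rw [← ofReal_norm, ← ENNReal.ofReal_pow (norm_nonneg _), h,
    ENNReal.ofReal_sum_of_nonneg fun _ _ => by positivity]
  refine Finset.sum_congr rfl fun j _ => ?_
  rw [ENNReal.ofReal_pow (norm_nonneg _), ofReal_norm]

/-- The coefficients depend on x_m, so the exclusion principle does not apply directly. Freezing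
their argument to a parameter y turns the sum of contractions into a rank-one operator with right
vector ∑_j c_j(y)^* φ_j, whose squared norm is ∑_j |c_j(y)|². The exclusion principle is used for
each y and the result is integrated over y. -/
theorem AntisymmOn.sum_lintegral_contract_le {S : Finset (Fin N)} {χ : ManyBody N}
    (hχ : AntisymmOn S χ) (hN : 0 < N) {φ : Fin N → OneBody} (hφ : Orthonormal ℂ φ)
    {c : Fin N → R3 → ℂ} (hc : ∀ j, Measurable (c j))
    {κ : R3 → (Fin N → R3) → ENNReal} (hκ : Measurable (Function.uncurry κ))
    (hS : ∀ m ∈ S, ∀ y x z, κ y (Function.update x m z) = κ y x) :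
    ∑ m ∈ S, ∫⁻ x, κ (x m) x * ‖∑ j, c j (x m) * contract (φ j) m χ x‖ₑ ^ 2
      ≤ ∫⁻ x, (∫⁻ y, κ y x * ∑ j, ‖c j y‖ₑ ^ 2) * ‖χ x‖ₑ ^ 2 := by
  set u := φ ⟨0, hN⟩ with hu_def
  have hu : ‖u‖ = 1 := hφ.1 _
  have hue : ‖u‖ₑ = 1 := by rw [← ofReal_norm, hu, ENNReal.ofReal_one]
  have hχm : Measurable fun x => ‖χ x‖ₑ ^ 2 :=
    (Lp.stronglyMeasurable χ).measurable.enorm.pow_const _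
  have hcm : Measurable fun y => ∑ j, ‖c j y‖ₑ ^ 2 :=
    Finset.measurable_fun_sum _ fun j _ => (hc j).enorm.pow_const _
  have hct : ∀ m j, Measurable (contract (φ j) m χ) := fun m j =>
    (stronglyMeasurable_contract (φ j) m (Lp.stronglyMeasurable χ)).measurable
  have hmeas : ∀ m ∈ S, Measurable fun y => ∫⁻ x, κ y x *
      ‖rankOne m u (orbitalCombination φ c y) χ x‖ₑ ^ 2 := by
    intro m _
    have : ∀ y, ∫⁻ x, κ y x * ‖rankOne m u (orbitalCombination φ c y) χ x‖ₑ ^ 2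
        = ∫⁻ x, κ y x * ‖u (x m) * ∑ j, c j y * contract (φ j) m χ x‖ₑ ^ 2 := fun y => by
      refine lintegral_congr_ae ?_
      filter_upwards [coeFn_rankOne_orbitalCombination φ c m u χ y] with x hx
      rw [hx]
    simp_rw [this]
    have h2 : Measurable fun z : R3 × (Fin N → R3) =>
        κ z.1 z.2 * ‖u (z.2 m) * ∑ j, c j z.1 * contract (φ j) m χ z.2‖ₑ ^ 2 := by
      refine hκ.mul (Measurable.pow_const (Measurable.enorm ?_) _)
      refine Measurable.mul ((Lp.stronglyMeasurable u).measurable.comp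
        ((measurable_pi_apply m).comp measurable_snd)) ?_
      exact Finset.measurable_fun_sum _ fun j _ =>
        ((hc j).comp measurable_fst).mul ((hct m j).comp measurable_snd)
    exact h2.lintegral_prod_right'
  calc _ = ∑ m ∈ S, ∫⁻ y, ∫⁻ x, κ y x * ‖rankOne m u (orbitalCombination φ c y) χ x‖ₑ ^ 2 :=
        Finset.sum_congr rfl fun m hm => lintegral_sum_contract φ hc m hu χ hκ (hS m hm)
    _ = ∫⁻ y, ∑ m ∈ S, ∫⁻ x, κ y x * ‖rankOne m u (orbitalCombination φ c y) χ x‖ₑ ^ 2 :=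
        (lintegral_finsetSum' _ fun m hm => (hmeas m hm).aemeasurable).symm
    _ ≤ ∫⁻ y, (∑ j, ‖c j y‖ₑ ^ 2) * ∫⁻ x, κ y x * ‖χ x‖ₑ ^ 2 := by
        refine lintegral_mono fun y => ?_
        refine (hχ.sum_lintegral_rankOne_le (hκ.comp measurable_prodMk_left)
          (fun m hm x z => hS m hm y x z) u _).trans (le_of_eq ?_)
        rw [hue, enorm_sq_orbitalCombination hφ]
        simp
    _ = ∫⁻ y, ∫⁻ x, (κ y x * ∑ j, ‖c j y‖ₑ ^ 2) * ‖χ x‖ₑ ^ 2 := by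
        refine lintegral_congr fun y => ?_
        have : Measurable fun x => κ y x * ‖χ x‖ₑ ^ 2 := (hκ.comp measurable_prodMk_left).mul hχm
        rw [← lintegral_const_mul _ this]
        refine lintegral_congr fun x => ?_
        ring
    _ = ∫⁻ x, ∫⁻ y, (κ y x * ∑ j, ‖c j y‖ₑ ^ 2) * ‖χ x‖ₑ ^ 2 := by
        refine lintegral_lintegral_swap ?_
        have : Measurable fun z : R3 × (Fin N → R3) =>
            (κ z.1 z.2 * ∑ j, ‖c j z.1‖ₑ ^ 2) * ‖χ z.2‖ₑ ^ 2 :=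
          (hκ.mul (hcm.comp measurable_fst)).mul (hχm.comp measurable_snd)
        exact this.aemeasurable
    _ = _ := by
        refine lintegral_congr fun x => ?_
        rw [lintegral_mul_const]
        exact (hκ.comp measurable_prodMk_right).mul hcm

end Fermi

/-! ### Functions of the number of bad particles for a commuting family of projections -/

section Counting

variable {A : Type*} [Ring A] {N : ℕ}

open Classical in
/-- The factor `q_m` for `m ∈ S` and `p_m` for `m ∉ S`. -/
def projFactor (p : Fin N → A) (S : Finset (Fin N)) (m : Fin N) : A :=
  if m ∈ S then 1 - p m else p m

/-- The product of the factors `q_m`, `m ∈ S`, and `p_m`, `m ∉ S`. -/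
def projList (p : Fin N → A) (S : Finset (Fin N)) : A :=
  ((List.finRange N).map (projFactor p S)).prod

/-- The sum of the products with exactly `k` factors `q_m`. -/
def countProj (p : Fin N → A) (k : ℕ) : A :=
  ∑ S ∈ Finset.powersetCard k Finset.univ, projList p S

/-- The number operator `∑_m q_m`. -/
def numOp (p : Fin N → A) : A := ∑ m, (1 - p m)

/-- A commuting family of idempotents. -/
structure CommIdem (p : Fin N → A) : Prop where
  comm : ∀ i j, Commute (p i) (p j)
  idem : ∀ i, p i * p i = p i

/-- Multiplying out the product of the factors p_m + q_m = 1. -/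
theorem sum_prod_projFactor (p : Fin N → A) (l : List (Fin N)) (hl : l.Nodup) :
    ∑ S ∈ l.toFinset.powerset, (l.map (projFactor p S)).prod = 1 := by
  induction l with
  | nil => simp
  | cons a l ih =>
    rw [List.nodup_cons] at hl
    have ha : a ∉ l.toFinset := by simpa using hl.1
    have h1 : ∀ S ∈ l.toFinset.powerset, ((a :: l).map (projFactor p S)).prod
        = p a * (l.map (projFactor p S)).prod := fun S hS => by
      have : a ∉ S := fun h => ha (Finset.mem_powerset.1 hS h)
      rw [List.map_cons, List.prod_cons, projFactor, if_neg this]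
    have h2 : ∀ S ∈ l.toFinset.powerset, ((a :: l).map (projFactor p (insert a S))).prod
        = (1 - p a) * (l.map (projFactor p S)).prod := fun S hS => by
      rw [List.map_cons, List.prod_cons, projFactor, if_pos (Finset.mem_insert_self a S)]
      congr 2
      refine List.map_congr_left fun b hb => ?_
      have hba : b ≠ a := fun h => hl.1 (h ▸ hb)
      simp [projFactor, hba]
    rw [List.toFinset_cons, Finset.sum_powerset_insert ha, Finset.sum_congr rfl h1,
      Finset.sum_congr rfl h2, ← Finset.mul_sum, ← Finset.mul_sum, ih hl.2]
    simp

theorem sum_countProj (p : Fin N → A) : ∑ k ∈ Finset.range (N + 1), countProj p k = 1 := by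
  have h := sum_prod_projFactor p (List.finRange N) (List.nodup_finRange N)
  have hu : (List.finRange N).toFinset = Finset.univ := by ext; simp
  rw [hu] at h
  rw [← h]
  rw [Finset.sum_powerset, Finset.card_univ, Fintype.card_fin]
  rfl

theorem CommIdem.commute_projFactor {p : Fin N → A} {B : A} {S : Finset (Fin N)} {m : Fin N}
    (h : Commute B (p m)) : Commute B (projFactor p S m) := by
  unfold projFactor
  split_ifs
  · exact (Commute.one_right B).sub_right h
  · exact h

theorem commute_projList {p : Fin N → A} {B : A} (h : ∀ m, Commute B (p m))
    (S : Finset (Fin N)) : Commute B (projList p S) := by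
  refine Commute.list_prod_right _ _ fun x hx => ?_
  obtain ⟨m, -, rfl⟩ := List.mem_map.1 hx
  exact CommIdem.commute_projFactor (h m)

theorem commute_countProj {p : Fin N → A} {B : A} (h : ∀ m, Commute B (p m)) (k : ℕ) :
    Commute B (countProj p k) :=
  Commute.sum_right _ _ _ fun S _ => commute_projList h S

theorem CommIdem.commute_numOp {p : Fin N → A} (hp : CommIdem p) (k : ℕ) :
    Commute (numOp p) (countProj p k) := by
  refine commute_countProj (fun m => ?_) k
  exact Commute.sum_left _ _ _ fun i _ => (Commute.one_left _).sub_left (hp.comm i m)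

variable [Algebra ℂ A]

/-- The operator `∑_k f(k) P_k`. -/
def hatOp (p : Fin N → A) (f : ℕ → ℝ) : A :=
  ∑ k ∈ Finset.range (N + 1), (f k : ℂ) • countProj p k

open Classical in
theorem CommIdem.projFactor_mul {p : Fin N → A} (hp : CommIdem p) (S : Finset (Fin N))
    (m : Fin N) : (1 - p m) * projFactor p S m
      = (if m ∈ S then (1 : ℂ) else 0) • projFactor p S m := by
  unfold projFactor
  split_ifs
  · rw [mul_sub, mul_one, sub_mul, hp.idem, one_mul, sub_self, sub_zero, one_smul]
  · rw [sub_mul, hp.idem, one_mul, sub_self, zero_smul]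

theorem mul_list_prod_of_mem {r : Fin N → A} {B : A} {c : ℂ} {m : Fin N}
    (hB : ∀ l, Commute B (r l)) (hm : B * r m = c • r m) (l : List (Fin N)) (hl : m ∈ l) :
    B * (l.map r).prod = c • (l.map r).prod := by
  induction l with
  | nil => simp at hl
  | cons a l ih =>
    rw [List.map_cons, List.prod_cons]
    by_cases h : m = a
    · subst h
      rw [← mul_assoc, hm, smul_mul_assoc]
    · have hml : m ∈ l := by simpa [h] using hl
      rw [← mul_assoc, (hB a).eq, mul_assoc, ih hml, mul_smul_comm]

open Classical in
theorem CommIdem.mul_projList {p : Fin N → A} (hp : CommIdem p) (S : Finset (Fin N))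
    (m : Fin N) : (1 - p m) * projList p S = (if m ∈ S then (1 : ℂ) else 0) • projList p S := by
  refine mul_list_prod_of_mem (m := m) (fun l => ?_) (hp.projFactor_mul S m) _
    (List.mem_finRange m)
  exact commute_projFactor ((Commute.one_left _).sub_left (hp.comm m l))

theorem CommIdem.numOp_mul_countProj {p : Fin N → A} (hp : CommIdem p) (k : ℕ) :
    numOp p * countProj p k = (k : ℂ) • countProj p k := by
  classical
  rw [numOp, countProj, Finset.mul_sum, Finset.smul_sum]
  refine Finset.sum_congr rfl fun S hS => ?_
  rw [Finset.sum_mul]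
  simp_rw [hp.mul_projList S]
  rw [← Finset.sum_smul]
  congr 1
  rw [Finset.sum_ite_mem, Finset.univ_inter, Finset.sum_const, nsmul_eq_mul, mul_one,
    (Finset.mem_powersetCard.1 hS).2]

theorem CommIdem.countProj_mul_numOp {p : Fin N → A} (hp : CommIdem p) (k : ℕ) :
    countProj p k * numOp p = (k : ℂ) • countProj p k := by
  rw [← (hp.commute_numOp k).eq, hp.numOp_mul_countProj]

/-- An operator that lowers the number operator by `c` maps the range of `P_l` to that of
`P_{l-c}`. -/
theorem CommIdem.countProj_mul_mul {p : Fin N → A} (hp : CommIdem p) {B : A} {c : ℕ}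
    (hB : numOp p * B + (c : ℂ) • B = B * numOp p) {k l : ℕ} (hkl : k + c ≠ l) :
    countProj p k * B * countProj p l = 0 := by
  -- Between P_k and P_l the number operator becomes a number on either side, and the relation reads
  -- (k + c - l) P_k B P_l = 0.
  have h := congrArg (fun X => countProj p k * X * countProj p l) hB
  simp only [mul_add, add_mul] at h
  rw [← mul_assoc, hp.countProj_mul_numOp, mul_assoc (countProj p k) (B * numOp p), mul_assoc B,
    hp.numOp_mul_countProj, smul_mul_assoc, smul_mul_assoc, mul_smul_comm, smul_mul_assoc,
    mul_smul_comm, mul_smul_comm, ← mul_assoc, ← add_smul, ← sub_eq_zero, ← sub_smul] at h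
  refine (smul_eq_zero.1 h).resolve_left ?_
  rw [sub_eq_zero]
  exact_mod_cast hkl

/-- Inserting ∑ P_k = 1 on both sides, only the blocks P_k B P_l with l = k + c are nonzero, and on
these the two weights agree. -/
theorem CommIdem.mul_hatOp {p : Fin N → A} (hp : CommIdem p) {B : A} {c : ℕ}
    (hB : numOp p * B + (c : ℂ) • B = B * numOp p) (f : ℕ → ℝ) :
    B * hatOp p f = hatOp p (fun k => f (k + c)) * B := by
  have h1 : B * hatOp p f = ∑ k ∈ Finset.range (N + 1), ∑ l ∈ Finset.range (N + 1),
      (f l : ℂ) • (countProj p k * B * countProj p l) := by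
    rw [hatOp, Finset.mul_sum]
    conv_lhs => rw [← one_mul (∑ _ ∈ _, _), ← sum_countProj p, Finset.sum_mul]
    refine Finset.sum_congr rfl fun k _ => ?_
    rw [Finset.mul_sum]
    refine Finset.sum_congr rfl fun l _ => ?_
    rw [mul_smul_comm, mul_smul_comm, mul_assoc]
  have h2 : hatOp p (fun k => f (k + c)) * B
      = ∑ k ∈ Finset.range (N + 1), ∑ l ∈ Finset.range (N + 1),
        (f (k + c) : ℂ) • (countProj p k * B * countProj p l) := by
    rw [hatOp, Finset.sum_mul]
    refine Finset.sum_congr rfl fun k _ => ?_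
    rw [← Finset.smul_sum, ← Finset.mul_sum, sum_countProj, mul_one, smul_mul_assoc]
  rw [h1, h2]
  refine Finset.sum_congr rfl fun k _ => Finset.sum_congr rfl fun l _ => ?_
  by_cases hkl : k + c = l
  · rw [hkl]
  · rw [hp.countProj_mul_mul hB hkl, smul_zero, smul_zero]

theorem CommIdem.countProj_mul_countProj {p : Fin N → A} (hp : CommIdem p) {k l : ℕ}
    (hkl : k ≠ l) : countProj p k * countProj p l = 0 := by
  have := hp.countProj_mul_mul (B := 1) (c := 0) (by simp) (k := k) (l := l) (by simpa using hkl)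
  simpa using this

theorem CommIdem.countProj_mul_self {p : Fin N → A} (hp : CommIdem p) {k : ℕ}
    (hk : k ∈ Finset.range (N + 1)) : countProj p k * countProj p k = countProj p k := by
  conv_rhs => rw [← mul_one (countProj p k), ← sum_countProj p, Finset.mul_sum]
  rw [Finset.sum_eq_single_of_mem k hk fun l _ hlk => hp.countProj_mul_countProj hlk.symm]

theorem CommIdem.hatOp_mul_hatOp {p : Fin N → A} (hp : CommIdem p) (f g : ℕ → ℝ) :
    hatOp p f * hatOp p g = hatOp p fun k => f k * g k := by
  simp only [hatOp]
  rw [Finset.sum_mul]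
  refine Finset.sum_congr rfl fun k hk => ?_
  rw [Finset.mul_sum, Finset.sum_eq_single_of_mem k hk]
  · rw [smul_mul_smul_comm, hp.countProj_mul_self hk, Complex.ofReal_mul]
  · intro l _ hlk
    rw [smul_mul_smul_comm, hp.countProj_mul_countProj hlk.symm, smul_zero]

theorem CommIdem.numOp_eq_hatOp {p : Fin N → A} (hp : CommIdem p) :
    numOp p = hatOp p fun k => k := by
  conv_lhs => rw [← mul_one (numOp p), ← sum_countProj p, Finset.mul_sum]
  refine Finset.sum_congr rfl fun k _ => ?_
  rw [hp.numOp_mul_countProj, Complex.ofReal_natCast]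

theorem hatOp_one (p : Fin N → A) : hatOp p (fun _ => 1) = 1 := by
  simp [hatOp, sum_countProj]

theorem hatOp_sub (p : Fin N → A) (f g : ℕ → ℝ) :
    hatOp p f - hatOp p g = hatOp p fun k => f k - g k := by
  simp [hatOp, ← Finset.sum_sub_distrib, sub_smul]

variable [StarRing A] [StarModule ℂ A]

/-- Taking adjoints of the products would reverse their order. Instead, the columns of P_k^* are
eigenvectors of the self-adjoint number operator with eigenvalue k, so P_l P_k^* = 0 for l ≠ k.
Hence P_k^* = P_k P_k^*, which is self-adjoint. -/
theorem CommIdem.star_countProj {p : Fin N → A} (hp : CommIdem p) (hs : ∀ m, star (p m) = p m)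
    {k : ℕ} (hk : k ∈ Finset.range (N + 1)) : star (countProj p k) = countProj p k := by
  have hn : star (numOp p) = numOp p := by simp [numOp, hs]
  have h1 : ∀ l, l ≠ k → countProj p l * star (countProj p k) = 0 := fun l hl => by
    have h2 : numOp p * star (countProj p k) = (k : ℂ) • star (countProj p k) := by
      have := congrArg star (hp.countProj_mul_numOp k)
      rw [star_mul, hn, star_smul] at this
      simpa using this
    have h3 : (l : ℂ) • (countProj p l * star (countProj p k))
        = (k : ℂ) • (countProj p l * star (countProj p k)) := by
      rw [← smul_mul_assoc, ← hp.countProj_mul_numOp, mul_assoc, h2, mul_smul_comm]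
    rw [← sub_eq_zero, ← sub_smul] at h3
    refine (smul_eq_zero.1 h3).resolve_left ?_
    rw [sub_eq_zero]
    exact_mod_cast hl
  have h4 : star (countProj p k) = countProj p k * star (countProj p k) := by
    conv_lhs => rw [← one_mul (star _), ← sum_countProj p, Finset.sum_mul]
    exact Finset.sum_eq_single_of_mem k hk fun l _ hl => h1 l hl
  have h5 := congrArg star h4
  rw [star_star, star_mul, star_star, ← h4] at h5
  exact h5.symm

theorem CommIdem.star_hatOp {p : Fin N → A} (hp : CommIdem p) (hs : ∀ m, star (p m) = p m)
    (f : ℕ → ℝ) : star (hatOp p f) = hatOp p f := by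
  rw [hatOp, star_sum]
  refine Finset.sum_congr rfl fun k hk => ?_
  rw [star_smul, hp.star_countProj hs hk]
  simp

end Counting

/-! ### The projections onto the orbitals -/

section OrbProj

variable {N : ℕ}

/-- The operator `p_m = ∑_j |φ_j⟩⟨φ_j|_m`. -/
def orbProj (φ : Fin N → OneBody) (m : Fin N) : ManyBody N →L[ℂ] ManyBody N :=
  ∑ j, rankOne m (φ j) (φ j)

theorem coeFn_sum {α ι : Type*} [MeasurableSpace α] {μ : Measure α} (s : Finset ι)
    (f : ι → Lp ℂ 2 μ) : (∑ j ∈ s, f j : Lp ℂ 2 μ) =ᵐ[μ] fun x => ∑ j ∈ s, f j x := by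
  classical
  induction s using Finset.induction_on with
  | empty =>
    simp only [Finset.sum_empty]
    exact Lp.coeFn_zero ℂ 2 μ
  | insert a s ha ih =>
    rw [Finset.sum_insert ha]
    filter_upwards [ih, Lp.coeFn_add (f a) (∑ j ∈ s, f j)] with x h1 h2
    rw [h2, Pi.add_apply, h1, Finset.sum_insert ha]

theorem coeFn_orbProj (φ : Fin N → OneBody) (m : Fin N) (ψ : ManyBody N) :
    orbProj φ m ψ =ᵐ[volume] fun x => ∑ j, φ j (x m) * contract (φ j) m ψ x := by
  have h : orbProj φ m ψ = ∑ j, rankOne m (φ j) (φ j) ψ := by simp [orbProj, _root_.sum_apply]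
  rw [h]
  have h2 : ∀ᵐ x : Fin N → R3, ∀ j, rankOne m (φ j) (φ j) ψ x = φ j (x m) * contract (φ j) m ψ x :=
    ae_all_iff.2 fun j => coeFn_rankOne m (φ j) (φ j) ψ
  filter_upwards [coeFn_sum Finset.univ fun j => rankOne m (φ j) (φ j) ψ, h2] with x h3 h4
  rw [h3]
  simp_rw [h4]

theorem projP_ae_eq (φ : Fin N → OneBody) (m : Fin N) {g : (Fin N → R3) → ℂ} {ψ : ManyBody N}
    (h : g =ᵐ[volume] ψ) : projP φ m g =ᵐ[volume] orbProj φ m ψ := by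
  have h2 : ∀ᵐ x : Fin N → R3, ∀ j, contract (φ j) m g x = contract (φ j) m ψ x :=
    ae_all_iff.2 fun j => contract_congr (φ j) m h
  filter_upwards [coeFn_orbProj φ m ψ, h2] with x h3 h4
  rw [h3]
  simp_rw [← h4]
  rfl

theorem projQ_ae_eq (φ : Fin N → OneBody) (m : Fin N) {g : (Fin N → R3) → ℂ} {ψ : ManyBody N}
    (h : g =ᵐ[volume] ψ) :
    projQ φ m g =ᵐ[volume] (1 - orbProj φ m : ManyBody N →L[ℂ] ManyBody N) ψ := by
  rw [sub_apply, one_apply_eq_self]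
  filter_upwards [projP_ae_eq φ m h, h, Lp.coeFn_sub ψ (orbProj φ m ψ)] with x h1 h2 h3
  rw [h3, projQ, h1, h2, Pi.sub_apply]

theorem projProd_ae_eq (φ : Fin N → OneBody) (S : Finset (Fin N)) (ψ : ManyBody N) :
    projProd φ S (fun z => ψ z) =ᵐ[volume] projList (orbProj φ) S ψ := by
  unfold projProd projList
  induction List.finRange N with
  | nil => simp [one_apply_eq_self]
  | cons m l ih =>
    rw [List.foldr_cons, List.map_cons, List.prod_cons, mul_apply_eq_comp, projFactor]
    split_ifs
    · exact projQ_ae_eq φ m ih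
    · exact projP_ae_eq φ m ih

/-- The bridge from the functional, defined by iterated integrals of representatives, to bounded
operators on L². Each projection respects almost everywhere equality, so the product of pointwise
projections represents the product of operators. -/
theorem countingFunctional_eq (f : ℕ → ℝ) (ψ : ManyBody N) (φ : Fin N → OneBody) :
    countingFunctional f ψ φ = (⟪ψ, hatOp (orbProj φ) f ψ⟫_ℂ).re := by
  have hk : ∀ k, projPNk φ k (fun z => ψ z) =ᵐ[volume] countProj (orbProj φ) k ψ := fun k => by
    have h1 : ∀ᵐ x : Fin N → R3, ∀ S, projProd φ S (fun z => ψ z) x = projList (orbProj φ) S ψ x :=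
      ae_all_iff.2 fun S => projProd_ae_eq φ S ψ
    rw [countProj, _root_.sum_apply]
    filter_upwards [h1, coeFn_sum (Finset.powersetCard k Finset.univ)
      fun S => projList (orbProj φ) S ψ] with x h2 h3
    rw [h3, projPNk]
    exact Finset.sum_congr rfl fun S _ => h2 S
  rw [countingFunctional, hatOp, _root_.sum_apply, inner_sum, Complex.re_sum]
  refine Finset.sum_congr rfl fun k _ => ?_
  rw [_root_.smul_apply, inner_smul_right, Complex.re_ofReal_mul, L2_inner_eq]
  congr 2
  refine integral_congr_ae ?_
  filter_upwards [hk k] with x hx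
  rw [hx]

theorem adjoint_orbProj (φ : Fin N → OneBody) (m : Fin N) :
    ContinuousLinearMap.adjoint (orbProj φ m) = orbProj φ m := by
  rw [orbProj, map_sum]
  exact Finset.sum_congr rfl fun j _ => adjoint_rankOne m _ _

theorem Orthonormal.rankOne_mul_orbProj {φ : Fin N → OneBody} (hφ : Orthonormal ℂ φ) (m j : Fin N)
    (g : OneBody) : rankOne m g (φ j) * orbProj φ m = rankOne m g (φ j) := by
  rw [orbProj, Finset.mul_sum, Finset.sum_eq_single_of_mem j (Finset.mem_univ j)]
  · rw [rankOne_mul_rankOne, inner_self_eq_norm_sq_to_K, hφ.1]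
    simp
  · intro k _ hkj
    rw [rankOne_mul_rankOne, hφ.2 hkj.symm, zero_smul]

theorem commute_orbProj_rankOne (φ : Fin N → OneBody) {m l : Fin N} (hml : m ≠ l) (f g : OneBody) :
    Commute (orbProj φ m) (rankOne l f g) :=
  Commute.sum_left _ _ _ fun j _ => rankOne_commute hml _ _ _ _

theorem commIdem_orbProj {φ : Fin N → OneBody} (hφ : Orthonormal ℂ φ) : CommIdem (orbProj φ) where
  comm i j := by
    by_cases h : i = j
    · exact h ▸ Commute.refl _
    · exact Commute.sum_right _ _ _ fun k _ => commute_orbProj_rankOne φ h _ _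
  idem i := by
    conv_lhs => rw [orbProj, Finset.sum_mul]
    exact Finset.sum_congr rfl fun j _ => hφ.rankOne_mul_orbProj i j _

theorem mulOp_commute_orbProj (φ : Fin N → OneBody) {h : (Fin N → R3) → ℂ} (hh : BddMeas h)
    (m : Fin N) (hm : ∀ x y, h (Function.update x m y) = h x) :
    Commute (mulOp volume h) (orbProj φ m) :=
  Commute.sum_right _ _ _ fun _ _ => mulOp_commute_rankOne hh m hm _ _

theorem permute_mul_orbProj (φ : Fin N → OneBody) (σ : Equiv.Perm (Fin N)) (m : Fin N) :
    permute σ * orbProj φ m = orbProj φ (σ m) * permute σ := by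
  simp_rw [orbProj, Finset.mul_sum, Finset.sum_mul, permute_mul_rankOne]

theorem permute_commute_numOp (φ : Fin N → OneBody) (σ : Equiv.Perm (Fin N)) :
    Commute (permute σ) (numOp (orbProj φ)) := by
  rw [commute_iff_eq, numOp, Finset.mul_sum, Finset.sum_mul]
  simp_rw [mul_sub, sub_mul, mul_one, one_mul, permute_mul_orbProj]
  exact Equiv.sum_comp σ fun m => permute σ - orbProj φ m * permute σ

theorem AntisymmOn.orbProj_apply {S : Finset (Fin N)} {χ : ManyBody N} (h : AntisymmOn S χ)
    (φ : Fin N → OneBody) {m : Fin N} (hm : m ∉ S) : AntisymmOn S (orbProj φ m χ) := by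
  refine h.apply fun i hi j hj hij => ?_
  rw [commute_iff_eq, permute_mul_orbProj, Equiv.swap_apply_of_ne_of_ne]
  · rintro rfl; exact hm hi
  · rintro rfl; exact hm hj

theorem AntisymmOn.one_sub_orbProj_apply {S : Finset (Fin N)} {χ : ManyBody N} (h : AntisymmOn S χ)
    (φ : Fin N → OneBody) {m : Fin N} (hm : m ∉ S) :
    AntisymmOn S ((1 - orbProj φ m : ManyBody N →L[ℂ] ManyBody N) χ) := by
  refine h.apply fun i hi j hj hij => (Commute.one_right _).sub_right ?_
  rw [commute_iff_eq, permute_mul_orbProj, Equiv.swap_apply_of_ne_of_ne]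
  · rintro rfl; exact hm hi
  · rintro rfl; exact hm hj

theorem AntisymmOn.hatOp_apply {S : Finset (Fin N)} {χ : ManyBody N} (h : AntisymmOn S χ)
    {φ : Fin N → OneBody} (hφ : Orthonormal ℂ φ) (f : ℕ → ℝ) :
    AntisymmOn S (hatOp (orbProj φ) f χ) := by
  refine h.apply fun i hi j hj hij => ?_
  have h1 := (commIdem_orbProj hφ).mul_hatOp (B := permute (Equiv.swap i j)) (c := 0)
    (by rw [Nat.cast_zero, zero_smul, add_zero, (permute_commute_numOp φ _).eq]) f
  exact h1

/-! ### Expectation values of functions of the number operator -/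

/-- The expectation value of `f` of the number operator. -/
def expect (φ : Fin N → OneBody) (Ψ : ManyBody N) (f : ℕ → ℝ) : ℝ :=
  (⟪Ψ, hatOp (orbProj φ) f Ψ⟫_ℂ).re

theorem star_orbProj (φ : Fin N → OneBody) (m : Fin N) : star (orbProj φ m) = orbProj φ m :=
  adjoint_orbProj φ m

theorem adjoint_hatOp {φ : Fin N → OneBody} (hφ : Orthonormal ℂ φ) (f : ℕ → ℝ) :
    ContinuousLinearMap.adjoint (hatOp (orbProj φ) f) = hatOp (orbProj φ) f :=
  (commIdem_orbProj hφ).star_hatOp (star_orbProj φ) f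

/-- The P_k are orthogonal projections, so the expectation is an average of f with nonnegative
weights. Monotonicity in f, and hence every later comparison of weights, rests on this. -/
theorem expect_eq_sum {φ : Fin N → OneBody} (hφ : Orthonormal ℂ φ) (Ψ : ManyBody N) (f : ℕ → ℝ) :
    expect φ Ψ f = ∑ k ∈ Finset.range (N + 1), f k * ‖countProj (orbProj φ) k Ψ‖ ^ 2 := by
  rw [expect, hatOp, _root_.sum_apply, inner_sum, Complex.re_sum]
  refine Finset.sum_congr rfl fun k hk => ?_
  rw [_root_.smul_apply, inner_smul_right, Complex.re_ofReal_mul,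
    ← inner_self_eq_norm_sq (𝕜 := ℂ), ← ContinuousLinearMap.adjoint_inner_right]
  have h1 : ContinuousLinearMap.adjoint (countProj (orbProj φ) k) = countProj (orbProj φ) k :=
    (commIdem_orbProj hφ).star_countProj (star_orbProj φ) hk
  rw [h1, ← mul_apply_eq_comp, (commIdem_orbProj hφ).countProj_mul_self hk]
  rfl

theorem expect_mono {φ : Fin N → OneBody} (hφ : Orthonormal ℂ φ) (Ψ : ManyBody N) {f g : ℕ → ℝ}
    (h : ∀ k ≤ N, f k ≤ g k) : expect φ Ψ f ≤ expect φ Ψ g := by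
  rw [expect_eq_sum hφ, expect_eq_sum hφ]
  refine Finset.sum_le_sum fun k hk => mul_le_mul_of_nonneg_right (h k ?_) (by positivity)
  simpa [Nat.lt_succ_iff] using hk

theorem expect_const_mul (φ : Fin N → OneBody) (Ψ : ManyBody N) (c : ℝ) (f : ℕ → ℝ) :
    expect φ Ψ (fun k => c * f k) = c * expect φ Ψ f := by
  have : hatOp (orbProj φ) (fun k => c * f k) = (c : ℂ) • hatOp (orbProj φ) f := by
    simp only [hatOp, Finset.smul_sum, Complex.ofReal_mul, mul_smul]
  rw [expect, this, _root_.smul_apply, inner_smul_right, Complex.re_ofReal_mul, expect]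

theorem expect_one (φ : Fin N → OneBody) (Ψ : ManyBody N) :
    expect φ Ψ (fun _ => 1) = ‖Ψ‖ ^ 2 := by
  rw [expect, hatOp_one, one_apply_eq_self, ← inner_self_eq_norm_sq (𝕜 := ℂ)]
  rfl

theorem expect_nonneg {φ : Fin N → OneBody} (hφ : Orthonormal ℂ φ) (Ψ : ManyBody N) {f : ℕ → ℝ}
    (h : ∀ k, 0 ≤ f k) : 0 ≤ expect φ Ψ f := by
  rw [expect_eq_sum hφ]
  exact Finset.sum_nonneg fun k _ => mul_nonneg (h k) (by positivity)

theorem inner_hatOp_mul_hatOp {φ : Fin N → OneBody} (hφ : Orthonormal ℂ φ) (Ψ : ManyBody N)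
    (s f : ℕ → ℝ) : (⟪hatOp (orbProj φ) s Ψ, hatOp (orbProj φ) f (hatOp (orbProj φ) s Ψ)⟫_ℂ).re
      = expect φ Ψ fun k => f k * s k ^ 2 := by
  rw [← ContinuousLinearMap.adjoint_inner_right, adjoint_hatOp hφ, ← mul_apply_eq_comp,
    ← mul_apply_eq_comp, (commIdem_orbProj hφ).hatOp_mul_hatOp,
    (commIdem_orbProj hφ).hatOp_mul_hatOp, expect]
  congr 4
  funext k
  ring

theorem norm_hatOp_sq {φ : Fin N → OneBody} (hφ : Orthonormal ℂ φ) (Ψ : ManyBody N) (s : ℕ → ℝ) :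
    ‖hatOp (orbProj φ) s Ψ‖ ^ 2 = expect φ Ψ fun k => s k ^ 2 := by
  have := inner_hatOp_mul_hatOp hφ Ψ s (fun _ => 1)
  simp only [one_mul] at this
  rw [← this, hatOp_one, one_apply_eq_self, ← inner_self_eq_norm_sq (𝕜 := ℂ)]
  rfl

theorem norm_one_sub_orbProj_sq {φ : Fin N → OneBody} (hφ : Orthonormal ℂ φ) (χ : ManyBody N)
    (m : Fin N) : ‖(1 - orbProj φ m : ManyBody N →L[ℂ] ManyBody N) χ‖ ^ 2
      = (⟪χ, (1 - orbProj φ m : ManyBody N →L[ℂ] ManyBody N) χ⟫_ℂ).re := by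
  have h1 : ContinuousLinearMap.adjoint (1 - orbProj φ m) = 1 - orbProj φ m := by
    rw [← ContinuousLinearMap.star_eq_adjoint, star_sub, star_one, star_orbProj]
  rw [← inner_self_eq_norm_sq (𝕜 := ℂ), ← ContinuousLinearMap.adjoint_inner_right, h1,
    ← mul_apply_eq_comp]
  rw [mul_sub, mul_one, sub_mul, (commIdem_orbProj hφ).idem, one_mul, sub_self, sub_zero]
  rfl

theorem sum_norm_one_sub_orbProj_sq {φ : Fin N → OneBody} (hφ : Orthonormal ℂ φ) (χ : ManyBody N) :
    ∑ m, ‖(1 - orbProj φ m : ManyBody N →L[ℂ] ManyBody N) χ‖ ^ 2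
      = (⟪χ, numOp (orbProj φ) χ⟫_ℂ).re := by
  simp_rw [norm_one_sub_orbProj_sq hφ]
  rw [numOp, _root_.sum_apply, inner_sum, Complex.re_sum]

theorem sum_norm_one_sub_orbProj_hatOp_sq {φ : Fin N → OneBody} (hφ : Orthonormal ℂ φ)
    (Ψ : ManyBody N) (s : ℕ → ℝ) :
    ∑ m, ‖(1 - orbProj φ m : ManyBody N →L[ℂ] ManyBody N) (hatOp (orbProj φ) s Ψ)‖ ^ 2
      = expect φ Ψ fun k => k * s k ^ 2 := by
  rw [sum_norm_one_sub_orbProj_sq hφ, (commIdem_orbProj hφ).numOp_eq_hatOp,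
    inner_hatOp_mul_hatOp hφ]

/-- Since q_i is a projection commuting with n, the i-th term is the expectation of n q_i; the sum
over i produces n². -/
theorem sum_norm_numOp_hatOp_sq {φ : Fin N → OneBody} (hφ : Orthonormal ℂ φ)
    (Ψ : ManyBody N) (s : ℕ → ℝ) :
    ∑ i, (⟪(1 - orbProj φ i : ManyBody N →L[ℂ] ManyBody N) (hatOp (orbProj φ) s Ψ),
      numOp (orbProj φ) ((1 - orbProj φ i : ManyBody N →L[ℂ] ManyBody N)
        (hatOp (orbProj φ) s Ψ))⟫_ℂ).re = expect φ Ψ fun k => (k : ℝ) ^ 2 * s k ^ 2 := by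
  set χ := hatOp (orbProj φ) s Ψ
  have hp := commIdem_orbProj hφ
  have h1 : ∀ i, ContinuousLinearMap.adjoint (1 - orbProj φ i) = 1 - orbProj φ i := fun i => by
    rw [← ContinuousLinearMap.star_eq_adjoint, star_sub, star_one, star_orbProj]
  have h2 : ∀ i, (1 - orbProj φ i) * (numOp (orbProj φ) * (1 - orbProj φ i))
      = numOp (orbProj φ) * (1 - orbProj φ i) := fun i => by
    have hc : Commute (1 - orbProj φ i) (numOp (orbProj φ)) :=
      Commute.sum_right _ _ _ fun j _ => (Commute.one_left _).sub_left
        ((Commute.one_right _).sub_right (hp.comm i j))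
    have hi : (1 - orbProj φ i) * (1 - orbProj φ i) = 1 - orbProj φ i := by
      rw [mul_sub, mul_one, sub_mul, hp.idem, one_mul, sub_self, sub_zero]
    rw [← mul_assoc, hc.eq, mul_assoc, hi]
  have h3 : ∀ i, ⟪(1 - orbProj φ i : ManyBody N →L[ℂ] ManyBody N) χ,
      numOp (orbProj φ) ((1 - orbProj φ i : ManyBody N →L[ℂ] ManyBody N) χ)⟫_ℂ
      = ⟪χ, (numOp (orbProj φ) * (1 - orbProj φ i)) χ⟫_ℂ := fun i => by
    rw [← ContinuousLinearMap.adjoint_inner_right, h1, ← h2 i]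
    rfl
  simp_rw [h3]
  rw [← Complex.re_sum, ← inner_sum, ← _root_.sum_apply, ← Finset.mul_sum]
  change (⟪χ, (numOp (orbProj φ) * numOp (orbProj φ)) χ⟫_ℂ).re = _
  rw [hp.numOp_eq_hatOp, hp.hatOp_mul_hatOp, inner_hatOp_mul_hatOp hφ]
  congr 1
  funext k
  ring

/-! ### Fermionic bounds for `p_m` -/

/-- The density `∑_j |φ_j|²` with values in `[0, ∞]`. -/
def edensity (φ : Fin N → OneBody) (y : R3) : ENNReal := ∑ j, ‖φ j y‖ₑ ^ 2

/-- The contraction bound with coefficients c_j = φ_j, for which ∑_j |c_j|² is the density. All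
bounds on the interaction reduce to this one through a suitable choice of κ and S. -/
theorem AntisymmOn.sum_lintegral_orbProj_le {S : Finset (Fin N)} {χ : ManyBody N}
    (hχ : AntisymmOn S χ) (hN : 0 < N) {φ : Fin N → OneBody} (hφ : Orthonormal ℂ φ)
    {κ : R3 → (Fin N → R3) → ENNReal} (hκ : Measurable (Function.uncurry κ))
    (hS : ∀ m ∈ S, ∀ y x z, κ y (Function.update x m z) = κ y x) :
    ∑ m ∈ S, ∫⁻ x, κ (x m) x * ‖orbProj φ m χ x‖ₑ ^ 2
      ≤ ∫⁻ x, (∫⁻ y, κ y x * edensity φ y) * ‖χ x‖ₑ ^ 2 := by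
  refine le_trans (le_of_eq ?_) (hχ.sum_lintegral_contract_le hN hφ
    (c := fun j y => φ j y) (fun j => (Lp.stronglyMeasurable (φ j)).measurable) hκ hS)
  refine Finset.sum_congr rfl fun m _ => lintegral_congr_ae ?_
  filter_upwards [coeFn_orbProj φ m χ] with x hx
  rw [hx]

end OrbProj

/-! ### Commutators with functions of the number operator -/

section Commutator

/-- The square root of the increment of `f` above `k`. -/
def upWeight (f : ℕ → ℝ) (c k : ℕ) : ℝ := √(f (k + c) - f k)

/-- The square root of the increment of `f` below `k`. -/
def downWeight (f : ℕ → ℝ) (c k : ℕ) : ℝ := if c ≤ k then √(f k - f (k - c)) else 0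

variable {A : Type*} [Ring A] [Algebra ℂ A] {N : ℕ} {p : Fin N → A}

/-- Pulling f(n) through B leaves the increment f(n+c) - f(n) in front of B. One of its two square
roots is pulled back through B, so that later both sides of an inner product carry a small weight.
-/
theorem CommIdem.lowering_commutator (hp : CommIdem p) {f : ℕ → ℝ} (hf : Monotone f) {B : A} {c : ℕ}
    (hB : numOp p * B + (c : ℂ) • B = B * numOp p) :
    B * hatOp p f - hatOp p f * B
      = hatOp p (upWeight f c) * B * hatOp p (downWeight f c) := by
  have h1 : (fun k => downWeight f c (k + c)) = upWeight f c := by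
    funext k; simp [downWeight, upWeight]
  rw [mul_assoc, hp.mul_hatOp hB (downWeight f c), h1, ← mul_assoc, hp.hatOp_mul_hatOp,
    hp.mul_hatOp hB f, ← sub_mul, hatOp_sub]
  congr 2
  funext k
  exact (Real.mul_self_sqrt (sub_nonneg.2 (hf (Nat.le_add_right k c)))).symm

variable [StarRing A] [StarModule ℂ A]

/-- The commutator of `W` with a function of the number operator, in terms of the parts of `W` that
lower the number operator by one and by two. -/
theorem CommIdem.commutator_eq (hp : CommIdem p) (hs : ∀ m, star (p m) = p m) {f : ℕ → ℝ}
    (hf : Monotone f) {W B₁ B₂ : A}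
    (h1 : numOp p * B₁ + ((1 : ℕ) : ℂ) • B₁ = B₁ * numOp p)
    (h2 : numOp p * B₂ + ((2 : ℕ) : ℂ) • B₂ = B₂ * numOp p)
    (hW : numOp p * W - W * numOp p = star B₁ + (2 : ℂ) • star B₂ - (B₁ + (2 : ℂ) • B₂)) :
    W * hatOp p f - hatOp p f * W
      = (hatOp p (upWeight f 1) * B₁ * hatOp p (downWeight f 1)
        + hatOp p (upWeight f 2) * B₂ * hatOp p (downWeight f 2))
        - star (hatOp p (upWeight f 1) * B₁ * hatOp p (downWeight f 1)
          + hatOp p (upWeight f 2) * B₂ * hatOp p (downWeight f 2)) := by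
  have hn : star (numOp p) = numOp p := by simp [numOp, hs]
  have hfs : star (hatOp p f) = hatOp p f := hp.star_hatOp hs f
  have s1 := congrArg star h1
  have s2 := congrArg star h2
  simp only [star_add, star_mul, star_smul, hn, Nat.cast_one, one_smul,
    Nat.cast_ofNat, star_ofNat] at s1 s2
  -- The part of W left after subtracting the lowering parts and their adjoints commutes with n,
  -- hence with every function of n, and disappears from the commutator.
  set D := W - B₁ - star B₁ - B₂ - star B₂ with hDdef
  have hD : numOp p * D + ((0 : ℕ) : ℂ) • D = D * numOp p := by
    rw [Nat.cast_zero, zero_smul, add_zero, ← sub_eq_zero]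
    simp only [Nat.cast_one, one_smul, Nat.cast_ofNat] at h1 h2
    have e : numOp p * D - D * numOp p = (numOp p * W - W * numOp p)
        - (numOp p * B₁ - B₁ * numOp p) - (numOp p * star B₁ - star B₁ * numOp p)
        - (numOp p * B₂ - B₂ * numOp p) - (numOp p * star B₂ - star B₂ * numOp p) := by
      rw [hDdef]; noncomm_ring
    rw [e, hW, ← h1, ← h2, ← s1, ← s2]
    noncomm_ring
  have hDf : D * hatOp p f = hatOp p f * D := by
    have := hp.mul_hatOp hD f
    simpa using this
  rw [← hp.lowering_commutator hf h1, ← hp.lowering_commutator hf h2]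
  simp only [star_add, star_sub, star_mul, hfs]
  have hWD : W = D + B₁ + star B₁ + B₂ + star B₂ := by rw [hDdef]; abel
  rw [hWD, ← sub_eq_zero]
  have e : (D + B₁ + star B₁ + B₂ + star B₂) * hatOp p f
      - hatOp p f * (D + B₁ + star B₁ + B₂ + star B₂)
      - (B₁ * hatOp p f - hatOp p f * B₁ + (B₂ * hatOp p f - hatOp p f * B₂)
        - (hatOp p f * star B₁ - star B₁ * hatOp p f
          + (hatOp p f * star B₂ - star B₂ * hatOp p f)))
      = D * hatOp p f - hatOp p f * D := by noncomm_ring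
  rw [e, hDf, sub_self]

end Commutator

/-! ### Decomposition of pair interactions -/

section Pair

variable {A : Type*} [Ring A] [Algebra ℂ A] {N : ℕ}

/-- The part of a pair operator `B` in which `i` goes from `q` to `p` and `j` stays. -/
def lowerOne (p : Fin N → A) (B : A) (i j : Fin N) : A :=
  p i * p j * B * ((1 - p i) * p j) + p i * (1 - p j) * B * ((1 - p i) * (1 - p j))

/-- The part of a pair operator `B` in which both particles go from `q` to `p`. -/
def lowerTwo (p : Fin N → A) (B : A) (i j : Fin N) : A :=
  p i * p j * B * ((1 - p i) * (1 - p j))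

variable {p : Fin N → A}

/-- The number operator splits into the part n₀ seen by X and Y, with eigenvalues a on the left and
b on the right, and a rest R that commutes with everything. So X B Y lowers it by b - a. -/
theorem lowering_of_eigen {X B Y n₀ R : A} {a b : ℂ} (hX : n₀ * X = a • X)
    (hY : Y * n₀ = b • Y) (hR : Commute R (X * B * Y)) :
    (n₀ + R) * (X * B * Y) + (b - a) • (X * B * Y) = (X * B * Y) * (n₀ + R) := by
  have h1 : n₀ * (X * B * Y) = a • (X * B * Y) := by
    rw [mul_assoc, ← mul_assoc, hX, smul_mul_assoc]
  have h2 : X * B * Y * n₀ = b • (X * B * Y) := by rw [mul_assoc, hY, mul_smul_comm]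
  rw [add_mul, mul_add, h1, h2, hR.eq, sub_smul]
  abel

theorem CommIdem.mul_one_sub (hp : CommIdem p) (i : Fin N) : p i * (1 - p i) = 0 := by
  rw [mul_sub, mul_one, hp.idem, sub_self]

theorem CommIdem.one_sub_mul (hp : CommIdem p) (i : Fin N) : (1 - p i) * p i = 0 := by
  rw [sub_mul, one_mul, hp.idem, sub_self]

theorem CommIdem.one_sub_idem (hp : CommIdem p) (i : Fin N) :
    (1 - p i) * (1 - p i) = 1 - p i := by
  rw [mul_sub, mul_one, hp.one_sub_mul, sub_zero]

theorem CommIdem.comm_one_sub (hp : CommIdem p) (i j : Fin N) : Commute (p i) (1 - p j) :=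
  (Commute.one_right _).sub_right (hp.comm i j)

theorem CommIdem.one_sub_comm (hp : CommIdem p) (i j : Fin N) : Commute (1 - p i) (1 - p j) :=
  (Commute.one_left _).sub_left (hp.comm_one_sub i j)

theorem numOp_eq_pair_add (p : Fin N → A) {i j : Fin N} (hij : i ≠ j) :
    numOp p = ((1 - p i) + (1 - p j)) + ∑ l ∈ (Finset.univ.erase i).erase j, (1 - p l) := by
  rw [numOp, ← Finset.add_sum_erase _ _ (Finset.mem_univ i),
    ← Finset.add_sum_erase _ _ (Finset.mem_erase.2 ⟨hij.symm, Finset.mem_univ j⟩), add_assoc]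

theorem commute_pair_rest {i j : Fin N} {B : A}
    (hB : ∀ l, l ≠ i → l ≠ j → Commute B (p l)) {X Y : A}
    (hX : ∀ l, Commute X (p l)) (hY : ∀ l, Commute Y (p l)) :
    Commute (∑ l ∈ (Finset.univ.erase i).erase j, (1 - p l)) (X * B * Y) := by
  refine Commute.sum_left _ _ _ fun l hl => (Commute.one_left _).sub_left ?_
  have hlj := (Finset.mem_erase.1 hl).1
  have hli := (Finset.mem_erase.1 (Finset.mem_erase.1 hl).2).1
  exact (((hX l).mul_left (hB l hli hlj)).mul_left (hY l)).symm

theorem CommIdem.comm_mul_left (hp : CommIdem p) (i j l : Fin N) :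
    Commute (p i * p j) (p l) ∧ Commute (p i * (1 - p j)) (p l) ∧
      Commute ((1 - p i) * p j) (p l) ∧ Commute ((1 - p i) * (1 - p j)) (p l) :=
  ⟨(hp.comm i l).mul_left (hp.comm j l), (hp.comm i l).mul_left (hp.comm_one_sub l j).symm,
    (hp.comm_one_sub l i).symm.mul_left (hp.comm j l),
    (hp.comm_one_sub l i).symm.mul_left (hp.comm_one_sub l j).symm⟩

theorem CommIdem.lowering_lowerTwo (hp : CommIdem p) {i j : Fin N} (hij : i ≠ j) {B : A}
    (hB : ∀ l, l ≠ i → l ≠ j → Commute B (p l)) :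
    numOp p * lowerTwo p B i j + ((2 : ℕ) : ℂ) • lowerTwo p B i j
      = lowerTwo p B i j * numOp p := by
  have h := lowering_of_eigen (X := p i * p j) (B := B) (Y := (1 - p i) * (1 - p j))
    (n₀ := (1 - p i) + (1 - p j)) (a := 0) (b := 2) ?_ ?_
    (commute_pair_rest hB (fun l => (hp.comm_mul_left i j l).1)
      fun l => (hp.comm_mul_left i j l).2.2.2)
  · rw [numOp_eq_pair_add p hij]
    simpa [lowerTwo] using h
  · rw [add_mul, ← mul_assoc, hp.one_sub_mul, zero_mul, (hp.comm i j).eq, ← mul_assoc,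
      hp.one_sub_mul, zero_mul, add_zero, zero_smul]
  · rw [mul_add, mul_assoc _ _ (1 - p j), hp.one_sub_idem, (hp.one_sub_comm i j).eq, mul_assoc,
      hp.one_sub_idem, two_smul]

/-- The first summand takes the pair from one excitation to none, the second from two to one. -/
theorem CommIdem.lowering_lowerOne (hp : CommIdem p) {i j : Fin N} (hij : i ≠ j) {B : A}
    (hB : ∀ l, l ≠ i → l ≠ j → Commute B (p l)) :
    numOp p * lowerOne p B i j + ((1 : ℕ) : ℂ) • lowerOne p B i j
      = lowerOne p B i j * numOp p := by
  have h1 := lowering_of_eigen (X := p i * p j) (B := B) (Y := (1 - p i) * p j)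
    (n₀ := (1 - p i) + (1 - p j)) (a := 0) (b := 1) ?_ ?_
    (commute_pair_rest hB (fun l => (hp.comm_mul_left i j l).1)
      fun l => (hp.comm_mul_left i j l).2.2.1)
  · have h2 := lowering_of_eigen (X := p i * (1 - p j)) (B := B) (Y := (1 - p i) * (1 - p j))
      (n₀ := (1 - p i) + (1 - p j)) (a := 1) (b := 2) ?_ ?_
      (commute_pair_rest hB (fun l => (hp.comm_mul_left i j l).2.1)
        fun l => (hp.comm_mul_left i j l).2.2.2)
    · rw [← numOp_eq_pair_add p hij] at h1 h2
      rw [lowerOne, mul_add, add_mul, ← h1, ← h2, sub_zero, Nat.cast_one,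
        show (2 : ℂ) - 1 = 1 by norm_num, smul_add]
      abel
    · rw [add_mul, ← mul_assoc, hp.one_sub_mul, zero_mul, zero_add,
        (hp.comm_one_sub i j).eq, ← mul_assoc, hp.one_sub_idem, one_smul]
    · rw [mul_add, mul_assoc _ _ (1 - p j), hp.one_sub_idem, (hp.one_sub_comm i j).eq, mul_assoc,
        hp.one_sub_idem, two_smul]
  · rw [add_mul, ← mul_assoc, hp.one_sub_mul, zero_mul, (hp.comm i j).eq, ← mul_assoc,
      hp.one_sub_mul, zero_mul, add_zero, zero_smul]
  · rw [mul_add, mul_assoc _ _ (1 - p j), hp.mul_one_sub, mul_zero, add_zero,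
      (hp.comm_one_sub j i).symm.eq, mul_assoc, hp.one_sub_idem, one_smul]

theorem CommIdem.lowering_single (hp : CommIdem p) {i : Fin N} {B : A}
    (hB : ∀ l, l ≠ i → Commute B (p l)) :
    numOp p * (p i * B * (1 - p i)) + ((1 : ℕ) : ℂ) • (p i * B * (1 - p i))
      = (p i * B * (1 - p i)) * numOp p := by
  have h := lowering_of_eigen (X := p i) (B := B) (Y := 1 - p i) (n₀ := 1 - p i) (a := 0) (b := 1)
    (R := ∑ l ∈ Finset.univ.erase i, (1 - p l)) (by rw [hp.one_sub_mul, zero_smul])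
    (by rw [hp.one_sub_idem, one_smul]) ?_
  · rw [Finset.add_sum_erase _ (fun l => 1 - p l) (Finset.mem_univ i), ← numOp, sub_zero] at h
    rwa [Nat.cast_one]
  · refine Commute.sum_left _ _ _ fun l hl => (Commute.one_left _).sub_left ?_
    exact ((hp.comm l i).mul_right (hB l (Finset.ne_of_mem_erase hl)).symm).mul_right
      (hp.comm_one_sub l i)

variable [StarRing A]

/-- The number operator may be replaced by q_i + q_j. The four products of p and q for the pair are
projections that add up to one, and q_i + q_j is a combination of them with coefficients 0, 1, 1, 2.
Expanding the commutator in these blocks, a block appears with the change of the number as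
coefficient, and the exchange of an excitation between i and j has coefficient zero. -/
theorem CommIdem.commutator_pair (hp : CommIdem p) (hs : ∀ m, star (p m) = p m) {i j : Fin N}
    (hij : i ≠ j) {B : A} (hBs : star B = B) (hB : ∀ l, l ≠ i → l ≠ j → Commute B (p l)) :
    numOp p * B - B * numOp p = star (lowerOne p B i j + lowerOne p B j i)
      + (2 : ℂ) • star (lowerTwo p B i j)
      - (lowerOne p B i j + lowerOne p B j i + (2 : ℂ) • lowerTwo p B i j) := by
  have hR : Commute (∑ l ∈ (Finset.univ.erase i).erase j, (1 - p l)) B := by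
    simpa using commute_pair_rest hB (X := 1) (Y := 1) (fun l => Commute.one_left _)
      fun l => Commute.one_left _
  rw [numOp_eq_pair_add p hij, add_mul, mul_add, hR.eq, add_sub_add_right_eq_sub]
  simp only [lowerOne, lowerTwo, star_add, star_mul, star_sub, star_one, hs, hBs, two_smul]
  have hc := (hp.comm i j).eq
  have h1 : (1 - p j) * (1 - p i) = (1 - p i) * (1 - p j) := (hp.one_sub_comm i j).eq.symm
  have h2 : (1 - p j) * p i = p i * (1 - p j) := (hp.comm_one_sub i j).eq.symm
  have h3 : p j * (1 - p i) = (1 - p i) * p j := (hp.comm_one_sub j i).eq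
  have h4 : p j * p i = p i * p j := hc.symm
  simp only [h1, h2, h3, h4]
  set Q := p i * (1 - p j)
  set Q' := (1 - p i) * p j
  set Z := p i * p j
  set X := (1 - p i) * (1 - p j)
  have e1 : Q + Q' + Z + X = 1 := by simp only [Q, Q', Z, X]; noncomm_ring
  have e2 : (1 - p i) + (1 - p j) = Q + Q' + X + X := by simp only [Q, Q', X]; noncomm_ring
  have e3 : Z = 1 - Q - Q' - X := by rw [← e1]; abel
  rw [e2, e3]
  noncomm_ring

theorem commutator_single (hs : ∀ m, star (p m) = p m) {i : Fin N}
    {B : A} (hBs : star B = B) (hB : ∀ l, l ≠ i → Commute B (p l)) :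
    numOp p * B - B * numOp p = star (p i * B * (1 - p i)) - p i * B * (1 - p i) := by
  have hR : Commute (∑ l ∈ Finset.univ.erase i, (1 - p l)) B :=
    Commute.sum_left _ _ _ fun l hl => (Commute.one_left _).sub_left
      (hB l (Finset.ne_of_mem_erase hl)).symm
  rw [numOp, ← Finset.add_sum_erase _ _ (Finset.mem_univ i), add_mul, mul_add, hR.eq,
    add_sub_add_right_eq_sub]
  simp only [star_mul, star_sub, star_one, hs, hBs]
  noncomm_ring

/-- The decomposition of a sum of pair and one-particle operators. -/
theorem CommIdem.commutator_sum [StarModule ℂ A] (hp : CommIdem p) (hs : ∀ m, star (p m) = p m)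
    {B : Fin N → Fin N → A} {V : Fin N → A} (hsymm : ∀ i j, B i j = B j i)
    (hBs : ∀ i j, star (B i j) = B i j) (hVs : ∀ i, star (V i) = V i)
    (hB : ∀ i j l, l ≠ i → l ≠ j → Commute (B i j) (p l))
    (hV : ∀ i l, l ≠ i → Commute (V i) (p l)) {f : ℕ → ℝ} (hf : Monotone f) :
    let W := (∑ i, ∑ j ∈ Finset.Ioi i, B i j) - ∑ i, V i
    let B₁ := (∑ i, ∑ j ∈ {i}ᶜ, lowerOne p (B i j) i j) - ∑ i, p i * V i * (1 - p i)
    let B₂ := ∑ i, ∑ j ∈ Finset.Ioi i, lowerTwo p (B i j) i j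
    W * hatOp p f - hatOp p f * W
      = (hatOp p (upWeight f 1) * B₁ * hatOp p (downWeight f 1)
        + hatOp p (upWeight f 2) * B₂ * hatOp p (downWeight f 2))
        - star (hatOp p (upWeight f 1) * B₁ * hatOp p (downWeight f 1)
          + hatOp p (upWeight f 2) * B₂ * hatOp p (downWeight f 2)) := by
  intro W B₁ B₂
  refine hp.commutator_eq hs hf ?_ ?_ ?_
  · simp only [B₁]
    rw [mul_sub (numOp p), sub_mul _ _ (numOp p), smul_sub]
    simp only [Finset.mul_sum, Finset.sum_mul, Finset.smul_sum]
    rw [sub_add_sub_comm, ← Finset.sum_add_distrib, ← Finset.sum_add_distrib]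
    simp_rw [← Finset.sum_add_distrib]
    congr 1
    · refine Finset.sum_congr rfl fun i _ => Finset.sum_congr rfl fun j hj => ?_
      exact hp.lowering_lowerOne (by simpa [eq_comm] using hj) (hB i j)
    · exact Finset.sum_congr rfl fun i _ => hp.lowering_single (hV i)
  · simp only [B₂, Finset.mul_sum, Finset.sum_mul, Finset.smul_sum, ← Finset.sum_add_distrib]
    refine Finset.sum_congr rfl fun i _ => Finset.sum_congr rfl fun j hj => ?_
    exact hp.lowering_lowerTwo (Finset.mem_Ioi.1 hj).ne (hB i j)
  -- In an unordered pair either particle may be the one that returns to p, so the sum for B₁ runs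
  -- over ordered pairs while that for B₂ does not.
  · have e1 : ∑ i, ∑ j ∈ {i}ᶜ, lowerOne p (B i j) i j
        = ∑ i, ∑ j ∈ Finset.Ioi i, (lowerOne p (B i j) i j + lowerOne p (B i j) j i) := by
      rw [← Finset.sum_sum_Ioi_add_eq_sum_sum_off_diag (fun j i => lowerOne p (B i j) i j)]
      refine Finset.sum_congr rfl fun i _ => Finset.sum_congr rfl fun j _ => ?_
      rw [hsymm j i]
    have e2 : numOp p * W - W * numOp p
        = (∑ i, ∑ j ∈ Finset.Ioi i, (numOp p * B i j - B i j * numOp p))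
          - ∑ i, (numOp p * V i - V i * numOp p) := by
      simp only [W, mul_sub, sub_mul, Finset.mul_sum, Finset.sum_mul, Finset.sum_sub_distrib]
      abel
    have e3 : ∀ i, ∀ j ∈ Finset.Ioi i, numOp p * B i j - B i j * numOp p = _ := fun i j hj =>
      hp.commutator_pair hs (Finset.mem_Ioi.1 hj).ne (hBs i j) (hB i j)
    rw [e2, Finset.sum_congr rfl fun i _ => Finset.sum_congr rfl (e3 i),
      Finset.sum_congr rfl fun i _ => commutator_single hs (hVs i) (hV i)]
    simp only [B₁, B₂, e1, star_sub, star_sum, star_add, Finset.sum_add_distrib,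
      Finset.sum_sub_distrib, Finset.smul_sum]
    abel

end Pair

/-! ### Bounds on the pair interaction -/

section PairEstimates

variable {N : ℕ}

/-- The interaction of the particles `i` and `j`. -/
def pairOp (v : R3 → ℝ) (i j : Fin N) : ManyBody N →L[ℂ] ManyBody N :=
  mulOp volume fun x => (v (x i - x j) : ℂ)

/-- Bounded even interactions with bounds on the convolutions with the density. -/
structure PairBounds (v : R3 → ℝ) (φ : Fin N → OneBody) (d₀ b₁ b₂ : ℝ) : Prop where
  meas : Measurable v
  bdd : ∃ C, ∀ x, |v x| ≤ C
  even : ∀ x, v (-x) = v x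
  d_nonneg : 0 ≤ d₀
  b₁_nonneg : 0 ≤ b₁
  b₂_nonneg : 0 ≤ b₂
  sup_abs : ∀ y, ∫⁻ x, ‖v (y - x)‖ₑ * edensity φ x ≤ ENNReal.ofReal d₀
  sup_sq : ∀ y, ∫⁻ x, ‖v (y - x)‖ₑ ^ 2 * edensity φ x ≤ ENNReal.ofReal b₁
  integral_sq : ∫⁻ y, (∫⁻ x, ‖v (y - x)‖ₑ ^ 2 * edensity φ x) * edensity φ y ≤ ENNReal.ofReal b₂

variable {v : R3 → ℝ} {φ : Fin N → OneBody} {d₀ b₁ b₂ : ℝ}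

theorem PairBounds.comm (h : PairBounds v φ d₀ b₁ b₂) (x y : R3) : v (x - y) = v (y - x) := by
  rw [← neg_sub, h.even]

theorem bddMeas_ofReal_comp {α : Type*} [MeasurableSpace α] (hm : Measurable v)
    (hb : ∃ C, ∀ x, |v x| ≤ C) {g : α → R3} (hg : Measurable g) :
    BddMeas fun x => (v (g x) : ℂ) :=
  ⟨Complex.measurable_ofReal.comp (hm.comp hg), hb.imp fun C hC x => by
    rw [Complex.norm_real]; exact hC _⟩

theorem measurable_coord_sub (i j : Fin N) : Measurable fun x : Fin N → R3 => x i - x j :=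
  (measurable_pi_apply i).sub (measurable_pi_apply j)

theorem PairBounds.bddMeas_pair (h : PairBounds v φ d₀ b₁ b₂) (i j : Fin N) :
    BddMeas fun x : Fin N → R3 => (v (x i - x j) : ℂ) :=
  bddMeas_ofReal_comp h.meas h.bdd (measurable_coord_sub i j)

theorem PairBounds.adjoint_pairOp (h : PairBounds v φ d₀ b₁ b₂) (i j : Fin N) :
    ContinuousLinearMap.adjoint (pairOp v i j) = pairOp v i j :=
  adjoint_mulOp_real (h.bddMeas_pair i j)

theorem PairBounds.pairOp_comm (h : PairBounds v φ d₀ b₁ b₂) (i j : Fin N) :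
    pairOp v i j = pairOp v j i := by
  unfold pairOp
  congr 1
  funext x
  rw [h.comm]

theorem PairBounds.pairOp_commute (h : PairBounds v φ d₀ b₁ b₂) {i j l : Fin N} (hi : l ≠ i)
    (hj : l ≠ j) : Commute (pairOp v i j) (orbProj φ l) :=
  mulOp_commute_orbProj φ (h.bddMeas_pair i j) l fun x y => by
    rw [Function.update_of_ne hi.symm, Function.update_of_ne hj.symm]

theorem enorm_ofReal_complex (r : ℝ) : ‖(r : ℂ)‖ₑ = ‖r‖ₑ := by
  rw [← ofReal_norm, ← ofReal_norm, Complex.norm_real]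

theorem measurable_edensity (φ : Fin N → OneBody) : Measurable (edensity φ) :=
  Finset.measurable_fun_sum _ fun j _ =>
    (Lp.stronglyMeasurable (φ j)).measurable.enorm.pow_const _

theorem PairBounds.enorm_pairOp_sq (h : PairBounds v φ d₀ b₁ b₂) (i j : Fin N) (χ : ManyBody N) :
    ‖pairOp v i j χ‖ₑ ^ 2 = ∫⁻ x, ‖v (x i - x j)‖ₑ ^ 2 * ‖χ x‖ₑ ^ 2 := by
  rw [pairOp, enorm_mulOp_sq (h.bddMeas_pair i j)]
  simp_rw [enorm_ofReal_complex]

theorem sum_norm_sq_le_of_enorm {ι E F : Type*} [NormedAddCommGroup E] [NormedAddCommGroup F]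
    {s : Finset ι} {a : ι → E} {b : F} {c : ℝ} (hc : 0 ≤ c)
    (h : ∑ i ∈ s, ‖a i‖ₑ ^ 2 ≤ ENNReal.ofReal c * ‖b‖ₑ ^ 2) :
    ∑ i ∈ s, ‖a i‖ ^ 2 ≤ c * ‖b‖ ^ 2 := by
  have h2 := ENNReal.toReal_mono (by finiteness) h
  rw [ENNReal.toReal_sum fun i _ => by finiteness] at h2
  simpa [ENNReal.toReal_ofReal hc] using h2

theorem norm_inner_le_weighted {E : Type*} [NormedAddCommGroup E] [InnerProductSpace ℂ E]
    (x y : E) {t : ℝ} (ht : 0 < t) : ‖⟪x, y⟫_ℂ‖ ≤ (t * ‖x‖ ^ 2 + t⁻¹ * ‖y‖ ^ 2) / 2 := by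
  refine (norm_inner_le_norm x y).trans ?_
  have h1 : t * t⁻¹ = 1 := mul_inv_cancel₀ ht.ne'
  have h2 : 0 ≤ t⁻¹ * (t * ‖x‖ - ‖y‖) ^ 2 := by positivity
  have h3 : t⁻¹ * (t * ‖x‖ - ‖y‖) ^ 2
      = (t * t⁻¹) * t * ‖x‖ ^ 2 - 2 * (t * t⁻¹) * ‖x‖ * ‖y‖ + t⁻¹ * ‖y‖ ^ 2 := by ring
  rw [h3, h1] at h2
  linarith

/-- For fixed j the weight v(y - x_j)² does not involve the variables other than x_j, so the
fermionic bound applies with S the complement of j, and its right side is v² ⋆ ρ at x_j. -/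
theorem PairBounds.sum_norm_pairOp_orbProj_sq_le (h : PairBounds v φ d₀ b₁ b₂) (hN : 0 < N)
    (hφ : Orthonormal ℂ φ) (j : Fin N) {χ : ManyBody N} (hχ : AntisymmOn {j}ᶜ χ) :
    ∑ i ∈ {j}ᶜ, ‖pairOp v i j (orbProj φ i χ)‖ ^ 2 ≤ b₁ * ‖χ‖ ^ 2 := by
  refine sum_norm_sq_le_of_enorm h.b₁_nonneg ?_
  simp_rw [h.enorm_pairOp_sq]
  have hκ : Measurable fun z : R3 × (Fin N → R3) => ‖v (z.1 - z.2 j)‖ₑ ^ 2 :=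
    (h.meas.comp (measurable_fst.sub ((measurable_pi_apply j).comp measurable_snd))).enorm.pow_const _
  refine (hχ.sum_lintegral_orbProj_le hN hφ (κ := fun y x => ‖v (y - x j)‖ₑ ^ 2) hκ
    fun m hm y x z => ?_).trans ?_
  · rw [Function.update_of_ne]
    rintro rfl; simp at hm
  · rw [Lp_enorm_sq, ← lintegral_const_mul _
      ((Lp.stronglyMeasurable χ).measurable.enorm.pow_const _)]
    refine lintegral_mono fun x => mul_le_mul_left ?_ _
    refine le_trans (le_of_eq (lintegral_congr fun y => ?_)) (h.sup_sq (x j))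
    rw [h.comm]

theorem sum_compl_comm {M : Type*} [AddCommMonoid M] (F : Fin N → Fin N → M) :
    ∑ i, ∑ j ∈ {i}ᶜ, F i j = ∑ j, ∑ i ∈ {j}ᶜ, F i j :=
  Finset.sum_comm' fun i j => by simp [eq_comm]

theorem inner_orbProj_left (φ : Fin N → OneBody) (m : Fin N) (χ χ' : ManyBody N) :
    ⟪orbProj φ m χ, χ'⟫_ℂ = ⟪χ, orbProj φ m χ'⟫_ℂ := by
  conv_lhs => rw [← adjoint_orbProj, ContinuousLinearMap.adjoint_inner_left]

theorem inner_one_sub_orbProj_left (φ : Fin N → OneBody) (m : Fin N) (χ χ' : ManyBody N) :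
    ⟪(1 - orbProj φ m : ManyBody N →L[ℂ] ManyBody N) χ, χ'⟫_ℂ
      = ⟪χ, (1 - orbProj φ m : ManyBody N →L[ℂ] ManyBody N) χ'⟫_ℂ := by
  rw [sub_apply, sub_apply, one_apply_eq_self, one_apply_eq_self, inner_sub_left, inner_sub_right,
    inner_orbProj_left]

theorem PairBounds.inner_pairOp_left (h : PairBounds v φ d₀ b₁ b₂) (i j : Fin N)
    (χ χ' : ManyBody N) : ⟪pairOp v i j χ, χ'⟫_ℂ = ⟪χ, pairOp v i j χ'⟫_ℂ := by
  conv_lhs => rw [← h.adjoint_pairOp, ContinuousLinearMap.adjoint_inner_left]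

/-- Adding the nonnegative terms with j = i completes the inner sum to the expectation of the number
operator in q_i χ. -/
theorem sum_sum_norm_qq_sq_le (hφ : Orthonormal ℂ φ) (χ : ManyBody N) :
    ∑ i, ∑ j ∈ {i}ᶜ, ‖((1 - orbProj φ i) * (1 - orbProj φ j) : ManyBody N →L[ℂ] ManyBody N) χ‖ ^ 2
      ≤ ∑ i, (⟪(1 - orbProj φ i : ManyBody N →L[ℂ] ManyBody N) χ,
        numOp (orbProj φ) ((1 - orbProj φ i : ManyBody N →L[ℂ] ManyBody N) χ)⟫_ℂ).re := by
  refine Finset.sum_le_sum fun i _ => ?_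
  rw [← sum_norm_one_sub_orbProj_sq hφ]
  refine le_trans (le_of_eq ?_) (Finset.sum_le_sum_of_subset_of_nonneg (Finset.subset_univ {i}ᶜ)
    fun _ _ _ => by positivity)
  refine Finset.sum_congr rfl fun j _ => ?_
  rw [((commIdem_orbProj hφ).one_sub_comm i j).eq, mul_apply_eq_comp]

/-- The terms with one transition between `p` and `q`, the other particle being in `q`. -/
theorem PairBounds.norm_sum_pq_qq_le (h : PairBounds v φ d₀ b₁ b₂) (hN : 0 < N)
    (hφ : Orthonormal ℂ φ) {χ χ' : ManyBody N} (hχ : AntisymmOn Finset.univ χ) {t : ℝ}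
    (ht : 0 < t) :
    ‖∑ i, ∑ j ∈ {i}ᶜ, ⟪χ, (orbProj φ i * (1 - orbProj φ j) * pairOp v i j *
        ((1 - orbProj φ i) * (1 - orbProj φ j))) χ'⟫_ℂ‖
      ≤ (t * (b₁ * ∑ j, ‖(1 - orbProj φ j : ManyBody N →L[ℂ] ManyBody N) χ‖ ^ 2)
        + t⁻¹ * ∑ i, (⟪(1 - orbProj φ i : ManyBody N →L[ℂ] ManyBody N) χ',
        numOp (orbProj φ) ((1 - orbProj φ i : ManyBody N →L[ℂ] ManyBody N) χ')⟫_ℂ).re) / 2 := by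
  have hp := commIdem_orbProj hφ
  have h1 : ∀ i j, ‖⟪χ, (orbProj φ i * (1 - orbProj φ j) * pairOp v i j *
        ((1 - orbProj φ i) * (1 - orbProj φ j))) χ'⟫_ℂ‖
      ≤ (t * ‖pairOp v i j (orbProj φ i ((1 - orbProj φ j : ManyBody N →L[ℂ] ManyBody N) χ))‖ ^ 2
        + t⁻¹ * ‖((1 - orbProj φ i) * (1 - orbProj φ j) : ManyBody N →L[ℂ] ManyBody N) χ'‖ ^ 2) / 2 := by
    intro i j
    refine le_trans (le_of_eq ?_) (norm_inner_le_weighted _ _ ht)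
    rw [h.inner_pairOp_left, inner_orbProj_left, inner_one_sub_orbProj_left, (hp.comm_one_sub i j).eq]
    simp only [mul_apply_eq_comp]
  refine (norm_sum_le _ _).trans ((Finset.sum_le_sum fun i _ => norm_sum_le _ _).trans
    ((Finset.sum_le_sum fun i _ => Finset.sum_le_sum fun j _ => h1 i j).trans ?_))
  simp_rw [← Finset.sum_div, Finset.sum_add_distrib, ← Finset.mul_sum]
  refine div_le_div_of_nonneg_right (add_le_add ?_ ?_) two_pos.le
  · refine mul_le_mul_of_nonneg_left ?_ ht.le
    -- The sum over i, for which the factor p_i is present, has to be done first, with j fixed.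
    rw [sum_compl_comm, Finset.mul_sum]
    refine Finset.sum_le_sum fun j _ => ?_
    exact h.sum_norm_pairOp_orbProj_sq_le hN hφ j
      ((hχ.mono (Finset.subset_univ _)).one_sub_orbProj_apply φ (by simp))
  · exact mul_le_mul_of_nonneg_left (sum_sum_norm_qq_sq_le hφ χ') (by positivity)

/-- Pointwise Cauchy-Schwarz inequality for two real multiplication operators. -/
theorem norm_inner_mulOp_mulOp_le {α : Type*} [MeasurableSpace α] {μ : Measure α} {a b : α → ℝ}
    (ha : BddMeas fun x => (a x : ℂ)) (hb : BddMeas fun x => (b x : ℂ)) (f g : Lp ℂ 2 μ) :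
    ‖⟪mulOp μ (fun x => (a x : ℂ)) f, mulOp μ (fun x => (b x : ℂ)) g⟫_ℂ‖
      ≤ (‖mulOp μ (fun x => ((√|a x * b x| : ℝ) : ℂ)) f‖ ^ 2
        + ‖mulOp μ (fun x => ((√|a x * b x| : ℝ) : ℂ)) g‖ ^ 2) / 2 := by
  have hab := ha.mul hb
  have hm : Measurable fun x => a x * b x := by
    have h0 : (fun x => a x * b x) = fun x => ((a x : ℂ) * (b x : ℂ)).re := by
      funext x
      simp [← Complex.ofReal_mul]
    rw [h0]
    exact Complex.measurable_re.comp hab.1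
  have hs : Measurable fun x => √|a x * b x| := (Real.continuous_sqrt.measurable.comp
    (continuous_abs.measurable.comp hm))
  obtain ⟨C, hC⟩ := hab.2
  have hC' : ∀ x, |a x * b x| ≤ C := fun x => by
    have h0 : ‖(a x : ℂ) * (b x : ℂ)‖ ≤ C := hC x
    rwa [← Complex.ofReal_mul, Complex.norm_real, Real.norm_eq_abs] at h0
  have h1 : BddMeas fun x => ((√|a x * b x| : ℝ) : ℂ) :=
    ⟨Complex.measurable_ofReal.comp hs, √C, fun x => by
      rw [Complex.norm_real, Real.norm_of_nonneg (Real.sqrt_nonneg _)]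
      exact Real.sqrt_le_sqrt (hC' x)⟩
  have hk : ∀ x, abs (a x * b x / √(abs (a x * b x))) = √(abs (a x * b x)) := fun x => by
    rw [abs_div, abs_of_nonneg (Real.sqrt_nonneg _), Real.div_sqrt]
  -- The product a b is distributed as √|a b| times a function of the same modulus. Where a b = 0,
  -- division by zero gives the value 0, which is the right one.
  have h2 : BddMeas fun x => ((a x * b x / √|a x * b x| : ℝ) : ℂ) :=
    ⟨Complex.measurable_ofReal.comp (hm.div hs), √C, fun x => by
      rw [Complex.norm_real, Real.norm_eq_abs, hk]
      exact Real.sqrt_le_sqrt (hC' x)⟩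
  have h3 : ⟪mulOp μ (fun x => (a x : ℂ)) f, mulOp μ (fun x => (b x : ℂ)) g⟫_ℂ
      = ⟪mulOp μ (fun x => ((√|a x * b x| : ℝ) : ℂ)) f,
        mulOp μ (fun x => ((a x * b x / √|a x * b x| : ℝ) : ℂ)) g⟫_ℂ := by
    rw [← ContinuousLinearMap.adjoint_inner_right, adjoint_mulOp_real ha,
      ← ContinuousLinearMap.adjoint_inner_right (mulOp μ fun x => ((√|a x * b x| : ℝ) : ℂ)),
      adjoint_mulOp_real h1, ← mul_apply_eq_comp, ← mul_apply_eq_comp, mulOp_mul ha hb,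
      mulOp_mul h1 h2]
    congr 3
    funext x
    rw [← Complex.ofReal_mul, ← Complex.ofReal_mul]
    congr 1
    by_cases h0 : a x * b x = 0
    · simp [h0]
    · have : √|a x * b x| ≠ 0 := Real.sqrt_ne_zero'.2 (abs_pos.2 h0)
      field_simp
  have h4 : ‖mulOp μ (fun x => ((a x * b x / √|a x * b x| : ℝ) : ℂ)) g‖
      = ‖mulOp μ (fun x => ((√|a x * b x| : ℝ) : ℂ)) g‖ := by
    have : ‖mulOp μ (fun x => ((a x * b x / √|a x * b x| : ℝ) : ℂ)) g‖ₑ ^ 2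
        = ‖mulOp μ (fun x => ((√|a x * b x| : ℝ) : ℂ)) g‖ₑ ^ 2 := by
      rw [enorm_mulOp_sq h1, enorm_mulOp_sq h2]
      refine lintegral_congr fun x => ?_
      congr 2
      rw [← ofReal_norm, ← ofReal_norm, Complex.norm_real, Complex.norm_real, Real.norm_eq_abs, hk,
        Real.norm_of_nonneg (Real.sqrt_nonneg _)]
    have h5 := (ENNReal.pow_right_strictMono (two_ne_zero)).injective this
    simpa using congrArg ENNReal.toReal h5
  rw [h3]
  refine (norm_inner_le_weighted _ _ one_pos).trans (le_of_eq ?_)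
  rw [h4]
  ring

end PairEstimates

/-! ### Two particles leaving the orbitals -/

section DoubleExcitation

variable {N : ℕ} {v : R3 → ℝ} {φ : Fin N → OneBody} {d₀ b₁ b₂ : ℝ}

/-- The fermionic bound is used twice: for the sum over j at fixed x_i, which produces v² ⋆ ρ at
x_i, and then for the sum over i with this function as weight. -/
theorem PairBounds.sum_sum_norm_pairOp_pp_sq_le (h : PairBounds v φ d₀ b₁ b₂) (hN : 0 < N)
    (hφ : Orthonormal ℂ φ) {χ : ManyBody N} (hχ : AntisymmOn Finset.univ χ) :
    ∑ i, ∑ j ∈ {i}ᶜ, ‖pairOp v i j (orbProj φ j (orbProj φ i χ))‖ ^ 2 ≤ b₂ * ‖χ‖ ^ 2 := by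
  rw [Finset.sum_sigma']
  refine sum_norm_sq_le_of_enorm h.b₂_nonneg ?_
  rw [← Finset.sum_sigma' Finset.univ (fun i => {i}ᶜ)
    fun i j => ‖pairOp v i j (orbProj φ j (orbProj φ i χ))‖ₑ ^ 2]
  set κ : R3 → ENNReal := fun y => ∫⁻ x, ‖v (y - x)‖ₑ ^ 2 * edensity φ x
  have hpi := fun i : Fin N => (measurable_pi_apply i : Measurable fun x : Fin N → R3 => x i)
  have hme := measurable_edensity φ
  have hκ : Measurable κ := by
    have : Measurable fun z : R3 × R3 => ‖v (z.1 - z.2)‖ₑ ^ 2 * edensity φ z.2 :=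
      ((h.meas.comp (measurable_fst.sub measurable_snd)).enorm.pow_const _).mul
        (hme.comp measurable_snd)
    exact this.lintegral_prod_right'
  have h1 : ∀ i, ∑ j ∈ {i}ᶜ, ‖pairOp v i j (orbProj φ j (orbProj φ i χ))‖ₑ ^ 2
      ≤ ∫⁻ x, κ (x i) * ‖orbProj φ i χ x‖ₑ ^ 2 := by
    intro i
    simp_rw [h.enorm_pairOp_sq]
    have hm : Measurable fun z : R3 × (Fin N → R3) => ‖v (z.2 i - z.1)‖ₑ ^ 2 :=
      (h.meas.comp (((hpi i).comp measurable_snd).sub measurable_fst)).enorm.pow_const _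
    refine ((hχ.mono (Finset.subset_univ {i}ᶜ)).orbProj_apply φ (m := i)
      (by simp)).sum_lintegral_orbProj_le hN hφ (κ := fun y x => ‖v (x i - y)‖ₑ ^ 2) hm
      fun m hm y x z => ?_
    rw [Function.update_of_ne]
    rintro rfl; simp at hm
  refine (Finset.sum_le_sum fun i _ => h1 i).trans ?_
  have hm : Measurable fun z : R3 × (Fin N → R3) => κ z.1 := hκ.comp measurable_fst
  refine (hχ.sum_lintegral_orbProj_le hN hφ (κ := fun y _ => κ y) hm fun m _ y x z => rfl).trans ?_
  rw [lintegral_const_mul _ ((Lp.stronglyMeasurable χ).measurable.enorm.pow_const _), Lp_enorm_sq]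
  exact mul_le_mul_left h.integral_sq _

/-- The square root of `|v(x_i - x_j) v(x_i - x_l)|`. -/
def tripleWeight (v : R3 → ℝ) (i j l : Fin N) (x : Fin N → R3) : ℝ :=
  √(abs (v (x i - x j) * v (x i - x l)))

theorem tripleWeight_comm (v : R3 → ℝ) (i j l : Fin N) :
    tripleWeight v i j l = tripleWeight v i l j := by
  funext x
  rw [tripleWeight, tripleWeight, mul_comm]

theorem PairBounds.bddMeas_tripleWeight (h : PairBounds v φ d₀ b₁ b₂) (i j l : Fin N) :
    BddMeas fun x : Fin N → R3 => (tripleWeight v i j l x : ℂ) := by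
  obtain ⟨C, hC⟩ := h.bdd
  have hm : Measurable fun x : Fin N → R3 => v (x i - x j) * v (x i - x l) :=
    (h.meas.comp (measurable_coord_sub i j)).mul (h.meas.comp (measurable_coord_sub i l))
  refine ⟨Complex.measurable_ofReal.comp
    (Real.continuous_sqrt.measurable.comp (continuous_abs.measurable.comp hm)), √(C * C),
    fun x => ?_⟩
  rw [Complex.norm_real, tripleWeight, Real.norm_of_nonneg (Real.sqrt_nonneg _), abs_mul]
  exact Real.sqrt_le_sqrt (mul_le_mul (hC _) (hC _) (abs_nonneg _) ((abs_nonneg _).trans (hC 0)))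

theorem enorm_tripleWeight_sq (v : R3 → ℝ) (i j l : Fin N) (x : Fin N → R3) :
    ‖(tripleWeight v i j l x : ℂ)‖ₑ ^ 2 = ‖v (x i - x j)‖ₑ * ‖v (x i - x l)‖ₑ := by
  rw [← ofReal_norm, Complex.norm_real, tripleWeight, Real.norm_of_nonneg (Real.sqrt_nonneg _),
    ← ENNReal.ofReal_pow (Real.sqrt_nonneg _), Real.sq_sqrt (abs_nonneg _), ← Real.norm_eq_abs,
    ofReal_norm, enorm_mul]

/-- The squared weight is |v(x_i - x_j)| |v(x_i - x_l)|. The sum over j at fixed x_i gives one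
factor |v| ⋆ ρ, and the sum over i at fixed x_l gives a second one. -/
theorem PairBounds.sum_sum_norm_tripleWeight_sq_le (h : PairBounds v φ d₀ b₁ b₂) (hN : 0 < N)
    (hφ : Orthonormal ℂ φ) (l : Fin N) {ω : ManyBody N} (hω : AntisymmOn {l}ᶜ ω) :
    ∑ i ∈ {l}ᶜ, ∑ j ∈ ({l}ᶜ : Finset (Fin N)).erase i,
      ‖mulOp volume (fun x => (tripleWeight v i j l x : ℂ)) (orbProj φ j (orbProj φ i ω))‖ ^ 2
      ≤ d₀ ^ 2 * ‖ω‖ ^ 2 := by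
  rw [Finset.sum_sigma']
  refine sum_norm_sq_le_of_enorm (sq_nonneg _) ?_
  rw [← Finset.sum_sigma' ({l}ᶜ) (fun i => ({l}ᶜ : Finset (Fin N)).erase i)
    fun i j => ‖mulOp volume (fun x => (tripleWeight v i j l x : ℂ))
      (orbProj φ j (orbProj φ i ω))‖ₑ ^ 2]
  have hpi := fun i : Fin N => (measurable_pi_apply i : Measurable fun x : Fin N → R3 => x i)
  have h1 : ∀ i ∈ ({l}ᶜ : Finset (Fin N)), ∑ j ∈ ({l}ᶜ : Finset (Fin N)).erase i,
      ‖mulOp volume (fun x => (tripleWeight v i j l x : ℂ)) (orbProj φ j (orbProj φ i ω))‖ₑ ^ 2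
      ≤ ENNReal.ofReal d₀ * ∫⁻ x, ‖v (x i - x l)‖ₑ * ‖orbProj φ i ω x‖ₑ ^ 2 := by
    intro i hi
    simp_rw [enorm_mulOp_sq (h.bddMeas_tripleWeight _ _ _), enorm_tripleWeight_sq]
    have hm : Measurable fun z : R3 × (Fin N → R3) =>
        ‖v (z.2 i - z.1)‖ₑ * ‖v (z.2 i - z.2 l)‖ₑ :=
      (h.meas.comp (((hpi i).comp measurable_snd).sub measurable_fst)).enorm.mul
        (h.meas.comp (((hpi i).comp measurable_snd).sub ((hpi l).comp measurable_snd))).enorm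
    refine ((hω.mono (Finset.erase_subset i _)).orbProj_apply φ (m := i)
      (by simp)).sum_lintegral_orbProj_le hN hφ
      (κ := fun y x => ‖v (x i - y)‖ₑ * ‖v (x i - x l)‖ₑ) hm (fun m hm y x z => ?_) |>.trans ?_
    · rw [Function.update_of_ne, Function.update_of_ne]
      · rintro rfl; simp at hm
      · rintro rfl; simp at hm
    · rw [← lintegral_const_mul]
      · refine lintegral_mono fun x => ?_
        simp only
        rw [← mul_assoc]
        refine mul_le_mul_left ?_ _
        simp_rw [mul_right_comm _ (‖v (x i - x l)‖ₑ)]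
        rw [lintegral_mul_const]
        · exact mul_le_mul_left (h.sup_abs (x i)) _
        · exact (h.meas.comp (measurable_const.sub measurable_id)).enorm.mul
            (measurable_edensity φ)
      · exact (h.meas.comp (measurable_coord_sub i l)).enorm.mul
          ((Lp.stronglyMeasurable _).measurable.enorm.pow_const _)
  refine (Finset.sum_le_sum h1).trans ?_
  rw [← Finset.mul_sum]
  have hm : Measurable fun z : R3 × (Fin N → R3) => ‖v (z.1 - z.2 l)‖ₑ :=
    (h.meas.comp (measurable_fst.sub ((hpi l).comp measurable_snd))).enorm
  have h2 := hω.sum_lintegral_orbProj_le hN hφ (κ := fun y x => ‖v (y - x l)‖ₑ) hm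
    fun m hm y x z => by
      rw [Function.update_of_ne]
      rintro rfl; simp at hm
  rw [ENNReal.ofReal_pow h.d_nonneg, sq, mul_assoc]
  refine mul_le_mul_right (h2.trans ?_) _
  rw [Lp_enorm_sq, ← lintegral_const_mul _
    ((Lp.stronglyMeasurable ω).measurable.enorm.pow_const _)]
  refine lintegral_mono fun x => mul_le_mul_left ?_ _
  refine le_trans (le_of_eq (lintegral_congr fun y => ?_)) (h.sup_abs (x l))
  rw [h.comm]

/-- The state in which particle `j` has been excited by particle `i`. -/
def excited (v : R3 → ℝ) (φ : Fin N → OneBody) (χ : ManyBody N) (i j : Fin N) : ManyBody N :=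
  (1 - orbProj φ j : ManyBody N →L[ℂ] ManyBody N)
    (pairOp v i j (orbProj φ j (orbProj φ i χ)))

/-- The state excited at j is built from operators that do not touch l, so q_l from the other side
passes through them to χ, and likewise with j and l interchanged. Both sides of the off-diagonal
inner product thereby acquire a factor q acting on χ, which makes it small. -/
theorem PairBounds.inner_excited (h : PairBounds v φ d₀ b₁ b₂) (hφ : Orthonormal ℂ φ)
    (χ : ManyBody N) {i j l : Fin N} (hji : j ≠ i) (hli : l ≠ i) (hjl : j ≠ l) :
    ⟪excited v φ χ i j, excited v φ χ i l⟫_ℂ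
      = ⟪pairOp v i j (orbProj φ j (orbProj φ i ((1 - orbProj φ l :
          ManyBody N →L[ℂ] ManyBody N) χ))),
        pairOp v i l (orbProj φ l (orbProj φ i ((1 - orbProj φ j :
          ManyBody N →L[ℂ] ManyBody N) χ)))⟫_ℂ := by
  have hp := commIdem_orbProj hφ
  have key : ∀ {j l : Fin N}, l ≠ i → j ≠ l →
      (1 - orbProj φ l : ManyBody N →L[ℂ] ManyBody N)
        (pairOp v i j (orbProj φ j (orbProj φ i χ)))
      = pairOp v i j (orbProj φ j (orbProj φ i ((1 - orbProj φ l :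
          ManyBody N →L[ℂ] ManyBody N) χ))) := by
    intro j l hli hjl
    have hc : Commute (pairOp v i j * orbProj φ j * orbProj φ i) (1 - orbProj φ l) :=
      (Commute.one_right _).sub_right
        (((h.pairOp_commute hli hjl.symm).mul_left (hp.comm j l)).mul_left (hp.comm i l))
    have := congrArg (fun A : ManyBody N →L[ℂ] ManyBody N => A χ) hc.eq
    simpa only [mul_apply_eq_comp] using this.symm
  have hc : ∀ Y : ManyBody N, (1 - orbProj φ l : ManyBody N →L[ℂ] ManyBody N)
      ((1 - orbProj φ j : ManyBody N →L[ℂ] ManyBody N) Y)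
      = (1 - orbProj φ j : ManyBody N →L[ℂ] ManyBody N)
        ((1 - orbProj φ l : ManyBody N →L[ℂ] ManyBody N) Y) := fun Y => by
    rw [← mul_apply_eq_comp, (hp.one_sub_comm l j).eq, mul_apply_eq_comp]
  unfold excited
  rw [← inner_one_sub_orbProj_left, hc, inner_one_sub_orbProj_left, key hli hjl, key hji hjl.symm]

/-- Expanding the square over pairs j, l, the diagonal j = l is controlled by ∫ (v² ⋆ ρ) ρ. Off the
diagonal, after the exchange of q_j and q_l, the interaction factors v(x_i - x_j) and v(x_i - x_l)
are shared equally between both sides as √|v v|; this needs only |v| ⋆ ρ and not its square version.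
-/
theorem PairBounds.sum_norm_sum_excited_sq_le (h : PairBounds v φ d₀ b₁ b₂) (hN : 0 < N)
    (hφ : Orthonormal ℂ φ) {χ : ManyBody N} (hχ : AntisymmOn Finset.univ χ) :
    ∑ i, ‖∑ j ∈ {i}ᶜ, excited v φ χ i j‖ ^ 2 ≤ b₂ * ‖χ‖ ^ 2
      + d₀ ^ 2 * ∑ l, ‖(1 - orbProj φ l : ManyBody N →L[ℂ] ManyBody N) χ‖ ^ 2 := by
  have hp := commIdem_orbProj hφ
  set w : Fin N → Fin N → Fin N → ℝ := fun i j l =>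
    ‖mulOp volume (fun x => (tripleWeight v i j l x : ℂ)) (orbProj φ j (orbProj φ i
      ((1 - orbProj φ l : ManyBody N →L[ℂ] ManyBody N) χ)))‖ ^ 2 with hw
  have h1 : ∀ i, ‖∑ j ∈ {i}ᶜ, excited v φ χ i j‖ ^ 2
      ≤ ∑ j ∈ {i}ᶜ, ‖excited v φ χ i j‖ ^ 2
        + ∑ j ∈ {i}ᶜ, ∑ l ∈ ({i}ᶜ : Finset (Fin N)).erase j, (w i j l + w i l j) / 2 := by
    intro i
    rw [← inner_self_eq_norm_sq (𝕜 := ℂ), sum_inner, map_sum, ← Finset.sum_add_distrib]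
    refine Finset.sum_le_sum fun j hj => ?_
    rw [inner_sum, map_sum, ← Finset.add_sum_erase _ _ hj]
    refine add_le_add (le_of_eq (inner_self_eq_norm_sq _)) (Finset.sum_le_sum fun l hl => ?_)
    have hji : j ≠ i := by simpa using hj
    have hli : l ≠ i := by simpa using Finset.mem_of_mem_erase hl
    have hlj : l ≠ j := Finset.ne_of_mem_erase hl
    rw [h.inner_excited hφ χ hji hli hlj.symm]
    refine (Complex.re_le_norm _).trans
      ((norm_inner_mulOp_mulOp_le (h.bddMeas_pair i j) (h.bddMeas_pair i l) _ _).trans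
      (le_of_eq ?_))
    simp only [hw]
    rw [tripleWeight_comm v i l j]
    rfl
  have h2 : ∀ i j, ‖excited v φ χ i j‖ ^ 2 ≤ ‖pairOp v i j (orbProj φ j (orbProj φ i χ))‖ ^ 2 := by
    intro i j
    rw [excited, norm_one_sub_orbProj_sq hφ]
    set Y := pairOp v i j (orbProj φ j (orbProj φ i χ))
    rw [sub_apply, one_apply_eq_self, inner_sub_right, Complex.sub_re]
    have h3 : 0 ≤ (⟪Y, orbProj φ j Y⟫_ℂ).re := by
      rw [← hp.idem j, mul_apply_eq_comp, ← inner_orbProj_left]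
      exact inner_self_nonneg (𝕜 := ℂ)
    have h4 : (⟪Y, Y⟫_ℂ).re = ‖Y‖ ^ 2 := inner_self_eq_norm_sq (𝕜 := ℂ) Y
    linarith
  refine (Finset.sum_le_sum fun i _ => h1 i).trans ?_
  rw [Finset.sum_add_distrib]
  refine add_le_add ((Finset.sum_le_sum fun i _ => Finset.sum_le_sum fun j _ => h2 i j).trans
    (h.sum_sum_norm_pairOp_pp_sq_le hN hφ hχ)) ?_
  have h5 : ∀ i : Fin N, ∑ j ∈ {i}ᶜ, ∑ l ∈ ({i}ᶜ : Finset (Fin N)).erase j, (w i j l + w i l j) / 2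
      = ∑ l ∈ {i}ᶜ, ∑ j ∈ ({i}ᶜ : Finset (Fin N)).erase l, w i j l := by
    intro i
    have hs : ∑ j ∈ {i}ᶜ, ∑ l ∈ ({i}ᶜ : Finset (Fin N)).erase j, w i j l
        = ∑ l ∈ {i}ᶜ, ∑ j ∈ ({i}ᶜ : Finset (Fin N)).erase l, w i j l :=
      Finset.sum_comm' fun x y => by
        simp only [Finset.mem_erase, ne_eq, Finset.mem_compl, Finset.mem_singleton, eq_comm]
        tauto
    simp_rw [← Finset.sum_div, Finset.sum_add_distrib]
    rw [hs]
    ring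
  simp_rw [h5]
  rw [sum_compl_comm, Finset.mul_sum]
  refine Finset.sum_le_sum fun l _ => ?_
  have h6 := h.sum_sum_norm_tripleWeight_sq_le hN hφ l
    ((hχ.mono (Finset.subset_univ {l}ᶜ)).one_sub_orbProj_apply φ (m := l) (by simp))
  refine le_trans (le_of_eq ?_) h6
  refine Finset.sum_congr rfl fun i _ => Finset.sum_congr ?_ fun j _ => rfl
  ext x
  simp only [Finset.mem_erase, ne_eq, Finset.mem_compl, Finset.mem_singleton]
  tauto

theorem sum_sum_Ioi_symm {F : Fin N → Fin N → ℂ} (hF : ∀ i j, F i j = F j i) :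
    2 * ∑ i, ∑ j ∈ Finset.Ioi i, F i j = ∑ i, ∑ j ∈ {i}ᶜ, F i j := by
  have h1 : ∑ i, ∑ j ∈ Finset.Ioi i, F i j = ∑ i, ∑ j ∈ Finset.Iio i, F i j := by
    rw [Finset.sum_comm' (t' := Finset.univ) (s' := fun j => Finset.Iio j)
      fun x y => by simp]
    simp_rw [hF]
  rw [two_mul]
  nth_rewrite 1 [h1]
  rw [← Finset.sum_add_distrib]
  refine Finset.sum_congr rfl fun i _ => ?_
  rw [← Finset.Ioi_disjUnion_Iio i, Finset.sum_disjUnion, add_comm]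

/-- The terms in which both particles make a transition between `p` and `q`. -/
theorem PairBounds.norm_sum_lowerTwo_le (h : PairBounds v φ d₀ b₁ b₂) (hN : 0 < N)
    (hφ : Orthonormal ℂ φ) {χ χ' : ManyBody N} (hχ : AntisymmOn Finset.univ χ) {t : ℝ}
    (ht : 0 < t) :
    2 * ‖∑ i, ∑ j ∈ Finset.Ioi i, ⟪χ, lowerTwo (orbProj φ) (pairOp v i j) i j χ'⟫_ℂ‖
      ≤ (t * (b₂ * ‖χ‖ ^ 2
          + d₀ ^ 2 * ∑ l, ‖(1 - orbProj φ l : ManyBody N →L[ℂ] ManyBody N) χ‖ ^ 2)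
        + t⁻¹ * ∑ i, ‖(1 - orbProj φ i : ManyBody N →L[ℂ] ManyBody N) χ'‖ ^ 2) / 2 := by
  have hp := commIdem_orbProj hφ
  have hsym : ∀ i j, ⟪χ, lowerTwo (orbProj φ) (pairOp v i j) i j χ'⟫_ℂ
      = ⟪χ, lowerTwo (orbProj φ) (pairOp v j i) j i χ'⟫_ℂ := fun i j => by
    rw [lowerTwo, lowerTwo, (hp.comm i j).eq, (hp.one_sub_comm i j).eq, h.pairOp_comm i j]
  have h1 : ∀ i j, ⟪χ, lowerTwo (orbProj φ) (pairOp v i j) i j χ'⟫_ℂ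
      = ⟪excited v φ χ i j, (1 - orbProj φ i : ManyBody N →L[ℂ] ManyBody N) χ'⟫_ℂ := fun i j => by
    rw [lowerTwo, excited, inner_one_sub_orbProj_left, h.inner_pairOp_left, inner_orbProj_left,
      inner_orbProj_left, (hp.one_sub_comm i j).eq]
    simp only [mul_apply_eq_comp]
  -- The factor 2 passes to ordered pairs. Then q_i can be kept on the right for each i, while the
  -- whole sum over j is collected in one vector on the left before Cauchy-Schwarz.
  have h2 : 2 * ‖∑ i, ∑ j ∈ Finset.Ioi i, ⟪χ, lowerTwo (orbProj φ) (pairOp v i j) i j χ'⟫_ℂ‖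
      = ‖∑ i, ⟪∑ j ∈ {i}ᶜ, excited v φ χ i j,
        (1 - orbProj φ i : ManyBody N →L[ℂ] ManyBody N) χ'⟫_ℂ‖ := by
    rw [← Complex.norm_two, ← norm_mul, sum_sum_Ioi_symm hsym]
    simp_rw [h1, sum_inner]
  rw [h2]
  refine (norm_sum_le _ _).trans ((Finset.sum_le_sum fun i _ => norm_inner_le_weighted _ _ ht).trans
    ?_)
  rw [← Finset.sum_div, Finset.sum_add_distrib, ← Finset.mul_sum, ← Finset.mul_sum]
  have := mul_le_mul_of_nonneg_left (h.sum_norm_sum_excited_sq_le hN hφ hχ) ht.le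
  linarith

end DoubleExcitation

/-! ### Integral representation of the mean field -/

section MeanField

variable {N : ℕ} {v : R3 → ℝ} {φ : Fin N → OneBody} {d₀ b₁ b₂ : ℝ}

/-- `∫ f(y)^* v(x - y) g(y) dy`. -/
def overlap (v : R3 → ℝ) (f g : OneBody) (x : R3) : ℂ :=
  ∫ y, conj (f y) * g y * (v (x - y) : ℂ)

theorem integrable_conj_mul {α : Type*} [MeasurableSpace α] {μ : Measure α} (f g : Lp ℂ 2 μ) :
    Integrable (fun y => conj (f y) * g y) μ := by
  have := L2.integrable_inner (𝕜 := ℂ) f g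
  refine this.congr (Filter.Eventually.of_forall fun x => ?_)
  simp [mul_comm]

theorem bddMeas_overlap (hm : Measurable v) (hb : ∃ C, ∀ x, |v x| ≤ C) (f g : OneBody) :
    BddMeas (overlap v f g) := by
  obtain ⟨C, hC⟩ := hb
  constructor
  · have h1 : StronglyMeasurable fun z : R3 × R3 => conj (f z.2) * g z.2 * (v (z.1 - z.2) : ℂ) := by
      have hf := (Lp.stronglyMeasurable f).measurable
      have hg := (Lp.stronglyMeasurable g).measurable
      have hv : Measurable fun z : R3 × R3 => (v (z.1 - z.2) : ℂ) :=
        Complex.measurable_ofReal.comp (hm.comp (measurable_fst.sub measurable_snd))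
      have h2 : Measurable fun z : R3 × R3 => conj (f z.2) :=
        Complex.continuous_conj.measurable.comp (hf.comp measurable_snd)
      exact ((h2.mul (hg.comp measurable_snd)).mul hv).stronglyMeasurable
    exact h1.integral_prod_right'.measurable
  · refine ⟨∫ y, ‖conj (f y) * g y‖ * C, fun x => ?_⟩
    refine norm_integral_le_of_norm_le ((integrable_conj_mul f g).norm.mul_const C)
      (Filter.Eventually.of_forall fun y => ?_)
    rw [norm_mul _ (v (x - y) : ℂ), Complex.norm_real]
    exact mul_le_mul_of_nonneg_left (hC _) (norm_nonneg _)

/-- Multiplication by `v(x_i - y)`. -/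
def probeOp (v : R3 → ℝ) (i : Fin N) (y : R3) : ManyBody N →L[ℂ] ManyBody N :=
  mulOp volume fun x => (v (x i - y) : ℂ)

/-- Multiplication by a function of the variable `x_i`. -/
def coordOp (w : R3 → ℂ) (i : Fin N) : ManyBody N →L[ℂ] ManyBody N :=
  mulOp volume fun x => w (x i)

theorem bddMeas_probe (hm : Measurable v) (hb : ∃ C, ∀ x, |v x| ≤ C) (i : Fin N) (y : R3) :
    BddMeas fun x : Fin N → R3 => (v (x i - y) : ℂ) :=
  bddMeas_ofReal_comp hm hb ((measurable_pi_apply i).sub measurable_const)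

theorem integrable_inner_probeOp (hm : Measurable v) (hb : ∃ C, ∀ x, |v x| ≤ C) (i : Fin N)
    (f g : OneBody) (A B : ManyBody N) :
    Integrable (fun y => conj (f y) * g y * ⟪A, probeOp v i y B⟫_ℂ) ∧
      ∫ y, conj (f y) * g y * ⟪A, probeOp v i y B⟫_ℂ = ⟪A, coordOp (overlap v f g) i B⟫_ℂ := by
  obtain ⟨C, hC⟩ := hb
  have hF : Integrable (fun z : R3 × (Fin N → R3) =>
      (v (z.2 i - z.1) : ℂ) * ((conj (f z.1) * g z.1) * (conj (A z.2) * B z.2)))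
      (volume.prod volume) := by
    have h1 := (integrable_conj_mul f g).mul_prod (integrable_conj_mul A B)
    have hv : Measurable fun z : R3 × (Fin N → R3) => (v (z.2 i - z.1) : ℂ) :=
      Complex.measurable_ofReal.comp
        (hm.comp (((measurable_pi_apply i).comp measurable_snd).sub measurable_fst))
    exact h1.bdd_mul hv.aestronglyMeasurable (c := C)
      (Filter.Eventually.of_forall fun z => by rw [Complex.norm_real]; exact hC _)
  have h2 : ∀ y, conj (f y) * g y * ⟪A, probeOp v i y B⟫_ℂ
      = ∫ x, (v (x i - y) : ℂ) * ((conj (f y) * g y) * (conj (A x) * B x)) := by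
    intro y
    rw [L2_inner_eq, ← integral_const_mul]
    refine integral_congr_ae ?_
    filter_upwards [coeFn_mulOp (bddMeas_probe hm ⟨C, hC⟩ i y) B] with x hx
    rw [probeOp, hx]
    ring
  simp_rw [h2]
  refine ⟨hF.integral_prod_left, ?_⟩
  rw [integral_integral_swap hF, L2_inner_eq]
  refine integral_congr_ae ?_
  filter_upwards [coeFn_mulOp ((bddMeas_overlap hm ⟨C, hC⟩ f g).comp (measurable_pi_apply i)) B]
    with x hx
  rw [coordOp, hx, overlap, mul_left_comm, ← integral_mul_const]
  refine integral_congr_ae (Filter.Eventually.of_forall fun y => ?_)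
  simp only
  ring

/-- Integrating out x_j between the two rank-one operators leaves a potential in x_i alone. -/
theorem rankOne_mul_pairOp_mul_rankOne (hm : Measurable v) (hb : ∃ C, ∀ x, |v x| ≤ C)
    {i j : Fin N} (hij : i ≠ j) (f g f' g' : OneBody) :
    rankOne j f g * pairOp v i j * rankOne j f' g'
      = coordOp (overlap v g f') i * rankOne j f g' := by
  ext1 ψ
  refine Lp.ext ?_
  simp only [mul_apply_eq_comp]
  have hp := bddMeas_ofReal_comp hm hb (measurable_coord_sub (N := N) i j)
  have h4 : pairOp v i j (rankOne j f' g' ψ) =ᵐ[volume]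
      fun x => (v (x i - x j) : ℂ) * (f' (x j) * contract g' j ψ x) := by
    filter_upwards [coeFn_mulOp hp (rankOne j f' g' ψ), coeFn_rankOne j f' g' ψ] with x h1 h2
    rw [pairOp, h1, h2]
  filter_upwards [coeFn_rankOne j f g (pairOp v i j (rankOne j f' g' ψ)), contract_congr g j h4,
    coeFn_mulOp ((bddMeas_overlap hm hb g f').comp (measurable_pi_apply i)) (rankOne j f g' ψ),
    coeFn_rankOne j f g' ψ] with x h1 h2 h3 h5
  rw [h1, h2, coordOp, h3, h5, overlap]
  have h6 : contract g j (fun x => (v (x i - x j) : ℂ) * (f' (x j) * contract g' j ψ x)) x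
      = (∫ y, conj (g y) * f' y * (v (x i - y) : ℂ)) * contract g' j ψ x := by
    rw [contract, ← integral_mul_const]
    refine integral_congr_ae (Filter.Eventually.of_forall fun y => ?_)
    simp only
    rw [Function.update_of_ne hij, Function.update_self, contract_update]
    ring
  rw [h6]
  ring

/-- `f_y = ∑_j φ_j(y)^* φ_j`. -/
abbrev orbitalAt (φ : Fin N → OneBody) (y : R3) : OneBody :=
  orbitalCombination φ (fun j y => φ j y) y

theorem rankOne_orbitalAt (φ : Fin N → OneBody) (j : Fin N) (y : R3) :
    rankOne j (orbitalAt φ y) (orbitalAt φ y)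
      = ∑ a, ∑ b, (conj (φ a y) * φ b y) • rankOne j (φ a) (φ b) := by
  have hl : ∀ (s : Finset (Fin N)) (F : Fin N → OneBody) (g : OneBody),
      rankOne j (∑ a ∈ s, F a) g = ∑ a ∈ s, rankOne j (F a) g := fun s F g =>
    map_sum (AddMonoidHom.mk' (fun f => rankOne j f g) fun f f' => rankOne_add_left j f f' g) F s
  have hr : ∀ (s : Finset (Fin N)) (F : Fin N → OneBody) (g : OneBody),
      rankOne j g (∑ a ∈ s, F a) = ∑ a ∈ s, rankOne j g (F a) := fun s F g =>
    map_sum (AddMonoidHom.mk' (fun f => rankOne j g f) fun f f' => rankOne_add_right j g f f') F s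
  rw [orbitalAt, orbitalCombination, hl]
  refine Finset.sum_congr rfl fun a _ => ?_
  rw [hr]
  refine Finset.sum_congr rfl fun b _ => ?_
  rw [rankOne_smul_left, rankOne_smul_right, smul_smul, Complex.conj_conj]

theorem norm_sq_orbitalAt (hφ : Orthonormal ℂ φ) (y : R3) :
    (‖orbitalAt φ y‖ : ℂ) ^ 2 = ∑ a, conj (φ a y) * φ a y := by
  rw [← Complex.ofReal_pow, ← inner_self_eq_norm_sq (𝕜 := ℂ), orbitalAt, orbitalCombination,
    hφ.inner_sum]
  simp_rw [Complex.conj_conj, mul_comm (φ _ y)]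
  rw [map_sum, Complex.ofReal_sum]
  refine Finset.sum_congr rfl fun a _ => ?_
  rw [mul_comm, Complex.mul_conj]
  exact congrArg _ (Complex.ofReal_re _)

/-- For j ≠ i the right side is a matrix element of p_j v(x_i - x_j) p_j; for j = i it is the
exchange term. So the interaction with a particle in the orbitals is a superposition over y of the
external potential v(x_i - y), weighted by the occupation of f_y. -/
theorem integrable_inner_probeOp_rankOne (hm : Measurable v) (hb : ∃ C, ∀ x, |v x| ≤ C)
    (φ : Fin N → OneBody) (i j : Fin N) (A B : ManyBody N) :
    Integrable (fun y => ⟪A, probeOp v i y (rankOne j (orbitalAt φ y) (orbitalAt φ y) B)⟫_ℂ) ∧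
      ∫ y, ⟪A, probeOp v i y (rankOne j (orbitalAt φ y) (orbitalAt φ y) B)⟫_ℂ
        = ∑ a, ∑ b, ⟪A, coordOp (overlap v (φ a) (φ b)) i (rankOne j (φ a) (φ b) B)⟫_ℂ := by
  have h1 : ∀ y, ⟪A, probeOp v i y (rankOne j (orbitalAt φ y) (orbitalAt φ y) B)⟫_ℂ
      = ∑ a, ∑ b, conj (φ a y) * φ b y * ⟪A, probeOp v i y (rankOne j (φ a) (φ b) B)⟫_ℂ := by
    intro y
    simp only [rankOne_orbitalAt, _root_.sum_apply, map_sum, inner_sum, _root_.smul_apply, map_smul,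
      inner_smul_right]
  have h2 := fun a b => integrable_inner_probeOp hm hb i (φ a) (φ b) A (rankOne j (φ a) (φ b) B)
  simp_rw [h1]
  refine ⟨integrable_finsetSum _ fun a _ => integrable_finsetSum _ fun b _ => (h2 a b).1, ?_⟩
  rw [integral_finsetSum _ fun a _ => integrable_finsetSum _ fun b _ => (h2 a b).1]
  refine Finset.sum_congr rfl fun a _ => ?_
  rw [integral_finsetSum _ fun b _ => (h2 a b).1]
  exact Finset.sum_congr rfl fun b _ => (h2 a b).2

theorem integrable_inner_probeOp_norm (hm : Measurable v) (hb : ∃ C, ∀ x, |v x| ≤ C)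
    (hφ : Orthonormal ℂ φ) (i : Fin N) (A B : ManyBody N) :
    Integrable (fun y => (‖orbitalAt φ y‖ : ℂ) ^ 2 * ⟪A, probeOp v i y B⟫_ℂ) ∧
      ∫ y, (‖orbitalAt φ y‖ : ℂ) ^ 2 * ⟪A, probeOp v i y B⟫_ℂ
        = ∑ a, ⟪A, coordOp (overlap v (φ a) (φ a)) i B⟫_ℂ := by
  have h2 := fun a => integrable_inner_probeOp hm hb i (φ a) (φ a) A B
  simp_rw [norm_sq_orbitalAt hφ, Finset.sum_mul]
  refine ⟨integrable_finsetSum _ fun a _ => (h2 a).1, ?_⟩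
  rw [integral_finsetSum _ fun a _ => (h2 a).1]
  exact Finset.sum_congr rfl fun a _ => (h2 a).2

theorem integral_rankOne_orbitalAt (hφ : Orthonormal ℂ φ) (j : Fin N) (A B : ManyBody N) :
    Integrable (fun y => ⟪A, rankOne j (orbitalAt φ y) (orbitalAt φ y) B⟫_ℂ) ∧
      ∫ y, ⟪A, rankOne j (orbitalAt φ y) (orbitalAt φ y) B⟫_ℂ = ⟪A, orbProj φ j B⟫_ℂ := by
  have h1 : ∀ y, ⟪A, rankOne j (orbitalAt φ y) (orbitalAt φ y) B⟫_ℂ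
      = ∑ a, ∑ b, conj (φ a y) * φ b y * ⟪A, rankOne j (φ a) (φ b) B⟫_ℂ := by
    intro y
    simp only [rankOne_orbitalAt, _root_.sum_apply, inner_sum, _root_.smul_apply, inner_smul_right]
  have h2 := fun a b => (integrable_conj_mul (φ a) (φ b)).mul_const ⟪A, rankOne j (φ a) (φ b) B⟫_ℂ
  simp_rw [h1]
  refine ⟨integrable_finsetSum _ fun a _ => integrable_finsetSum _ fun b _ => h2 a b, ?_⟩
  rw [integral_finsetSum _ fun a _ => integrable_finsetSum _ fun b _ => h2 a b, orbProj,
    _root_.sum_apply, inner_sum]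
  refine Finset.sum_congr rfl fun a _ => ?_
  rw [integral_finsetSum _ fun b _ => h2 a b]
  simp_rw [integral_mul_const, ← L2_inner_eq]
  rw [Finset.sum_eq_single_of_mem a (Finset.mem_univ a), inner_self_eq_norm_sq_to_K, hφ.1]
  · simp
  · intro b _ hb
    rw [hφ.2 hb.symm, zero_mul]

/-- The integral of |f_y⟩⟨f_y|_m over y is p_m, and that of ‖f_y‖² is N. Total holes thus equal the
number of orbitals minus the number of particles of S in the orbitals. -/
theorem integral_holeOp_orbitalAt (hφ : Orthonormal ℂ φ) (S : Finset (Fin N)) (χ : ManyBody N) :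
    Integrable (fun y => (⟪χ, holeOp S (orbitalAt φ y) χ⟫_ℂ).re) ∧
      ∫ y, (⟪χ, holeOp S (orbitalAt φ y) χ⟫_ℂ).re
        = N * ‖χ‖ ^ 2 - ∑ m ∈ S, (⟪χ, orbProj φ m χ⟫_ℂ).re := by
  have h1 : ∀ y, ⟪χ, holeOp S (orbitalAt φ y) χ⟫_ℂ
      = (∑ a, conj (φ a y) * φ a y) * ⟪χ, χ⟫_ℂ
        - ∑ m ∈ S, ⟪χ, rankOne m (orbitalAt φ y) (orbitalAt φ y) χ⟫_ℂ := by
    intro y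
    rw [holeOp_apply, inner_sub_right, inner_sum, inner_smul_right, norm_sq_orbitalAt hφ]
  have h2 := fun m => integral_rankOne_orbitalAt hφ m χ χ
  have h3 : Integrable fun y => (∑ a, conj (φ a y) * φ a y) * ⟪χ, χ⟫_ℂ :=
    (integrable_finsetSum _ fun a _ => integrable_conj_mul (φ a) (φ a)).mul_const _
  have h4 : Integrable fun y => ∑ m ∈ S, ⟪χ, rankOne m (orbitalAt φ y) (orbitalAt φ y) χ⟫_ℂ :=
    integrable_finsetSum _ fun m _ => (h2 m).1
  have h5 : Integrable fun y => ⟪χ, holeOp S (orbitalAt φ y) χ⟫_ℂ := by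
    simp_rw [h1]
    exact h3.sub h4
  refine ⟨h5.re, ?_⟩
  have h6 : ∫ y, (⟪χ, holeOp S (orbitalAt φ y) χ⟫_ℂ).re
      = (∫ y, ⟪χ, holeOp S (orbitalAt φ y) χ⟫_ℂ).re := integral_re h5
  rw [h6]
  simp_rw [h1]
  rw [integral_sub h3 h4, integral_mul_const, integral_finsetSum _ fun a _ =>
    integrable_conj_mul (φ a) (φ a), integral_finsetSum _ fun m _ => (h2 m).1, Complex.sub_re,
    Complex.re_sum]
  simp_rw [(h2 _).2, ← L2_inner_eq, inner_self_eq_norm_sq_to_K, hφ.1]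
  simp [← Complex.ofReal_pow]

end MeanField

/-! ### One particle leaving the orbitals -/

section SingleExcitation

variable {N : ℕ} {v : R3 → ℝ} {φ : Fin N → OneBody} {d₀ b₁ b₂ : ℝ}

theorem AntisymmOn.holeOp_apply_univ {χ : ManyBody N} (h : AntisymmOn Finset.univ χ) (f : OneBody) :
    AntisymmOn Finset.univ (holeOp Finset.univ f χ) := by
  refine h.apply fun i _ j _ _ => ?_
  rw [commute_iff_eq, holeOp, mul_sub, sub_mul, Finset.mul_sum, Finset.sum_mul]
  simp_rw [permute_mul_rankOne]
  rw [Equiv.sum_comp (Equiv.swap i j) fun m => rankOne m f f * permute (Equiv.swap i j)]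
  simp

theorem PairBounds.sum_norm_probeOp_orbProj_sq_le (h : PairBounds v φ d₀ b₁ b₂) (hN : 0 < N)
    (hφ : Orthonormal ℂ φ) (y : R3) {χ : ManyBody N} (hχ : AntisymmOn Finset.univ χ) :
    ∑ i, ‖probeOp v i y (orbProj φ i χ)‖ ^ 2 ≤ b₁ * ‖χ‖ ^ 2 := by
  refine sum_norm_sq_le_of_enorm h.b₁_nonneg ?_
  have h1 : ∀ i, ‖probeOp v i y (orbProj φ i χ)‖ₑ ^ 2
      = ∫⁻ x, ‖v (x i - y)‖ₑ ^ 2 * ‖orbProj φ i χ x‖ₑ ^ 2 := fun i => by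
    rw [probeOp, enorm_mulOp_sq (bddMeas_probe h.meas h.bdd i y)]
    simp_rw [enorm_ofReal_complex]
  simp_rw [h1]
  have hκ : Measurable fun z : R3 × (Fin N → R3) => ‖v (z.1 - y)‖ₑ ^ 2 :=
    (h.meas.comp (measurable_fst.sub measurable_const)).enorm.pow_const _
  refine (hχ.sum_lintegral_orbProj_le hN hφ (κ := fun z _ => ‖v (z - y)‖ₑ ^ 2) hκ
    fun m _ y x z => rfl).trans ?_
  rw [Lp_enorm_sq, lintegral_const_mul _
      ((Lp.stronglyMeasurable χ).measurable.enorm.pow_const _)]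
  refine mul_le_mul_left ?_ _
  refine le_trans (le_of_eq (lintegral_congr fun z => ?_)) (h.sup_sq y)
  rw [h.comm]

theorem inner_probeOp_left (hm : Measurable v) (hb : ∃ C, ∀ x, |v x| ≤ C) (i : Fin N) (y : R3)
    (χ χ' : ManyBody N) : ⟪probeOp v i y χ, χ'⟫_ℂ = ⟪χ, probeOp v i y χ'⟫_ℂ := by
  have h1 : ContinuousLinearMap.adjoint (probeOp (N := N) v i y) = probeOp v i y :=
    adjoint_mulOp_real (bddMeas_probe hm hb i y)
  conv_lhs => rw [← h1, ContinuousLinearMap.adjoint_inner_left]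

theorem inner_holeOp_left (S : Finset (Fin N)) (f : OneBody) (χ χ' : ManyBody N) :
    ⟪holeOp S f χ, χ'⟫_ℂ = ⟪χ, holeOp S f χ'⟫_ℂ := by
  conv_lhs => rw [← adjoint_holeOp, ContinuousLinearMap.adjoint_inner_left]

theorem holeOp_compl_eq (i : Fin N) (f : OneBody) :
    holeOp {i}ᶜ f = holeOp Finset.univ f + rankOne i f f := by
  rw [holeOp, holeOp, ← Finset.sum_compl_add_sum {i} fun m => rankOne m f f,
    Finset.sum_singleton]
  abel

theorem commute_holeOp_compl_orbProj (φ : Fin N → OneBody) (i : Fin N) (f : OneBody) :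
    Commute (holeOp {i}ᶜ f) (orbProj φ i) := by
  refine ((Commute.one_left _).smul_left _).sub_left (Commute.sum_left _ _ _ fun m hm => ?_)
  exact (commute_orbProj_rankOne φ (by simpa [eq_comm] using hm) f f).symm

theorem commute_holeOp_compl_probeOp (hm : Measurable v) (hb : ∃ C, ∀ x, |v x| ≤ C) (i : Fin N)
    (f : OneBody) (y : R3) : Commute (holeOp {i}ᶜ f) (probeOp v i y) := by
  refine ((Commute.one_left _).smul_left _).sub_left (Commute.sum_left _ _ _ fun m hm' => ?_)
  refine (mulOp_commute_rankOne (bddMeas_probe hm hb i y) m (fun x z => ?_) f f).symm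
  rw [Function.update_of_ne]
  rintro rfl; simp at hm'

/-- If no particle at all is in f, then no particle other than i is: the two operators differ by
|f⟩⟨f|_i, which annihilates the state. -/
theorem AntisymmOn.holeOp_compl_holeOp {χ : ManyBody N} (h : AntisymmOn Finset.univ χ) (i : Fin N)
    (f : OneBody) : holeOp {i}ᶜ f (holeOp Finset.univ f χ)
      = ((‖f‖ : ℂ) ^ 2) • holeOp Finset.univ f χ := by
  rw [holeOp_compl_eq, _root_.add_apply, h.holeOp_holeOp, h.rankOne_holeOp (Finset.mem_univ i),
    add_zero]

/-- Pointwise bound on the direct term. -/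
theorem PairBounds.norm_sum_direct_le (h : PairBounds v φ d₀ b₁ b₂) (hN : 0 < N)
    (hφ : Orthonormal ℂ φ) {χ χ' : ManyBody N} (hχ : AntisymmOn Finset.univ χ)
    (hχ' : AntisymmOn Finset.univ χ') (f : OneBody) (y : R3) {t : ℝ} (ht : 0 < t) :
    ‖∑ i, ⟪orbProj φ i (holeOp Finset.univ f χ), probeOp v i y
        ((1 - orbProj φ i : ManyBody N →L[ℂ] ManyBody N) χ')⟫_ℂ‖
      ≤ (t * (b₁ * (⟪χ, holeOp Finset.univ f χ⟫_ℂ).re)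
        + t⁻¹ * ∑ i, (⟪(1 - orbProj φ i : ManyBody N →L[ℂ] ManyBody N) χ', holeOp {i}ᶜ f
          ((1 - orbProj φ i : ManyBody N →L[ℂ] ManyBody N) χ')⟫_ℂ).re) / 2 := by
  by_cases hf : f = 0
  · simp [hf, holeOp_apply, rankOne_zero_right]
  have hf' : 0 < ‖f‖ ^ 2 := by positivity
  have hc : ((‖f‖ : ℂ) ^ 2) ≠ 0 := by exact_mod_cast hf'.ne'
  set ω := holeOp Finset.univ f χ with hω
  have hωa : AntisymmOn Finset.univ ω := hχ.holeOp_apply_univ f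
  set β : Fin N → ManyBody N := fun i => (1 - orbProj φ i : ManyBody N →L[ℂ] ManyBody N) χ' with hβ
  have hβa : ∀ i, AntisymmOn {i}ᶜ (β i) := fun i =>
    (hχ'.mono (Finset.subset_univ _)).one_sub_orbProj_apply φ (by simp)
  -- The left vector is an eigenvector, with eigenvalue ‖f‖², of the hole operator of the particles
  -- other than i. That operator can therefore be inserted and moved to the right, so both sides
  -- carry a hole and the bound involves hole expectations on both sides.
  have h1 : ∀ i, ((‖f‖ : ℂ) ^ 2) * ⟪orbProj φ i ω, probeOp v i y (β i)⟫_ℂ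
      = ⟪probeOp v i y (orbProj φ i ω), holeOp {i}ᶜ f (β i)⟫_ℂ := by
    intro i
    have h2 : holeOp {i}ᶜ f (orbProj φ i ω) = ((‖f‖ : ℂ) ^ 2) • orbProj φ i ω := by
      rw [← mul_apply_eq_comp, (commute_holeOp_compl_orbProj φ i f).eq, mul_apply_eq_comp, hω,
        hχ.holeOp_compl_holeOp, map_smul]
    have h3 : ((‖f‖ : ℂ) ^ 2) * ⟪orbProj φ i ω, probeOp v i y (β i)⟫_ℂ
        = ⟪((‖f‖ : ℂ) ^ 2) • orbProj φ i ω, probeOp v i y (β i)⟫_ℂ := by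
      rw [inner_smul_left]; simp
    have h9 : holeOp {i}ᶜ f (probeOp v i y (β i)) = probeOp v i y (holeOp {i}ᶜ f (β i)) := by
      rw [← mul_apply_eq_comp, (commute_holeOp_compl_probeOp h.meas h.bdd i f y).eq,
        mul_apply_eq_comp]
    rw [h3, ← h2, inner_holeOp_left, h9, inner_probeOp_left h.meas h.bdd]
  have h4 : ‖f‖ ^ 2 * ‖∑ i, ⟪orbProj φ i ω, probeOp v i y (β i)⟫_ℂ‖
      ≤ (t * ∑ i, ‖probeOp v i y (orbProj φ i ω)‖ ^ 2
        + t⁻¹ * ∑ i, ‖holeOp {i}ᶜ f (β i)‖ ^ 2) / 2 := by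
    have h5 : ‖f‖ ^ 2 * ‖∑ i, ⟪orbProj φ i ω, probeOp v i y (β i)⟫_ℂ‖
        = ‖∑ i, ⟪probeOp v i y (orbProj φ i ω), holeOp {i}ᶜ f (β i)⟫_ℂ‖ := by
      simp_rw [← h1, ← Finset.mul_sum]
      rw [norm_mul, norm_pow, Complex.norm_real, norm_norm]
    rw [h5]
    refine (norm_sum_le _ _).trans
      ((Finset.sum_le_sum fun i _ => norm_inner_le_weighted _ _ ht).trans (le_of_eq ?_))
    rw [← Finset.sum_div, Finset.sum_add_distrib, ← Finset.mul_sum, ← Finset.mul_sum]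
  have h6 := h.sum_norm_probeOp_orbProj_sq_le hN hφ y hωa
  rw [hχ.norm_holeOp_sq] at h6
  simp_rw [(hβa _).norm_holeOp_sq f, ← Finset.mul_sum] at h4
  have h7 := mul_le_mul_of_nonneg_left h6 ht.le
  have h8 : ‖f‖ ^ 2 * ‖∑ i, ⟪orbProj φ i ω, probeOp v i y (β i)⟫_ℂ‖
      ≤ ‖f‖ ^ 2 * ((t * (b₁ * (⟪χ, ω⟫_ℂ).re)
        + t⁻¹ * ∑ i, (⟪β i, holeOp {i}ᶜ f (β i)⟫_ℂ).re) / 2) := by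
    refine h4.trans ?_
    have : ‖f‖ ^ 2 * ((t * (b₁ * (⟪χ, ω⟫_ℂ).re)
        + t⁻¹ * ∑ i, (⟪β i, holeOp {i}ᶜ f (β i)⟫_ℂ).re) / 2)
        = (t * (b₁ * (‖f‖ ^ 2 * (⟪χ, ω⟫_ℂ).re))
        + t⁻¹ * (‖f‖ ^ 2 * ∑ i, (⟪β i, holeOp {i}ᶜ f (β i)⟫_ℂ).re)) / 2 := by ring
    rw [this]
    linarith
  exact le_of_mul_le_mul_left h8 hf'

/-- The exchange potential applied to the orbital `φ_b`, at the point `x`. -/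
def exchangeCoeff (v : R3 → ℝ) (φ : Fin N → OneBody) (b : Fin N) (x : R3) : ℂ :=
  ∑ a, overlap v (φ a) (φ b) x * φ a x

/-- The coefficients are inner products of one vector, v(x - ·) f_x, with the orthonormal orbitals.
Bessel's inequality bounds their sum by its norm, and |f_x(y)|² ≤ ρ(x) ρ(y) by Cauchy-Schwarz. -/
theorem sum_enorm_exchangeCoeff_sq_le (hm : Measurable v) (hb : ∃ C, ∀ x, |v x| ≤ C)
    (hφ : Orthonormal ℂ φ) (x : R3) :
    ∑ b, ‖exchangeCoeff v φ b x‖ₑ ^ 2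
      ≤ (∫⁻ y, ‖v (x - y)‖ₑ ^ 2 * edensity φ y) * edensity φ x := by
  have hh : BddMeas fun y => (v (x - y) : ℂ) :=
    bddMeas_ofReal_comp hm hb (measurable_const.sub measurable_id)
  set g : OneBody := mulOp volume (fun y => (v (x - y) : ℂ)) (orbitalAt φ x) with hg
  have h1 : ∀ b, exchangeCoeff v φ b x = ⟪g, φ b⟫_ℂ := by
    intro b
    have h2 : ∀ a, ⟪mulOp volume (fun y => (v (x - y) : ℂ)) (φ a), φ b⟫_ℂ
        = overlap v (φ a) (φ b) x := by
      intro a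
      rw [L2_inner_eq, overlap]
      refine integral_congr_ae ?_
      filter_upwards [coeFn_mulOp hh (φ a)] with y hy
      rw [hy, map_mul, Complex.conj_ofReal]
      ring
    rw [hg, orbitalAt, orbitalCombination, map_sum, sum_inner, exchangeCoeff]
    refine Finset.sum_congr rfl fun a _ => ?_
    rw [map_smul, inner_smul_left, Complex.conj_conj, h2, mul_comm]
  have h3 : ∑ b, ‖exchangeCoeff v φ b x‖ₑ ^ 2 ≤ ‖g‖ₑ ^ 2 := by
    have h4 := hφ.sum_inner_products_le (s := Finset.univ) g
    have h5 := ENNReal.ofReal_le_ofReal h4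
    rw [ENNReal.ofReal_sum_of_nonneg fun _ _ => by positivity] at h5
    simp_rw [ENNReal.ofReal_pow (norm_nonneg _), ofReal_norm] at h5
    refine le_trans (le_of_eq (Finset.sum_congr rfl fun b _ => ?_)) h5
    rw [h1, ← ofReal_norm, norm_inner_symm, ofReal_norm]
  refine h3.trans ?_
  rw [hg, enorm_mulOp_sq hh, ← lintegral_mul_const]
  · have h6 : orbitalAt φ x =ᵐ[volume] fun y => ∑ a, conj (φ a x) * φ a y := by
      have h7 : ∀ᵐ y, ∀ a, (conj (φ a x) • φ a : OneBody) y = conj (φ a x) * φ a y :=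
        ae_all_iff.2 fun a => Lp.coeFn_smul (conj (φ a x)) (φ a)
      filter_upwards [coeFn_sum Finset.univ fun a => conj (φ a x) • φ a, h7] with y h8 h9
      rw [orbitalAt, orbitalCombination, h8]
      simp_rw [h9]
    refine lintegral_mono_ae ?_
    filter_upwards [h6] with y hy
    rw [hy, enorm_ofReal_complex, mul_assoc]
    refine mul_le_mul_right ?_ _
    have h10 : ‖∑ a, conj (φ a x) * φ a y‖ ^ 2 ≤ (∑ a, ‖φ a y‖ ^ 2) * ∑ a, ‖φ a x‖ ^ 2 := by
      have h11 : ‖∑ a, conj (φ a x) * φ a y‖ ≤ ∑ a, ‖φ a y‖ * ‖φ a x‖ :=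
        (norm_sum_le _ _).trans (le_of_eq (Finset.sum_congr rfl fun a _ => by
          rw [norm_mul, RCLike.norm_conj, mul_comm]))
      exact (pow_le_pow_left₀ (norm_nonneg _) h11 2).trans (Finset.sum_mul_sq_le_sq_mul_sq _ _ _)
    have h12 := ENNReal.ofReal_le_ofReal h10
    rw [ENNReal.ofReal_mul (by positivity), ENNReal.ofReal_sum_of_nonneg fun _ _ => by positivity,
      ENNReal.ofReal_sum_of_nonneg fun _ _ => by positivity] at h12
    simp_rw [ENNReal.ofReal_pow (norm_nonneg _), ofReal_norm] at h12
    exact h12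
  · exact ((hm.comp (measurable_const.sub measurable_id)).enorm.pow_const _).mul
      (measurable_edensity φ)

/-- The exchange term. -/
def exchangeState (v : R3 → ℝ) (φ : Fin N → OneBody) (i : Fin N) (χ : ManyBody N) : ManyBody N :=
  ∑ a, ∑ b, coordOp (overlap v (φ a) (φ b)) i (rankOne i (φ a) (φ b) χ)

/-- Collecting the first orbital sum into coefficients at x_i gives a sum of contractions, to which
the fermionic contraction bound with κ = 1 applies. -/
theorem PairBounds.sum_norm_exchangeState_sq_le (h : PairBounds v φ d₀ b₁ b₂) (hN : 0 < N)
    (hφ : Orthonormal ℂ φ) {χ : ManyBody N} (hχ : AntisymmOn Finset.univ χ) :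
    ∑ i, ‖exchangeState v φ i χ‖ ^ 2 ≤ b₂ * ‖χ‖ ^ 2 := by
  refine sum_norm_sq_le_of_enorm h.b₂_nonneg ?_
  have hc : ∀ b, Measurable (exchangeCoeff v φ b) := fun b =>
    Finset.measurable_fun_sum _ fun a _ => (bddMeas_overlap h.meas h.bdd (φ a) (φ b)).1.mul
      (Lp.stronglyMeasurable (φ a)).measurable
  have h1 : ∀ i, exchangeState v φ i χ =ᵐ[volume]
      fun x => ∑ b, exchangeCoeff v φ b (x i) * contract (φ b) i χ x := by
    intro i
    have h2 : ∀ᵐ x : Fin N → R3, ∀ a b, coordOp (overlap v (φ a) (φ b)) i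
        (rankOne i (φ a) (φ b) χ) x
        = overlap v (φ a) (φ b) (x i) * (φ a (x i) * contract (φ b) i χ x) :=
      ae_all_iff.2 fun a => ae_all_iff.2 fun b => by
        filter_upwards [coeFn_mulOp ((bddMeas_overlap h.meas h.bdd (φ a) (φ b)).comp
          (measurable_pi_apply i)) (rankOne i (φ a) (φ b) χ), coeFn_rankOne i (φ a) (φ b) χ]
          with x h3 h4
        rw [coordOp, h3, h4]
    have h5 : ∀ᵐ x : Fin N → R3, ∀ a, (∑ b, coordOp (overlap v (φ a) (φ b)) i
        (rankOne i (φ a) (φ b) χ) : ManyBody N) x = ∑ b, coordOp (overlap v (φ a) (φ b)) i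
        (rankOne i (φ a) (φ b) χ) x := ae_all_iff.2 fun a => coeFn_sum _ _
    filter_upwards [h2, h5, coeFn_sum Finset.univ fun a => ∑ b, coordOp (overlap v (φ a) (φ b)) i
        (rankOne i (φ a) (φ b) χ)] with x h6 h7 h8
    rw [exchangeState, h8]
    simp_rw [h7, h6, exchangeCoeff, Finset.sum_mul]
    rw [Finset.sum_comm]
    simp_rw [mul_assoc]
  have h2 : ∀ i, ‖exchangeState v φ i χ‖ₑ ^ 2
      = ∫⁻ x, 1 * ‖∑ b, exchangeCoeff v φ b (x i) * contract (φ b) i χ x‖ₑ ^ 2 := fun i => by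
    rw [Lp_enorm_sq]
    refine lintegral_congr_ae ?_
    filter_upwards [h1 i] with x hx
    rw [hx, one_mul]
  simp_rw [h2]
  refine (hχ.sum_lintegral_contract_le hN hφ hc (κ := fun _ _ => 1) measurable_const
    fun _ _ _ _ _ => rfl).trans ?_
  rw [lintegral_const_mul _ ((Lp.stronglyMeasurable χ).measurable.enorm.pow_const _), Lp_enorm_sq]
  refine mul_le_mul_left ((lintegral_mono fun y => ?_).trans h.integral_sq) _
  rw [one_mul]
  exact sum_enorm_exchangeCoeff_sq_le h.meas h.bdd hφ y

theorem overlap_sum_eq_meanField (hm : Measurable v) (hb : ∃ C, ∀ x, |v x| ≤ C)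
    (φ : Fin N → OneBody) (x : R3) :
    ∑ a, overlap v (φ a) (φ a) x = (meanField v φ x : ℂ) := by
  obtain ⟨C, hC⟩ := hb
  have h1 : ∀ a, Integrable fun y => conj (φ a y) * φ a y * (v (x - y) : ℂ) := fun a =>
    (integrable_conj_mul (φ a) (φ a)).mul_bdd (Complex.measurable_ofReal.comp
      (hm.comp (measurable_const.sub measurable_id))).aestronglyMeasurable (c := C)
      (Filter.Eventually.of_forall fun y => by
        simp only [Complex.norm_real]; exact hC _)
  simp_rw [overlap]
  have h2 : (meanField v φ x : ℂ) = ∫ y, ((v (x - y) * density φ y : ℝ) : ℂ) := integral_ofReal.symm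
  rw [← integral_finsetSum _ fun a _ => h1 a, h2]
  refine integral_congr_ae (Filter.Eventually.of_forall fun y => ?_)
  simp only [density]
  rw [← Finset.sum_mul, Complex.ofReal_mul, mul_comm]
  congr 1
  push_cast
  refine Finset.sum_congr rfl fun a _ => ?_
  rw [mul_comm, Complex.mul_conj, Complex.normSq_eq_norm_sq, Complex.ofReal_pow]

/-- The mean field acting on the particle `i`. -/
def meanFieldOp (v : R3 → ℝ) (φ : Fin N → OneBody) (i : Fin N) : ManyBody N →L[ℂ] ManyBody N :=
  coordOp (fun x => (meanField v φ x : ℂ)) i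

theorem meanFieldOp_eq (hm : Measurable v) (hb : ∃ C, ∀ x, |v x| ≤ C) (φ : Fin N → OneBody)
    (i : Fin N) : meanFieldOp v φ i = ∑ a, coordOp (overlap v (φ a) (φ a)) i := by
  have h1 := fun a => bddMeas_overlap hm hb (φ a) (φ a)
  have h2 : BddMeas fun x => ∑ a, overlap v (φ a) (φ a) x := by
    choose C hC using fun a => (h1 a).2
    exact ⟨Finset.measurable_fun_sum _ fun a _ => (h1 a).1, ∑ a, C a, fun x =>
      (norm_sum_le _ _).trans (Finset.sum_le_sum fun a _ => hC a x)⟩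
  rw [meanFieldOp]
  simp_rw [← overlap_sum_eq_meanField hm hb]
  ext1 ψ
  refine Lp.ext ?_
  rw [_root_.sum_apply]
  have h3 : ∀ᵐ x : Fin N → R3, ∀ a, coordOp (overlap v (φ a) (φ a)) i ψ x
      = overlap v (φ a) (φ a) (x i) * ψ x := ae_all_iff.2 fun a =>
    coeFn_mulOp ((h1 a).comp (measurable_pi_apply i)) ψ
  filter_upwards [coeFn_mulOp (h2.comp (measurable_pi_apply i)) ψ, h3,
    coeFn_sum Finset.univ fun a => coordOp (overlap v (φ a) (φ a)) i ψ] with x h4 h5 h6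
  rw [h6, coordOp, h4, Finset.sum_mul]
  exact Finset.sum_congr rfl fun a _ => (h5 a).symm

theorem orbProj_pairOp_orbProj (hm : Measurable v) (hb : ∃ C, ∀ x, |v x| ≤ C)
    (φ : Fin N → OneBody) {i j : Fin N} (hij : i ≠ j) :
    orbProj φ j * pairOp v i j * orbProj φ j
      = ∑ a, ∑ b, coordOp (overlap v (φ a) (φ b)) i * rankOne j (φ a) (φ b) := by
  simp_rw [orbProj, Finset.sum_mul, Finset.mul_sum, rankOne_mul_pairOp_mul_rankOne hm hb hij]

theorem Orthonormal.orbProj_mul_rankOne (hφ : Orthonormal ℂ φ) (m j : Fin N) (g : OneBody) :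
    orbProj φ m * rankOne m (φ j) g = rankOne m (φ j) g := by
  rw [orbProj, Finset.sum_mul, Finset.sum_eq_single_of_mem j (Finset.mem_univ j)]
  · rw [rankOne_mul_rankOne, inner_self_eq_norm_sq_to_K, hφ.1]
    simp
  · intro k _ hkj
    rw [rankOne_mul_rankOne, hφ.2 hkj, zero_smul]

/-- The terms with one transition between `p` and `q`, the other particle being in `p`, together
with the mean field. -/
theorem PairBounds.norm_sum_pp_qp_le (h : PairBounds v φ d₀ b₁ b₂) (hN : 0 < N)
    (hφ : Orthonormal ℂ φ) {χ χ' : ManyBody N} (hχ : AntisymmOn Finset.univ χ)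
    (hχ' : AntisymmOn Finset.univ χ') {t s : ℝ} (ht : 0 < t) (hs : 0 < s) :
    ‖∑ i, ∑ j ∈ {i}ᶜ, ⟪χ, (orbProj φ i * orbProj φ j * pairOp v i j *
        ((1 - orbProj φ i) * orbProj φ j)) χ'⟫_ℂ
      - ∑ i, ⟪χ, (orbProj φ i * meanFieldOp v φ i * (1 - orbProj φ i)) χ'⟫_ℂ‖
      ≤ (t * (b₁ * ∑ j, ‖(1 - orbProj φ j : ManyBody N →L[ℂ] ManyBody N) χ‖ ^ 2)
        + t⁻¹ * ∑ i, (⟪(1 - orbProj φ i : ManyBody N →L[ℂ] ManyBody N) χ',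
        numOp (orbProj φ) ((1 - orbProj φ i : ManyBody N →L[ℂ] ManyBody N) χ')⟫_ℂ).re) / 2
      + (s * (b₂ * ‖χ‖ ^ 2)
        + s⁻¹ * ∑ i, ‖(1 - orbProj φ i : ManyBody N →L[ℂ] ManyBody N) χ'‖ ^ 2) / 2 := by
  have hp := commIdem_orbProj hφ
  set β : Fin N → ManyBody N := fun i => (1 - orbProj φ i : ManyBody N →L[ℂ] ManyBody N) χ' with hβ
  set R : Fin N → R3 → ManyBody N →L[ℂ] ManyBody N :=
    fun j y => rankOne j (orbitalAt φ y) (orbitalAt φ y) with hR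
  -- the integrands
  have iR := fun i j => integrable_inner_probeOp_rankOne h.meas h.bdd φ i j (orbProj φ i χ) (β i)
  have iM := fun i => integrable_inner_probeOp_norm h.meas h.bdd hφ i (orbProj φ i χ) (β i)
  have iX := fun i => integrable_inner_probeOp_rankOne h.meas h.bdd φ i i (β i) χ
  set F : R3 → ℂ := fun y => ∑ i, ∑ j ∈ {i}ᶜ, ⟪orbProj φ i χ, probeOp v i y (R j y (β i))⟫_ℂ
    - ∑ i, (‖orbitalAt φ y‖ : ℂ) ^ 2 * ⟪orbProj φ i χ, probeOp v i y (β i)⟫_ℂ with hF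
  -- The exchange term: the sum over j ≠ i lacks the index i, and X compensates for it.
  set X : R3 → ℂ := fun y => ∑ i, conj ⟪β i, probeOp v i y (R i y χ)⟫_ℂ with hX
  have hFi : Integrable F := (integrable_finsetSum _ fun i _ => integrable_finsetSum _ fun j _ =>
    (iR i j).1).sub (integrable_finsetSum _ fun i _ => (iM i).1)
  have iX' : ∀ i, Integrable fun y => conj ⟪β i, probeOp v i y (R i y χ)⟫_ℂ := fun i =>
    (Complex.conjCLE : ℂ →L[ℝ] ℂ).integrable_comp (iX i).1
  have hXi : Integrable X := integrable_finsetSum _ fun i _ => iX' i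
  have hFint : ∑ i, ∑ j ∈ {i}ᶜ, ⟪χ, (orbProj φ i * orbProj φ j * pairOp v i j *
        ((1 - orbProj φ i) * orbProj φ j)) χ'⟫_ℂ
      - ∑ i, ⟪χ, (orbProj φ i * meanFieldOp v φ i * (1 - orbProj φ i)) χ'⟫_ℂ = ∫ y, F y := by
    rw [hF, integral_sub (integrable_finsetSum _ fun i _ => integrable_finsetSum _ fun j _ =>
      (iR i j).1) (integrable_finsetSum _ fun i _ => (iM i).1),
      integral_finsetSum _ fun i _ => integrable_finsetSum _ fun j _ => (iR i j).1,
      integral_finsetSum _ fun i _ => (iM i).1]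
    congr 1
    · refine Finset.sum_congr rfl fun i _ => ?_
      rw [integral_finsetSum _ fun j _ => (iR i j).1]
      refine Finset.sum_congr rfl fun j hj => ?_
      have hij : i ≠ j := by simpa [eq_comm] using hj
      rw [(iR i j).2]
      have e1 : orbProj φ i * orbProj φ j * pairOp v i j * ((1 - orbProj φ i) * orbProj φ j)
          = orbProj φ i * (orbProj φ j * pairOp v i j * orbProj φ j) * (1 - orbProj φ i) := by
        rw [(hp.comm_one_sub j i).eq.symm]
        noncomm_ring
      rw [e1, orbProj_pairOp_orbProj h.meas h.bdd φ hij, mul_apply_eq_comp, mul_apply_eq_comp,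
        ← inner_orbProj_left]
      simp only [_root_.sum_apply, inner_sum, mul_apply_eq_comp]
      rfl
    · refine Finset.sum_congr rfl fun i _ => ?_
      rw [(iM i).2, mul_apply_eq_comp, mul_apply_eq_comp, ← inner_orbProj_left,
        meanFieldOp_eq h.meas h.bdd, _root_.sum_apply, inner_sum]
  have hXint : ∫ y, X y = ∑ i, ⟪exchangeState v φ i χ, β i⟫_ℂ := by
    rw [hX, integral_finsetSum _ fun i _ => iX' i]
    refine Finset.sum_congr rfl fun i _ => ?_
    rw [integral_conj, (iX i).2, ← inner_conj_symm (exchangeState v φ i χ), exchangeState]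
    simp only [inner_sum]
  -- At fixed y, interaction minus mean field is minus the hole operator of the particles other than
  -- i. Moved to the left, past p_i, it becomes the full hole operator of χ plus an occupation term
  -- of particle i; the latter is cancelled by X.
  have hFX : ∀ y, F y + X y = -∑ i, ⟪orbProj φ i (holeOp Finset.univ (orbitalAt φ y) χ),
      probeOp v i y (β i)⟫_ℂ := by
    intro y
    have e1 : ∀ i, orbProj φ i (R i y χ) = R i y χ := fun i => by
      rw [hR]
      simp only [rankOne_orbitalAt, ← mul_apply_eq_comp, Finset.mul_sum, mul_smul_comm,
        hφ.orbProj_mul_rankOne]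
    rw [hF, hX]
    simp only
    rw [← Finset.sum_sub_distrib, ← Finset.sum_add_distrib, ← Finset.sum_neg_distrib]
    refine Finset.sum_congr rfl fun i _ => ?_
    have e2 : ∑ j ∈ {i}ᶜ, ⟪orbProj φ i χ, probeOp v i y (R j y (β i))⟫_ℂ
        - (‖orbitalAt φ y‖ : ℂ) ^ 2 * ⟪orbProj φ i χ, probeOp v i y (β i)⟫_ℂ
        = -⟪orbProj φ i χ, probeOp v i y (holeOp {i}ᶜ (orbitalAt φ y) (β i))⟫_ℂ := by
      rw [holeOp_apply, map_sub, map_smul, map_sum, inner_sub_right, inner_sum, inner_smul_right,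
        neg_sub]
    have e3 : probeOp v i y (holeOp {i}ᶜ (orbitalAt φ y) (β i))
        = holeOp {i}ᶜ (orbitalAt φ y) (probeOp v i y (β i)) := by
      rw [← mul_apply_eq_comp, ← (commute_holeOp_compl_probeOp h.meas h.bdd i _ y).eq,
        mul_apply_eq_comp]
    have e4 : holeOp {i}ᶜ (orbitalAt φ y) (orbProj φ i χ)
        = orbProj φ i (holeOp Finset.univ (orbitalAt φ y) χ) + R i y χ := by
      rw [← mul_apply_eq_comp, (commute_holeOp_compl_orbProj φ i _).eq, mul_apply_eq_comp,
        holeOp_compl_eq, _root_.add_apply, map_add]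
      exact congrArg _ (e1 i)
    rw [e2, e3, ← inner_holeOp_left, e4, inner_add_left, inner_conj_symm,
      inner_probeOp_left h.meas h.bdd]
    ring
  rw [hFint]
  have hsplit : ∫ y, F y = (∫ y, (F y + X y)) - ∫ y, X y := by
    rw [integral_add hFi hXi]; ring
  rw [hsplit]
  refine (norm_sub_le _ _).trans (add_le_add ?_ ?_)
  · have i1 := integral_holeOp_orbitalAt hφ Finset.univ χ
    have i2 := fun i => integral_holeOp_orbitalAt hφ {i}ᶜ (β i)
    have i3 : Integrable fun y => (t * (b₁ * (⟪χ, holeOp Finset.univ (orbitalAt φ y) χ⟫_ℂ).re)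
        + t⁻¹ * ∑ i, (⟪β i, holeOp {i}ᶜ (orbitalAt φ y) (β i)⟫_ℂ).re) / 2 :=
      (((i1.1.const_mul b₁).const_mul t).add
        ((integrable_finsetSum _ fun i _ => (i2 i).1).const_mul t⁻¹)).div_const 2
    refine (norm_integral_le_of_norm_le i3 (Filter.Eventually.of_forall fun y => ?_)).trans
      (le_of_eq ?_)
    · rw [hFX, norm_neg]
      exact h.norm_sum_direct_le hN hφ hχ hχ' _ y ht
    · rw [integral_div, integral_add ((i1.1.const_mul b₁).const_mul t)
        ((integrable_finsetSum _ fun i _ => (i2 i).1).const_mul t⁻¹), integral_const_mul,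
        integral_const_mul, integral_const_mul, integral_finsetSum _ fun i _ => (i2 i).1, i1.2]
      simp_rw [(i2 _).2]
      -- As n = N - ∑ p_m, the integrated hole expectations are expectations of n. In q_i χ' the
      -- missing index m = i makes no difference because p_i q_i = 0.
      have e0 : ∀ χ : ManyBody N, (⟪χ, numOp (orbProj φ) χ⟫_ℂ).re
          = N * ‖χ‖ ^ 2 - ∑ m, (⟪χ, orbProj φ m χ⟫_ℂ).re := by
        intro χ
        rw [numOp, _root_.sum_apply, inner_sum, Complex.re_sum]
        simp_rw [sub_apply, one_apply_eq_self, inner_sub_right, Complex.sub_re]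
        rw [Finset.sum_sub_distrib, Finset.sum_const, Finset.card_univ, Fintype.card_fin,
          nsmul_eq_mul]
        congr 2
        exact inner_self_eq_norm_sq (𝕜 := ℂ) χ
      rw [sum_norm_one_sub_orbProj_sq hφ, e0]
      congr 4
      funext i
      rw [e0, ← Finset.sum_compl_add_sum {i} fun m => (⟪β i, orbProj φ m (β i)⟫_ℂ).re,
        Finset.sum_singleton]
      have : orbProj φ i (β i) = 0 := by
        rw [hβ]
        simp only
        rw [← mul_apply_eq_comp, hp.mul_one_sub, _root_.zero_apply]
      rw [this, inner_zero_right, Complex.zero_re, add_zero]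
  · rw [hXint]
    refine (norm_sum_le _ _).trans ((Finset.sum_le_sum fun i _ => norm_inner_le_weighted _ _
      hs).trans ?_)
    rw [← Finset.sum_div, Finset.sum_add_distrib, ← Finset.mul_sum, ← Finset.mul_sum]
    have := mul_le_mul_of_nonneg_left (h.sum_norm_exchangeState_sq_le hN hφ hχ) hs.le
    linarith

end SingleExcitation

/-! ### The weight function -/

section Weight

variable {N : ℕ} {γ : ℝ}

theorem one_le_rpow_of_pos (hN : 0 < N) (hγ : 0 < γ) : 1 ≤ (N : ℝ) ^ γ :=
  Real.one_le_rpow (by exact_mod_cast hN) hγ.le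

theorem weightM_eq_min (hN : 0 < N) (hγ : 0 < γ) (k : ℕ) :
    weightM N γ k = min ((k : ℝ) / (N : ℝ) ^ γ) 1 := by
  have hL := one_le_rpow_of_pos hN hγ
  unfold weightM
  split_ifs with h
  · rw [min_eq_left ((div_le_one (by linarith)).2 h)]
  · rw [min_eq_right ((one_le_div (by linarith)).2 (not_le.1 h).le)]

theorem weightM_mono (hN : 0 < N) (hγ : 0 < γ) : Monotone (weightM N γ) := by
  intro k l hkl
  rw [weightM_eq_min hN hγ, weightM_eq_min hN hγ]
  have hL := one_le_rpow_of_pos hN hγ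
  exact min_le_min_right _ (div_le_div_of_nonneg_right (by exact_mod_cast hkl) (by linarith))

theorem weightM_nonneg (hN : 0 < N) (hγ : 0 < γ) (k : ℕ) : 0 ≤ weightM N γ k := by
  rw [weightM_eq_min hN hγ]
  have hL := one_le_rpow_of_pos hN hγ
  positivity

theorem weightM_add_sub_le (hN : 0 < N) (hγ : 0 < γ) (k c : ℕ) :
    weightM N γ (k + c) - weightM N γ k ≤ c / (N : ℝ) ^ γ ∧
      ((N : ℝ) ^ γ ≤ k → weightM N γ (k + c) - weightM N γ k = 0) := by
  have hL := one_le_rpow_of_pos hN hγ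
  have hL' : 0 < (N : ℝ) ^ γ := by linarith
  rw [weightM_eq_min hN hγ, weightM_eq_min hN hγ]
  have hc : (0 : ℝ) ≤ c / (N : ℝ) ^ γ := by positivity
  constructor
  · push_cast
    rw [add_div]
    rcases min_cases ((k : ℝ) / (N : ℝ) ^ γ) 1 with ⟨h1, _⟩ | ⟨h1, _⟩ <;> rw [h1]
    · linarith [min_le_left ((k : ℝ) / (N : ℝ) ^ γ + c / (N : ℝ) ^ γ) 1]
    · linarith [min_le_right ((k : ℝ) / (N : ℝ) ^ γ + c / (N : ℝ) ^ γ) 1]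
  · intro h
    rw [min_eq_right ((one_le_div hL').2 h), min_eq_right ((one_le_div hL').2 ?_), sub_self]
    push_cast
    linarith [(Nat.cast_nonneg c : (0 : ℝ) ≤ c)]

theorem upWeight_sq (hN : 0 < N) (hγ : 0 < γ) (c k : ℕ) :
    upWeight (weightM N γ) c k ^ 2 = weightM N γ (k + c) - weightM N γ k :=
  Real.sq_sqrt (sub_nonneg.2 (weightM_mono hN hγ (Nat.le_add_right k c)))

theorem upWeight_sq_le (hN : 0 < N) (hγ : 0 < γ) (c k : ℕ) :
    upWeight (weightM N γ) c k ^ 2 ≤ c / (N : ℝ) ^ γ :=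
  (upWeight_sq hN hγ c k).trans_le (weightM_add_sub_le hN hγ k c).1

/-- The increment vanishes for k ≥ N^γ, and for smaller k the weight is linear, so that k c / N^γ is
c times the weight. -/
theorem mul_upWeight_sq_le (hN : 0 < N) (hγ : 0 < γ) (c k : ℕ) :
    k * upWeight (weightM N γ) c k ^ 2 ≤ c * weightM N γ k := by
  have hL := one_le_rpow_of_pos hN hγ
  by_cases h : (N : ℝ) ^ γ ≤ k
  · rw [upWeight_sq hN hγ, (weightM_add_sub_le hN hγ k c).2 h, mul_zero]
    exact mul_nonneg (Nat.cast_nonneg _) (weightM_nonneg hN hγ k)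
  · refine (mul_le_mul_of_nonneg_left (upWeight_sq_le hN hγ c k) (Nat.cast_nonneg k)).trans
      (le_of_eq ?_)
    rw [weightM, if_pos (not_le.1 h).le]
    ring

/-- A nonzero increment below k = l + c needs l < N^γ, hence k ≤ (c + 1) N^γ, where N^γ ≥ 1 is used.
The weight at k may already be capped at 1, which costs the factor c + 1; each additional power of k
costs another (c + 1) N^γ. -/
theorem mul_downWeight_sq_le (hN : 0 < N) (hγ : 0 < γ) (c k : ℕ) :
    k * downWeight (weightM N γ) c k ^ 2 ≤ c * (c + 1) * weightM N γ k ∧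
    k ^ 2 * downWeight (weightM N γ) c k ^ 2
      ≤ c * (c + 1) ^ 2 * (N : ℝ) ^ γ * weightM N γ k := by
  have hL := one_le_rpow_of_pos hN hγ
  have hL' : 0 < (N : ℝ) ^ γ := by linarith
  have hw := weightM_nonneg hN hγ k
  have hc0 : (0 : ℝ) ≤ c := Nat.cast_nonneg c
  have hk0 : (0 : ℝ) ≤ k := Nat.cast_nonneg k
  have hz : (0 : ℝ) ≤ c * (c + 1) * weightM N γ k ∧
      (0 : ℝ) ≤ c * (c + 1) ^ 2 * (N : ℝ) ^ γ * weightM N γ k := by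
    constructor <;> positivity
  by_cases hck : c ≤ k
  · obtain ⟨l, rfl⟩ := Nat.exists_eq_add_of_le' hck
    have hd : downWeight (weightM N γ) c (l + c) ^ 2 = weightM N γ (l + c) - weightM N γ l := by
      rw [downWeight, if_pos hck, Nat.add_sub_cancel]
      exact Real.sq_sqrt (sub_nonneg.2 (weightM_mono hN hγ (Nat.le_add_right l c)))
    rw [hd]
    by_cases h : (N : ℝ) ^ γ ≤ l
    · rw [(weightM_add_sub_le hN hγ l c).2 h, mul_zero, mul_zero]
      exact hz
    · have h1 := (weightM_add_sub_le hN hγ l c).1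
      have hk : ((l + c : ℕ) : ℝ) ≤ (c + 1) * (N : ℝ) ^ γ := by
        push_cast
        have := not_le.1 h
        nlinarith
      have h2 : ((l + c : ℕ) : ℝ) * (weightM N γ (l + c) - weightM N γ l)
          ≤ c * (c + 1) * weightM N γ (l + c) := by
        refine (mul_le_mul_of_nonneg_left h1 hk0).trans ?_
        have h3 : ((l + c : ℕ) : ℝ) / (N : ℝ) ^ γ ≤ (c + 1) * weightM N γ (l + c) := by
          rw [weightM]
          split_ifs with h4
          · have : 0 ≤ ((l + c : ℕ) : ℝ) / (N : ℝ) ^ γ := by positivity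
            nlinarith
          · rw [mul_one]
            exact (div_le_iff₀ hL').2 hk
        calc ((l + c : ℕ) : ℝ) * (c / (N : ℝ) ^ γ) = c * (((l + c : ℕ) : ℝ) / (N : ℝ) ^ γ) := by ring
          _ ≤ c * ((c + 1) * weightM N γ (l + c)) := mul_le_mul_of_nonneg_left h3 hc0
          _ = _ := by ring
      refine ⟨h2, ?_⟩
      calc ((l + c : ℕ) : ℝ) ^ 2 * (weightM N γ (l + c) - weightM N γ l)
          = ((l + c : ℕ) : ℝ) * (((l + c : ℕ) : ℝ) * (weightM N γ (l + c) - weightM N γ l)) := by ring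
        _ ≤ ((c + 1) * (N : ℝ) ^ γ) * (c * (c + 1) * weightM N γ (l + c)) :=
          mul_le_mul hk h2 (mul_nonneg hk0 (sub_nonneg.2
            (weightM_mono hN hγ (Nat.le_add_right l c)))) (by positivity)
        _ = _ := by ring
  · rw [downWeight, if_neg hck]
    simpa using hz

end Weight

/-! ### The commutator estimate for bounded interactions -/

section CommutatorEstimate

variable {N : ℕ} {v : R3 → ℝ} {φ : Fin N → OneBody} {γ D₀ D₁ b₂ : ℝ}

/-- The interaction minus the mean field. -/
def fluctuation (v : R3 → ℝ) (φ : Fin N → OneBody) : ManyBody N →L[ℂ] ManyBody N :=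
  (∑ i, ∑ j ∈ Finset.Ioi i, pairOp v i j) - ∑ i, meanFieldOp v φ i

theorem ofReal_density (φ : Fin N → OneBody) (y : R3) :
    ENNReal.ofReal (density φ y) = edensity φ y := by
  rw [density, ENNReal.ofReal_sum_of_nonneg fun _ _ => by positivity, edensity]
  simp_rw [ENNReal.ofReal_pow (norm_nonneg _), ofReal_norm]

theorem density_nonneg (φ : Fin N → OneBody) (y : R3) : 0 ≤ density φ y :=
  Finset.sum_nonneg fun _ _ => by positivity

theorem enorm_density (φ : Fin N → OneBody) (y : R3) : ‖density φ y‖ₑ = edensity φ y := by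
  rw [← ofReal_norm, Real.norm_of_nonneg (density_nonneg φ y), ofReal_density]

theorem abs_meanField_le {d₀ : ℝ} (hd : 0 ≤ d₀)
    (h : ∀ y, ∫⁻ x, ‖v (y - x)‖ₑ * edensity φ x ≤ ENNReal.ofReal d₀) (x : R3) :
    |meanField v φ x| ≤ d₀ := by
  have h1 : ‖meanField v φ x‖ₑ ≤ ENNReal.ofReal d₀ := by
    refine (enorm_integral_le_lintegral_enorm _).trans (le_trans (le_of_eq ?_) (h x))
    simp_rw [enorm_mul, enorm_density]
  rw [← ofReal_norm] at h1
  exact (ENNReal.ofReal_le_ofReal_iff hd).1 h1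

theorem measurable_density (φ : Fin N → OneBody) : Measurable (density φ) :=
  Finset.measurable_fun_sum _ fun j _ => (Lp.stronglyMeasurable (φ j)).measurable.norm.pow_const _

theorem measurable_meanField (hm : Measurable v) (φ : Fin N → OneBody) :
    Measurable (meanField v φ) := by
  have h1 : Measurable fun z : R3 × R3 => v (z.1 - z.2) * density φ z.2 :=
    (hm.comp (measurable_fst.sub measurable_snd)).mul
      ((measurable_density φ).comp measurable_snd)
  exact h1.stronglyMeasurable.integral_prod_right'.measurable

theorem bddMeas_meanField {d₀ : ℝ} (hm : Measurable v) (hd : 0 ≤ d₀)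
    (h : ∀ y, ∫⁻ x, ‖v (y - x)‖ₑ * edensity φ x ≤ ENNReal.ofReal d₀) :
    BddMeas fun x => (meanField v φ x : ℂ) :=
  ⟨Complex.measurable_ofReal.comp (measurable_meanField hm φ), d₀, fun x => by
    rw [Complex.norm_real]; exact abs_meanField_le hd h x⟩

theorem PairBounds.bddMeas_meanField (h : PairBounds v φ D₀ D₁ b₂) :
    BddMeas fun x => (meanField v φ x : ℂ) :=
  _root_.bddMeas_meanField h.meas h.d_nonneg h.sup_abs

/-- The commutator is Y minus its adjoint, so its expectation is at most twice that of Y. Absorbing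
the square roots of the increments into Ψ gives four weighted states, to which the three pair
estimates apply; the weights convert their n and n² into α, and ‖χ₁‖², ‖χ₂‖² into N^{-γ}. -/
theorem PairBounds.norm_commutator_le (hN : 0 < N) (hγ : 0 < γ) (hD₀ : 0 < D₀) (hD₁ : 0 < D₁)
    (h : PairBounds v φ D₀ (D₁ / (N : ℝ) ^ γ) b₂) (hφ : Orthonormal ℂ φ) {Ψ : ManyBody N}
    (hΨ : AntisymmOn Finset.univ Ψ) (hΨ1 : ‖Ψ‖ ≤ 1) :
    ‖⟪fluctuation v φ Ψ, hatOp (orbProj φ) (weightM N γ) Ψ⟫_ℂ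
      - ⟪hatOp (orbProj φ) (weightM N γ) Ψ, fluctuation v φ Ψ⟫_ℂ‖
      ≤ (8 * √D₁ + 6 * D₀) * expect φ Ψ (weightM N γ) + 2 * (b₂ / (N : ℝ) ^ γ / D₀) := by
  have hp := commIdem_orbProj hφ
  have hL := one_le_rpow_of_pos hN hγ
  set L := (N : ℝ) ^ γ with hLdef
  have hL' : 0 < L := by linarith
  set f := weightM N γ with hf
  set α := expect φ Ψ f with hα
  have hα0 : 0 ≤ α := expect_nonneg hφ Ψ (weightM_nonneg hN hγ)
  have hVs : ∀ i, star (meanFieldOp v φ i) = meanFieldOp v φ i := fun i =>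
    adjoint_mulOp_real (h.bddMeas_meanField.comp (measurable_pi_apply i))
  have hV : ∀ i l, l ≠ i → Commute (meanFieldOp v φ i) (orbProj φ l) := fun i l hl =>
    mulOp_commute_orbProj φ (h.bddMeas_meanField.comp (measurable_pi_apply i)) l fun x y => by
      rw [Function.update_of_ne hl.symm]
  have hcomm := hp.commutator_sum (star_orbProj φ) h.pairOp_comm h.adjoint_pairOp hVs
    (fun i j l hi hj => h.pairOp_commute hi hj) hV (weightM_mono hN hγ)
  simp only at hcomm
  set B₁ := (∑ i, ∑ j ∈ {i}ᶜ, lowerOne (orbProj φ) (pairOp v i j) i j)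
    - ∑ i, orbProj φ i * meanFieldOp v φ i * (1 - orbProj φ i) with hB₁
  set B₂ := ∑ i, ∑ j ∈ Finset.Ioi i, lowerTwo (orbProj φ) (pairOp v i j) i j with hB₂
  set Y := hatOp (orbProj φ) (upWeight f 1) * B₁ * hatOp (orbProj φ) (downWeight f 1)
        + hatOp (orbProj φ) (upWeight f 2) * B₂ * hatOp (orbProj φ) (downWeight f 2) with hY
  have hWs : star (fluctuation v φ) = fluctuation v φ := by
    rw [fluctuation, star_sub, star_sum, star_sum]
    simp only [star_sum, hVs]
    congr 1
    exact Finset.sum_congr rfl fun i _ => Finset.sum_congr rfl fun j _ => h.adjoint_pairOp i j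
  have hfs : ContinuousLinearMap.adjoint (hatOp (orbProj φ) f) = hatOp (orbProj φ) f :=
    adjoint_hatOp hφ f
  have e1 : ⟪fluctuation v φ Ψ, hatOp (orbProj φ) f Ψ⟫_ℂ - ⟪hatOp (orbProj φ) f Ψ, fluctuation v φ Ψ⟫_ℂ
      = ⟪Ψ, Y Ψ⟫_ℂ - conj ⟪Ψ, Y Ψ⟫_ℂ := by
    have e2 : ⟪fluctuation v φ Ψ, hatOp (orbProj φ) f Ψ⟫_ℂ
        = ⟪Ψ, (fluctuation v φ * hatOp (orbProj φ) f) Ψ⟫_ℂ := by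
      conv_lhs => rw [← hWs, ContinuousLinearMap.star_eq_adjoint,
        ContinuousLinearMap.adjoint_inner_left]
      rw [mul_apply_eq_comp]
    have e3 : ⟪hatOp (orbProj φ) f Ψ, fluctuation v φ Ψ⟫_ℂ
        = ⟪Ψ, (hatOp (orbProj φ) f * fluctuation v φ) Ψ⟫_ℂ := by
      conv_lhs => rw [← hfs, ContinuousLinearMap.adjoint_inner_left]
      rw [mul_apply_eq_comp]
    rw [e2, e3, ← inner_sub_right, ← sub_apply]
    have e4 : fluctuation v φ * hatOp (orbProj φ) f - hatOp (orbProj φ) f * fluctuation v φ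
      = Y - star Y := hcomm
    rw [e4, sub_apply, inner_sub_right, ContinuousLinearMap.star_eq_adjoint,
      ContinuousLinearMap.adjoint_inner_right, inner_conj_symm]
  have e5 : ⟪Ψ, Y Ψ⟫_ℂ
      = ⟪hatOp (orbProj φ) (upWeight f 1) Ψ, B₁ (hatOp (orbProj φ) (downWeight f 1) Ψ)⟫_ℂ
      + ⟪hatOp (orbProj φ) (upWeight f 2) Ψ, B₂ (hatOp (orbProj φ) (downWeight f 2) Ψ)⟫_ℂ := by
    rw [hY, _root_.add_apply, inner_add_right]
    simp only [mul_apply_eq_comp]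
    rw [← ContinuousLinearMap.adjoint_inner_left, adjoint_hatOp hφ,
      ← ContinuousLinearMap.adjoint_inner_left (hatOp (orbProj φ) (upWeight f 2)), adjoint_hatOp hφ]
  set χ₁ := hatOp (orbProj φ) (upWeight f 1) Ψ with hχ₁
  set χ₁' := hatOp (orbProj φ) (downWeight f 1) Ψ with hχ₁'
  set χ₂ := hatOp (orbProj φ) (upWeight f 2) Ψ with hχ₂
  set χ₂' := hatOp (orbProj φ) (downWeight f 2) Ψ with hχ₂'
  have a₁ : AntisymmOn Finset.univ χ₁ := hΨ.hatOp_apply hφ _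
  have a₁' : AntisymmOn Finset.univ χ₁' := hΨ.hatOp_apply hφ _
  have a₂ : AntisymmOn Finset.univ χ₂ := hΨ.hatOp_apply hφ _
  -- the weights
  have w1 : ∑ j, ‖(1 - orbProj φ j : ManyBody N →L[ℂ] ManyBody N) χ₁‖ ^ 2 ≤ α := by
    rw [hχ₁, sum_norm_one_sub_orbProj_hatOp_sq hφ]
    exact expect_mono hφ Ψ fun k _ => by simpa using mul_upWeight_sq_le hN hγ 1 k
  have w2 : ∑ i, (⟪(1 - orbProj φ i : ManyBody N →L[ℂ] ManyBody N) χ₁', numOp (orbProj φ)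
      ((1 - orbProj φ i : ManyBody N →L[ℂ] ManyBody N) χ₁')⟫_ℂ).re ≤ 4 * L * α := by
    rw [hχ₁', sum_norm_numOp_hatOp_sq hφ, ← expect_const_mul]
    refine expect_mono hφ Ψ fun k _ => ?_
    have := (mul_downWeight_sq_le hN hγ 1 k).2
    norm_num at this ⊢
    exact this
  have w3 : ‖χ₁‖ ^ 2 ≤ 1 / L := by
    rw [hχ₁, norm_hatOp_sq hφ]
    refine (expect_mono hφ Ψ (g := fun _ => (1 / L) * 1) fun k _ => ?_).trans ?_
    · simpa using upWeight_sq_le hN hγ 1 k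
    · rw [expect_const_mul, expect_one]
      exact mul_le_of_le_one_right (by positivity) (pow_le_one₀ (norm_nonneg _) hΨ1)
  have w4 : ∑ i, ‖(1 - orbProj φ i : ManyBody N →L[ℂ] ManyBody N) χ₁'‖ ^ 2 ≤ 2 * α := by
    rw [hχ₁', sum_norm_one_sub_orbProj_hatOp_sq hφ, ← expect_const_mul]
    refine expect_mono hφ Ψ fun k _ => ?_
    have := (mul_downWeight_sq_le hN hγ 1 k).1
    norm_num at this ⊢
    exact this
  have w5 : ‖χ₂‖ ^ 2 ≤ 2 / L := by
    rw [hχ₂, norm_hatOp_sq hφ]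
    refine (expect_mono hφ Ψ (g := fun _ => (2 / L) * 1) fun k _ => ?_).trans ?_
    · simpa using upWeight_sq_le hN hγ 2 k
    · rw [expect_const_mul, expect_one]
      exact mul_le_of_le_one_right (by positivity) (pow_le_one₀ (norm_nonneg _) hΨ1)
  have w6 : ∑ j, ‖(1 - orbProj φ j : ManyBody N →L[ℂ] ManyBody N) χ₂‖ ^ 2 ≤ 2 * α := by
    rw [hχ₂, sum_norm_one_sub_orbProj_hatOp_sq hφ, ← expect_const_mul]
    exact expect_mono hφ Ψ fun k _ => by simpa using mul_upWeight_sq_le hN hγ 2 k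
  have w7 : ∑ i, ‖(1 - orbProj φ i : ManyBody N →L[ℂ] ManyBody N) χ₂'‖ ^ 2 ≤ 6 * α := by
    rw [hχ₂', sum_norm_one_sub_orbProj_hatOp_sq hφ, ← expect_const_mul]
    refine expect_mono hφ Ψ fun k _ => ?_
    have := (mul_downWeight_sq_le hN hγ 2 k).1
    norm_num at this ⊢
    exact this
  -- the three types of terms
  have hs : 0 < √D₁ := Real.sqrt_pos.2 hD₁
  have hss : √D₁ * √D₁ = D₁ := Real.mul_self_sqrt hD₁.le
  -- This parameter balances D₁ L^{-1} α against 4 L α; the parameter 1 / D₀ below does the same for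
  -- the exchange and double-excitation terms, up to constants.
  have ht : 0 < 2 * L / √D₁ := by positivity
  have hs' : 0 < 1 / D₀ := by positivity
  have t3 := h.norm_sum_pq_qq_le hN hφ (χ' := χ₁') a₁ ht
  have t1 := h.norm_sum_pp_qp_le hN hφ a₁ a₁' ht hs'
  have t2 := h.norm_sum_lowerTwo_le hN hφ (χ' := χ₂') a₂ hs'
  have hb₂ := h.b₂_nonneg
  have hmid : 2 * L / √D₁ * (D₁ / L * ∑ j, ‖(1 - orbProj φ j : ManyBody N →L[ℂ] ManyBody N) χ₁‖ ^ 2)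
      + (2 * L / √D₁)⁻¹ * ∑ i, (⟪(1 - orbProj φ i : ManyBody N →L[ℂ] ManyBody N) χ₁',
        numOp (orbProj φ) ((1 - orbProj φ i : ManyBody N →L[ℂ] ManyBody N) χ₁')⟫_ℂ).re
      ≤ 4 * √D₁ * α := by
    have h1 : 2 * L / √D₁ * (D₁ / L * α) + (2 * L / √D₁)⁻¹ * (4 * L * α) = 4 * √D₁ * α := by
      nth_rewrite 2 [← hss]
      field_simp
      ring
    rw [← h1]
    gcongr
  have hex : 1 / D₀ * (b₂ * ‖χ₁‖ ^ 2) + (1 / D₀)⁻¹ *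
      ∑ i, ‖(1 - orbProj φ i : ManyBody N →L[ℂ] ManyBody N) χ₁'‖ ^ 2
      ≤ b₂ / L / D₀ + 2 * D₀ * α := by
    have h1 : 1 / D₀ * (b₂ * (1 / L)) + (1 / D₀)⁻¹ * (2 * α) = b₂ / L / D₀ + 2 * D₀ * α := by
      field_simp
    rw [← h1]
    gcongr
  have htwo : 1 / D₀ * (b₂ * ‖χ₂‖ ^ 2
        + D₀ ^ 2 * ∑ l, ‖(1 - orbProj φ l : ManyBody N →L[ℂ] ManyBody N) χ₂‖ ^ 2)
      + (1 / D₀)⁻¹ * ∑ i, ‖(1 - orbProj φ i : ManyBody N →L[ℂ] ManyBody N) χ₂'‖ ^ 2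
      ≤ 2 * (b₂ / L / D₀) + 8 * D₀ * α := by
    have h1 : 1 / D₀ * (b₂ * (2 / L) + D₀ ^ 2 * (2 * α)) + (1 / D₀)⁻¹ * (6 * α)
        = 2 * (b₂ / L / D₀) + 8 * D₀ * α := by
      field_simp
      ring
    rw [← h1]
    gcongr
  have e6 : ⟪χ₁, B₁ χ₁'⟫_ℂ = (∑ i, ∑ j ∈ {i}ᶜ, ⟪χ₁, (orbProj φ i * orbProj φ j * pairOp v i j *
        ((1 - orbProj φ i) * orbProj φ j)) χ₁'⟫_ℂ
      - ∑ i, ⟪χ₁, (orbProj φ i * meanFieldOp v φ i * (1 - orbProj φ i)) χ₁'⟫_ℂ)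
      + ∑ i, ∑ j ∈ {i}ᶜ, ⟪χ₁, (orbProj φ i * (1 - orbProj φ j) * pairOp v i j *
        ((1 - orbProj φ i) * (1 - orbProj φ j))) χ₁'⟫_ℂ := by
    rw [hB₁, sub_apply, inner_sub_right]
    simp only [_root_.sum_apply, inner_sum, lowerOne, _root_.add_apply, inner_add_right,
      Finset.sum_add_distrib]
    ring
  have e7 : ⟪χ₂, B₂ χ₂'⟫_ℂ
      = ∑ i, ∑ j ∈ Finset.Ioi i, ⟪χ₂, lowerTwo (orbProj φ) (pairOp v i j) i j χ₂'⟫_ℂ := by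
    rw [hB₂]
    simp only [_root_.sum_apply, inner_sum]
  rw [e1]
  refine (norm_sub_le _ _).trans ?_
  rw [RCLike.norm_conj, e5]
  have n0 := norm_add_le ⟪χ₁, B₁ χ₁'⟫_ℂ ⟪χ₂, B₂ χ₂'⟫_ℂ
  have n1 : ‖⟪χ₁, B₁ χ₁'⟫_ℂ‖ ≤ _ := (le_of_eq (congrArg _ e6)).trans (norm_add_le _ _)
  rw [e7] at n0 ⊢
  linarith

end CommutatorEstimate

/-! ### Unbounded interactions -/

section Truncation

/-- Bounded pointwise convergence of multipliers gives strong convergence, by dominated convergence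
applied to the squared norm. -/
theorem tendsto_mulOp_of_dominated {α : Type*} [MeasurableSpace α] {μ : Measure α}
    {g : ℕ → α → ℂ} {g₀ : α → ℂ} {C : ℝ} (hg : ∀ n, Measurable (g n)) (hg₀ : Measurable g₀)
    (hC : ∀ n x, ‖g n x‖ ≤ C) (hlim : ∀ x, Filter.Tendsto (fun n => g n x) Filter.atTop (nhds (g₀ x)))
    (ψ : Lp ℂ 2 μ) :
    Filter.Tendsto (fun n => mulOp μ (g n) ψ) Filter.atTop (nhds (mulOp μ g₀ ψ)) := by
  have hC₀ : ∀ x, ‖g₀ x‖ ≤ C := fun x => le_of_tendsto (hlim x).norm (Filter.Eventually.of_forall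
    fun n => hC n x)
  have h1 : ∀ n, ‖mulOp μ (g n) ψ - mulOp μ g₀ ψ‖ₑ ^ 2
      = ∫⁻ x, ‖g n x - g₀ x‖ₑ ^ 2 * ‖ψ x‖ₑ ^ 2 ∂μ := fun n => by
    rw [Lp_enorm_sq]
    refine lintegral_congr_ae ?_
    filter_upwards [Lp.coeFn_sub (mulOp μ (g n) ψ) (mulOp μ g₀ ψ), coeFn_mulOp ⟨hg n, C, hC n⟩ ψ,
      coeFn_mulOp ⟨hg₀, C, hC₀⟩ ψ] with x h2 h3 h4
    rw [h2, Pi.sub_apply, h3, h4, ← sub_mul, enorm_mul, mul_pow]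
  have hψ : Measurable fun x => ‖ψ x‖ₑ ^ 2 := (Lp.stronglyMeasurable ψ).measurable.enorm.pow_const _
  have h2 : Filter.Tendsto (fun n => ∫⁻ x, ‖g n x - g₀ x‖ₑ ^ 2 * ‖ψ x‖ₑ ^ 2 ∂μ) Filter.atTop
      (nhds (∫⁻ _, 0 ∂μ)) := by
    refine tendsto_lintegral_of_dominated_convergence
      (fun x => ENNReal.ofReal (C + C) ^ 2 * ‖ψ x‖ₑ ^ 2)
      (fun n => (((hg n).sub hg₀).enorm.pow_const _).mul hψ)
      (fun n => Filter.Eventually.of_forall fun x => ?_) ?_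
      (Filter.Eventually.of_forall fun x => ?_)
    · refine mul_le_mul_left (pow_le_pow_left' ?_ 2) _
      rw [← ofReal_norm]
      exact ENNReal.ofReal_le_ofReal ((norm_sub_le _ _).trans (add_le_add (hC n x) (hC₀ x)))
    · rw [lintegral_const_mul _ hψ, ← Lp_enorm_sq]
      finiteness
    · have h3 : Filter.Tendsto (fun n => ‖g n x - g₀ x‖ₑ) Filter.atTop (nhds 0) := by
        have := ((hlim x).sub_const (g₀ x)).enorm
        simpa using this
      have h4 : Filter.Tendsto (fun n => ‖g n x - g₀ x‖ₑ ^ 2) Filter.atTop (nhds (0 ^ 2)) :=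
        ENNReal.Tendsto.pow h3
      rw [zero_pow two_ne_zero] at h4
      have := ENNReal.Tendsto.mul_const (b := ‖ψ x‖ₑ ^ 2) h4 (Or.inr (by finiteness))
      simpa using this
  rw [tendsto_iff_norm_sub_tendsto_zero]
  simp_rw [← h1, lintegral_zero] at h2
  have h3 : Filter.Tendsto (fun n => ‖mulOp μ (g n) ψ - mulOp μ g₀ ψ‖ ^ 2) Filter.atTop (nhds 0) := by
    have := (ENNReal.tendsto_toReal ENNReal.zero_ne_top).comp h2
    simpa [Function.comp_def] using this
  have h4 := (Real.continuous_sqrt.tendsto 0).comp h3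
  simpa [Function.comp_def, Real.sqrt_sq (norm_nonneg _)] using h4

variable {N : ℕ} {v : R3 → ℝ} {φ : Fin N → OneBody} {γ D₀ D₁ b₂ : ℝ}

/-- The function `v` cut off where it exceeds `n` in absolute value. -/
def truncate (v : R3 → ℝ) (n : ℕ) (x : R3) : ℝ := if |v x| ≤ n then v x else 0

theorem measurable_truncate (hm : Measurable v) (n : ℕ) : Measurable (truncate v n) :=
  Measurable.ite (measurableSet_le (continuous_abs.measurable.comp hm) measurable_const) hm
    measurable_const

theorem abs_truncate_le (v : R3 → ℝ) (n : ℕ) (x : R3) : |truncate v n x| ≤ |v x| := by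
  unfold truncate
  split_ifs <;> simp

theorem enorm_truncate_le (v : R3 → ℝ) (n : ℕ) (x : R3) : ‖truncate v n x‖ₑ ≤ ‖v x‖ₑ := by
  rw [← ofReal_norm, ← ofReal_norm]
  exact ENNReal.ofReal_le_ofReal (abs_truncate_le v n x)

theorem eventually_truncate_eq (v : R3 → ℝ) (x : R3) :
    ∀ᶠ n in Filter.atTop, truncate v n x = v x := by
  obtain ⟨m, hm⟩ := exists_nat_ge |v x|
  filter_upwards [Filter.eventually_ge_atTop m] with n hn
  exact if_pos (hm.trans (by exact_mod_cast hn))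

/-- Bounds on the convolutions of an even interaction with the density. -/
structure DensityBounds (v : R3 → ℝ) (φ : Fin N → OneBody) (d₀ b₁ b₂ : ℝ) : Prop where
  meas : Measurable v
  even : ∀ x, v (-x) = v x
  d_nonneg : 0 ≤ d₀
  b₁_nonneg : 0 ≤ b₁
  b₂_nonneg : 0 ≤ b₂
  sup_abs : ∀ y, ∫⁻ x, ‖v (y - x)‖ₑ * edensity φ x ≤ ENNReal.ofReal d₀
  sup_sq : ∀ y, ∫⁻ x, ‖v (y - x)‖ₑ ^ 2 * edensity φ x ≤ ENNReal.ofReal b₁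
  integral_sq : ∫⁻ y, (∫⁻ x, ‖v (y - x)‖ₑ ^ 2 * edensity φ x) * edensity φ y ≤ ENNReal.ofReal b₂

theorem DensityBounds.truncate {d₀ b₁ b₂ : ℝ} (h : DensityBounds v φ d₀ b₁ b₂) (n : ℕ) :
    PairBounds (truncate v n) φ d₀ b₁ b₂ where
  meas := measurable_truncate h.meas n
  bdd := ⟨n, fun x => by
    unfold _root_.truncate
    split_ifs with h
    · exact h
    · simp⟩
  even x := by simp only [_root_.truncate, h.even]
  d_nonneg := h.d_nonneg
  b₁_nonneg := h.b₁_nonneg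
  b₂_nonneg := h.b₂_nonneg
  sup_abs y := (lintegral_mono fun x => mul_le_mul_left (enorm_truncate_le v n _) _).trans
    (h.sup_abs y)
  sup_sq y := (lintegral_mono fun x => mul_le_mul_left
    (pow_le_pow_left' (enorm_truncate_le v n _) 2) _).trans (h.sup_sq y)
  integral_sq := (lintegral_mono fun y => mul_le_mul_left (lintegral_mono fun x => mul_le_mul_left
    (pow_le_pow_left' (enorm_truncate_le v n _) 2) _) _).trans h.integral_sq

theorem DensityBounds.tendsto_meanField (h : DensityBounds v φ D₀ D₁ b₂) (x : R3) :
    Filter.Tendsto (fun n => meanField (_root_.truncate v n) φ x) Filter.atTop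
      (nhds (meanField v φ x)) := by
  have h1 : Measurable fun y => v (x - y) * density φ y :=
    (h.meas.comp (measurable_const.sub measurable_id)).mul (measurable_density φ)
  have h2 : Integrable fun y => v (x - y) * density φ y := by
    refine ⟨h1.aestronglyMeasurable, ?_⟩
    refine lt_of_le_of_lt ?_ ((h.sup_abs x).trans_lt ENNReal.ofReal_lt_top)
    simp_rw [enorm_mul, enorm_density, le_refl]
  refine tendsto_integral_of_dominated_convergence _ (fun n => ?_) h2.norm (fun n => ?_) ?_
  · exact (((measurable_truncate h.meas n).comp (measurable_const.sub measurable_id)).mul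
      (measurable_density φ)).aestronglyMeasurable
  · refine Filter.Eventually.of_forall fun y => ?_
    rw [norm_mul, norm_mul]
    exact mul_le_mul_of_nonneg_right (abs_truncate_le v n _) (norm_nonneg _)
  · refine Filter.Eventually.of_forall fun y => tendsto_const_nhds.congr' ?_
    filter_upwards [eventually_truncate_eq v (x - y)] with n hn
    rw [hn]

/-- The truncated interaction applied to Ψ is ζ cut off by an indicator function that tends to 1.
Convergence is therefore strong on every Ψ for which v Ψ is in L², although v is unbounded. -/
theorem DensityBounds.tendsto_pairOp (h : DensityBounds v φ D₀ D₁ b₂) (i j : Fin N)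
    {Ψ ζ : ManyBody N} (hζ : ζ =ᵐ[volume] fun x => (v (x i - x j) : ℂ) * Ψ x) :
    Filter.Tendsto (fun n => pairOp (_root_.truncate v n) i j Ψ) Filter.atTop (nhds ζ) := by
  set g : ℕ → (Fin N → R3) → ℂ := fun n x => if |v (x i - x j)| ≤ n then 1 else 0 with hg
  have hgm : ∀ n, Measurable (g n) := fun n => Measurable.ite (measurableSet_le
    (continuous_abs.measurable.comp (h.meas.comp (measurable_coord_sub i j))) measurable_const)
    measurable_const measurable_const
  have hgC : ∀ n x, ‖g n x‖ ≤ 1 := fun n x => by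
    simp only [hg]; split_ifs <;> simp
  have h1 := tendsto_mulOp_of_dominated (μ := volume) (g₀ := fun _ => 1) hgm measurable_const hgC
    (fun x => by
      obtain ⟨m, hm⟩ := exists_nat_ge |v (x i - x j)|
      refine tendsto_const_nhds.congr' ?_
      filter_upwards [Filter.eventually_ge_atTop m] with n hn
      exact (if_pos (hm.trans (by exact_mod_cast hn))).symm) ζ
  have h2 : mulOp volume (fun _ => 1) ζ = ζ := by
    refine Lp.ext ?_
    filter_upwards [coeFn_mulOp (μ := volume) (h := fun _ : Fin N → R3 => (1 : ℂ))
      ⟨measurable_const, 1, fun _ => by simp⟩ ζ] with x hx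
    rw [hx, one_mul]
  rw [h2] at h1
  refine h1.congr fun n => Lp.ext ?_
  filter_upwards [coeFn_mulOp ⟨hgm n, 1, hgC n⟩ ζ, hζ,
    coeFn_mulOp ((h.truncate n).bddMeas_pair i j) Ψ] with x h3 h4 h5
  rw [h3, h4, pairOp, h5, hg]
  simp only [_root_.truncate]
  split_ifs <;> simp

/-- The commutator estimate. -/
theorem DensityBounds.norm_commutator_le (hN : 0 < N) (hγ : 0 < γ) (hD₀ : 0 < D₀) (hD₁ : 0 < D₁)
    (h : DensityBounds v φ D₀ (D₁ / (N : ℝ) ^ γ) b₂) (hφ : Orthonormal ℂ φ) {Ψ : ManyBody N}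
    (hΨ : AntisymmOn Finset.univ Ψ) (hΨ1 : ‖Ψ‖ ≤ 1) {ζ : Fin N → Fin N → ManyBody N}
    (hζ : ∀ i, ∀ j ∈ Finset.Ioi i, ζ i j =ᵐ[volume] fun x => (v (x i - x j) : ℂ) * Ψ x)
    {w : ManyBody N}
    (hw : w = (∑ i, ∑ j ∈ Finset.Ioi i, ζ i j) - ∑ i, meanFieldOp v φ i Ψ) :
    ‖⟪w, hatOp (orbProj φ) (weightM N γ) Ψ⟫_ℂ - ⟪hatOp (orbProj φ) (weightM N γ) Ψ, w⟫_ℂ‖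
      ≤ (8 * √D₁ + 6 * D₀) * expect φ Ψ (weightM N γ) + 2 * (b₂ / (N : ℝ) ^ γ / D₀) := by
  have h1 : Filter.Tendsto (fun n => fluctuation (_root_.truncate v n) φ Ψ) Filter.atTop
      (nhds w) := by
    rw [hw]
    simp only [fluctuation, sub_apply, _root_.sum_apply]
    refine Filter.Tendsto.sub (tendsto_finsetSum _ fun i _ => tendsto_finsetSum _ fun j hj =>
      h.tendsto_pairOp i j (hζ i j hj)) (tendsto_finsetSum _ fun i _ => ?_)
    refine tendsto_mulOp_of_dominated (C := D₀)
      (fun n => ((h.truncate n).bddMeas_meanField.comp (measurable_pi_apply i)).1)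
      ((bddMeas_meanField h.meas h.d_nonneg h.sup_abs).comp (measurable_pi_apply i)).1
      (fun n x => ?_) (fun x => ?_) Ψ
    · rw [Complex.norm_real]
      exact abs_meanField_le h.d_nonneg (h.truncate n).sup_abs _
    · exact (Complex.continuous_ofReal.tendsto _).comp (h.tendsto_meanField (x i))
  refine le_of_tendsto ((Filter.Tendsto.sub (h1.inner tendsto_const_nhds)
    (tendsto_const_nhds.inner h1)).norm) (Filter.Eventually.of_forall fun n => ?_)
  exact (h.truncate n).norm_commutator_le hN hγ hD₀ hD₁ hφ hΨ hΨ1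

end Truncation

/-! ### Forward averages -/

section ForwardAverage

open Filter Topology

/-- Continuity of translations in L¹. -/
theorem tendsto_lintegral_translate {E : Type*} [NormedAddCommGroup E] {f : ℝ → E} (hf : Integrable f) :
    Tendsto (fun s => ∫⁻ t, ‖f (t + s) - f t‖ₑ) (𝓝 0) (𝓝 0) := by
  set F : Lp E 1 (volume : Measure ℝ) := (memLp_one_iff_integrable.2 hf).toLp f with hF
  set g : ℝ → C(ℝ, ℝ) := fun s => ⟨fun t => t + s, continuous_add_const s⟩ with hg
  have hgc : Continuous g := by
    have : Continuous fun z : ℝ × ℝ => z.2 + z.1 := by fun_prop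
    exact (ContinuousMap.mk (fun z : ℝ × ℝ => z.2 + z.1) this).curry.continuous
  have hgm : ∀ s, MeasurePreserving (g s) volume volume := fun s => measurePreserving_add_right _ s
  have h1 := (continuous_const (y := F)).compMeasurePreservingLp hgc hgm ENNReal.one_ne_top
  have h2 : Tendsto (fun s => ‖Lp.compMeasurePreserving (g s) (hgm s) F - F‖ₑ) (𝓝 0) (𝓝 0) := by
    have h3 := ((h1.tendsto 0).sub_const F).enorm
    have h4 : Lp.compMeasurePreserving (g 0) (hgm 0) F = F := by
      refine Lp.ext ?_
      filter_upwards [Lp.coeFn_compMeasurePreserving F (hgm 0)] with x hx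
      rw [hx]
      simp [hg]
    rw [h4, sub_self, enorm_zero] at h3
    exact h3
  refine h2.congr fun s => ?_
  rw [Lp.enorm_def, eLpNorm_one_eq_lintegral_enorm]
  refine lintegral_congr_ae ?_
  have hFf : F =ᵐ[volume] f := MemLp.coeFn_toLp _
  filter_upwards [Lp.coeFn_sub (Lp.compMeasurePreserving (g s) (hgm s) F) F,
    Lp.coeFn_compMeasurePreserving F (hgm s), hFf,
    (hgm s).quasiMeasurePreserving.ae hFf] with x h3 h4 h5 h6
  rw [h3, Pi.sub_apply, h4, h5, Function.comp_apply, h6]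
  rfl

variable {E : Type*} [NormedAddCommGroup E] [NormedSpace ℝ E]

/-- The average of `u` over `[t, t + h]`. -/
def forwardAverage (h : ℝ) (u : ℝ → E) (t : ℝ) : E := h⁻¹ • ∫ r in t..t + h, u r

theorem hasDerivAt_forwardAverage [CompleteSpace E] {u : ℝ → E} (hu : Continuous u) (h t : ℝ) :
    HasDerivAt (forwardAverage h u) (h⁻¹ • (u (t + h) - u t)) t := by
  have h1 : ∀ s, ∫ r in s..s + h, u r = (∫ r in (0 : ℝ)..s + h, u r) - ∫ r in (0 : ℝ)..s, u r :=
    fun s => (intervalIntegral.integral_interval_sub_left (hu.intervalIntegrable _ _)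
      (hu.intervalIntegrable _ _)).symm
  have h2 : ∀ s, HasDerivAt (fun s => ∫ r in (0 : ℝ)..s, u r) (u s) s := fun s =>
    hu.integral_hasStrictDerivAt 0 s |>.hasDerivAt
  have h3 := ((h2 (t + h)).comp_add_const t h).sub (h2 t)
  refine HasDerivAt.const_smul h⁻¹ (h3.congr_of_eventuallyEq (Eventually.of_forall fun s => ?_))
  exact h1 s

theorem tendsto_forwardAverage [CompleteSpace E] {u : ℝ → E} (hu : Continuous u) (t : ℝ) :
    Tendsto (fun h => forwardAverage h u t) (𝓝[>] 0) (𝓝 (u t)) := by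
  have h2 : HasDerivAt (fun s => ∫ r in t..s, u r) (u t) t :=
    hu.integral_hasStrictDerivAt t t |>.hasDerivAt
  have h3 := h2.hasDerivWithinAt (s := Ioi t)
  have h4 := hasDerivAt_iff_tendsto_slope_zero.1 h2
  refine (h4.mono_left (nhdsWithin_mono 0 fun x hx => ne_of_gt hx)).congr fun h => ?_
  simp [forwardAverage]

theorem norm_forwardAverage_le {u : ℝ → E} {M h t : ℝ} (hM : ∀ r ∈ Ioc t (t + h), ‖u r‖ ≤ M)
    (hh : 0 < h) : ‖forwardAverage h u t‖ ≤ M := by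
  have h1 := intervalIntegral.norm_integral_le_of_norm_le_const (a := t) (b := t + h) (f := u)
    fun r hr => hM r (by rwa [uIoc_of_le (by linarith)] at hr)
  rw [add_sub_cancel_left, abs_of_pos hh] at h1
  rw [forwardAverage, norm_smul, norm_inv, Real.norm_of_nonneg hh.le, inv_mul_le_iff₀ hh]
  linarith

theorem continuous_forwardAverage {f : ℝ → E} (hf : Integrable f) (h : ℝ) :
    Continuous (forwardAverage h f) := by
  have h1 : ∀ s, ∫ r in s..s + h, f r = (∫ r in (0 : ℝ)..s + h, f r) - ∫ r in (0 : ℝ)..s, f r :=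
    fun s => (intervalIntegral.integral_interval_sub_left hf.intervalIntegrable
      hf.intervalIntegrable).symm
  have h2 := intervalIntegral.continuous_primitive (fun _ _ => hf.intervalIntegrable) 0
    (μ := volume) (f := f)
  unfold forwardAverage
  simp_rw [h1]
  exact ((h2.comp (continuous_add_const h)).sub h2).const_smul _

/-- The deviation of the average is bounded by an average over s in (0, h] of translation
differences; Tonelli exchanges it with the integral over t. -/
theorem tendsto_lintegral_forwardAverage [CompleteSpace E] {f : ℝ → E} (hf : StronglyMeasurable f)
    (hfi : Integrable f) :
    Tendsto (fun h => ∫⁻ t, ‖forwardAverage h f t - f t‖ₑ) (𝓝[>] 0) (𝓝 0) := by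
  rw [ENNReal.tendsto_nhds_zero]
  intro ε hε
  have h1 := ENNReal.tendsto_nhds_zero.1 (tendsto_lintegral_translate hfi) ε hε
  obtain ⟨d, hd, hball⟩ := Metric.eventually_nhds_iff.1 h1
  filter_upwards [Ioo_mem_nhdsGT hd] with h hh
  have hh0 : 0 < h := hh.1
  have h2 : ∀ t, ‖forwardAverage h f t - f t‖ₑ
      ≤ ENNReal.ofReal h⁻¹ * ∫⁻ s in Ioc 0 h, ‖f (t + s) - f t‖ₑ := by
    intro t
    have h3 : forwardAverage h f t - f t = h⁻¹ • ∫ s in (0 : ℝ)..h, (f (t + s) - f t) := by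
      rw [intervalIntegral.integral_sub, intervalIntegral.integral_const, smul_sub, sub_zero,
        smul_smul, inv_mul_cancel₀ hh0.ne', one_smul, intervalIntegral.integral_comp_add_left,
        add_zero]
      · rfl
      · exact (hfi.comp_add_left t).intervalIntegrable
      · exact intervalIntegrable_const
    rw [h3, intervalIntegral.integral_of_le hh0.le, enorm_smul, ← ofReal_norm h⁻¹,
      Real.norm_of_nonneg (inv_nonneg.2 hh0.le)]
    exact mul_le_mul_right (enorm_integral_le_lintegral_enorm _) _
  have hjm : Measurable fun z : ℝ × ℝ => ‖f (z.1 + z.2) - f z.1‖ₑ :=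
    ((hf.comp_measurable (measurable_fst.add measurable_snd)).sub
      (hf.comp_measurable measurable_fst)).enorm
  calc ∫⁻ t, ‖forwardAverage h f t - f t‖ₑ
      ≤ ∫⁻ t, ENNReal.ofReal h⁻¹ * ∫⁻ s in Ioc 0 h, ‖f (t + s) - f t‖ₑ := lintegral_mono h2
    _ = ENNReal.ofReal h⁻¹ * ∫⁻ t, ∫⁻ s in Ioc 0 h, ‖f (t + s) - f t‖ₑ :=
        lintegral_const_mul _ (hjm.lintegral_prod_right')
    _ = ENNReal.ofReal h⁻¹ * ∫⁻ s in Ioc 0 h, ∫⁻ t, ‖f (t + s) - f t‖ₑ := by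
        rw [lintegral_lintegral_swap hjm.aemeasurable]
    _ ≤ ENNReal.ofReal h⁻¹ * ∫⁻ _ in Ioc 0 h, ε := by
        refine mul_le_mul_right (setLIntegral_mono measurable_const fun s hs => hball ?_) _
        rw [Real.dist_eq, sub_zero, abs_of_pos hs.1]
        exact hs.2.trans_lt hh.2
    _ = ε := by
        rw [setLIntegral_const, Real.volume_Ioc, sub_zero, mul_comm ε, ← mul_assoc,
          ← ENNReal.ofReal_mul (inv_nonneg.2 hh0.le), inv_mul_cancel₀ hh0.ne', ENNReal.ofReal_one,
          one_mul]

/-- Forward averages of an integrable function along a suitable sequence converge almost everywhere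
and are dominated by an integrable function. -/
theorem exists_seq_forwardAverage [CompleteSpace E] {f : ℝ → E} (hf : StronglyMeasurable f)
    (hfi : Integrable f) :
    ∃ h : ℕ → ℝ, Tendsto h atTop (𝓝[>] 0) ∧
      (∀ᵐ t, Tendsto (fun n => forwardAverage (h n) f t) atTop (𝓝 (f t))) ∧
      ∃ G : ℝ → ℝ, Integrable G ∧ ∀ᵐ t, ∀ n, ‖forwardAverage (h n) f t‖ ≤ G t := by
  -- With L¹ errors at most 2^{-n} the sum of all pointwise deviations is integrable. Its finiteness
  -- gives almost everywhere convergence, and the sum together with ‖f‖ is the common dominating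
  -- function.
  have h1 := fun n : ℕ => ((ENNReal.tendsto_nhds_zero.1 (tendsto_lintegral_forwardAverage hf hfi)
    ((2 : ENNReal)⁻¹ ^ n) (ENNReal.pow_pos (by simp) n)).and (Ioo_mem_nhdsGT (Nat.one_div_pos_of_nat (α := ℝ) (n := n)))).exists
  choose h hh1 hh2 using h1
  have htend : Tendsto h atTop (𝓝[>] 0) := by
    refine tendsto_nhdsWithin_iff.2 ⟨?_, Eventually.of_forall fun n => (hh2 n).1⟩
    exact squeeze_zero (fun n => (hh2 n).1.le) (fun n => (hh2 n).2.le)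
      tendsto_one_div_add_atTop_nhds_zero_nat
  set d : ℕ → ℝ → ENNReal := fun n t => ‖forwardAverage (h n) f t - f t‖ₑ with hd
  have hdm : ∀ n, Measurable (d n) := fun n =>
    ((continuous_forwardAverage hfi (h n)).stronglyMeasurable.sub hf).enorm
  have hsum : ∫⁻ t, ∑' n, d n t ≠ ⊤ := by
    rw [lintegral_tsum fun n => (hdm n).aemeasurable]
    refine ne_top_of_le_ne_top ?_ (ENNReal.tsum_le_tsum hh1)
    rw [ENNReal.tsum_geometric]
    simp
  have hSm : Measurable fun t => ∑' n, d n t := Measurable.tsum hdm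
  have hfin := ae_lt_top hSm hsum
  refine ⟨h, htend, ?_, fun t => ‖f t‖ + (∑' n, d n t).toReal,
    hfi.norm.add (integrable_toReal_of_lintegral_ne_top hSm.aemeasurable hsum), ?_⟩
  · filter_upwards [hfin] with t ht
    have h2 : Tendsto (fun n => d n t) atTop (𝓝 0) :=
      ENNReal.tendsto_atTop_zero_of_tsum_ne_top ht.ne
    rw [tendsto_iff_norm_sub_tendsto_zero]
    have h3 := (ENNReal.tendsto_toReal ENNReal.zero_ne_top).comp h2
    simpa [hd, Function.comp_def] using h3
  · filter_upwards [hfin] with t ht n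
    have h2 : ‖forwardAverage (h n) f t - f t‖ ≤ (∑' n, d n t).toReal := by
      have := ENNReal.toReal_mono ht.ne (ENNReal.le_tsum (f := fun n => d n t) n)
      simpa [hd] using this
    have h3 := norm_add_le (f t) (forwardAverage (h n) f t - f t)
    rw [add_sub_cancel] at h3
    linarith

end ForwardAverage

/-! ### Weak solutions of inhomogeneous Schrödinger equations -/

section WeakSolution

open Filter Topology

variable {E : Type*} [NormedAddCommGroup E] [InnerProductSpace ℂ E] [CompleteSpace E]

/-- Weak solutions `u` of `i u' = A u + η` on `[0, b)`. -/
structure IsWeakSolution (A : E →ₗ.[ℂ] E) (b : ℝ) (u η : ℝ → E) : Prop where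
  continuous : Continuous u
  stronglyMeasurable : StronglyMeasurable η
  integrable : Integrable η
  hasDeriv : ∀ t ∈ Ico 0 b, ∀ χ : A.domain, HasDerivWithinAt (fun s => ⟪(χ : E), u s⟫_ℂ)
    (-Complex.I * (⟪A χ, u t⟫_ℂ + ⟪(χ : E), η t⟫_ℂ)) (Ioi t) t

theorem intervalIntegral_inner {f : ℝ → E} {s t : ℝ} (hst : s ≤ t)
    (hf : IntervalIntegrable f volume s t) (c : E) :
    ∫ r in s..t, ⟪c, f r⟫_ℂ = ⟪c, ∫ r in s..t, f r⟫_ℂ := by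
  rw [intervalIntegral.integral_of_le hst, intervalIntegral.integral_of_le hst]
  exact integral_inner hf.1 c

/-- Integrating the weak equation against χ in time shows that ⟨∫ u, A χ⟩ is a bounded functional of
χ. So ∫ u is in the domain of the adjoint, which is A. -/
theorem IsWeakSolution.integral_mem_graph {A : E →ₗ.[ℂ] E} (hA : IsSelfAdjoint A) {b : ℝ}
    {u η : ℝ → E} (hu : IsWeakSolution A b u η) {s t : ℝ} (hs : 0 ≤ s) (hst : s ≤ t) (ht : t ≤ b) :
    (∫ r in s..t, u r, Complex.I • (u t - u s) - ∫ r in s..t, η r) ∈ A.graph := by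
  have hd := hA.dense_domain
  have hui : IntervalIntegrable u volume s t := hu.continuous.intervalIntegrable _ _
  have hηi : IntervalIntegrable η volume s t := hu.integrable.intervalIntegrable
  have key : ∀ χ : A.domain, ⟪Complex.I • (u t - u s) - ∫ r in s..t, η r, (χ : E)⟫_ℂ
      = ⟪∫ r in s..t, u r, A χ⟫_ℂ := by
    intro χ
    have i1 : IntervalIntegrable (fun r => ⟪A χ, u r⟫_ℂ) volume s t :=
      ⟨hui.1.const_inner _, hui.2.const_inner _⟩
    have i2 : IntervalIntegrable (fun r => ⟪(χ : E), η r⟫_ℂ) volume s t :=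
      ⟨hηi.1.const_inner _, hηi.2.const_inner _⟩
    have h1 := intervalIntegral.integral_eq_sub_of_hasDeriv_right_of_le hst
      (f := fun r => ⟪(χ : E), u r⟫_ℂ) (continuous_const.inner hu.continuous).continuousOn
      (fun r hr => hu.hasDeriv r ⟨hs.trans hr.1.le, hr.2.trans_le ht⟩ χ)
      ((i1.add i2).const_mul _)
    rw [intervalIntegral.integral_const_mul, intervalIntegral.integral_add i1 i2,
      intervalIntegral_inner hst hui, intervalIntegral_inner hst hηi, ← inner_sub_right] at h1
    have h2 : ⟪A χ, ∫ r in s..t, u r⟫_ℂ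
        = ⟪(χ : E), Complex.I • (u t - u s) - ∫ r in s..t, η r⟫_ℂ := by
      rw [inner_sub_right, inner_smul_right, ← h1]
      linear_combination (⟪A χ, ∫ r in s..t, u r⟫_ℂ + ⟪(χ : E), ∫ r in s..t, η r⟫_ℂ)
        * Complex.I_mul_I
    rw [← inner_conj_symm, ← h2, inner_conj_symm]
  have hm := LinearPMap.mem_adjoint_domain_of_exists _ ⟨_, key⟩
  have hv := LinearPMap.adjoint_apply_eq hd ⟨_, hm⟩ key
  have hg : (∫ r in s..t, u r, Complex.I • (u t - u s) - ∫ r in s..t, η r)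
      ∈ (LinearPMap.adjoint A).graph := LinearPMap.mem_graph_iff _ |>.2 ⟨⟨_, hm⟩, rfl, hv⟩
  rwa [LinearPMap.isSelfAdjoint_def.1 hA] at hg

theorem IsWeakSolution.forwardAverage_mem_graph {A : E →ₗ.[ℂ] E} (hA : IsSelfAdjoint A) {b : ℝ}
    {u η : ℝ → E} (hu : IsWeakSolution A b u η) {h t : ℝ} (ht : 0 ≤ t) (hh : 0 < h)
    (hb : t + h ≤ b) :
    (forwardAverage h u t, Complex.I • (h⁻¹ • (u (t + h) - u t)) - forwardAverage h η t)
      ∈ A.graph := by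
  have h1 := A.graph.smul_mem ((h⁻¹ : ℝ) : ℂ) (hu.integral_mem_graph hA ht (by linarith) hb)
  convert h1 using 1
  ext
  · simp only [forwardAverage, Prod.smul_mk, Complex.coe_smul]
  · simp only [forwardAverage, Prod.smul_mk, smul_sub, Complex.coe_smul]
    rw [smul_comm, smul_comm h⁻¹ Complex.I (u t)]

theorem LinearPMap.inner_graph_symm {A : E →ₗ.[ℂ] E} (hA : IsSelfAdjoint A) {z z' : E × E}
    (hz : z ∈ A.graph) (hz' : z' ∈ A.graph) : ⟪z.2, z'.1⟫_ℂ = ⟪z.1, z'.2⟫_ℂ := by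
  obtain ⟨x, hx1, hx2⟩ := (LinearPMap.mem_graph_iff _).1 hz
  obtain ⟨y, hy1, hy2⟩ := (LinearPMap.mem_graph_iff _).1 hz'
  have h1 := LinearPMap.adjoint_isFormalAdjoint (T := A) hA.dense_domain
  rw [LinearPMap.isSelfAdjoint_def.1 hA] at h1
  rw [← hx1, ← hx2, ← hy1, ← hy2]
  exact h1 x y

/-- Inner products of weak solutions are constant if the inhomogeneities are compatible. -/
theorem IsWeakSolution.inner_eq {A : E →ₗ.[ℂ] E} (hA : IsSelfAdjoint A) {b : ℝ}
    {u η w ζ : ℝ → E} (hu : IsWeakSolution A b u η) (hw : IsWeakSolution A b w ζ)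
    (hηζ : ∀ t ∈ Ico 0 b, ⟪η t, w t⟫_ℂ = ⟪u t, ζ t⟫_ℂ) {M : ℝ} (hMu : ∀ t, ‖u t‖ ≤ M)
    (hMw : ∀ t, ‖w t‖ ≤ M) {t : ℝ} (ht : 0 ≤ t) (htb : t < b) :
    ⟪u t, w t⟫_ℂ = ⟪u 0, w 0⟫_ℂ := by
  obtain ⟨h, hh, hlim, G, hG, hle⟩ := exists_seq_forwardAverage
    (f := fun t => (η t, ζ t)) (hu.stronglyMeasurable.prodMk hw.stronglyMeasurable)
    (hu.integrable.prodMk hw.integrable)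
  have hpair : ∀ n t, forwardAverage (h n) (fun t => (η t, ζ t)) t
      = (forwardAverage (h n) η t, forwardAverage (h n) ζ t) := fun n t => by
    have e1 : (∫ r in t..t + h n, (η r, ζ r))
        = (∫ r in t..t + h n, η r, ∫ r in t..t + h n, ζ r) := by
      simp only [intervalIntegral]
      rw [integral_pair hu.integrable.integrableOn hw.integrable.integrableOn,
        integral_pair hu.integrable.integrableOn hw.integrable.integrableOn]
      rfl
    simp only [forwardAverage, e1, Prod.smul_mk]
  simp_rw [hpair] at hlim hle
  have hM : 0 ≤ M := (norm_nonneg _).trans (hMu 0)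
  set g : ℕ → ℝ → ℂ := fun n r => Complex.I * (⟪forwardAverage (h n) η r, forwardAverage (h n) w r⟫_ℂ
    - ⟪forwardAverage (h n) u r, forwardAverage (h n) ζ r⟫_ℂ) with hg
  have hcu : ∀ n, Continuous (forwardAverage (h n) u) := fun n =>
    continuous_iff_continuousAt.2 fun t => (hasDerivAt_forwardAverage hu.continuous (h n) t).continuousAt
  have hcw : ∀ n, Continuous (forwardAverage (h n) w) := fun n =>
    continuous_iff_continuousAt.2 fun t => (hasDerivAt_forwardAverage hw.continuous (h n) t).continuousAt
  have hcg : ∀ n, Continuous (g n) := fun n => continuous_const.mul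
    (((continuous_forwardAverage hu.integrable (h n)).inner (hcw n)).sub
      ((hcu n).inner (continuous_forwardAverage hw.integrable (h n))))
  have hev : ∀ᶠ n in atTop, ⟪forwardAverage (h n) u t, forwardAverage (h n) w t⟫_ℂ
      - ⟪forwardAverage (h n) u 0, forwardAverage (h n) w 0⟫_ℂ = ∫ r in (0 : ℝ)..t, g n r := by
    filter_upwards [hh.eventually (Ioo_mem_nhdsGT (sub_pos.2 htb))] with n hn
    refine (intervalIntegral.integral_eq_sub_of_hasDerivAt
      (f := fun r => ⟪forwardAverage (h n) u r, forwardAverage (h n) w r⟫_ℂ) (fun r hr => ?_)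
      ((hcg n).intervalIntegrable _ _)).symm
    rw [uIcc_of_le ht] at hr
    have d1 := (hasDerivAt_forwardAverage hu.continuous (h n) r).inner ℂ
      (hasDerivAt_forwardAverage hw.continuous (h n) r)
    have m1 := hu.forwardAverage_mem_graph hA hr.1 hn.1 (by linarith [hr.2, hn.2])
    have m2 := hw.forwardAverage_mem_graph hA hr.1 hn.1 (by linarith [hr.2, hn.2])
    -- Both averages are in the domain, so the terms with A cancel by symmetry and only the averaged
    -- inhomogeneities are left in the derivative.
    have m3 := LinearPMap.inner_graph_symm hA m1 m2
    refine d1.congr_deriv ?_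
    simp only [hg, inner_sub_left, inner_sub_right, inner_smul_left, inner_smul_right,
      Complex.conj_I] at m3 ⊢
    linear_combination Complex.I * m3
      + (⟪(h n)⁻¹ • (u (r + h n) - u r), forwardAverage (h n) w r⟫_ℂ
        + ⟪forwardAverage (h n) u r, (h n)⁻¹ • (w (r + h n) - w r)⟫_ℂ) * Complex.I_mul_I
  have hlim1 : Tendsto (fun n => ⟪forwardAverage (h n) u t, forwardAverage (h n) w t⟫_ℂ
      - ⟪forwardAverage (h n) u 0, forwardAverage (h n) w 0⟫_ℂ) atTop
      (𝓝 (⟪u t, w t⟫_ℂ - ⟪u 0, w 0⟫_ℂ)) :=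
    ((((tendsto_forwardAverage hu.continuous t).comp hh).inner
      ((tendsto_forwardAverage hw.continuous t).comp hh))).sub
    ((((tendsto_forwardAverage hu.continuous 0).comp hh).inner
      ((tendsto_forwardAverage hw.continuous 0).comp hh)))
  have hlim2 : Tendsto (fun n => ∫ r in (0 : ℝ)..t, g n r) atTop (𝓝 (∫ r in (0 : ℝ)..t, (0 : ℂ))) := by
    refine intervalIntegral.tendsto_integral_filter_of_dominated_convergence
      (fun r => 2 * M * G r) (Eventually.of_forall fun n => (hcg n).aestronglyMeasurable) ?_
      ((hG.const_mul _).intervalIntegrable) ?_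
    · filter_upwards [hh.eventually self_mem_nhdsWithin] with n hn
      filter_upwards [hle] with r hr _
      have hr' := hr n
      have n1 : ‖forwardAverage (h n) η r‖ ≤ G r := (norm_fst_le _).trans hr'
      have n2 : ‖forwardAverage (h n) ζ r‖ ≤ G r := (norm_snd_le _).trans hr'
      have n3 := norm_forwardAverage_le (fun r _ => hMu r) hn (t := r)
      have n4 := norm_forwardAverage_le (fun r _ => hMw r) hn (t := r)
      have hG0 : 0 ≤ G r := (norm_nonneg _).trans n1
      rw [hg]
      simp only
      rw [norm_mul, Complex.norm_I, one_mul]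
      refine (norm_sub_le _ _).trans ?_
      have k1 := (norm_inner_le_norm (𝕜 := ℂ) (forwardAverage (h n) η r)
        (forwardAverage (h n) w r)).trans (mul_le_mul n1 n4 (norm_nonneg _) hG0)
      have k2 := (norm_inner_le_norm (𝕜 := ℂ) (forwardAverage (h n) u r)
        (forwardAverage (h n) ζ r)).trans (mul_le_mul n3 n2 (norm_nonneg _) hM)
      linarith
    · filter_upwards [hlim] with r hr hrt
      rw [uIoc_of_le ht] at hrt
      have l1 := hr.fst_nhds
      have l2 := hr.snd_nhds
      have := (((l1.inner ((tendsto_forwardAverage hw.continuous r).comp hh)).sub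
        (((tendsto_forwardAverage hu.continuous r).comp hh).inner l2))).const_mul Complex.I
      simp only [hηζ r ⟨hrt.1.le, hrt.2.trans_lt htb⟩, sub_self, mul_zero] at this
      exact this
  have h3 := tendsto_nhds_unique (hlim1.congr' hev) hlim2
  rw [intervalIntegral.integral_zero, sub_eq_zero] at h3
  exact h3

end WeakSolution

/-! ### Derivations acting on functions of the number operator -/

section HatDeriv

variable {A : Type*} [Ring A] {N : ℕ}

open Classical in
/-- The derivative of `projFactor p S m` if `p` has the derivative `d`. -/
def factorDeriv (d : Fin N → A) (S : Finset (Fin N)) (m : Fin N) : A :=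
  if m ∈ S then -d m else d m

/-- The derivative of a product of factors. -/
def listDeriv (p d : Fin N → A) (S : Finset (Fin N)) : List (Fin N) → A
  | [] => 0
  | m :: l => factorDeriv d S m * (l.map (projFactor p S)).prod
      + projFactor p S m * listDeriv p d S l

variable [Algebra ℂ A]

/-- The derivative of `hatOp p f` if `p` has the derivative `d`. -/
def hatDeriv (p d : Fin N → A) (f : ℕ → ℝ) : A :=
  ∑ k ∈ Finset.range (N + 1), (f k : ℂ) •
    ∑ S ∈ Finset.powersetCard k Finset.univ, listDeriv p d S (List.finRange N)

theorem hatDeriv_add (p d d' : Fin N → A) (f : ℕ → ℝ) :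
    hatDeriv p (fun m => d m + d' m) f = hatDeriv p d f + hatDeriv p d' f := by
  have h1 : ∀ (S : Finset (Fin N)) (l : List (Fin N)),
      listDeriv p (fun m => d m + d' m) S l = listDeriv p d S l + listDeriv p d' S l := by
    intro S l
    induction l with
    | nil => simp [listDeriv]
    | cons m l ih =>
      have h2 : factorDeriv (fun m => d m + d' m) S m = factorDeriv d S m + factorDeriv d' S m := by
        unfold factorDeriv
        split_ifs
        · exact neg_add _ _
        · rfl
      simp only [listDeriv, ih, h2, add_mul, mul_add]
      abel
  simp only [hatDeriv, h1, Finset.sum_add_distrib, smul_add]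

theorem hatDeriv_smul (p d : Fin N → A) (c : ℂ) (f : ℕ → ℝ) :
    hatDeriv p (fun m => c • d m) f = c • hatDeriv p d f := by
  have h1 : ∀ (S : Finset (Fin N)) (l : List (Fin N)),
      listDeriv p (fun m => c • d m) S l = c • listDeriv p d S l := by
    intro S l
    induction l with
    | nil => simp [listDeriv]
    | cons m l ih =>
      have h2 : factorDeriv (fun m => c • d m) S m = c • factorDeriv d S m := by
        unfold factorDeriv
        split_ifs
        · rw [smul_neg]
        · rfl
      simp only [listDeriv, ih, h2, smul_add, smul_mul_assoc, mul_smul_comm]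
  simp only [hatDeriv, h1, Finset.smul_sum, smul_comm c]

end HatDeriv

/-! ### Differentiation, continuity and uniform bounds for functions of the number operator. -/

section HatDerivNormed

variable {A : Type*} [NormedRing A] [NormedAlgebra ℂ A] {N : ℕ}

theorem hasDerivAt_hatOp {p : ℝ → Fin N → A} {d : Fin N → A} {t : ℝ}
    (h : ∀ m, HasDerivAt (fun s => p s m) (d m) t) (f : ℕ → ℝ) :
    HasDerivAt (fun s => hatOp (p s) f) (hatDeriv (p t) d f) t := by
  have h1 : ∀ (S : Finset (Fin N)) (m : Fin N),
      HasDerivAt (fun s => projFactor (p s) S m) (factorDeriv d S m) t := by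
    intro S m
    unfold projFactor factorDeriv
    split_ifs
    · exact (h m).const_sub 1
    · exact h m
  have h2 : ∀ (S : Finset (Fin N)) (l : List (Fin N)),
      HasDerivAt (fun s => (l.map (projFactor (p s) S)).prod) (listDeriv (p t) d S l) t := by
    intro S l
    induction l with
    | nil => simpa [listDeriv] using hasDerivAt_const t (1 : A)
    | cons m l ih =>
      simp only [List.map_cons, List.prod_cons, listDeriv]
      exact (h1 S m).mul ih
  exact HasDerivAt.fun_sum fun k _ => (HasDerivAt.fun_sum fun S _ =>
    h2 S (List.finRange N)).const_smul (f k : ℂ)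

theorem continuous_hatOp (f : ℕ → ℝ) : Continuous fun p : Fin N → A => hatOp p f := by
  have h1 : ∀ (S : Finset (Fin N)) (m : Fin N), Continuous fun p : Fin N → A => projFactor p S m := by
    intro S m
    unfold projFactor
    split_ifs <;> fun_prop
  have h2 : ∀ (S : Finset (Fin N)) (l : List (Fin N)),
      Continuous fun p : Fin N → A => (l.map (projFactor p S)).prod := by
    intro S l
    induction l with
    | nil => simpa using continuous_const
    | cons m l ih =>
      simp only [List.map_cons, List.prod_cons]
      exact (h1 S m).mul ih
  exact continuous_finsetSum _ fun k _ => (continuous_finsetSum _ fun S _ =>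
    h2 S (List.finRange N)).const_smul _

theorem continuous_hatDeriv (f : ℕ → ℝ) :
    Continuous fun x : (Fin N → A) × (Fin N → A) => hatDeriv x.1 x.2 f := by
  have h1 : ∀ (S : Finset (Fin N)) (m : Fin N),
      Continuous fun x : (Fin N → A) × (Fin N → A) => projFactor x.1 S m := by
    intro S m
    unfold projFactor
    split_ifs <;> fun_prop
  have h2 : ∀ (S : Finset (Fin N)) (m : Fin N),
      Continuous fun x : (Fin N → A) × (Fin N → A) => factorDeriv x.2 S m := by
    intro S m
    unfold factorDeriv
    split_ifs <;> fun_prop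
  have h3 : ∀ (S : Finset (Fin N)) (l : List (Fin N)),
      Continuous fun x : (Fin N → A) × (Fin N → A) => (l.map (projFactor x.1 S)).prod := by
    intro S l
    induction l with
    | nil => simpa using continuous_const
    | cons m l ih =>
      simp only [List.map_cons, List.prod_cons]
      exact (h1 S m).mul ih
  have h4 : ∀ (S : Finset (Fin N)) (l : List (Fin N)),
      Continuous fun x : (Fin N → A) × (Fin N → A) => listDeriv x.1 x.2 S l := by
    intro S l
    induction l with
    | nil => simpa [listDeriv] using continuous_const
    | cons m l ih =>
      simp only [listDeriv]
      exact ((h2 S m).mul (h3 S l)).add ((h1 S m).mul ih)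
  exact continuous_finsetSum _ fun k _ => (continuous_finsetSum _ fun S _ =>
    h4 S (List.finRange N)).const_smul _

theorem Continuous.hatOp {Z : Type*} [TopologicalSpace Z] {p : Z → Fin N → A}
    (hp : ∀ m, Continuous fun z => p z m) (f : ℕ → ℝ) : Continuous fun z => hatOp (p z) f :=
  (continuous_hatOp f).comp (continuous_pi hp)

theorem Continuous.hatDeriv {Z : Type*} [TopologicalSpace Z] {p d : Z → Fin N → A}
    (hp : ∀ m, Continuous fun z => p z m) (hd : ∀ m, Continuous fun z => d z m) (f : ℕ → ℝ) :
    Continuous fun z => hatDeriv (p z) (d z) f :=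
  (continuous_hatDeriv f).comp ((continuous_pi hp).prodMk (continuous_pi hd))

/-- The constant depends only on N, M and f, and the second bound is linear in the size of the
derivative. This supplies the dominating functions when averages are removed. -/
theorem exists_norm_hatOp_le (N : ℕ) (M : ℝ) (f : ℕ → ℝ) :
    ∃ K, ∀ p d : Fin N → A, ∀ D, 0 ≤ D → (∀ m, ‖p m‖ ≤ M) → (∀ m, ‖d m‖ ≤ D) →
      ‖hatOp p f‖ ≤ K ∧ ‖hatDeriv p d f‖ ≤ K * D := by
  set c := ‖(1 : A)‖ + |M| with hc
  have hc0 : 0 ≤ c := by positivity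
  have h1 : ∀ (p : Fin N → A), (∀ m, ‖p m‖ ≤ M) → ∀ S m, ‖projFactor p S m‖ ≤ c := by
    intro p hp S m
    have h2 := (hp m).trans (le_abs_self M)
    unfold projFactor
    split_ifs
    · exact (norm_sub_le _ _).trans (add_le_add le_rfl h2)
    · exact h2.trans (le_add_of_nonneg_left (norm_nonneg _))
  have h2 : ∀ l : List (Fin N), ∃ K, 0 ≤ K ∧ ∀ p d : Fin N → A, ∀ D, 0 ≤ D → (∀ m, ‖p m‖ ≤ M) →
      (∀ m, ‖d m‖ ≤ D) → ∀ S, ‖(l.map (projFactor p S)).prod‖ ≤ K ∧ ‖listDeriv p d S l‖ ≤ K * D := by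
    intro l
    induction l with
    | nil =>
      refine ⟨‖(1 : A)‖, norm_nonneg _, fun p d D hD hp hd S => ⟨by simp, ?_⟩⟩
      rw [listDeriv, norm_zero]
      positivity
    | cons m l ih =>
      obtain ⟨K, hK0, hK⟩ := ih
      refine ⟨c * K + K, by positivity, fun p d D hD hp hd S => ?_⟩
      obtain ⟨k1, k2⟩ := hK p d D hD hp hd S
      have k3 : ‖factorDeriv d S m‖ ≤ D := by
        unfold factorDeriv
        split_ifs
        · rw [norm_neg]; exact hd m
        · exact hd m
      constructor
      · rw [List.map_cons, List.prod_cons]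
        refine (norm_mul_le _ _).trans ((mul_le_mul (h1 p hp S m) k1 (norm_nonneg _) hc0).trans ?_)
        linarith
      · rw [listDeriv]
        refine (norm_add_le _ _).trans ((add_le_add ((norm_mul_le _ _).trans
          (mul_le_mul k3 k1 (norm_nonneg _) hD)) ((norm_mul_le _ _).trans
          (mul_le_mul (h1 p hp S m) k2 (norm_nonneg _) hc0))).trans (le_of_eq ?_))
        ring
  obtain ⟨K, hK0, hK⟩ := h2 (List.finRange N)
  refine ⟨∑ k ∈ Finset.range (N + 1), |f k| * ∑ _S ∈ Finset.powersetCard k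
    (Finset.univ : Finset (Fin N)), K, fun p d D hD hp hd => ⟨?_, ?_⟩⟩
  · refine (norm_sum_le _ _).trans (Finset.sum_le_sum fun k _ => ?_)
    rw [norm_smul, Complex.norm_real, Real.norm_eq_abs]
    exact mul_le_mul_of_nonneg_left ((norm_sum_le _ _).trans (Finset.sum_le_sum fun S _ =>
      (hK p d D hD hp hd S).1)) (abs_nonneg _)
  · rw [Finset.sum_mul]
    refine (norm_sum_le _ _).trans (Finset.sum_le_sum fun k _ => ?_)
    rw [norm_smul, Complex.norm_real, Real.norm_eq_abs, mul_assoc, Finset.sum_mul]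
    exact mul_le_mul_of_nonneg_left ((norm_sum_le _ _).trans (Finset.sum_le_sum fun S _ =>
      (hK p d D hD hp hd S).2)) (abs_nonneg _)

end HatDerivNormed

/-! ### Commutators with an operator given by its graph -/

section Derives

variable {E : Type*} [NormedAddCommGroup E] [NormedSpace ℂ E]

/-- `B` preserves the domain of the operator with graph `G`, and the commutator is `B'`. -/
def Derives (G : Submodule ℂ (E × E)) (B B' : E →L[ℂ] E) : Prop :=
  ∀ z ∈ G, (B z.1, B z.2 + B' z.1) ∈ G

variable {G : Submodule ℂ (E × E)} {B B' C C' : E →L[ℂ] E}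

theorem Derives.add (hB : Derives G B B') (hC : Derives G C C') : Derives G (B + C) (B' + C') := by
  intro z hz
  convert G.add_mem (hB z hz) (hC z hz) using 1
  simp only [Prod.mk_add_mk, _root_.add_apply]
  congr 1
  abel

theorem Derives.smul (hB : Derives G B B') (c : ℂ) : Derives G (c • B) (c • B') := by
  intro z hz
  convert G.smul_mem c (hB z hz) using 1
  simp only [Prod.smul_mk, _root_.smul_apply, smul_add]

theorem Derives.zero : Derives G 0 0 := by
  intro z hz
  simp only [_root_.zero_apply, add_zero]
  exact G.zero_mem

theorem Derives.one : Derives G 1 0 := by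
  intro z hz
  simpa only [one_apply_eq_self, _root_.zero_apply, add_zero] using hz

theorem Derives.neg (hB : Derives G B B') : Derives G (-B) (-B') := by
  simpa using hB.smul (-1)

theorem Derives.mul (hB : Derives G B B') (hC : Derives G C C') :
    Derives G (B * C) (B' * C + B * C') := by
  intro z hz
  convert hB _ (hC z hz) using 1
  simp only [mul_apply_eq_comp, _root_.add_apply, map_add]
  congr 1
  abel

theorem Derives.sum {ι : Type*} {s : Finset ι} {B B' : ι → E →L[ℂ] E}
    (h : ∀ i ∈ s, Derives G (B i) (B' i)) : Derives G (∑ i ∈ s, B i) (∑ i ∈ s, B' i) := by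
  classical
  induction s using Finset.induction_on with
  | empty => simpa using Derives.zero
  | insert a s ha ih =>
    rw [Finset.sum_insert ha, Finset.sum_insert ha]
    exact (h a (Finset.mem_insert_self a s)).add
      (ih fun i hi => h i (Finset.mem_insert_of_mem hi))

theorem Derives.hatOp {N : ℕ} {p d : Fin N → E →L[ℂ] E} (h : ∀ m, Derives G (p m) (d m))
    (f : ℕ → ℝ) : Derives G (hatOp p f) (hatDeriv p d f) := by
  have h1 : ∀ (S : Finset (Fin N)) (m : Fin N),
      Derives G (projFactor p S m) (factorDeriv d S m) := by
    intro S m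
    unfold projFactor factorDeriv
    split_ifs
    · simpa [sub_eq_add_neg] using Derives.one.add (h m).neg
    · exact h m
  have h2 : ∀ (S : Finset (Fin N)) (l : List (Fin N)),
      Derives G (l.map (projFactor p S)).prod (listDeriv p d S l) := by
    intro S l
    induction l with
    | nil => simpa [listDeriv] using Derives.one
    | cons m l ih => simpa only [List.map_cons, List.prod_cons, listDeriv] using (h1 S m).mul ih
  exact Derives.sum fun k _ => (Derives.sum fun S _ => h2 S (List.finRange N)).smul _

/-- The derivation that is given by a bounded operator. -/
theorem hatDeriv_commutator {N : ℕ} (p : Fin N → E →L[ℂ] E) (X : E →L[ℂ] E) (f : ℕ → ℝ) :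
    hatDeriv p (fun m => X * p m - p m * X) f = X * _root_.hatOp p f - _root_.hatOp p f * X := by
  -- For a bounded operator X, compatibility with its graph is the commutator identity itself, so
  -- the derivation calculus for unbounded operators also covers this case.
  set G : Submodule ℂ (E × E) := LinearMap.graph (X : E →ₗ[ℂ] E) with hG
  have h1 : ∀ m, Derives G (p m) (X * p m - p m * X) := by
    intro m z hz
    rw [hG, LinearMap.mem_graph_iff] at hz ⊢
    simp only [hz, sub_apply, mul_apply_eq_comp, ContinuousLinearMap.coe_coe]
    abel
  ext1 z
  have h2 := Derives.hatOp h1 f (z, X z) (by rw [hG, LinearMap.mem_graph_iff]; rfl)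
  rw [hG, LinearMap.mem_graph_iff] at h2
  simp only [ContinuousLinearMap.coe_coe] at h2
  rw [sub_apply, mul_apply_eq_comp, mul_apply_eq_comp, ← h2]
  abel

end Derives

/-! ### The graph of the free Hamiltonian -/

section FreeGraph

variable {N : ℕ} {H0 : OneBody →ₗ.[ℂ] OneBody}

/-- The image of a product under the free Hamiltonian. -/
def freeTensor (H0 : OneBody →ₗ.[ℂ] OneBody) (f : Fin N → H0.domain) : ManyBody N :=
  ∑ j, tensor (Function.update (fun i => (f i : OneBody)) j (H0 (f j)))

theorem coeFn_freeTensor (f : Fin N → H0.domain) : freeTensor H0 f =ᵐ[volume] fun x =>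
    ∑ j, (H0 (f j)) (x j) * ∏ i ∈ Finset.univ.erase j, (f i : OneBody) (x i) := by
  have h1 : ∀ᵐ x : Fin N → R3, ∀ j,
      tensor (Function.update (fun i => (f i : OneBody)) j (H0 (f j))) x
        = ∏ i, Function.update (fun i => (f i : OneBody)) j (H0 (f j)) i (x i) :=
    ae_all_iff.2 fun j => coeFn_tensor _
  filter_upwards [h1, coeFn_sum Finset.univ fun j =>
    tensor (Function.update (fun i => (f i : OneBody)) j (H0 (f j)))] with x h2 h3
  rw [freeTensor, h3]
  refine Finset.sum_congr rfl fun j _ => ?_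
  rw [h2, ← Finset.mul_prod_erase _ _ (Finset.mem_univ j), Function.update_self]
  congr 1
  refine Finset.prod_congr rfl fun i hi => ?_
  rw [Function.update_of_ne (Finset.ne_of_mem_erase hi)]

theorem tensor_mem_freeGraph (f : Fin N → H0.domain) :
    (tensor fun i => (f i : OneBody), freeTensor H0 f) ∈ freeGraph N H0 :=
  Submodule.le_topologicalClosure _ (Submodule.subset_span
    ⟨f, coeFn_tensor _, coeFn_freeTensor f⟩)

/-- Closed linear properties of the graph need to be checked only on products of domain vectors. -/
theorem freeGraph_le {K : Submodule ℂ (ManyBody N × ManyBody N)}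
    (hK : IsClosed (K : Set (ManyBody N × ManyBody N)))
    (h : ∀ f : Fin N → H0.domain, (tensor fun i => (f i : OneBody), freeTensor H0 f) ∈ K) :
    freeGraph N H0 ≤ K := by
  refine Submodule.topologicalClosure_minimal _ (Submodule.span_le.2 ?_) hK
  rintro ⟨w₁, w₂⟩ ⟨f, h1, h2⟩
  have e1 : w₁ = tensor fun i => (f i : OneBody) := Lp.ext (h1.trans (coeFn_tensor _).symm)
  have e2 : w₂ = freeTensor H0 f := Lp.ext (h2.trans (coeFn_freeTensor f).symm)
  rw [e1, e2]
  exact h f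

theorem isClosed_freeGraph : IsClosed (freeGraph N H0 : Set (ManyBody N × ManyBody N)) :=
  Submodule.isClosed_topologicalClosure _

theorem IsSelfAdjoint.inner_apply_comm {H0 : OneBody →ₗ.[ℂ] OneBody} (hH0 : IsSelfAdjoint H0)
    (f g : H0.domain) : ⟪H0 f, (g : OneBody)⟫_ℂ = ⟪(f : OneBody), H0 g⟫_ℂ :=
  LinearPMap.inner_graph_symm hH0 (z := (_, _)) (z' := (_, _))
    ((LinearPMap.mem_graph_iff _).2 ⟨f, rfl, rfl⟩) ((LinearPMap.mem_graph_iff _).2 ⟨g, rfl, rfl⟩)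

/-- Symmetry holds for two products because H⁰ is symmetric. It extends by linearity and closedness
in one argument and then, after exchanging the roles, in the other. -/
theorem freeGraph_symm (hH0 : IsSelfAdjoint H0) {z z' : ManyBody N × ManyBody N}
    (hz : z ∈ freeGraph N H0) (hz' : z' ∈ freeGraph N H0) : ⟪z.2, z'.1⟫_ℂ = ⟪z.1, z'.2⟫_ℂ := by
  set K : ManyBody N × ManyBody N → Submodule ℂ (ManyBody N × ManyBody N) := fun z =>
    LinearMap.ker (((innerSL ℂ z.2).comp (ContinuousLinearMap.fst ℂ _ _)
      - (innerSL ℂ z.1).comp (ContinuousLinearMap.snd ℂ _ _) :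
        ManyBody N × ManyBody N →L[ℂ] ℂ) : ManyBody N × ManyBody N →ₗ[ℂ] ℂ) with hK
  have hmem : ∀ z z', z' ∈ K z ↔ ⟪z.2, z'.1⟫_ℂ = ⟪z.1, z'.2⟫_ℂ := fun z z' => by
    simp [hK, sub_eq_zero]
  have hcl : ∀ z, IsClosed (K z : Set (ManyBody N × ManyBody N)) := fun z =>
    ContinuousLinearMap.isClosed_ker _
  have hswap : ∀ z z', z' ∈ K z → z ∈ K z' := fun z z' h => by
    rw [hmem] at h ⊢
    rw [← inner_conj_symm, ← h, inner_conj_symm]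
  have h1 : ∀ f g : Fin N → H0.domain, (tensor fun i => (g i : OneBody), freeTensor H0 g)
      ∈ K (tensor fun i => (f i : OneBody), freeTensor H0 f) := by
    intro f g
    rw [hmem]
    simp only [freeTensor, sum_inner, inner_sum, inner_tensor]
    refine Finset.sum_congr rfl fun j _ => Finset.prod_congr rfl fun i _ => ?_
    by_cases hij : i = j
    · subst hij
      rw [Function.update_self, Function.update_self, hH0.inner_apply_comm]
    · rw [Function.update_of_ne hij, Function.update_of_ne hij]
  have h2 : ∀ f : Fin N → H0.domain, z' ∈ K (tensor fun i => (f i : OneBody), freeTensor H0 f) :=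
    fun f => freeGraph_le (hcl _) (h1 f) hz'
  exact (hmem _ _).1 (hswap _ _ (freeGraph_le (hcl z') (fun f => hswap _ _ (h2 f)) hz))

theorem freeGraph_permute (σ : Equiv.Perm (Fin N)) {z : ManyBody N × ManyBody N}
    (hz : z ∈ freeGraph N H0) : (permute σ z.1, permute σ z.2) ∈ freeGraph N H0 := by
  set Λ : ManyBody N × ManyBody N →L[ℂ] ManyBody N × ManyBody N :=
    (permute σ).prodMap (permute σ) with hΛ
  have h1 : freeGraph N H0 ≤ (freeGraph N H0).comap (Λ : _ →ₗ[ℂ] _) := by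
    refine freeGraph_le (isClosed_freeGraph.preimage Λ.continuous) fun f => ?_
    have e1 := tensor_mem_freeGraph fun i => f (σ.symm i)
    have e2 : permute σ (freeTensor H0 f) = freeTensor H0 fun i => f (σ.symm i) := by
      rw [freeTensor, map_sum, freeTensor, ← Equiv.sum_comp σ fun j => tensor
        (Function.update (fun i => (f (σ.symm i) : OneBody)) j (H0 (f (σ.symm j))))]
      refine Finset.sum_congr rfl fun j _ => ?_
      rw [permute_tensor]
      congr 1
      funext i
      by_cases hij : i = σ j
      · subst hij
        simp
      · rw [Function.update_of_ne hij, Function.update_of_ne]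
        rintro rfl
        simp at hij
    rw [← e2] at e1
    rw [Submodule.mem_comap]
    convert e1 using 1
    simp [hΛ, permute_tensor]
  exact h1 hz

/-- Replacing the factor m of a product by a changes the free Hamiltonian only in this factor: it
now acts on a, and the lost action on the old factor is moved onto b by symmetry of H⁰. The identity
passes to the closure because both operators are bounded. -/
theorem derives_rankOne (hH0 : IsSelfAdjoint H0) (m : Fin N) (a b : H0.domain) :
    Derives (freeGraph N H0) (rankOne m a b) (rankOne m (H0 a) b - rankOne m a (H0 b)) := by
  intro z hz
  set B := rankOne m (a : OneBody) (b : OneBody) with hB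
  set B' := rankOne m (H0 a) (b : OneBody) - rankOne m (a : OneBody) (H0 b) with hB'
  set Λ : ManyBody N × ManyBody N →L[ℂ] ManyBody N × ManyBody N :=
    (B.comp (ContinuousLinearMap.fst ℂ _ _)).prod
      (B.comp (ContinuousLinearMap.snd ℂ _ _) + B'.comp (ContinuousLinearMap.fst ℂ _ _)) with hΛ
  have h1 : freeGraph N H0 ≤ (freeGraph N H0).comap (Λ : _ →ₗ[ℂ] _) := by
    refine freeGraph_le (isClosed_freeGraph.preimage Λ.continuous) fun f => ?_
    set F : Fin N → OneBody := fun i => (f i : OneBody) with hF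
    set f' : Fin N → H0.domain := Function.update f m a with hf'
    have hf'' : (fun i => (f' i : OneBody)) = Function.update F m a := by
      funext i
      by_cases h : i = m
      · subst h; simp [hf']
      · simp [hf', h, hF]
    have e1 := (freeGraph N H0).smul_mem ⟪(b : OneBody), F m⟫_ℂ (tensor_mem_freeGraph f')
    rw [Submodule.mem_comap]
    convert e1 using 1
    have g1 : B (tensor F) = ⟪(b : OneBody), F m⟫_ℂ • tensor (Function.update F m a) :=
      rankOne_tensor m _ _ F
    have g2 : freeTensor H0 f' = tensor (Function.update F m (H0 a))
        + ∑ j ∈ {m}ᶜ, tensor (Function.update (Function.update F m a) j (H0 (f j))) := by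
      rw [freeTensor, ← Finset.sum_compl_add_sum {m}, Finset.sum_singleton, add_comm, hf'']
      congr 1
      · congr 1
        rw [Function.update_idem, hf', Function.update_self]
      · refine Finset.sum_congr rfl fun j hj => ?_
        have hjm : j ≠ m := by simpa using hj
        rw [hf', Function.update_of_ne hjm]
    have g3 : B (freeTensor H0 f) = ⟪(b : OneBody), H0 (f m)⟫_ℂ • tensor (Function.update F m a)
        + ⟪(b : OneBody), F m⟫_ℂ •
          ∑ j ∈ {m}ᶜ, tensor (Function.update (Function.update F m a) j (H0 (f j))) := by
      rw [freeTensor, map_sum, ← Finset.sum_compl_add_sum {m}, Finset.sum_singleton, add_comm,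
        Finset.smul_sum]
      congr 1
      · rw [hB, rankOne_tensor, Function.update_self, Function.update_idem]
      · refine Finset.sum_congr rfl fun j hj => ?_
        have hjm : j ≠ m := by simpa using hj
        rw [hB, rankOne_tensor, Function.update_of_ne hjm.symm, Function.update_comm hjm]
    have g4 : B' (tensor F) = ⟪(b : OneBody), F m⟫_ℂ • tensor (Function.update F m (H0 a))
        - ⟪(b : OneBody), H0 (f m)⟫_ℂ • tensor (Function.update F m a) := by
      rw [hB', sub_apply, rankOne_tensor, rankOne_tensor, hH0.inner_apply_comm]
    simp only [hΛ, ContinuousLinearMap.coe_coe, ContinuousLinearMap.prod_apply,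
      ContinuousLinearMap.comp_apply, ContinuousLinearMap.coe_fst', ContinuousLinearMap.coe_snd',
      _root_.add_apply, Prod.smul_mk]
    rw [g1, g3, g4, g2, hf'', smul_add]
    congr 1
    abel
  exact h1 hz

end FreeGraph

/-! ### Bounded sesquilinear maps -/

section Sesquilinear

open Filter Topology

variable {F A : Type*} [NormedAddCommGroup F] [NormedSpace ℂ F] [NormedRing A] [NormedAlgebra ℂ A]

/-- Maps that are linear in the first and antilinear in the second argument, of norm at most one. -/
structure IsContractiveSesquilinear (r : F → F → A) : Prop where
  add_left : ∀ f f' g, r (f + f') g = r f g + r f' g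
  smul_left : ∀ (c : ℂ) f g, r (c • f) g = c • r f g
  add_right : ∀ f g g', r f (g + g') = r f g + r f g'
  smul_right : ∀ (c : ℂ) f g, r f (c • g) = conj c • r f g
  norm_le : ∀ f g, ‖r f g‖ ≤ ‖f‖ * ‖g‖

/-- Antilinearity in the second argument rules out complex bilinearity; over ℝ the product rule is
available, which is enough for time derivatives. -/
theorem IsContractiveSesquilinear.isBoundedBilinearMap {r : F → F → A}
    (hr : IsContractiveSesquilinear r) : IsBoundedBilinearMap ℝ fun p : F × F => r p.1 p.2 where
  add_left := hr.add_left
  smul_left c f g := by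
    have h := hr.smul_left (c : ℂ) f g
    simpa only [Complex.coe_smul] using h
  add_right := hr.add_right
  smul_right c f g := by
    have h := hr.smul_right (c : ℂ) f g
    simpa only [Complex.conj_ofReal, Complex.coe_smul] using h
  bound := ⟨1, one_pos, fun f g => by rw [one_mul]; exact hr.norm_le f g⟩

variable {N : ℕ}

/-- The sum of the projections onto the orbitals `φ j` with respect to `r`. -/
def orbitalSum (r : Fin N → F → F → A) (φ : Fin N → F) (m : Fin N) : A := ∑ j, r m (φ j) (φ j)

/-- The contribution of inhomogeneities `η` in `i φ_j' = H⁰ φ_j + η_j` to the derivative of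
`orbitalSum r φ`. -/
def sourceDeriv (r : Fin N → F → F → A) (φ η : Fin N → F) (m : Fin N) : A :=
  (-Complex.I) • ∑ j, (r m (η j) (φ j) - r m (φ j) (η j))

variable {r : Fin N → F → F → A}

theorem Continuous.orbitalSum {Z : Type*} [TopologicalSpace Z]
    (hr : ∀ m, IsContractiveSesquilinear (r m)) {φ : Z → Fin N → F} (hφ : Continuous φ)
    (m : Fin N) : Continuous fun z => orbitalSum r (φ z) m := by
  have h1 : ∀ j, Continuous fun z => φ z j := fun j => (continuous_apply j).comp hφ
  exact continuous_finsetSum _ fun j _ =>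
    (hr m).isBoundedBilinearMap.continuous.comp ((h1 j).prodMk (h1 j))

theorem Continuous.sourceDeriv {Z : Type*} [TopologicalSpace Z]
    (hr : ∀ m, IsContractiveSesquilinear (r m)) {φ η : Z → Fin N → F} (hφ : Continuous φ)
    (hη : Continuous η) (m : Fin N) : Continuous fun z => sourceDeriv r (φ z) (η z) m := by
  have h1 : ∀ j, Continuous fun z => φ z j := fun j => (continuous_apply j).comp hφ
  have h2 : ∀ j, Continuous fun z => η z j := fun j => (continuous_apply j).comp hη
  have h3 := (hr m).isBoundedBilinearMap.continuous
  have h4 : Continuous fun z => ∑ j, (r m (η z j) (φ z j) - r m (φ z j) (η z j)) :=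
    continuous_finsetSum _ fun j _ => (h3.comp ((h2 j).prodMk (h1 j))).sub
      (h3.comp ((h1 j).prodMk (h2 j)))
  exact h4.const_smul (-Complex.I)

theorem norm_orbitalSum_le (hr : ∀ m, IsContractiveSesquilinear (r m)) {φ : Fin N → F} {M : ℝ}
    (hM : ∀ j, ‖φ j‖ ≤ M) (m : Fin N) : ‖orbitalSum r φ m‖ ≤ N * (M * M) := by
  refine (norm_sum_le_of_le _ fun j _ => ((hr m).norm_le _ _).trans (mul_le_mul (hM j) (hM j)
    (norm_nonneg _) ((norm_nonneg _).trans (hM j)))).trans (le_of_eq ?_)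
  simp

theorem norm_sourceDeriv_le (hr : ∀ m, IsContractiveSesquilinear (r m)) {φ η : Fin N → F}
    {M D : ℝ} (hM : ∀ j, ‖φ j‖ ≤ M) (hD : ∀ j, ‖η j‖ ≤ D) (m : Fin N) :
    ‖sourceDeriv r φ η m‖ ≤ N * (2 * (M * D)) := by
  rw [sourceDeriv, norm_smul, norm_neg, Complex.norm_I, one_mul]
  refine (norm_sum_le_of_le (n := fun _ => 2 * (M * D)) _ fun j _ =>
    (norm_sub_le _ _).trans ?_).trans (le_of_eq (by simp))
  have h1 := ((hr m).norm_le (η j) (φ j)).trans (mul_le_mul (hD j) (hM j)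
    (norm_nonneg _) ((norm_nonneg _).trans (hD j)))
  have h2 := ((hr m).norm_le (φ j) (η j)).trans (mul_le_mul (hM j) (hD j)
    (norm_nonneg _) ((norm_nonneg _).trans (hM j)))
  linarith

theorem hasDerivAt_orbitalSum (hr : ∀ m, IsContractiveSesquilinear (r m)) {φ : ℝ → Fin N → F}
    {φ' : Fin N → F} {t : ℝ} (hφ : ∀ j, HasDerivAt (fun s => φ s j) (φ' j) t) (m : Fin N) :
    HasDerivAt (fun s => orbitalSum r (φ s) m)
      (∑ j, (r m (φ t j) (φ' j) + r m (φ' j) (φ t j))) t := by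
  refine HasDerivAt.fun_sum fun j _ => ?_
  exact ((hr m).isBoundedBilinearMap.hasFDerivAt (φ t j, φ t j)).comp_hasDerivAt t
    ((hφ j).prodMk (hφ j))

end Sesquilinear

/-! ### The time derivative of the expected weight -/

section ExpectDeriv

open Filter Topology

variable {F E : Type*} [NormedAddCommGroup F] [InnerProductSpace ℂ F]
  [NormedAddCommGroup E] [InnerProductSpace ℂ E] {N : ℕ}
  {r : Fin N → F → F → E →L[ℂ] E} {G : Submodule ℂ (E × E)} {H0 : F →ₗ.[ℂ] F}

theorem HasDerivAt.complex_clm_apply {B : ℝ → E →L[ℂ] E} {B' : E →L[ℂ] E} {u : ℝ → E} {u' : E}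
    {t : ℝ} (hB : HasDerivAt B B' t) (hu : HasDerivAt u u' t) :
    HasDerivAt (fun s => B s (u s)) (B' (u t) + B t u') t :=
  ((ContinuousLinearMap.restrictScalarsL ℂ E E ℝ ℝ).hasFDerivAt.comp_hasDerivAt t hB).clm_apply hu

/-- The free Hamiltonian enters through Ψ' and through the motion of the orbitals. The second
contribution is the commutator of the free Hamiltonian with the observable, in the sense of
`Derives`, so the two cancel by symmetry of G; what is left comes from w and from the sources η. -/
theorem hasDerivAt_inner_hatOp (hr : ∀ m, IsContractiveSesquilinear (r m))
    (hsymm : ∀ z ∈ G, ∀ z' ∈ G, ⟪z.2, z'.1⟫_ℂ = ⟪z.1, z'.2⟫_ℂ)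
    (hder : ∀ m (a b : H0.domain), Derives G (r m a b) (r m (H0 a) b - r m a (H0 b)))
    {Ψ : ℝ → E} {Ψ' κ w : E} {t : ℝ} (hΨ : HasDerivAt Ψ Ψ' t) (hΨ' : Complex.I • Ψ' = κ + w)
    (hκ : (Ψ t, κ) ∈ G) {φ : ℝ → Fin N → F} {φ' η : Fin N → F}
    (hφ : ∀ j, HasDerivAt (fun s => φ s j) (φ' j) t)
    (hφ' : ∀ j, (φ t j, Complex.I • φ' j - η j) ∈ H0.graph) (f : ℕ → ℝ) :
    HasDerivAt (fun s => ⟪Ψ s, hatOp (orbitalSum r (φ s)) f (Ψ s)⟫_ℂ)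
      (Complex.I * ⟪w, hatOp (orbitalSum r (φ t)) f (Ψ t)⟫_ℂ
        - Complex.I * ⟪Ψ t, hatOp (orbitalSum r (φ t)) f w⟫_ℂ
        + ⟪Ψ t, hatDeriv (orbitalSum r (φ t)) (sourceDeriv r (φ t) η) f (Ψ t)⟫_ℂ) t := by
  set B := hatOp (orbitalSum r (φ t)) f with hB
  choose a ha1 ha2 using fun j => (LinearPMap.mem_graph_iff _).1 (hφ' j)
  set c : Fin N → E →L[ℂ] E := fun m =>
    ∑ j, (r m (H0 (a j)) (φ t j) - r m (φ t j) (H0 (a j))) with hc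
  have hφI : ∀ j, φ' j = (-Complex.I) • (H0 (a j) + η j) := fun j => by
    rw [ha2 j, sub_add_cancel, smul_smul, neg_mul, Complex.I_mul_I, neg_neg, one_smul]
  have hΨI : Ψ' = (-Complex.I) • (κ + w) := by
    rw [← hΨ', smul_smul, neg_mul, Complex.I_mul_I, neg_neg, one_smul]
  have hp' : ∀ m, ∑ j, (r m (φ t j) (φ' j) + r m (φ' j) (φ t j))
      = (-Complex.I) • c m + sourceDeriv r (φ t) η m := by
    intro m
    rw [hc, sourceDeriv, ← smul_add, ← Finset.sum_add_distrib, Finset.smul_sum]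
    refine Finset.sum_congr rfl fun j _ => ?_
    rw [hφI, (hr m).smul_left, (hr m).smul_right, (hr m).add_left, (hr m).add_right,
      map_neg, Complex.conj_I, neg_neg]
    module
  have hderB : Derives G B (hatDeriv (orbitalSum r (φ t)) c f) := by
    refine Derives.hatOp (fun m => Derives.sum fun j _ => ?_) f
    have h1 := hder m (a j) (a j)
    rwa [ha1] at h1
  have hs := hsymm _ hκ _ (hderB _ hκ)
  have hd : HasDerivAt (fun s => hatOp (orbitalSum r (φ s)) f)
      ((-Complex.I) • hatDeriv (orbitalSum r (φ t)) c f
        + hatDeriv (orbitalSum r (φ t)) (sourceDeriv r (φ t) η) f) t := by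
    have h1 := hasDerivAt_hatOp (fun m => hasDerivAt_orbitalSum hr hφ m) f
    simp only [hp'] at h1
    rw [hatDeriv_add, hatDeriv_smul] at h1
    exact h1
  have hd2 := hΨ.inner ℂ (hd.complex_clm_apply hΨ)
  refine hd2.congr_deriv ?_
  simp only [hΨI, _root_.add_apply, _root_.smul_apply, map_smul, map_add, inner_add_right,
    inner_smul_right, inner_add_left, inner_smul_left, map_neg, Complex.conj_I, neg_neg] at hs ⊢
  linear_combination Complex.I * hs

end ExpectDeriv

/-! ### The integrated evolution of the expected weight -/

section ExpectIntegral

open Filter Topology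

variable {F E : Type*} [NormedAddCommGroup F] [InnerProductSpace ℂ F]
  [NormedAddCommGroup E] [InnerProductSpace ℂ E] {N : ℕ}
  {r : Fin N → F → F → E →L[ℂ] E} {G : Submodule ℂ (E × E)} {H0 : F →ₗ.[ℂ] F}

/-- The derivative of the expectation of `hatOp (orbitalSum r φ) f` in the state `Ψ`. -/
def expectRate (r : Fin N → F → F → E →L[ℂ] E) (f : ℕ → ℝ) (Ψ w : E) (φ η : Fin N → F) : ℂ :=
  Complex.I * ⟪w, hatOp (orbitalSum r φ) f Ψ⟫_ℂ - Complex.I * ⟪Ψ, hatOp (orbitalSum r φ) f w⟫_ℂ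
    + ⟪Ψ, hatDeriv (orbitalSum r φ) (sourceDeriv r φ η) f Ψ⟫_ℂ

theorem continuous_expectRate (hr : ∀ m, IsContractiveSesquilinear (r m)) (f : ℕ → ℝ)
    {Z : Type*} [TopologicalSpace Z] {Ψ w : Z → E} {φ η : Z → Fin N → F} (hΨ : Continuous Ψ)
    (hw : Continuous w) (hφ : Continuous φ) (hη : Continuous η) :
    Continuous fun z => expectRate r f (Ψ z) (w z) (φ z) (η z) := by
  have h0 := fun m => hφ.orbitalSum hr m
  have h1 : Continuous fun z => hatOp (orbitalSum r (φ z)) f := Continuous.hatOp h0 f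
  have h2 : Continuous fun z => hatDeriv (orbitalSum r (φ z)) (sourceDeriv r (φ z) (η z)) f :=
    Continuous.hatDeriv h0 (fun m => hφ.sourceDeriv hr hη m) f
  have h3 : Continuous fun z => Complex.I * ⟪w z, hatOp (orbitalSum r (φ z)) f (Ψ z)⟫_ℂ :=
    continuous_const.mul (hw.inner (h1.clm_apply hΨ))
  have h4 : Continuous fun z => Complex.I * ⟪Ψ z, hatOp (orbitalSum r (φ z)) f (w z)⟫_ℂ :=
    continuous_const.mul (hΨ.inner (h1.clm_apply hw))
  exact (h3.sub h4).add (hΨ.inner (h2.clm_apply hΨ))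

theorem tendsto_expectRate (hr : ∀ m, IsContractiveSesquilinear (r m)) (f : ℕ → ℝ) (Ψ w : E)
    {φ η : ℕ → Fin N → F} {φ₀ η₀ : Fin N → F} (hφ : Tendsto φ atTop (𝓝 φ₀))
    (hη : Tendsto η atTop (𝓝 η₀)) : Tendsto (fun n => expectRate r f Ψ w (φ n) (η n)) atTop
      (𝓝 (expectRate r f Ψ w φ₀ η₀)) := by
  have hc : Continuous fun p : (Fin N → F) × (Fin N → F) => expectRate r f Ψ w p.1 p.2 :=
    continuous_expectRate hr f continuous_const continuous_const continuous_fst continuous_snd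
  have h1 : Tendsto (fun n => (φ n, η n)) atTop (𝓝 (φ₀, η₀)) := hφ.prodMk_nhds hη
  have h2 := (hc.tendsto (φ₀, η₀)).comp h1
  simp only [Function.comp_def] at h2
  exact h2

theorem tendsto_inner_hatOp (hr : ∀ m, IsContractiveSesquilinear (r m)) (f : ℕ → ℝ) (Ψ : E)
    {φ : ℕ → Fin N → F} {φ₀ : Fin N → F} (hφ : Tendsto φ atTop (𝓝 φ₀)) :
    Tendsto (fun n => ⟪Ψ, hatOp (orbitalSum r (φ n)) f Ψ⟫_ℂ) atTop
      (𝓝 ⟪Ψ, hatOp (orbitalSum r φ₀) f Ψ⟫_ℂ) := by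
  have hc : Continuous fun x : Fin N → F => hatOp (orbitalSum r x) f :=
    Continuous.hatOp (fun m => continuous_id.orbitalSum hr m) f
  have hc2 : Continuous fun x : Fin N → F => ⟪Ψ, hatOp (orbitalSum r x) f Ψ⟫_ℂ :=
    continuous_const.inner (hc.clm_apply continuous_const)
  exact (hc2.tendsto φ₀).comp hφ

theorem exists_norm_expectRate_le (hr : ∀ m, IsContractiveSesquilinear (r m)) (f : ℕ → ℝ) (M : ℝ) :
    ∃ K, ∀ (Ψ w : E) (φ η : Fin N → F) (D : ℝ), 0 ≤ D → (∀ j, ‖φ j‖ ≤ M) → (∀ j, ‖η j‖ ≤ D) →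
      ‖expectRate r f Ψ w φ η‖ ≤ K * ‖Ψ‖ * ‖w‖ + K * ‖Ψ‖ ^ 2 * D := by
  obtain ⟨K, hK⟩ := exists_norm_hatOp_le (A := E →L[ℂ] E) N (N * (M * M)) f
  refine ⟨|K| * 2 + |K| * (N * (2 * |M|)), fun Ψ w φ η D hD hφ hη => ?_⟩
  obtain ⟨k1, k2⟩ := hK (orbitalSum r φ) (sourceDeriv r φ η) (N * (2 * (|M| * D))) (by positivity)
    (norm_orbitalSum_le hr hφ) (norm_sourceDeriv_le hr (fun j => (hφ j).trans (le_abs_self M)) hη)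
  have k3 := k1.trans (le_abs_self K)
  have k4 : ‖hatDeriv (orbitalSum r φ) (sourceDeriv r φ η) f‖ ≤ |K| * (N * (2 * (|M| * D))) :=
    k2.trans (mul_le_mul_of_nonneg_right (le_abs_self K) (by positivity))
  have n1 : ‖⟪w, hatOp (orbitalSum r φ) f Ψ⟫_ℂ‖ ≤ ‖w‖ * (|K| * ‖Ψ‖) :=
    (norm_inner_le_norm _ _).trans (mul_le_mul_of_nonneg_left
      ((ContinuousLinearMap.le_opNorm _ _).trans (mul_le_mul_of_nonneg_right k3 (norm_nonneg _)))
      (norm_nonneg _))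
  have n2 : ‖⟪Ψ, hatOp (orbitalSum r φ) f w⟫_ℂ‖ ≤ ‖Ψ‖ * (|K| * ‖w‖) :=
    (norm_inner_le_norm _ _).trans (mul_le_mul_of_nonneg_left
      ((ContinuousLinearMap.le_opNorm _ _).trans (mul_le_mul_of_nonneg_right k3 (norm_nonneg _)))
      (norm_nonneg _))
  have n3 : ‖⟪Ψ, hatDeriv (orbitalSum r φ) (sourceDeriv r φ η) f Ψ⟫_ℂ‖
      ≤ ‖Ψ‖ * (|K| * (N * (2 * (|M| * D))) * ‖Ψ‖) :=
    (norm_inner_le_norm _ _).trans (mul_le_mul_of_nonneg_left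
      ((ContinuousLinearMap.le_opNorm _ _).trans (mul_le_mul_of_nonneg_right k4 (norm_nonneg _)))
      (norm_nonneg _))
  have n4 : ‖expectRate r f Ψ w φ η‖ ≤ ‖w‖ * (|K| * ‖Ψ‖) + ‖Ψ‖ * (|K| * ‖w‖)
      + ‖Ψ‖ * (|K| * (N * (2 * (|M| * D))) * ‖Ψ‖) := by
    refine (norm_add_le _ _).trans (add_le_add ((norm_sub_le _ _).trans ?_) n3)
    rw [norm_mul, norm_mul, Complex.norm_I, one_mul, one_mul]
    exact add_le_add n1 n2
  have p1 : 0 ≤ |K| * (N * (2 * |M|)) * ‖Ψ‖ * ‖w‖ := by positivity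
  have p2 : 0 ≤ |K| * 2 * ‖Ψ‖ ^ 2 * D := by positivity
  nlinarith [n4, p1, p2]

/-- Ψ is differentiable here, but the orbitals are only weak solutions. The derivative formula is
applied with averaged orbitals, which lie in the domain of H⁰, and the averaging is removed along a
sequence for which the averaged sources converge almost everywhere and are dominated. -/
theorem inner_hatOp_sub_eq_integral [CompleteSpace F] (hr : ∀ m, IsContractiveSesquilinear (r m))
    (hsymm : ∀ z ∈ G, ∀ z' ∈ G, ⟪z.2, z'.1⟫_ℂ = ⟪z.1, z'.2⟫_ℂ)
    (hder : ∀ m (a b : H0.domain), Derives G (r m a b) (r m (H0 a) b - r m a (H0 b)))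
    (hH0 : IsSelfAdjoint H0) {b : ℝ} {φ η : ℝ → Fin N → F}
    (hφ : ∀ j, IsWeakSolution H0 b (fun t => φ t j) (fun t => η t j)) {M : ℝ}
    (hM : ∀ t j, ‖φ t j‖ ≤ M) {Ψ Ψ' w : ℝ → E} (hΨ : ∀ t, HasDerivAt Ψ (Ψ' t) t)
    (hw : Continuous w) {s t : ℝ} (hs : 0 ≤ s) (hst : s ≤ t) (htb : t < b)
    (hΨw : ∀ q ∈ Icc s t, ∃ κ, (Ψ q, κ) ∈ G ∧ Complex.I • Ψ' q = κ + w q) (f : ℕ → ℝ) :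
    ⟪Ψ t, hatOp (orbitalSum r (φ t)) f (Ψ t)⟫_ℂ - ⟪Ψ s, hatOp (orbitalSum r (φ s)) f (Ψ s)⟫_ℂ
      = ∫ q in s..t, expectRate r f (Ψ q) (w q) (φ q) (η q) := by
  have hηm : StronglyMeasurable η :=
    by
    have h1 := Finset.stronglyMeasurable_fun_sum Finset.univ fun j _ =>
      (continuous_single j).comp_stronglyMeasurable (hφ j).stronglyMeasurable
    convert h1 using 2 with t
    funext i
    simp [Finset.sum_apply, Pi.single_apply]
  have hηi : Integrable η := Integrable.of_eval fun j => (hφ j).integrable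
  have hφc : Continuous φ := continuous_pi fun j => (hφ j).continuous
  have hΨc : Continuous Ψ := continuous_iff_continuousAt.2 fun q => (hΨ q).continuousAt
  obtain ⟨h, hh, hlim, D, hD, hle⟩ := exists_seq_forwardAverage hηm hηi
  have happ : ∀ n (u : ℝ → Fin N → F), (∀ x y, IntervalIntegrable u volume x y) → ∀ q j,
      forwardAverage (h n) u q j = forwardAverage (h n) (fun x => u x j) q := by
    intro n u hu q j
    simp only [forwardAverage, Pi.smul_apply]
    congr 1
    exact ((ContinuousLinearMap.proj (R := ℝ) j).intervalIntegral_comp_comm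
      (hu q (q + h n))).symm
  have hφn : ∀ n q j, forwardAverage (h n) φ q j = forwardAverage (h n) (fun x => φ x j) q :=
    fun n => happ n φ fun x y => hφc.intervalIntegrable x y
  have hηn : ∀ n q j, forwardAverage (h n) η q j = forwardAverage (h n) (fun x => η x j) q :=
    fun n => happ n η fun x y => hηi.intervalIntegrable
  have hφnc : ∀ n, Continuous (forwardAverage (h n) φ) := fun n =>
    continuous_iff_continuousAt.2 fun t => (hasDerivAt_forwardAverage hφc (h n) t).continuousAt
  set g : ℕ → ℝ → ℂ := fun n q =>
    expectRate r f (Ψ q) (w q) (forwardAverage (h n) φ q) (forwardAverage (h n) η q) with hg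
  have hgc : ∀ n, Continuous (g n) := fun n => continuous_expectRate hr f hΨc hw (hφnc n)
    (continuous_forwardAverage hηi (h n))
  have hev : ∀ᶠ n in atTop, ⟪Ψ t, hatOp (orbitalSum r (forwardAverage (h n) φ t)) f (Ψ t)⟫_ℂ
      - ⟪Ψ s, hatOp (orbitalSum r (forwardAverage (h n) φ s)) f (Ψ s)⟫_ℂ
      = ∫ q in s..t, g n q := by
    filter_upwards [hh.eventually (Ioo_mem_nhdsGT (sub_pos.2 htb))] with n hn
    refine (intervalIntegral.integral_eq_sub_of_hasDerivAt
      (f := fun q => ⟪Ψ q, hatOp (orbitalSum r (forwardAverage (h n) φ q)) f (Ψ q)⟫_ℂ)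
      (fun q hq => ?_) ((hgc n).intervalIntegrable _ _)).symm
    rw [uIcc_of_le hst] at hq
    obtain ⟨κ, hκ1, hκ2⟩ := hΨw q hq
    refine hasDerivAt_inner_hatOp hr hsymm hder (hΨ q) hκ2 hκ1
      (φ' := fun j => (h n)⁻¹ • (φ (q + h n) j - φ q j)) (fun j => ?_) (fun j => ?_) f
    · simp only [hφn]
      exact hasDerivAt_forwardAverage (hφ j).continuous (h n) q
    · rw [hφn, hηn]
      exact (hφ j).forwardAverage_mem_graph hH0 (hs.trans hq.1) hn.1 (by linarith [hq.2, hn.2])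
  have hcq : ∀ q, Tendsto (fun n => ⟪Ψ q, hatOp (orbitalSum r (forwardAverage (h n) φ q)) f (Ψ q)⟫_ℂ)
      atTop (𝓝 ⟪Ψ q, hatOp (orbitalSum r (φ q)) f (Ψ q)⟫_ℂ) :=
    fun q => tendsto_inner_hatOp hr f (Ψ q) ((tendsto_forwardAverage hφc q).comp hh)
  have hlim2 : Tendsto (fun n => ∫ q in s..t, g n q) atTop
      (𝓝 (∫ q in s..t, expectRate r f (Ψ q) (w q) (φ q) (η q))) := by
    obtain ⟨K, hK⟩ := exists_norm_expectRate_le hr f M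
    have hbc : Continuous fun q => K * ‖Ψ q‖ * ‖w q‖ := by fun_prop
    have hbc2 : Continuous fun q => K * ‖Ψ q‖ ^ 2 := by fun_prop
    refine intervalIntegral.tendsto_integral_filter_of_dominated_convergence
      (fun q => K * ‖Ψ q‖ * ‖w q‖ + K * ‖Ψ q‖ ^ 2 * D q)
      (Eventually.of_forall fun n => (hgc n).aestronglyMeasurable) ?_
      ((hbc.intervalIntegrable _ _).add
        (hD.intervalIntegrable.continuousOn_mul hbc2.continuousOn)) ?_
    · filter_upwards [hh.eventually self_mem_nhdsWithin] with n hn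
      filter_upwards [hle] with q hq _
      refine hK _ _ _ _ _ ((norm_nonneg _).trans (hq n)) (fun j => ?_) fun j =>
        (norm_le_pi_norm _ j).trans (hq n)
      rw [hφn]
      exact norm_forwardAverage_le (fun x _ => hM x j) hn
    · filter_upwards [hlim] with q hq _
      exact tendsto_expectRate hr f (Ψ q) (w q) ((tendsto_forwardAverage hφc q).comp hh) hq
  exact tendsto_nhds_unique (((hcq t).sub (hcq s)).congr' hev) hlim2

end ExpectIntegral

/-! ### The rate of change as a commutator with the interaction minus the mean field. -/

section ExpectCommutator

variable {F E : Type*} [NormedAddCommGroup E] [InnerProductSpace ℂ E] [CompleteSpace E] {N : ℕ}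
  {r : Fin N → F → F → E →L[ℂ] E}

/-- If the inhomogeneities are given by bounded operators, the rate is a commutator. -/
theorem expectRate_eq_commutator {φ η : Fin N → F} {V : Fin N → E →L[ℂ] E}
    (hV : ∀ m, ContinuousLinearMap.adjoint (V m) = V m)
    (hleft : ∀ m j, r m (η j) (φ j) = V m * r m (φ j) (φ j))
    (hright : ∀ m j, r m (φ j) (η j) = r m (φ j) (φ j) * V m)
    (hcomm : ∀ m l, l ≠ m → ∀ j, Commute (V l) (r m (φ j) (φ j))) {f : ℕ → ℝ}
    (hadj : ContinuousLinearMap.adjoint (hatOp (orbitalSum r φ) f) = hatOp (orbitalSum r φ) f)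
    (Ψ w : E) : expectRate r f Ψ w φ η
      = Complex.I * (⟪w - ∑ m, V m Ψ, hatOp (orbitalSum r φ) f Ψ⟫_ℂ
        - ⟪hatOp (orbitalSum r φ) f Ψ, w - ∑ m, V m Ψ⟫_ℂ) := by
  set B := hatOp (orbitalSum r φ) f with hB
  set X : E →L[ℂ] E := ∑ l, V l with hX
  have h1 : ∀ m, sourceDeriv r φ η m
      = (-Complex.I) • (X * orbitalSum r φ m - orbitalSum r φ m * X) := by
    intro m
    rw [sourceDeriv, orbitalSum, Finset.mul_sum, Finset.sum_mul, ← Finset.sum_sub_distrib]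
    congr 1
    refine Finset.sum_congr rfl fun j _ => ?_
    rw [hleft, hright, hX, Finset.sum_mul, Finset.mul_sum, ← Finset.sum_sub_distrib,
      Finset.sum_eq_single_of_mem m (Finset.mem_univ m)]
    intro l _ hl
    rw [(hcomm m l hl j).eq, sub_self]
  have h2 : hatDeriv (orbitalSum r φ) (sourceDeriv r φ η) f = (-Complex.I) • (X * B - B * X) := by
    rw [show sourceDeriv r φ η = fun m => (-Complex.I) • (X * orbitalSum r φ m
      - orbitalSum r φ m * X) from funext h1, hatDeriv_smul, hatDeriv_commutator]
  have h3 : ContinuousLinearMap.adjoint X = X := by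
    rw [hX, map_sum]
    exact Finset.sum_congr rfl fun m _ => hV m
  have h4 : ∀ x y, ⟪x, X y⟫_ℂ = ⟪X x, y⟫_ℂ := fun x y => by
    rw [← ContinuousLinearMap.adjoint_inner_left, h3]
  have h5 : ∀ x y, ⟪x, B y⟫_ℂ = ⟪B x, y⟫_ℂ := fun x y => by
    rw [← ContinuousLinearMap.adjoint_inner_left, hadj]
  have h6 : ∑ m, V m Ψ = X Ψ := by rw [hX, _root_.sum_apply]
  rw [expectRate, h2, h6, _root_.smul_apply, sub_apply, mul_apply_eq_comp, mul_apply_eq_comp,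
    inner_smul_right, inner_sub_right, h4, h5 Ψ (X Ψ), h5 Ψ w, inner_sub_left, inner_sub_right]
  ring

end ExpectCommutator

/-! ### The mean field term -/

section HartreeTerm

open Filter Topology

variable {N : ℕ} {v : R3 → ℝ}

/-- The mean field term `(v ⋆ ρ) φ_j` of the Hartree equations. -/
def hartreeTerm (v : R3 → ℝ) (φ : Fin N → OneBody) (j : Fin N) : OneBody :=
  mulOp volume (fun x => (meanField v φ x : ℂ)) (φ j)

theorem meanField_eq_sum_inner (hm : Measurable v) (hb : ∃ C, ∀ x, |v x| ≤ C)
    (φ : Fin N → OneBody) (x : R3) :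
    (meanField v φ x : ℂ) = ∑ a, ⟪φ a, mulOp volume (fun y => (v (x - y) : ℂ)) (φ a)⟫_ℂ := by
  rw [← overlap_sum_eq_meanField hm hb]
  refine Finset.sum_congr rfl fun a _ => ?_
  rw [L2_inner_eq, overlap]
  refine integral_congr_ae ?_
  have hx : Measurable fun y : R3 => x - y := measurable_const.sub measurable_id
  filter_upwards [coeFn_mulOp (bddMeas_ofReal_comp hm hb hx) (φ a)] with y hy
  rw [hy]
  ring

theorem continuous_meanField (hm : Measurable v) (hb : ∃ C, ∀ x, |v x| ≤ C) (x : R3) :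
    Continuous fun φ : Fin N → OneBody => (meanField v φ x : ℂ) := by
  simp_rw [meanField_eq_sum_inner hm hb]
  fun_prop

theorem norm_meanField_le (hm : Measurable v) {C : ℝ} (hC : ∀ x, |v x| ≤ C) {φ : Fin N → OneBody}
    {M : ℝ} (hM : ‖φ‖ ≤ M) (x : R3) : ‖(meanField v φ x : ℂ)‖ ≤ N * (M * (C * M)) := by
  rw [meanField_eq_sum_inner hm ⟨C, hC⟩]
  refine (norm_sum_le_of_le (n := fun _ => M * (C * M)) _ fun a _ => ?_).trans (le_of_eq (by simp))
  have hC0 : 0 ≤ C := (abs_nonneg _).trans (hC 0)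
  have h1 := (norm_le_pi_norm φ a).trans hM
  have hx : Measurable fun y : R3 => x - y := measurable_const.sub measurable_id
  have h2 : ‖mulOp volume (fun y => (v (x - y) : ℂ)) (φ a)‖ ≤ C * ‖φ a‖ :=
    norm_mulOp_apply_le (bddMeas_ofReal_comp hm ⟨C, hC⟩ hx).1 (fun y => by
      rw [Complex.norm_real]; exact hC _) _
  exact (norm_inner_le_norm _ _).trans (mul_le_mul h1
    (h2.trans (mul_le_mul_of_nonneg_left h1 hC0)) (norm_nonneg _) ((norm_nonneg _).trans h1))

/-- For bounded v the mean field depends continuously on the orbitals at every point and is bounded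
uniformly along convergent sequences. The varying potential is first applied to the fixed limit
orbital, by dominated convergence, and then to the vanishing difference. -/
theorem continuous_hartreeTerm (hm : Measurable v) (hb : ∃ C, ∀ x, |v x| ≤ C) (j : Fin N) :
    Continuous fun φ : Fin N → OneBody => hartreeTerm v φ j := by
  obtain ⟨C, hC⟩ := hb
  refine continuous_iff_continuousAt.2 fun φ => tendsto_of_seq_tendsto fun u hu => ?_
  obtain ⟨M, hM⟩ := hu.norm.bddAbove_range
  have hM' : ∀ n, ‖u n‖ ≤ M := fun n => hM (mem_range_self n)
  have hmeas : ∀ φ : Fin N → OneBody, Measurable fun x => (meanField v φ x : ℂ) := fun φ =>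
    Complex.measurable_ofReal.comp (measurable_meanField hm φ)
  have h1 : Tendsto (fun n => mulOp volume (fun x => (meanField v (u n) x : ℂ)) (φ j)) atTop
      (𝓝 (hartreeTerm v φ j)) :=
    tendsto_mulOp_of_dominated (fun n => hmeas (u n)) (hmeas φ)
      (fun n x => norm_meanField_le hm hC (hM' n) x)
      (fun x => ((continuous_meanField hm ⟨C, hC⟩ x).tendsto φ).comp hu) (φ j)
  have h2 : Tendsto (fun n => mulOp volume (fun x => (meanField v (u n) x : ℂ)) (u n j - φ j)) atTop
      (𝓝 0) := by
    have h3 : Tendsto (fun n => u n j - φ j) atTop (𝓝 0) := by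
      have h4 := ((continuous_apply j).tendsto φ).comp hu
      simpa using h4.sub_const (φ j)
    refine squeeze_zero_norm (fun n => norm_mulOp_apply_le (hmeas (u n))
      (norm_meanField_le hm hC (hM' n)) _) ?_
    simpa using h3.norm.const_mul (N * (M * (C * M)))
  have h5 := h1.add h2
  rw [add_zero] at h5
  refine h5.congr fun n => ?_
  rw [← map_add, add_sub_cancel, Function.comp_apply, hartreeTerm]

variable {d₀ b₁ b₂ : ℝ}

theorem DensityBounds.bddMeas_meanField {φ : Fin N → OneBody} (h : DensityBounds v φ d₀ b₁ b₂) :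
    BddMeas fun x => (meanField v φ x : ℂ) :=
  _root_.bddMeas_meanField h.meas h.d_nonneg h.sup_abs

theorem DensityBounds.norm_hartreeTerm_le {φ : Fin N → OneBody} (h : DensityBounds v φ d₀ b₁ b₂)
    (j : Fin N) : ‖hartreeTerm v φ j‖ ≤ d₀ * ‖φ j‖ :=
  norm_mulOp_apply_le h.bddMeas_meanField.1 (fun x => by
    rw [Complex.norm_real]; exact abs_meanField_le h.d_nonneg h.sup_abs x) _

theorem DensityBounds.tendsto_hartreeTerm {φ : Fin N → OneBody} (h : DensityBounds v φ d₀ b₁ b₂)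
    (j : Fin N) : Tendsto (fun n => hartreeTerm (_root_.truncate v n) φ j) atTop
      (𝓝 (hartreeTerm v φ j)) :=
  tendsto_mulOp_of_dominated (C := d₀)
    (fun n => (h.truncate n).bddMeas_meanField.1) h.bddMeas_meanField.1
    (fun n x => by
      rw [Complex.norm_real]; exact abs_meanField_le h.d_nonneg (h.truncate n).sup_abs _)
    (fun x => (Complex.continuous_ofReal.tendsto _).comp (h.tendsto_meanField x)) (φ j)

/-- For unbounded v the dependence on time need not be evidently continuous; measurability survives
as a limit of the continuous functions obtained from truncated interactions. -/
theorem stronglyMeasurable_hartreeTerm {φ : ℝ → Fin N → OneBody} (hφ : Continuous φ)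
    (h : ∀ t, ∃ d₀ b₁ b₂, DensityBounds v (φ t) d₀ b₁ b₂) (j : Fin N) :
    StronglyMeasurable fun t => hartreeTerm v (φ t) j := by
  obtain ⟨_, _, _, h0⟩ := h 0
  refine stronglyMeasurable_of_tendsto atTop
    (f := fun n t => hartreeTerm (truncate v n) (φ t) j) (fun n => ?_) (tendsto_pi_nhds.2 fun t => ?_)
  · exact ((continuous_hartreeTerm (h0.truncate n).meas (h0.truncate n).bdd j).comp
      hφ).stronglyMeasurable
  · obtain ⟨_, _, _, h1⟩ := h t
    exact h1.tendsto_hartreeTerm j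

theorem inner_hartreeTerm {φ : Fin N → OneBody} (h : DensityBounds v φ d₀ b₁ b₂) (i j : Fin N) :
    ⟪hartreeTerm v φ i, φ j⟫_ℂ = ⟪φ i, hartreeTerm v φ j⟫_ℂ := by
  rw [hartreeTerm, hartreeTerm, ← ContinuousLinearMap.adjoint_inner_right,
    adjoint_mulOp_real h.bddMeas_meanField]

theorem adjoint_meanFieldOp {φ : Fin N → OneBody} (h : DensityBounds v φ d₀ b₁ b₂) (m : Fin N) :
    ContinuousLinearMap.adjoint (meanFieldOp v φ m) = meanFieldOp v φ m :=
  adjoint_mulOp_real (h := fun x : Fin N → R3 => meanField v φ (x m))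
    (h.bddMeas_meanField.comp (measurable_pi_apply m))

theorem rankOne_hartreeTerm_left {φ : Fin N → OneBody} (h : DensityBounds v φ d₀ b₁ b₂)
    (m j : Fin N) (g : OneBody) :
    rankOne m (hartreeTerm v φ j) g = meanFieldOp v φ m * rankOne m (φ j) g := by
  ext1 ψ
  refine Lp.ext ?_
  rw [mul_apply_eq_comp]
  filter_upwards [coeFn_rankOne m (hartreeTerm v φ j) g ψ, coeFn_rankOne m (φ j) g ψ,
    coeFn_mulOp (h.bddMeas_meanField.comp (measurable_pi_apply m)) (rankOne m (φ j) g ψ),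
    ae_comp_eval (coeFn_mulOp h.bddMeas_meanField (φ j)) m] with x h1 h2 h3 h4
  rw [h1, meanFieldOp, coordOp, h3, h2, hartreeTerm, h4, mul_assoc]

theorem rankOne_hartreeTerm_right {φ : Fin N → OneBody} (h : DensityBounds v φ d₀ b₁ b₂)
    (m j : Fin N) (f : OneBody) :
    rankOne m f (hartreeTerm v φ j) = rankOne m f (φ j) * meanFieldOp v φ m := by
  have h1 := congrArg ContinuousLinearMap.adjoint (rankOne_hartreeTerm_left h m j f)
  rw [adjoint_rankOne, ← ContinuousLinearMap.star_eq_adjoint, star_mul,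
    ContinuousLinearMap.star_eq_adjoint, ContinuousLinearMap.star_eq_adjoint, adjoint_rankOne,
    adjoint_meanFieldOp h] at h1
  exact h1

theorem meanFieldOp_commute_rankOne {φ : Fin N → OneBody} (h : DensityBounds v φ d₀ b₁ b₂)
    {m l : Fin N} (hl : l ≠ m) (f g : OneBody) :
    Commute (meanFieldOp v φ l) (rankOne m f g) :=
  mulOp_commute_rankOne (h.bddMeas_meanField.comp (measurable_pi_apply l)) m
    (fun x y => by simp only [Function.update_of_ne hl]) f g

theorem isContractiveSesquilinear_rankOne (m : Fin N) :
    IsContractiveSesquilinear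
      (rankOne m : OneBody → OneBody → ManyBody N →L[ℂ] ManyBody N) where
  add_left := rankOne_add_left m
  smul_left := rankOne_smul_left m
  add_right := rankOne_add_right m
  smul_right := rankOne_smul_right m
  norm_le := norm_rankOne_le m

end HartreeTerm

/-! ### The given solutions as weak solutions -/

section Clamp

open Filter Topology

/-- The point of `[0, b]` closest to `t`. -/
def clamp (b t : ℝ) : ℝ := max 0 (min t b)

theorem continuous_clamp (b : ℝ) : Continuous (clamp b) := by
  unfold clamp
  fun_prop

theorem clamp_mem {b : ℝ} (hb : 0 ≤ b) (t : ℝ) : clamp b t ∈ Icc 0 b :=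
  ⟨le_max_left _ _, max_le hb (min_le_right _ _)⟩

theorem clamp_of_mem {b t : ℝ} (ht : t ∈ Icc 0 b) : clamp b t = t := by
  rw [clamp, min_eq_left ht.2, max_eq_right ht.1]

variable {T : EReal} {b : ℝ}

theorem Icc_subset_timeInterval (hb : b ∈ timeInterval T) : Icc 0 b ⊆ timeInterval T :=
  fun _ ht => ⟨ht.1, lt_of_le_of_lt (EReal.coe_le_coe_iff.2 ht.2) hb.2⟩

theorem continuous_comp_clamp {E : Type*} [TopologicalSpace E] {u : ℝ → E}
    (hu : ContinuousOn u (timeInterval T)) (hb : b ∈ timeInterval T) :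
    Continuous fun t => u (clamp b t) :=
  hu.comp_continuous (continuous_clamp b)
    fun t => Icc_subset_timeInterval hb (clamp_mem hb.1 t)

theorem exists_norm_comp_clamp_le {E : Type*} [SeminormedAddCommGroup E] {u : ℝ → E}
    (hu : ContinuousOn u (timeInterval T)) (hb : b ∈ timeInterval T) :
    ∃ M, ∀ t, ‖u (clamp b t)‖ ≤ M := by
  obtain ⟨M, hM⟩ := isCompact_Icc.exists_bound_of_continuousOn
    (hu.mono (Icc_subset_timeInterval hb))
  exact ⟨M, fun t => hM _ (clamp_mem hb.1 t)⟩

/-- Freezing the solution outside [0, b] makes it globally continuous but may break two-sided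
differentiability at 0; the derivative from the right is kept. -/
theorem HasDerivWithinAt.comp_clamp {g : ℝ → ℂ} {c : ℂ} {t : ℝ} (hb : b ∈ timeInterval T)
    (ht : t ∈ Ico 0 b) (h : HasDerivWithinAt g c (timeInterval T) t) :
    HasDerivWithinAt (fun s => g (clamp b s)) c (Ioi t) t := by
  have h1 : Icc 0 b ∈ 𝓝[>] t := mem_of_superset (Ioo_mem_nhdsGT ht.2) fun s hs =>
    ⟨ht.1.trans hs.1.le, hs.2.le⟩
  have h2 : HasDerivWithinAt g c (Ioi t) t :=
    h.mono_of_mem_nhdsWithin (mem_of_superset h1 (Icc_subset_timeInterval hb))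
  refine h2.congr_of_eventuallyEq (mem_of_superset h1 fun s hs => ?_) ?_
  · simp only [mem_ofPred_eq, clamp_of_mem hs]
  · simp only [clamp_of_mem (Ico_subset_Icc_self ht)]

theorem IsSchrodingerSolution.isWeakSolution {N : ℕ} {H : ManyBody N →ₗ.[ℂ] ManyBody N}
    {ψ : ℝ → ManyBody N} (hψ : IsSchrodingerSolution H T ψ) (hb : b ∈ timeInterval T) :
    IsWeakSolution H b (fun t => ψ (clamp b t)) (fun _ => 0) where
  continuous := continuous_comp_clamp hψ.continuousOn hb
  stronglyMeasurable := stronglyMeasurable_const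
  integrable := integrable_zero _ _ _
  hasDeriv t ht χ := by
    rw [inner_zero_right, add_zero, clamp_of_mem (Ico_subset_Icc_self ht)]
    exact (hψ.hasDeriv t (Icc_subset_timeInterval hb (Ico_subset_Icc_self ht)) χ).comp_clamp hb ht

/-- The source has norm at most d₀ times that of the orbital, which is bounded on [0, b], so
integrability of D suffices. The source is set to zero outside [0, b). -/
theorem IsHartreeSolution.isWeakSolution {N : ℕ} {H0 : OneBody →ₗ.[ℂ] OneBody} {v : R3 → ℝ}
    {φ : ℝ → Fin N → OneBody} (hφ : IsHartreeSolution H0 v T φ) (hb : b ∈ timeInterval T)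
    {D : ℝ → ℝ} (hD : IntervalIntegrable D volume 0 b)
    (h : ∀ t ∈ Icc 0 b, ∃ d₀ b₁ b₂, d₀ ≤ D t ∧ DensityBounds v (φ t) d₀ b₁ b₂) (j : Fin N) :
    IsWeakSolution H0 b (fun t => φ (clamp b t) j)
      ((Ico 0 b).indicator fun t => hartreeTerm v (φ (clamp b t)) j) where
  continuous := continuous_comp_clamp (hφ.continuousOn j) hb
  stronglyMeasurable := by
    refine (stronglyMeasurable_hartreeTerm (continuous_pi fun i => continuous_comp_clamp
      (hφ.continuousOn i) hb) (fun t => ?_) j).indicator measurableSet_Ico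
    obtain ⟨d₀, b₁, b₂, -, h1⟩ := h _ (clamp_mem hb.1 t)
    exact ⟨d₀, b₁, b₂, h1⟩
  integrable := by
    obtain ⟨M, hM⟩ := exists_norm_comp_clamp_le (hφ.continuousOn j) hb
    have hm := (stronglyMeasurable_hartreeTerm (continuous_pi fun i => continuous_comp_clamp
      (hφ.continuousOn i) hb) (fun t => by
        obtain ⟨d₀, b₁, b₂, -, h1⟩ := h _ (clamp_mem hb.1 t)
        exact ⟨d₀, b₁, b₂, h1⟩) j)
    have hDi : IntegrableOn D (Ico 0 b) :=
      (intervalIntegrable_iff_integrableOn_Ico_of_le hb.1).1 hD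
    refine (integrable_indicator_iff measurableSet_Ico).2 ((hDi.mul_const M).mono'
      hm.aestronglyMeasurable ?_)
    refine (ae_restrict_iff' measurableSet_Ico).2 (Eventually.of_forall fun t ht => ?_)
    obtain ⟨d₀, b₁, b₂, h1, h2⟩ := h t (Ico_subset_Icc_self ht)
    have h3 := hM t
    rw [clamp_of_mem (Ico_subset_Icc_self ht)] at h3 ⊢
    exact (h2.norm_hartreeTerm_le j).trans (mul_le_mul h1 h3 (norm_nonneg _)
      (h2.d_nonneg.trans h1))
  hasDeriv t ht χ := by
    have ht' := Ico_subset_Icc_self ht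
    rw [indicator_of_mem ht, clamp_of_mem ht']
    obtain ⟨η, h1, h2⟩ := hφ.hasDeriv t (Icc_subset_timeInterval hb ht') j
    obtain ⟨d₀, b₁, b₂, -, h3⟩ := h t ht'
    have h4 : hartreeTerm v (φ t) j = η :=
      Lp.ext ((coeFn_mulOp h3.bddMeas_meanField (φ t j)).trans h1.symm)
    rw [h4]
    exact (h2 χ).comp_clamp hb ht

end Clamp

/-! ### Operations on weak solutions -/

section WeakSolutionOps

open Filter Topology

variable {E : Type*} [NormedAddCommGroup E] [InnerProductSpace ℂ E]
  {A : E →ₗ.[ℂ] E} {b : ℝ} {u η w ζ : ℝ → E}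

theorem IsWeakSolution.add (hu : IsWeakSolution A b u η) (hw : IsWeakSolution A b w ζ) :
    IsWeakSolution A b (fun t => u t + w t) (fun t => η t + ζ t) where
  continuous := hu.continuous.add hw.continuous
  stronglyMeasurable := hu.stronglyMeasurable.add hw.stronglyMeasurable
  integrable := hu.integrable.add hw.integrable
  hasDeriv t ht χ := by
    simp only [inner_add_right]
    refine ((hu.hasDeriv t ht χ).add (hw.hasDeriv t ht χ)).congr_deriv ?_
    ring

theorem IsWeakSolution.map [CompleteSpace E] (hu : IsWeakSolution A b u η) {U : E →L[ℂ] E}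
    (hU : ∀ z ∈ A.graph, (ContinuousLinearMap.adjoint U z.1, ContinuousLinearMap.adjoint U z.2)
      ∈ A.graph) : IsWeakSolution A b (fun t => U (u t)) (fun t => U (η t)) where
  continuous := U.continuous.comp hu.continuous
  stronglyMeasurable := U.continuous.comp_stronglyMeasurable hu.stronglyMeasurable
  integrable := U.integrable_comp hu.integrable
  hasDeriv t ht χ := by
    obtain ⟨χ', h1, h2⟩ := (LinearPMap.mem_graph_iff _).1
      (hU ((χ : E), A χ) ((LinearPMap.mem_graph_iff _).2 ⟨χ, rfl, rfl⟩))
    have h3 := hu.hasDeriv t ht χ'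
    simp only [h1, h2, ContinuousLinearMap.adjoint_inner_left] at h3
    exact h3

end WeakSolutionOps

/-! ### The many-body Hamiltonian -/

section Hamiltonian

open Filter Topology

variable {N : ℕ} {H0 : OneBody →ₗ.[ℂ] OneBody} {v : R3 → ℝ} {H : ManyBody N →ₗ.[ℂ] ManyBody N}

/-- The sum over i < j is not manifestly invariant under relabelling of the particles; the full sum
and the diagonal are. -/
theorem two_mul_sum_Ioi {w : Fin N → Fin N → ℂ} (hw : ∀ i j, w i j = w j i) :
    2 * ∑ i, ∑ j ∈ Finset.Ioi i, w i j = ∑ i, ∑ j, w i j - ∑ i, w i i := by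
  rw [sum_sum_Ioi_symm hw, ← Finset.sum_sub_distrib]
  refine Finset.sum_congr rfl fun i _ => ?_
  rw [← Finset.sum_compl_add_sum {i}, Finset.sum_singleton, add_sub_cancel_right]

theorem sum_Ioi_comp_perm {w : Fin N → Fin N → ℂ} (hw : ∀ i j, w i j = w j i)
    (σ : Equiv.Perm (Fin N)) :
    ∑ i, ∑ j ∈ Finset.Ioi i, w (σ i) (σ j) = ∑ i, ∑ j ∈ Finset.Ioi i, w i j := by
  have h1 := two_mul_sum_Ioi hw
  have h2 := two_mul_sum_Ioi (w := fun i j => w (σ i) (σ j)) fun i j => hw _ _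
  rw [Equiv.sum_comp σ fun i => w i i, Equiv.sum_comp σ fun i => ∑ j, w i (σ j)] at h2
  simp_rw [fun i => Equiv.sum_comp σ (w i)] at h2
  exact mul_left_cancel₀ two_ne_zero (h2.trans h1.symm)

theorem IsManyBodyHamiltonian.permute_mem_graph (hsum : IsManyBodyHamiltonian H0 v H)
    (hv : ∀ x, v (-x) = v x) (σ : Equiv.Perm (Fin N)) {z : ManyBody N × ManyBody N}
    (hz : z ∈ H.graph) : (permute σ z.1, permute σ z.2) ∈ H.graph := by
  obtain ⟨ψ, η⟩ := z
  obtain ⟨κ, h1, h2, h3⟩ := (hsum ψ η).1 hz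
  have hsymm : ∀ x y, v (x - y) = v (y - x) := fun x y => by rw [← hv, neg_sub]
  have h2' : ∀ i j, i ≠ j → MemLp (fun x : Fin N → R3 => (v (x i - x j) : ℂ) * ψ x) 2 volume := by
    intro i j hij
    rcases lt_or_gt_of_ne hij with h | h
    · exact h2 i j h
    · simpa only [hsymm] using h2 j i h
  have hmp := measurePreserving_permute (N := N) σ
  refine (hsum _ _).2 ⟨permute σ κ, freeGraph_permute σ h1, fun i j hij => ?_, ?_⟩
  · have h4 := (h2' (σ.symm i) (σ.symm j) fun h => hij.ne (σ.symm.injective h)).comp_measurePreserving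
      hmp
    refine h4.ae_eq ?_
    filter_upwards [coeFn_permute σ ψ] with x hx
    simp only [Function.comp_apply, hx, Equiv.apply_symm_apply]
  · filter_upwards [coeFn_permute σ ψ, coeFn_permute σ κ, coeFn_permute σ η,
      hmp.quasiMeasurePreserving.ae h3] with x e1 e2 e3 e4
    rw [e1, e2, e3, e4]
    congr 1
    exact sum_Ioi_comp_perm (w := fun i j => (v (x i - x j) : ℂ) * ψ fun j => x (σ j))
      (fun i j => by rw [hsymm]) σ

theorem IsAntisymmetricWave.antisymmOn {ψ : ManyBody N} (h : IsAntisymmetricWave ψ) :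
    AntisymmOn Finset.univ ψ := by
  intro i _ j _ hij
  refine Lp.ext ?_
  filter_upwards [coeFn_permute (Equiv.swap i j) ψ, h (Equiv.swap i j), Lp.coeFn_neg ψ]
    with x h1 h2 h3
  rw [h1, h2, h3, Equiv.Perm.sign_swap hij]
  simp

/-- The interaction is bounded with respect to the graph norm. -/
theorem IsManyBodyHamiltonian.exists_interaction (hsum : IsManyBodyHamiltonian H0 v H)
    (hH : IsSelfAdjoint H) {φ : Fin N → OneBody} {d₀ b₁ b₂ : ℝ}
    (hd : DensityBounds v φ d₀ b₁ b₂) :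
    ∃ W : H.graph →L[ℂ] ManyBody N, ∀ z : H.graph, ∃ κ : ManyBody N,
      (z.1.1, κ) ∈ freeGraph N H0 ∧ z.1.2 = κ + W z ∧ ∃ ζ : Fin N → Fin N → ManyBody N,
        (∀ i, ∀ j ∈ Finset.Ioi i, ζ i j =ᵐ[volume] fun x => (v (x i - x j) : ℂ) * z.1.1 x) ∧
        W z = ∑ i, ∑ j ∈ Finset.Ioi i, ζ i j := by
  have hcl : IsClosed (H.graph : Set (ManyBody N × ManyBody N)) := hH.isClosed
  have : CompleteSpace H.graph := hcl.completeSpace_coe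
  have h1 : ∀ z : H.graph, ∃ (κ : ManyBody N) (ζ : Fin N → Fin N → ManyBody N),
      (z.1.1, κ) ∈ freeGraph N H0 ∧ z.1.2 = κ + ∑ i, ∑ j ∈ Finset.Ioi i, ζ i j ∧
      ∀ i, ∀ j ∈ Finset.Ioi i, ζ i j =ᵐ[volume] fun x => (v (x i - x j) : ℂ) * z.1.1 x := by
    rintro ⟨⟨ψ, η⟩, hz⟩
    obtain ⟨κ, k1, k2, k3⟩ := (hsum ψ η).1 hz
    classical
    set ζ : Fin N → Fin N → ManyBody N := fun i j =>
      if h : i < j then (k2 i j h).toLp _ else 0 with hζ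
    have hζ' : ∀ i, ∀ j ∈ Finset.Ioi i, ζ i j =ᵐ[volume] fun x => (v (x i - x j) : ℂ) * ψ x := by
      intro i j hij
      simp only [hζ, dif_pos (Finset.mem_Ioi.1 hij)]
      exact MemLp.coeFn_toLp _
    refine ⟨κ, ζ, k1, Lp.ext ?_, hζ'⟩
    have e1 : ∀ᵐ x, ∀ i, ∀ j ∈ Finset.Ioi i, ζ i j x = (v (x i - x j) : ℂ) * ψ x :=
      ae_all_iff.2 fun i => (ae_ball_iff (Set.to_countable _)).2 (hζ' i)
    have e2 : ∀ᵐ x, ∀ i, (∑ j ∈ Finset.Ioi i, ζ i j : ManyBody N) x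
        = ∑ j ∈ Finset.Ioi i, ζ i j x := ae_all_iff.2 fun i => coeFn_sum _ _
    filter_upwards [k3, e1, e2, coeFn_sum Finset.univ fun i => ∑ j ∈ Finset.Ioi i, ζ i j,
      Lp.coeFn_add κ (∑ i, ∑ j ∈ Finset.Ioi i, ζ i j)] with x f1 f2 f3 f4 f5
    rw [f1, f5, Pi.add_apply, f4]
    congr 1
    refine Finset.sum_congr rfl fun i _ => ?_
    rw [f3]
    exact Finset.sum_congr rfl fun j hj => (f2 i j hj).symm
  choose κ ζ hκ hη hζ using h1
  set g : ℕ → H.graph →L[ℂ] ManyBody N := fun n =>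
    (∑ i, ∑ j ∈ Finset.Ioi i, pairOp (truncate v n) i j).comp
      ((ContinuousLinearMap.fst ℂ (ManyBody N) (ManyBody N)).comp H.graph.subtypeL) with hg
  have hlim : Tendsto (fun n (z : H.graph) => g n z) atTop
      (𝓝 fun z => ∑ i, ∑ j ∈ Finset.Ioi i, ζ z i j) := by
    refine tendsto_pi_nhds.2 fun z => ?_
    simp only [hg, ContinuousLinearMap.comp_apply, _root_.sum_apply]
    exact tendsto_finsetSum _ fun i _ => tendsto_finsetSum _ fun j hj =>
      hd.tendsto_pairOp i j (hζ z i j hj)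
  -- The graph is closed, hence complete, and the truncated interactions converge pointwise on it;
  -- by the uniform boundedness principle the limit is a bounded operator.
  exact ⟨continuousLinearMapOfTendsto g hlim, fun z => ⟨κ z, hκ z, hη z, ζ z, hζ z, rfl⟩⟩

end Hamiltonian

/-! ### Conservation laws -/

section Evolution

open Filter Topology

variable {N : ℕ}

/-- The wave function `u` and the orbitals `φ` on `[0, b)`, in the form used for the estimates. -/
structure MeanFieldEvolution (H0 : OneBody →ₗ.[ℂ] OneBody) (v : R3 → ℝ)
    (H : ManyBody N →ₗ.[ℂ] ManyBody N) (b M : ℝ) (u : ℝ → ManyBody N)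
    (φ η : ℝ → Fin N → OneBody) : Prop where
  selfAdjoint_one : IsSelfAdjoint H0
  selfAdjoint_many : IsSelfAdjoint H
  hamiltonian : IsManyBodyHamiltonian H0 v H
  wave : IsWeakSolution H b u fun _ => 0
  orbital : ∀ j, IsWeakSolution H0 b (fun t => φ t j) fun t => η t j
  source : ∀ t ∈ Ico 0 b, ∀ j, η t j = hartreeTerm v (φ t) j
  bounds : ∀ t ∈ Ico 0 b, ∃ d₀ b₁ b₂, DensityBounds v (φ t) d₀ b₁ b₂
  norm_wave_le : ∀ t, ‖u t‖ ≤ M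
  norm_orbital_le : ∀ t j, ‖φ t j‖ ≤ M
  norm_zero : ‖u 0‖ = 1
  antisymm_zero : AntisymmOn Finset.univ (u 0)
  orthonormal_zero : Orthonormal ℂ (φ 0)

namespace MeanFieldEvolution

variable {H0 : OneBody →ₗ.[ℂ] OneBody} {v : R3 → ℝ} {H : ManyBody N →ₗ.[ℂ] ManyBody N} {b M : ℝ}
  {u : ℝ → ManyBody N} {φ η : ℝ → Fin N → OneBody}

theorem norm_wave (h : MeanFieldEvolution H0 v H b M u φ η) {t : ℝ} (ht : t ∈ Ico 0 b) :
    ‖u t‖ = 1 := by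
  have h1 := h.wave.inner_eq h.selfAdjoint_many h.wave (by simp) h.norm_wave_le h.norm_wave_le
    ht.1 ht.2
  rw [inner_self_eq_norm_sq_to_K, inner_self_eq_norm_sq_to_K, h.norm_zero, RCLike.ofReal_one,
    one_pow] at h1
  have h2 : ‖u t‖ ^ 2 = 1 := Complex.ofReal_eq_one.1 (by rw [Complex.ofReal_pow]; exact h1)
  exact (pow_eq_one_iff_of_nonneg (norm_nonneg _) two_ne_zero).1 h2

/-- The inhomogeneities of all orbitals come from the same real potential, so ⟨η_i, φ_j⟩ = ⟨φ_i,
η_j⟩ and inner products are conserved. -/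
theorem orthonormal (h : MeanFieldEvolution H0 v H b M u φ η) {t : ℝ} (ht : t ∈ Ico 0 b) :
    Orthonormal ℂ (φ t) := by
  rw [orthonormal_iff_ite]
  intro i j
  rw [← orthonormal_iff_ite.1 h.orthonormal_zero i j]
  refine (h.orbital i).inner_eq h.selfAdjoint_one (h.orbital j) (fun s hs => ?_)
    (fun s => h.norm_orbital_le s i) (fun s => h.norm_orbital_le s j) ht.1 ht.2
  obtain ⟨_, _, _, h1⟩ := h.bounds s hs
  rw [h.source s hs, h.source s hs, inner_hartreeTerm h1]

/-- For a transposition U, the function U u + u is again a weak solution because H commutes with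
permutations. It vanishes at time zero and its norm is conserved. -/
theorem antisymm (h : MeanFieldEvolution H0 v H b M u φ η) {t : ℝ} (ht : t ∈ Ico 0 b) :
    AntisymmOn Finset.univ (u t) := by
  intro i hi j hj hij
  obtain ⟨_, _, _, h0⟩ := h.bounds t ht
  set U : ManyBody N →L[ℂ] ManyBody N := permute (Equiv.swap i j) with hU
  have h1 : IsWeakSolution H b (fun t => U (u t) + u t) (fun _ => U 0 + 0) :=
    (h.wave.map fun z hz => by
      rw [hU, adjoint_permute]
      exact h.hamiltonian.permute_mem_graph h0.even _ hz).add h.wave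
  have h2 : ∀ s, ‖U (u s) + u s‖ ≤ ‖U‖ * M + M := fun s => (norm_add_le _ _).trans
    (add_le_add ((U.le_opNorm _).trans (mul_le_mul_of_nonneg_left (h.norm_wave_le s)
      (norm_nonneg _))) (h.norm_wave_le s))
  have h3 := h1.inner_eq h.selfAdjoint_many h1 (by simp) h2 h2 ht.1 ht.2
  have h4 : U (u 0) + u 0 = 0 := by
    rw [h.antisymm_zero i hi j hj hij, neg_add_cancel]
  rw [h4, inner_zero_left, inner_self_eq_zero] at h3
  exact eq_neg_of_add_eq_zero_left h3

end MeanFieldEvolution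

end Evolution

/-! ### The integral inequality for the counting functional -/

section IntegralInequality

open Filter Topology

variable {N : ℕ}

instance (priority := 1100) ManyBody.realNormedSpace : NormedSpace ℝ (ManyBody N) :=
  NormedSpace.complexToReal

theorem continuous_expect {Z : Type*} [TopologicalSpace Z] {φ : Z → Fin N → OneBody}
    {Ψ : Z → ManyBody N} (hφ : Continuous φ) (hΨ : Continuous Ψ) (f : ℕ → ℝ) :
    Continuous fun z => expect (φ z) (Ψ z) f := by
  have h1 : ∀ m, Continuous fun z => (orbProj (φ z) m : ManyBody N →L[ℂ] ManyBody N) := fun m =>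
    hφ.orbitalSum isContractiveSesquilinear_rankOne m
  have h2 : Continuous fun z => hatOp (orbProj (φ z) : Fin N → ManyBody N →L[ℂ] ManyBody N) f :=
    Continuous.hatOp h1 f
  exact Complex.continuous_re.comp (hΨ.inner (h2.clm_apply hΨ))

theorem weightM_le_one (γ : ℝ) (k : ℕ) : weightM N γ k ≤ 1 := by
  unfold weightM
  split_ifs with h
  · exact div_le_one_of_le₀ h (by positivity)
  · exact le_rfl

theorem expect_weightM_mem {φ : Fin N → OneBody} (hN : 0 < N) {γ : ℝ} (hγ : 0 < γ)
    (hφ : Orthonormal ℂ φ) {Ψ : ManyBody N} (hΨ : ‖Ψ‖ ≤ 1) :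
    expect φ Ψ (weightM N γ) ∈ Icc 0 1 := by
  refine ⟨expect_nonneg hφ Ψ fun k => weightM_nonneg hN hγ k, ?_⟩
  refine (expect_mono hφ Ψ (g := fun _ => 1) fun k _ => weightM_le_one γ k).trans ?_
  rw [expect_one]
  exact pow_le_one₀ (norm_nonneg _) hΨ

namespace MeanFieldEvolution

variable {H0 : OneBody →ₗ.[ℂ] OneBody} {v : R3 → ℝ} {H : ManyBody N →ₗ.[ℂ] ManyBody N} {b M : ℝ}
  {u : ℝ → ManyBody N} {φ η : ℝ → Fin N → OneBody}

theorem norm_forwardAverage_le (h : MeanFieldEvolution H0 v H b M u φ η) {t d : ℝ} (ht : 0 ≤ t)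
    (hd : 0 < d) (htd : t + d < b) : ‖forwardAverage d u t‖ ≤ 1 :=
  _root_.norm_forwardAverage_le
    (fun _ hq => (h.norm_wave ⟨ht.trans hq.1.le, hq.2.trans_lt htd⟩).le) hd

theorem antisymm_forwardAverage (h : MeanFieldEvolution H0 v H b M u φ η) {t d : ℝ} (ht : 0 ≤ t)
    (hd : 0 < d) (htd : t + d < b) : AntisymmOn Finset.univ (forwardAverage d u t) := by
  intro i hi j hj hij
  have h1 : permute (Equiv.swap i j) (∫ r in t..t + d, u r) = -∫ r in t..t + d, u r := by
    rw [← ContinuousLinearMap.intervalIntegral_comp_comm _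
      (h.wave.continuous.intervalIntegrable _ _), ← intervalIntegral.integral_neg]
    refine intervalIntegral.integral_congr fun q hq => ?_
    rw [uIcc_of_le (by linarith)] at hq
    exact h.antisymm ⟨ht.trans hq.1, hq.2.trans_lt htd⟩ i hi j hj hij
  rw [forwardAverage, ← Complex.coe_smul, map_smul, h1, smul_neg]

/-- The time-averaged wave function moves continuously in the graph norm of H, and the interaction
is bounded in that norm, so the interaction term w is continuous in time. Clamping extends it beyond
[0, c]. -/
theorem exists_forwardAverage_splitting (h : MeanFieldEvolution H0 v H b M u φ η) {c d : ℝ}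
    (hc : 0 ≤ c) (hd : 0 < d) (hcd : c + d < b) : ∃ Ψ' w : ℝ → ManyBody N,
      (∀ t, HasDerivAt (forwardAverage d u) (Ψ' t) t) ∧ Continuous w ∧
      ∀ t ∈ Icc 0 c, ∃ (κ : ManyBody N) (ζ : Fin N → Fin N → ManyBody N),
        (forwardAverage d u t, κ) ∈ freeGraph N H0 ∧ Complex.I • Ψ' t = κ + w t ∧
        (∀ i, ∀ j ∈ Finset.Ioi i, ζ i j =ᵐ[volume] fun x =>
          (v (x i - x j) : ℂ) * forwardAverage d u t x) ∧
        w t = ∑ i, ∑ j ∈ Finset.Ioi i, ζ i j := by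
  obtain ⟨_, _, _, h0⟩ := h.bounds 0 ⟨le_rfl, by linarith⟩
  obtain ⟨W, hW⟩ := h.hamiltonian.exists_interaction h.selfAdjoint_many h0
  have hmem : ∀ t ∈ Icc 0 c,
      (forwardAverage d u t, Complex.I • (d⁻¹ • (u (t + d) - u t))) ∈ H.graph := by
    intro t ht
    have h1 := h.wave.forwardAverage_mem_graph h.selfAdjoint_many ht.1 hd (by linarith [ht.2])
    have h2 : forwardAverage d (fun _ => (0 : ManyBody N)) t = 0 := by
      rw [forwardAverage, intervalIntegral.integral_zero]
      exact smul_zero _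
    rwa [h2, sub_zero] at h1
  have hΨ : ∀ t, HasDerivAt (forwardAverage d u) (d⁻¹ • (u (t + d) - u t)) t :=
    hasDerivAt_forwardAverage h.wave.continuous d
  have hΨc : Continuous (forwardAverage d u) :=
    continuous_iff_continuousAt.2 fun t => (hΨ t).continuousAt
  have huc := h.wave.continuous
  set z : ℝ → H.graph := fun t => ⟨_, hmem (clamp c t) (clamp_mem hc t)⟩ with hz
  have hzc : Continuous z := by
    refine Continuous.subtype_mk ?_ _
    have h1 : Continuous fun t => d⁻¹ • (u (t + d) - u t) := by fun_prop
    exact (hΨc.prodMk (h1.const_smul Complex.I)).comp (continuous_clamp c)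
  refine ⟨fun t => d⁻¹ • (u (t + d) - u t), fun t => W (z t), hΨ, W.continuous.comp hzc,
    fun t ht => ?_⟩
  obtain ⟨κ, h1, h2, ζ, h3, h4⟩ := hW (z t)
  simp only [hz, clamp_of_mem ht] at h1 h2 h3 h4
  refine ⟨κ, ζ, h1, ?_, h3, ?_⟩
  · simp only [hz, clamp_of_mem ht]
    exact h2
  · simp only [hz, clamp_of_mem ht]
    exact h4

variable {γ ε : ℝ} {C : ℝ → ℝ}

/-- The wave function is averaged while the orbitals are the exact ones, so the bounds on the
density hold at each time. The average is still antisymmetric and of norm at most one, which is all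
that the commutator estimate asks of it. -/
theorem expect_forwardAverage_le (h : MeanFieldEvolution H0 v H b M u φ η) (hN : 0 < N)
    (hγ : 0 < γ)
    (hC : ∀ t ∈ Ico 0 b, ∃ D₀ D₁ b₂, 0 < D₀ ∧ 0 < D₁ ∧
      DensityBounds v (φ t) D₀ (D₁ / (N : ℝ) ^ γ) b₂ ∧ 8 * √D₁ + 6 * D₀ ≤ C t ∧
      2 * (b₂ / (N : ℝ) ^ γ / D₀) ≤ C t * ε)
    {t d : ℝ} (ht : 0 ≤ t) (hd : 0 < d) (htd : t + d < b) (hCi : IntervalIntegrable C volume 0 t) :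
    expect (φ t) (forwardAverage d u t) (weightM N γ)
      - expect (φ 0) (forwardAverage d u 0) (weightM N γ)
      ≤ ∫ q in (0 : ℝ)..t, C q * (expect (φ q) (forwardAverage d u q) (weightM N γ) + ε) := by
  obtain ⟨Ψ', w, hΨ, hw, hsplit⟩ := h.exists_forwardAverage_splitting ht hd htd
  have hΨc : Continuous (forwardAverage d u) :=
    continuous_iff_continuousAt.2 fun t => (hΨ t).continuousAt
  have hφc : Continuous φ := continuous_pi fun j => (h.orbital j).continuous
  have key := inner_hatOp_sub_eq_integral (r := fun m => rankOne m)
    isContractiveSesquilinear_rankOne (fun z hz z' hz' => freeGraph_symm h.selfAdjoint_one hz hz')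
    (fun m a b => derives_rankOne h.selfAdjoint_one m a b) h.selfAdjoint_one h.orbital
    h.norm_orbital_le hΨ hw le_rfl ht (by linarith)
    (fun q hq => by
      obtain ⟨κ, _, h1, h2, -⟩ := hsplit q hq
      exact ⟨κ, h1, h2⟩) (weightM N γ)
  have hint : IntervalIntegrable (fun q => C q *
      (expect (φ q) (forwardAverage d u q) (weightM N γ) + ε)) volume 0 t :=
    hCi.mul_continuousOn ((continuous_expect hφc hΨc _).add continuous_const).continuousOn
  have hle : ‖∫ q in (0 : ℝ)..t, expectRate (fun m => rankOne m) (weightM N γ)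
      (forwardAverage d u q) (w q) (φ q) (η q)‖
      ≤ ∫ q in (0 : ℝ)..t, C q * (expect (φ q) (forwardAverage d u q) (weightM N γ) + ε) := by
    refine intervalIntegral.norm_integral_le_of_norm_le ht (Eventually.of_forall fun q hq => ?_) hint
    have hqb : q ∈ Ico 0 b := ⟨hq.1.le, by linarith [hq.2]⟩
    obtain ⟨κ, ζ, -, -, h3, h4⟩ := hsplit q ⟨hq.1.le, hq.2⟩
    obtain ⟨D₀, D₁, b₂, k1, k2, k3, k4, k5⟩ := hC q hqb
    have hor := h.orthonormal hqb
    rw [expectRate_eq_commutator (V := meanFieldOp v (φ q)) (adjoint_meanFieldOp k3)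
      (fun m j => by rw [h.source q hqb, rankOne_hartreeTerm_left k3])
      (fun m j => by rw [h.source q hqb, rankOne_hartreeTerm_right k3])
      (fun m l hl j => meanFieldOp_commute_rankOne k3 hl _ _) (adjoint_hatOp hor _),
      norm_mul, Complex.norm_I, one_mul]
    have h5 := k3.norm_commutator_le hN hγ k1 k2 hor
      (h.antisymm_forwardAverage hq.1.le hd (by linarith [hq.2]))
      (h.norm_forwardAverage_le hq.1.le hd (by linarith [hq.2])) h3 (congrArg (· - _) h4)
    have h6 := (expect_weightM_mem hN hγ hor
      (h.norm_forwardAverage_le hq.1.le hd (by linarith [hq.2]))).1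
    have h7 := mul_le_mul_of_nonneg_right k4 h6
    refine h5.trans ?_
    linarith
  refine le_trans ?_ hle
  rw [← key]
  refine le_trans (le_of_eq ?_) (Complex.re_le_norm _)
  rw [Complex.sub_re]
  rfl

/-- The length d of the average tends to zero. Expectations of the weight lie in [0, 1], so the
integrands are dominated by |C| (1 + |ε|). -/
theorem expect_le (h : MeanFieldEvolution H0 v H b M u φ η) (hN : 0 < N) (hγ : 0 < γ)
    (hC : ∀ t ∈ Ico 0 b, ∃ D₀ D₁ b₂, 0 < D₀ ∧ 0 < D₁ ∧
      DensityBounds v (φ t) D₀ (D₁ / (N : ℝ) ^ γ) b₂ ∧ 8 * √D₁ + 6 * D₀ ≤ C t ∧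
      2 * (b₂ / (N : ℝ) ^ γ / D₀) ≤ C t * ε)
    {t : ℝ} (ht : t ∈ Ico 0 b) (hCi : IntervalIntegrable C volume 0 t) :
    expect (φ t) (u t) (weightM N γ) - expect (φ 0) (u 0) (weightM N γ)
      ≤ ∫ q in (0 : ℝ)..t, C q * (expect (φ q) (u q) (weightM N γ) + ε) := by
  have hφc : Continuous φ := continuous_pi fun j => (h.orbital j).continuous
  have hd : Ioo 0 (b - t) ∈ 𝓝[>] (0 : ℝ) := Ioo_mem_nhdsGT (sub_pos.2 ht.2)
  have hlim : ∀ q, Tendsto (fun d => expect (φ q) (forwardAverage d u q) (weightM N γ)) (𝓝[>] 0)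
      (𝓝 (expect (φ q) (u q) (weightM N γ))) := fun q =>
    ((continuous_expect (φ := fun _ : ManyBody N => φ q) continuous_const continuous_id _).tendsto
      (u q)).comp (tendsto_forwardAverage h.wave.continuous q)
  refine le_of_tendsto_of_tendsto ((hlim t).sub (hlim 0))
    (intervalIntegral.tendsto_integral_filter_of_dominated_convergence
      (fun q => |C q| * (1 + |ε|)) ?_ ?_ (hCi.abs.mul_const _) ?_)
    (mem_of_superset hd fun d hd' =>
      h.expect_forwardAverage_le hN hγ hC ht.1 hd'.1 (by linarith [hd'.2]) hCi)
  · filter_upwards with d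
    have hΨc : Continuous (forwardAverage d u) := continuous_iff_continuousAt.2 fun t =>
      (hasDerivAt_forwardAverage h.wave.continuous d t).continuousAt
    rw [uIoc_of_le ht.1]
    exact (hCi.mul_continuousOn
      ((continuous_expect hφc hΨc _).add continuous_const).continuousOn).1.aestronglyMeasurable
  · filter_upwards [hd] with d hd'
    refine Eventually.of_forall fun q hq => ?_
    rw [uIoc_of_le ht.1] at hq
    have h1 := expect_weightM_mem hN hγ (h.orthonormal ⟨hq.1.le, hq.2.trans_lt ht.2⟩)
      (h.norm_forwardAverage_le hq.1.le hd'.1 (by linarith [hd'.2, hq.2]))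
    rw [norm_mul, Real.norm_eq_abs]
    refine mul_le_mul_of_nonneg_left ((norm_add_le _ _).trans (add_le_add ?_ le_rfl)) (abs_nonneg _)
    rw [Real.norm_of_nonneg h1.1]
    exact h1.2
  · exact Eventually.of_forall fun q _ => ((hlim q).add_const ε).const_mul (C q)

end MeanFieldEvolution

end IntegralInequality

/-! ### An integral form of Grönwall's inequality -/

section Gronwall

open Filter Topology

/-- C is only integrable, so the usual differentiation argument is avoided. With K the primitive of
C, monotonicity of F gives F(s) (1 - (K(s) - K(r))) ≤ F(r). Cutting [0, t] into n pieces of equal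
K-increment and letting n grow turns (1 - K(t)/n)^n into exp(-K(t)). -/
theorem le_exp_integral_mul {C w : ℝ → ℝ} {t : ℝ} (ht : 0 ≤ t)
    (hC : IntervalIntegrable C volume 0 t) (hC0 : ∀ q ∈ Icc 0 t, 0 ≤ C q)
    (hw : ContinuousOn w (Icc 0 t)) (hw0 : ∀ q ∈ Icc 0 t, 0 ≤ w q)
    (h : ∀ s ∈ Icc 0 t, w s ≤ w 0 + ∫ q in (0 : ℝ)..s, C q * w q) :
    w t ≤ Real.exp (∫ q in (0 : ℝ)..t, C q) * w 0 := by
  set F : ℝ → ℝ := fun s => w 0 + ∫ q in (0 : ℝ)..s, C q * w q with hF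
  set K : ℝ → ℝ := fun s => ∫ q in (0 : ℝ)..s, C q with hK
  have hCw : IntervalIntegrable (fun q => C q * w q) volume 0 t :=
    hC.mul_continuousOn (by rwa [uIcc_of_le ht])
  have hsub : ∀ {g : ℝ → ℝ}, IntervalIntegrable g volume 0 t → ∀ {r s : ℝ}, 0 ≤ r → r ≤ s → s ≤ t →
      IntervalIntegrable g volume r s := fun hg r s h0 h1 h2 => hg.mono_set (by
    rw [uIcc_of_le h1, uIcc_of_le ht]; exact Icc_subset_Icc h0 h2)
  have hdiff : ∀ {g : ℝ → ℝ}, IntervalIntegrable g volume 0 t → ∀ {r s : ℝ}, 0 ≤ r → r ≤ s → s ≤ t →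
      (∫ q in (0 : ℝ)..s, g q) = (∫ q in (0 : ℝ)..r, g q) + ∫ q in r..s, g q :=
    fun hg r s h0 h1 h2 => (intervalIntegral.integral_add_adjacent_intervals
      (hsub hg le_rfl h0 (h1.trans h2)) (hsub hg h0 h1 h2)).symm
  have hmono : ∀ {r s : ℝ}, 0 ≤ r → r ≤ s → s ≤ t → F r ≤ F s := by
    intro r s h0 h1 h2
    have h3 : 0 ≤ ∫ q in r..s, C q * w q := intervalIntegral.integral_nonneg h1 fun q hq =>
      mul_nonneg (hC0 q ⟨h0.trans hq.1, hq.2.trans h2⟩) (hw0 q ⟨h0.trans hq.1, hq.2.trans h2⟩)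
    simp only [hF, hdiff hCw h0 h1 h2]
    linarith
  have hstep : ∀ {r s : ℝ}, 0 ≤ r → r ≤ s → s ≤ t → F s * (1 - (K s - K r)) ≤ F r := by
    intro r s h0 h1 h2
    have h3 : ∫ q in r..s, C q * w q ≤ ∫ q in r..s, C q * F s := by
      refine intervalIntegral.integral_mono_on h1 (hsub hCw h0 h1 h2)
        ((hsub hC h0 h1 h2).mul_const _) fun q hq => ?_
      have hq' : q ∈ Icc 0 t := ⟨h0.trans hq.1, hq.2.trans h2⟩
      exact mul_le_mul_of_nonneg_left ((h q hq').trans (hmono hq'.1 hq.2 h2)) (hC0 q hq')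
    rw [intervalIntegral.integral_mul_const] at h3
    have e1 : F s = F r + ∫ q in r..s, C q * w q := by
      simp only [hF, hdiff hCw h0 h1 h2]; ring
    have e2 : K s - K r = ∫ q in r..s, C q := by simp only [hK, hdiff hC h0 h1 h2]; ring
    rw [e2]
    linarith
  have hF0 : ∀ {s : ℝ}, 0 ≤ s → s ≤ t → 0 ≤ F s := fun h1 h2 =>
    (hw0 _ ⟨h1, h2⟩).trans (h _ ⟨h1, h2⟩)
  have hK0 : K 0 = 0 := intervalIntegral.integral_same
  have hKc : ContinuousOn K (Icc 0 t) := by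
    have := intervalIntegral.continuousOn_primitive_interval' hC left_mem_uIcc
    rwa [uIcc_of_le ht] at this
  have hKt : 0 ≤ K t := intervalIntegral.integral_nonneg ht hC0
  have hpow : ∀ κ : ℝ, 0 ≤ κ → κ ≤ 1 → ∀ i : ℕ, ∀ s ∈ Icc 0 t, K s ≤ i * κ →
      F s * (1 - κ) ^ i ≤ F 0 := by
    intro κ hκ hκ1 i
    induction i with
    | zero =>
      intro s hs hKs
      have h1 := hstep le_rfl hs.1 hs.2
      rw [hK0] at h1
      have h2 := mul_nonneg (hF0 hs.1 hs.2) (show 0 ≤ -K s by simpa using hKs)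
      rw [pow_zero]
      linarith
    | succ i ih =>
      intro s hs hKs
      have h1 : (1 - κ) ^ i * (1 - κ) ≤ (1 - κ) ^ i :=
        mul_le_of_le_one_right (by have := sub_nonneg.2 hκ1; positivity) (by linarith)
      rcases le_or_gt (K s) (i * κ) with h2 | h2
      · rw [pow_succ]
        exact (mul_le_mul_of_nonneg_left h1 (hF0 hs.1 hs.2)).trans (ih s hs h2)
      -- The cutting point is one at which the continuous function K takes the value i κ, so that at
      -- most κ remains up to s.
      · obtain ⟨r, hr, hKr⟩ := intermediate_value_Icc hs.1 (hKc.mono (Icc_subset_Icc le_rfl hs.2))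
          (show (i : ℝ) * κ ∈ Icc (K 0) (K s) from ⟨by rw [hK0]; positivity, h2.le⟩)
        have h3 := hstep hr.1 hr.2 hs.2
        have h4 := ih r ⟨hr.1, hr.2.trans hs.2⟩ hKr.le
        have h5 : F s * (1 - κ) ≤ F r := by
          refine le_trans (mul_le_mul_of_nonneg_left ?_ (hF0 hs.1 hs.2)) h3
          push_cast at hKs
          linarith
        rw [pow_succ', ← mul_assoc]
        exact (mul_le_mul_of_nonneg_right h5 (pow_nonneg (sub_nonneg.2 hκ1) i)).trans h4
  have hlim : F t * Real.exp (-K t) ≤ F 0 := by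
    refine le_of_tendsto ((Real.tendsto_one_add_div_pow_exp (-K t)).const_mul (F t)) ?_
    obtain ⟨m, hm⟩ := exists_nat_gt (K t)
    filter_upwards [eventually_ge_atTop m] with n hn
    have hn' : K t < n := hm.trans_le (by exact_mod_cast hn)
    have hn0 : (0 : ℝ) < n := hKt.trans_lt hn'
    have h1 := hpow (K t / n) (by positivity) ((div_le_one hn0).2 hn'.le) n t ⟨ht, le_rfl⟩
      (le_of_eq (by field_simp))
    rwa [neg_div, ← sub_eq_add_neg]
  have hF00 : F 0 = w 0 := by simp [hF]
  rw [hF00, Real.exp_neg, ← div_eq_mul_inv, div_le_iff₀ (Real.exp_pos _)] at hlim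
  calc w t ≤ F t := h t ⟨ht, le_rfl⟩
    _ ≤ Real.exp (K t) * w 0 := by linarith

end Gronwall

/-! ### The bounds on the density and the rate -/

section Rate

variable {N : ℕ}

theorem MeanFieldBounds.densityBounds {v : R3 → ℝ} {φ : Fin N → OneBody} {Ω : Set R3}
    {γ δ₂ δ₃ δ₄ D₀ D₁ D₂ D₃ D₄ : ℝ} (hv : Measurable v) (hv_even : ∀ x, v (-x) = v x)
    (hD₀ : 0 ≤ D₀) (hD₁ : 0 ≤ D₁) (hD₂ : 0 ≤ D₂)
    (h : MeanFieldBounds N v (density φ) Ω γ δ₂ δ₃ δ₄ D₀ D₁ D₂ D₃ D₄) :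
    DensityBounds v φ D₀ (D₁ / (N : ℝ) ^ γ) (D₂ * (N : ℝ) ^ δ₂) where
  meas := hv
  even := hv_even
  d_nonneg := hD₀
  b₁_nonneg := by positivity
  b₂_nonneg := by positivity
  sup_abs y := by
    refine le_trans (le_of_eq ?_) ((le_iSup _ y).trans h.sup_abs)
    simp_rw [ENNReal.ofReal_mul (abs_nonneg _), ofReal_density, Real.enorm_eq_ofReal_abs]
  sup_sq y := by
    have h1 := h.sup_sq
    rw [Real.rpow_neg (Nat.cast_nonneg N), ← div_eq_mul_inv] at h1
    refine le_trans (le_of_eq ?_) ((le_iSup _ y).trans h1)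
    simp_rw [ENNReal.ofReal_mul (sq_nonneg _), ofReal_density, Real.enorm_eq_ofReal_abs,
      ← ENNReal.ofReal_pow (abs_nonneg _), sq_abs]
  integral_sq := by
    refine le_trans (le_of_eq ?_) h.integral_sq
    simp_rw [ENNReal.ofReal_mul (sq_nonneg _), ofReal_density, Real.enorm_eq_ofReal_abs,
      ← ENNReal.ofReal_pow (abs_nonneg _), sq_abs]

/-- Since √12 ≥ 3, the prefactor 12 yields 36. These bounds leave room for 8√D₁ + 6D₀ and 2 D₂/D₀,
which the commutator estimate requires. -/
theorem rateC_bounds {δ₃ δ₄ D₀ D₁ D₂ D₃ D₄ : ℝ} (hD₀ : 0 < D₀) (hD₂ : 0 < D₂) :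
    36 * D₀ ≤ rateC N δ₃ δ₄ D₀ D₁ D₂ D₃ D₄ ∧ 36 * (D₂ / D₀) ≤ rateC N δ₃ δ₄ D₀ D₁ D₂ D₃ D₄ ∧
      96 * √D₁ ≤ rateC N δ₃ δ₄ D₀ D₁ D₂ D₃ D₄ := by
  have h12 : (3 : ℝ) ≤ √12 := Real.le_sqrt_of_sq_le (by norm_num)
  have hq : 0 < D₂ / D₀ := by positivity
  unfold rateC
  set a := 4 * √D₃ * (N : ℝ) ^ (-(δ₃ / 2))
  set c := 4 * √2 * D₄ * (N : ℝ) ^ (-δ₄)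
  have h1 : √12 * D₀ ≤ max a (max c (max (√12 * D₀) (max (√12 * (D₂ / D₀)) (8 * √D₁)))) := by
    simp
  have h2 : √12 * (D₂ / D₀)
      ≤ max a (max c (max (√12 * D₀) (max (√12 * (D₂ / D₀)) (8 * √D₁)))) := by simp
  have h3 : 8 * √D₁ ≤ max a (max c (max (√12 * D₀) (max (√12 * (D₂ / D₀)) (8 * √D₁)))) := by simp
  have h4 := mul_le_mul_of_nonneg_right h12 hD₀.le
  have h5 := mul_le_mul_of_nonneg_right h12 hq.le
  exact ⟨by linarith, by linarith, by linarith⟩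

end Rate

end

/-! ### The estimate for the counting functional. -/

theorem mainTheorem1
    (N : ℕ) (hN : 0 < N) (T : EReal) (hT : 0 < T)
    -- the one-particle Hamiltonian, the interaction and the many-body Hamiltonian
    (H0 : OneBody →ₗ.[ℂ] OneBody) (hH0 : IsSelfAdjoint H0)
    (v : R3 → ℝ) (hv : Measurable v) (hv_even : ∀ x, v (-x) = v x)
    (H : ManyBody N →ₗ.[ℂ] ManyBody N) (hH_sum : IsManyBodyHamiltonian H0 v H)
    (hH : IsSelfAdjoint H)
    -- the solution of the Schrödinger equation
    (ψ : ℝ → ManyBody N) (hψ : IsSchrodingerSolution H T ψ)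
    (hψ_anti : IsAntisymmetricWave (ψ 0)) (hψ_norm : ‖ψ 0‖ = 1)
    -- the solution of the fermionic Hartree equations
    (φ : ℝ → Fin N → OneBody) (hφ : IsHartreeSolution H0 v T φ) (hφ_orth : Orthonormal ℂ (φ 0))
    -- the assumptions on the interaction and the density
    (Ω : Set R3) (hΩ : MeasurableSet Ω)
    (γ δ₂ δ₃ δ₄ : ℝ) (hγ : 0 < γ) (hγ' : γ ≤ 1) (hδ₂ : δ₂ < γ) (hδ₃ : 0 ≤ δ₃) (hδ₄ : 0 ≤ δ₄)
    (D₀ D₁ D₂ D₃ D₄ : ℝ → ℝ)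
    (hD : ∀ t ∈ timeInterval T, 0 < D₀ t ∧ 0 < D₁ t ∧ 0 < D₂ t ∧ 0 < D₃ t ∧ 0 < D₄ t)
    (hbounds : ∀ t ∈ timeInterval T, MeanFieldBounds N v (density (φ t)) Ω γ δ₂ δ₃ δ₄
      (D₀ t) (D₁ t) (D₂ t) (D₃ t) (D₄ t))
    (δ : ℝ) (hδ : δ = min (γ - δ₂) (min (γ + δ₃ / 2) (γ + δ₄)))
    (C : ℝ → ℝ) (hC : ∀ t, C t = rateC N δ₃ δ₄ (D₀ t) (D₁ t) (D₂ t) (D₃ t) (D₄ t))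
    -- the integrals of `C` over `[0, t]` make sense
    (hC_int : ∀ t ∈ timeInterval T, IntervalIntegrable C volume 0 t) :
    0 < δ ∧ ∀ t ∈ timeInterval T, 0 < C t ∧
      countingFunctional (weightM N γ) (ψ t) (φ t) ≤
        Real.exp (∫ s in (0 : ℝ)..t, C s) * countingFunctional (weightM N γ) (ψ 0) (φ 0)
          + (Real.exp (∫ s in (0 : ℝ)..t, C s) - 1) * (N : ℝ) ^ (-δ) := by
  have hδ_pos : 0 < δ := by
    rw [hδ]
    exact lt_min (by linarith) (lt_min (by linarith) (by linarith))
  have hN1 : (1 : ℝ) ≤ N := by exact_mod_cast hN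
  have hbnd : ∀ s ∈ timeInterval T, ∃ d₀ d₁ b₂, 0 < d₀ ∧ 0 < d₁ ∧
      DensityBounds v (φ s) d₀ (d₁ / (N : ℝ) ^ γ) b₂ ∧ d₀ ≤ C s ∧ 8 * √d₁ + 6 * d₀ ≤ C s ∧
      2 * (b₂ / (N : ℝ) ^ γ / d₀) ≤ C s * (N : ℝ) ^ (-δ) := by
    intro s hs
    obtain ⟨h0, h1, h2, -, -⟩ := hD s hs
    obtain ⟨r0, r2, r1⟩ := rateC_bounds (N := N) (δ₃ := δ₃) (δ₄ := δ₄) (D₁ := D₁ s) (D₃ := D₃ s)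
      (D₄ := D₄ s) h0 h2
    rw [← hC] at r0 r1 r2
    refine ⟨D₀ s, D₁ s, _, h0, h1, (hbounds s hs).densityBounds hv hv_even h0.le h1.le h2.le,
      by linarith, by linarith, ?_⟩
    -- Uses δ ≤ γ - δ₂ and N ≥ 1.
    have e1 : (N : ℝ) ^ δ₂ / (N : ℝ) ^ γ ≤ (N : ℝ) ^ (-δ) := by
      rw [← Real.rpow_sub (by linarith)]
      refine Real.rpow_le_rpow_of_exponent_le hN1 ?_
      have := hδ.le.trans (min_le_left _ _)
      linarith
    have e2 : 2 * (D₂ s * (N : ℝ) ^ δ₂ / (N : ℝ) ^ γ / D₀ s)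
        = 2 * (D₂ s / D₀ s) * ((N : ℝ) ^ δ₂ / (N : ℝ) ^ γ) := by ring
    have e3 : 0 < D₂ s / D₀ s := by positivity
    rw [e2]
    exact mul_le_mul (by linarith) e1 (by positivity) (by linarith)
  have hC_pos : ∀ s ∈ timeInterval T, 0 < C s := fun s hs => by
    obtain ⟨d₀, _, _, h0, -, -, h1, -⟩ := hbnd s hs
    exact h0.trans_le h1
  refine ⟨hδ_pos, fun t ht => ⟨hC_pos t ht, ?_⟩⟩
  -- A real b strictly between t and T leaves space for averages over [t, t + d] and works for
  -- infinite T as well.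
  obtain ⟨b, htb, hbT⟩ := EReal.lt_iff_exists_real_btwn.1 ht.2
  have htb' : t < b := EReal.coe_lt_coe_iff.1 htb
  have hb : b ∈ timeInterval T := ⟨ht.1.trans htb'.le, hbT⟩
  have hsub := Icc_subset_timeInterval hb
  obtain ⟨M, hM⟩ := exists_norm_comp_clamp_le (u := fun s => (ψ s, φ s))
    (hψ.continuousOn.prodMk (continuousOn_pi.2 hφ.continuousOn)) hb
  have h0b : (0 : ℝ) ∈ Icc 0 b := ⟨le_rfl, hb.1⟩
  have hev : MeanFieldEvolution H0 v H b M (fun s => ψ (clamp b s)) (fun s => φ (clamp b s))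
      (fun s j => (Ico 0 b).indicator (fun s => hartreeTerm v (φ (clamp b s)) j) s) :=
    { selfAdjoint_one := hH0
      selfAdjoint_many := hH
      hamiltonian := hH_sum
      wave := hψ.isWeakSolution hb
      orbital := hφ.isWeakSolution hb (hC_int b hb) fun s hs => by
        obtain ⟨d₀, d₁, b₂, -, -, h1, h2, -⟩ := hbnd s (hsub hs)
        exact ⟨d₀, _, b₂, h2, h1⟩
      source := fun s hs j => indicator_of_mem hs _
      bounds := fun s hs => by
        obtain ⟨d₀, d₁, b₂, -, -, h1, -⟩ := hbnd _ (hsub (clamp_mem hb.1 s))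
        exact ⟨d₀, _, b₂, h1⟩
      norm_wave_le := fun s => (norm_fst_le _).trans (hM s)
      norm_orbital_le := fun s j => (norm_le_pi_norm _ j).trans ((norm_snd_le _).trans (hM s))
      norm_zero := by rw [clamp_of_mem h0b, hψ_norm]
      antisymm_zero := by rw [clamp_of_mem h0b]; exact hψ_anti.antisymmOn
      orthonormal_zero := by rw [clamp_of_mem h0b]; exact hφ_orth }
  set α : ℝ → ℝ := fun s => expect (φ (clamp b s)) (ψ (clamp b s)) (weightM N γ) with hα
  have hε : 0 ≤ (N : ℝ) ^ (-δ) := by positivity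
  have hst : ∀ s ∈ Icc 0 t, s ∈ Ico 0 b := fun s hs => ⟨hs.1, hs.2.trans_lt htb'⟩
  have hint : ∀ s ∈ Icc 0 t, α s - α 0 ≤ ∫ q in (0 : ℝ)..s, C q * (α q + (N : ℝ) ^ (-δ)) :=
    fun s hs => hev.expect_le hN hγ (fun q hq => by
      obtain ⟨d₀, d₁, b₂, h0, h1, h2, -, h3, h4⟩ := hbnd q (hsub (Ico_subset_Icc_self hq))
      simp only [clamp_of_mem (Ico_subset_Icc_self hq)]
      exact ⟨d₀, d₁, b₂, h0, h1, h2, h3, h4⟩) (hst s hs)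
      (hC_int s (hsub (Ico_subset_Icc_self (hst s hs))))
  have hαc : Continuous α := continuous_expect
    (continuous_pi fun j => (hev.orbital j).continuous) hev.wave.continuous _
  -- Adding the constant N^{-δ} to α makes the integral inequality homogeneous; subtracting it at
  -- the end produces the term with exp - 1.
  have hgr := le_exp_integral_mul (w := fun s => α s + (N : ℝ) ^ (-δ)) ht.1 (hC_int t ht)
    (fun q hq => (hC_pos q (hsub (Ico_subset_Icc_self (hst q hq)))).le)
    (hαc.add continuous_const).continuousOn
    (fun q hq => add_nonneg (expect_weightM_mem hN hγ (hev.orthonormal (hst q hq))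
      (hev.norm_wave (hst q hq)).le).1 hε)
    (fun s hs => by have := hint s hs; linarith)
  have hα_eq : ∀ s ∈ Icc 0 b, α s = countingFunctional (weightM N γ) (ψ s) (φ s) := fun s hs => by
    rw [countingFunctional_eq, hα]
    simp only [clamp_of_mem hs]
    rfl
  simp only [hα_eq t ⟨ht.1, htb'.le⟩, hα_eq 0 h0b] at hgr
  linarith
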